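/- Proposition (odd twisted Chern character). Let $\mathcal H$ be an infinite-dimensional separable complex Hilbert space, $U=U(\mathcal H)$ and $PU=U/U(1)$ with their norm topologies, $M$ a (finite-dimensional, Hausdorff, second countable) smooth manifold and $\pi\colon P\to M$ a smooth principal $PU$ bundle. Let $L\to P^{[2]}=P\times_M P$ be its lifting bundle gerbe: the fibre $L_{(p_1,p_2)}$ is the complex line spanned by the $\hat u\in U$ with $p_1=p_2[\hat u]$, with the product $L_{(p_1,p_2)}\otimes L_{(p_2,p_3)}\to L_{(p_1,p_3)}$ induced by multiplication in $U$. Write $\pi_i\colon P^{[2]}\to P$, $(p_1,p_2)\mapsto p_i$. Let $\nabla_L$ be a bundle gerbe connection on $L$ (a connection compatible with the product), with curvature $F_L$, let $f\in\Omega^2(P)$ be a curving, $F_L=\pi_1^*f-\pi_2^*f$, and let $H\in\Omega^3(M)$ be the 3-curvature, $df=\pi^*H$ (all forms complex-valued). Let $H^{\mathrm{odd}}(M,P)=H^{\mathrm{odd}}(M,H)$ be the odd cohomology of $\Omega^\bullet(M)$ with respect to $d-H\wedge$. Let $\mathcal L^1$ be the Banach space of trace class operators with the trace norm, and let $U_{\mathrm{tr}}$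 be the group of unitaries in $1+\mathcal L^1$. A $U_{\mathrm{tr}}$ bundle gerbe module is a Hilbert bundle $E\to P$ with fibre $\mathcal H$ whose structure group is reduced smoothly to $U_{\mathrm{tr}}$, with a unitary isomorphism $\psi\colon\pi_1^*E\otimes L\to\pi_2^*E$ compatible with the product of $L$, such that for every $\hat u\in L_{(p_1,p_2)}\cap U$ the map $s\mapsto \psi(\,\cdot\otimes\hat u)\circ s\circ\hat u^{-1}$ carries $U_{\mathrm{tr}}$-frames $s\colon\mathcal H\to E_{p_1}$ to $U_{\mathrm{tr}}$-frames of $E_{p_2}$. A module connection $\nabla_E$ is a connection on $E$ (locally $d+A$ with $A$ a smooth 1-form with values in the bounded operators) with $\pi_1^*\nabla_E\otimes 1+1\otimes\nabla_L=\psi^{-1}\circ\pi_2^*\nabla_E\circ\psi$. Consider smooth automorphisms $\varphi$ of the module $E$, that is, invertible bundle endomorphisms commuting with $\psi$, such that $\varphi-I$ is trace class, smoothly for the trace norm. (1) For every such $E$, $\nabla_E$, $\varphi$ the difference $A(\varphi)=\varphi^{-1}\nabla_E\varphi-\nabla_E$ is a smooth 1-form with values in trace class operators. Let $\nabla_E(s)=s\,\varphi^{-1}\nabla_E\varphi+(1-s)\nabla_E$,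 with curvature $F_E(s)$. Then $A(\varphi)\exp(F_E(s)+fI)$ takes trace class values in each degree, its trace is integrable in $s\in[0,1]$, and there is a unique smooth odd form $ch_P(\nabla_E,\varphi)\in\Omega^\bullet(M)$ with $$\pi^*ch_P(\nabla_E,\varphi)=\int_0^1\mathrm{tr}\bigl(A(\varphi)\exp(F_E(s)+fI)\bigr)\,ds .$$ It is closed with respect to $d-H$. (2) The class $[ch_P(\nabla_E,\varphi)]\in H^{\mathrm{odd}}(M,P)$ does not depend on the module connection $\nabla_E$, and it is the same for automorphisms $\varphi,\varphi'$ of $E$ as above that are joined by a path of automorphisms $\varphi_t$ of the module $E$ with $\varphi_t-I$ trace class, jointly continuous for the trace norm. (3) Let $K^1(M,P)=[P,GL_{\mathcal K}]^{PU}$ be the set of homotopy classes of norm-continuous $PU$-equivariant maps from $P$ to the group $GL_{\mathcal K}$ of invertible operators that differ from the identity by a compact operator, on which $PU$ acts by conjugation. If $E$ is isomorphic as a module to the trivial module $P\times\mathcal H$ (on which $\hat u\in L$ acts as $\hat u$), then $\varphi$ becomes such a map and so defines a class $[E,\varphi]\in K^1(M,P)$. There is exactly one map $ch_P\colon K^1(M,P)\to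 H^{\mathrm{odd}}(M,P)$ with $ch_P([E,\varphi])=[ch_P(\nabla_E,\varphi)]$ for all such $E$ (with any such isomorphism), $\nabla_E$ and $\varphi$. -/

import Mathlib

open scoped Manifold ContDiff Topology InnerProductSpace

noncomputable section

namespace OddChern

section UnitaryManifold

variable (A : Type*) [CStarAlgebra A]

/-- The Lie algebra of the unitary group: skew-adjoint elements, a real Banach space. -/
abbrev Skew : Type _ := ↥(skewAdjoint.submodule ℝ A)

variable {A}

theorem Skew.star_eq (X : Skew A) : star (X : A) = -(X : A) := X.2

theorem Skew.isUnit_one_sub (X : Skew A) : IsUnit (1 - (X : A)) := by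
  by_contra h
  have h1 : (1 : ℂ) ∈ spectrum ℂ (X : A) := by
    rw [spectrum.mem_iff]; simpa using h
  have h2 : IsSelfAdjoint (Complex.I • (X : A)) := by
    rw [IsSelfAdjoint, star_smul, X.star_eq]; simp
  have h3 : Complex.I • (1 : ℂ) ∈ spectrum ℂ (Complex.I • (X : A)) :=
    (spectrum.smul_mem_smul_iff (r := Units.mk0 Complex.I Complex.I_ne_zero)).2 h1
  have h4 := congrArg Complex.im (h2.mem_spectrum_eq_re h3)
  simp at h4

theorem Skew.isUnit_one_add (X : Skew A) : IsUnit (1 + (X : A)) := by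
  simpa using (-X).isUnit_one_sub

/-- The projection `a ↦ (a - a⋆) / 2` onto the skew-adjoint elements. -/
def skewPart : A →L[ℝ] Skew A where
  toFun a := ⟨(2⁻¹ : ℝ) • (a - star a), by
    change star _ = -_; simp [← smul_neg]⟩
  map_add' a b := by ext; simp [← smul_add]; abel
  map_smul' r a := by ext; simp [← smul_sub, smul_comm r]
  cont := by fun_prop

theorem skewPart_coe {a : A} (h : star a = -a) : (skewPart a : A) = a := by
  change (2⁻¹ : ℝ) • (a - star a) = a
  rw [h, sub_neg_eq_add, ← two_smul ℝ a, smul_smul]; norm_num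

/-- The inverse Cayley transform `X ↦ (1 + X) (1 - X)⁻¹`. -/
def cayleyInv (X : Skew A) : unitary A :=
  ⟨(1 + (X : A)) * Ring.inverse (1 - (X : A)), by
    have hs := X.isUnit_one_sub
    have ha := X.isUnit_one_add
    have hst : star (Ring.inverse (1 - (X : A))) = Ring.inverse (1 + (X : A)) := by
      rw [← Ring.inverse_star]; simp [X.star_eq]
    have hc : Commute (1 + (X : A)) (1 - (X : A)) := by
      rw [Commute, SemiconjBy]; noncomm_ring
    have hc' := hc.ringInverse_ringInverse
    have e1 := Ring.mul_inverse_cancel _ hs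
    have e2 := Ring.inverse_mul_cancel _ hs
    have e3 := Ring.mul_inverse_cancel _ ha
    have e4 := Ring.inverse_mul_cancel _ ha
    rw [Unitary.mem_iff]
    simp only [star_mul, star_add, star_one, X.star_eq, hst, ← sub_eq_add_neg]
    constructor
    · rw [mul_assoc, ← mul_assoc (1 - (X : A)), ← hc.eq, mul_assoc, e1, mul_one, e4]
    · rw [mul_assoc, ← mul_assoc (Ring.inverse (1 - (X : A))), ← hc'.eq, mul_assoc, e2, mul_one, e3]⟩

theorem cayleyInv_coe (X : Skew A) :
    (cayleyInv X : A) = (1 + (X : A)) * Ring.inverse (1 - (X : A)) := rfl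

/-- The Cayley transform `w ↦ (w - 1) (w + 1)⁻¹`. -/
def cayleyFun (w : unitary A) : Skew A := skewPart (((w : A) - 1) * Ring.inverse ((w : A) + 1))

theorem cayleyFun_coe {w : unitary A} (hw : IsUnit ((w : A) + 1)) :
    (cayleyFun w : A) = ((w : A) - 1) * Ring.inverse ((w : A) + 1) := by
  apply skewPart_coe
  have h1 := Unitary.star_mul_self_of_mem w.2
  have h2 := Unitary.mul_star_self_of_mem w.2
  have hw' : IsUnit (star ((w : A) + 1)) := hw.star
  have e1 := Ring.inverse_mul_cancel _ hw'
  have e2 := Ring.mul_inverse_cancel _ hw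
  rw [star_mul, ← Ring.inverse_star]
  have key : star ((w : A) - 1) * ((w : A) + 1) = - (star ((w : A) + 1) * ((w : A) - 1)) := by
    simp only [star_sub, star_add, star_one, sub_mul, mul_add, add_mul, mul_sub, h1, mul_one, one_mul]; abel
  calc _ = Ring.inverse (star ((w : A) + 1)) * star ((w : A) - 1)
          * (((w : A) + 1) * Ring.inverse ((w : A) + 1)) := by rw [e2, mul_one]
    _ = Ring.inverse (star ((w : A) + 1)) * (star ((w : A) - 1) * ((w : A) + 1))
          * Ring.inverse ((w : A) + 1) := by simp only [mul_assoc]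
    _ = -((Ring.inverse (star ((w : A) + 1)) * star ((w : A) + 1)) * ((w : A) - 1)
          * Ring.inverse ((w : A) + 1)) := by rw [key]; simp only [mul_assoc, mul_neg, neg_mul]
    _ = _ := by rw [e1, one_mul]

theorem cayleyInv_add_one (X : Skew A) :
    (cayleyInv X : A) + 1 = 2 * Ring.inverse (1 - (X : A)) := by
  rw [cayleyInv_coe]
  have e := Ring.mul_inverse_cancel _ X.isUnit_one_sub
  calc _ = (1 + (X : A)) * Ring.inverse (1 - (X : A))
        + (1 - (X : A)) * Ring.inverse (1 - (X : A)) := by rw [e]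
    _ = _ := by noncomm_ring

theorem cayleyInv_sub_one (X : Skew A) :
    (cayleyInv X : A) - 1 = 2 * (X : A) * Ring.inverse (1 - (X : A)) := by
  rw [cayleyInv_coe]
  have e := Ring.mul_inverse_cancel _ X.isUnit_one_sub
  calc _ = (1 + (X : A)) * Ring.inverse (1 - (X : A))
        - (1 - (X : A)) * Ring.inverse (1 - (X : A)) := by rw [e]
    _ = _ := by noncomm_ring

theorem isUnit_two' : IsUnit (2 : A) := by
  have : IsUnit (algebraMap ℂ A 2) := (IsUnit.mk0 (2 : ℂ) two_ne_zero).map _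
  rwa [map_ofNat] at this

theorem isUnit_cayleyInv_add_one (X : Skew A) : IsUnit ((cayleyInv X : A) + 1) := by
  rw [cayleyInv_add_one]
  exact isUnit_two'.mul X.isUnit_one_sub.ringInverse

theorem contDiffAt_inverse {a : A} (h : IsUnit a) : ContDiffAt ℝ ∞ (Ring.inverse : A → A) a := by
  obtain ⟨u, rfl⟩ := h
  exact contDiffAt_ringInverse ℝ u

/-- The Cayley transform as a chart of the unitary group at the identity. -/
def cayley : OpenPartialHomeomorph (unitary A) (Skew A) where
  toFun := cayleyFun
  invFun := cayleyInv
  source := {w | IsUnit ((w : A) + 1)}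
  target := Set.univ
  map_source' _ _ := Set.mem_univ _
  map_target' X _ := isUnit_cayleyInv_add_one X
  left_inv' w hw := by
    have hw : IsUnit ((w : A) + 1) := hw
    ext
    rw [cayleyInv_coe, cayleyFun_coe hw]
    have e2 := Ring.mul_inverse_cancel _ hw
    have h1 : 1 + ((w : A) - 1) * Ring.inverse ((w : A) + 1)
        = 2 * w * Ring.inverse ((w : A) + 1) := by
      nth_rw 1 [← e2]; rw [← add_mul]; congr 1; noncomm_ring
    have h2 : 1 - ((w : A) - 1) * Ring.inverse ((w : A) + 1)
        = 2 * Ring.inverse ((w : A) + 1) := by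
      nth_rw 1 [← e2]; rw [← sub_mul]; congr 1; abel_nf; simp
    have h3 : IsUnit (2 * Ring.inverse ((w : A) + 1)) := isUnit_two'.mul hw.ringInverse
    rw [h1, h2]
    have hc : (2 : A) * w = w * 2 := by noncomm_ring
    rw [hc, mul_assoc (w : A), mul_assoc (w : A), Ring.mul_inverse_cancel _ h3, mul_one]
  right_inv' X _ := by
    ext
    rw [cayleyFun_coe (isUnit_cayleyInv_add_one X)]
    have h : (cayleyInv X : A) - 1 = X * ((cayleyInv X : A) + 1) := by
      rw [cayleyInv_sub_one, cayleyInv_add_one]; noncomm_ring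
    rw [h, mul_assoc, Ring.mul_inverse_cancel _ (isUnit_cayleyInv_add_one X), mul_one]
  open_source := Units.isOpen.preimage (by fun_prop : Continuous fun w : unitary A => (w : A) + 1)
  open_target := isOpen_univ
  continuousOn_toFun w hw := by
    apply ContinuousAt.continuousWithinAt
    have h1 : ContinuousAt (fun w : unitary A => Ring.inverse ((w : A) + 1)) w :=
      (contDiffAt_inverse hw).continuousAt.comp (f := fun w : unitary A => (w : A) + 1)
        (by fun_prop)
    exact skewPart.continuous.continuousAt.comp
      ((by fun_prop : ContinuousAt (fun w : unitary A => (w : A) - 1) w).mul h1)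
  continuousOn_invFun X _ := by
    apply ContinuousAt.continuousWithinAt
    rw [Topology.IsInducing.subtypeVal.continuousAt_iff]
    have h1 : ContinuousAt (fun X : Skew A => Ring.inverse (1 - (X : A))) X :=
      (contDiffAt_inverse X.isUnit_one_sub).continuousAt.comp (f := fun X : Skew A => 1 - (X : A))
        (by fun_prop)
    exact (by fun_prop : ContinuousAt (fun X : Skew A => 1 + (X : A)) X).mul h1

/-- The chart `u ↦ cayley (u₀⁻¹ u)` of the unitary group at `u₀`. -/
def cayleyAt (u₀ : unitary A) : OpenPartialHomeomorph (unitary A) (Skew A) :=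
  (Homeomorph.mulLeft u₀⁻¹).toOpenPartialHomeomorph.trans cayley

/-- The unitary group of a C⋆-algebra as a Banach manifold, with its norm topology. -/
instance unitaryChartedSpace : ChartedSpace (Skew A) (unitary A) where
  atlas := Set.range cayleyAt
  chartAt := cayleyAt
  mem_chart_source u := by
    have h : IsUnit (((u⁻¹ * u : unitary A) : A) + 1) := by
      rw [inv_mul_cancel, OneMemClass.coe_one, one_add_one_eq_two]; exact isUnit_two'
    exact ⟨Set.mem_univ _, h⟩
  chart_mem_atlas u := ⟨u, rfl⟩

instance unitaryIsManifold : IsManifold 𝓘(ℝ, Skew A) ∞ (unitary A) := by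
  apply isManifold_of_contDiffOn
  rintro _ _ ⟨u, rfl⟩ ⟨v, rfl⟩ X hX
  apply ContDiffAt.contDiffWithinAt
  have hX' : IsUnit (((v⁻¹ * (u * cayleyInv X) : unitary A) : A) + 1) := by
    have hu : (Homeomorph.mulLeft u⁻¹).symm (cayleyInv X) = u * cayleyInv X := by
      simp [Homeomorph.mulLeft_symm]
    simpa [cayleyAt, cayley, hu] using hX
  have hs : ContDiffAt ℝ ∞ (fun X : Skew A => (X : A)) X :=
    (skewAdjoint.submodule ℝ A).subtypeL.contDiff.contDiffAt
  have h1 : ContDiffAt ℝ ∞ (fun X : Skew A => (cayleyInv X : A)) X :=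
    (contDiffAt_const.add hs).mul
      (ContDiffAt.comp (f := fun X : Skew A => 1 - (X : A)) X
        (contDiffAt_inverse X.isUnit_one_sub) (contDiffAt_const.sub hs))
  have h2 : ContDiffAt ℝ ∞ (fun X : Skew A => ((v⁻¹ * (u * cayleyInv X) : unitary A) : A)) X := by
    simp only [Submonoid.coe_mul]
    exact contDiffAt_const.mul (contDiffAt_const.mul h1)
  have h3 := (h2.sub (contDiffAt_const (c := (1 : A)))).mul
    (ContDiffAt.comp (f := fun X : Skew A => ((v⁻¹ * (u * cayleyInv X) : unitary A) : A) + 1) X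
      (contDiffAt_inverse hX') (h2.add contDiffAt_const))
  have h4 := skewPart.contDiff.contDiffAt.comp X h3
  refine h4.congr_of_eventuallyEq (Filter.Eventually.of_forall fun Y => ?_)
  have hu : (Homeomorph.mulLeft u⁻¹).symm (cayleyInv Y) = u * cayleyInv Y := by
    simp [Homeomorph.mulLeft_symm]
  change cayleyFun (v⁻¹ * (Homeomorph.mulLeft u⁻¹).symm (cayleyInv Y)) = _
  rw [hu]; rfl

end UnitaryManifold

section TraceClassOperators

variable {H : Type*} [NormedAddCommGroup H] [InnerProductSpace ℂ H]

/-- `T = ∑ₙ ⟪yₙ, ·⟫ xₙ` with `∑ₙ ‖xₙ‖ ‖yₙ‖ < ∞`. -/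
structure IsNuclearRep (T : H →L[ℂ] H) (x y : ℕ → H) : Prop where
  summable : Summable fun n => ‖x n‖ * ‖y n‖
  hasSum : ∀ v, HasSum (fun n => ⟪y n, v⟫_ℂ • x n) (T v)

/-- Trace class (that is, nuclear) operators on a Hilbert space. -/
def IsTraceClass (T : H →L[ℂ] H) : Prop := ∃ x y, IsNuclearRep T x y

/-- The trace norm (that is, the nuclear norm). -/
def traceNorm (T : H →L[ℂ] H) : ℝ :=
  sInf {r | ∃ x y, IsNuclearRep T x y ∧ r = ∑' n, ‖x n‖ * ‖y n‖}

theorem IsNuclearRep.zero : IsNuclearRep (0 : H →L[ℂ] H) 0 0 :=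
  ⟨by simp [summable_zero], fun v => by simp [hasSum_zero]⟩

theorem IsNuclearRep.smul (c : ℂ) {T : H →L[ℂ] H} {x y : ℕ → H} (h : IsNuclearRep T x y) :
    IsNuclearRep (c • T) (c • x) y :=
  ⟨by simpa [norm_smul, mul_assoc] using h.summable.mul_left ‖c‖,
    fun v => by
      have := (h.hasSum v).const_smul c
      simp_rw [smul_comm c] at this
      exact this⟩

/-- Interleaving of two sequences. -/
def interleave {α : Type*} (x x' : ℕ → α) : ℕ → α := Sum.elim x x' ∘ Equiv.natSumNatEquivNat.symm

theorem hasSum_interleave {F : Type*} [NormedAddCommGroup F] {g g' : ℕ → F} {a a' : F}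
    (h : HasSum g a) (h' : HasSum g' a') :
    HasSum (Sum.elim g g' ∘ Equiv.natSumNatEquivNat.symm) (a + a') :=
  (Equiv.hasSum_iff Equiv.natSumNatEquivNat.symm).2 (HasSum.sum h h')

theorem interleave_comp {α F : Type*} (B : α → α → F) (x x' y y' : ℕ → α) :
    (fun n => B (interleave x x' n) (interleave y y' n)) =
      Sum.elim (fun n => B (x n) (y n)) (fun n => B (x' n) (y' n)) ∘
        Equiv.natSumNatEquivNat.symm := by
  funext n
  simp only [interleave, Function.comp]
  cases Equiv.natSumNatEquivNat.symm n <;> rfl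

theorem IsNuclearRep.add {T T' : H →L[ℂ] H} {x y x' y' : ℕ → H} (h : IsNuclearRep T x y)
    (h' : IsNuclearRep T' x' y') :
    IsNuclearRep (T + T') (interleave x x') (interleave y y') ∧
      ∑' n, ‖interleave x x' n‖ * ‖interleave y y' n‖ =
        ∑' n, ‖x n‖ * ‖y n‖ + ∑' n, ‖x' n‖ * ‖y' n‖ := by
  have h1 := hasSum_interleave h.summable.hasSum h'.summable.hasSum
  rw [← interleave_comp (fun a b => ‖a‖ * ‖b‖)] at h1
  refine ⟨⟨h1.summable, fun v => ?_⟩, h1.tsum_eq⟩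
  have h2 := hasSum_interleave (h.hasSum v) (h'.hasSum v)
  rwa [← interleave_comp (fun a b => ⟪b, v⟫_ℂ • a)] at h2

theorem IsNuclearRep.norm_le {T : H →L[ℂ] H} {x y : ℕ → H} (h : IsNuclearRep T x y) :
    ‖T‖ ≤ ∑' n, ‖x n‖ * ‖y n‖ := by
  refine T.opNorm_le_bound (tsum_nonneg fun n => by positivity) fun v => ?_
  rw [← (h.hasSum v).tsum_eq]
  have hb : ∀ n, ‖⟪y n, v⟫_ℂ • x n‖ ≤ ‖x n‖ * ‖y n‖ * ‖v‖ := fun n => by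
    rw [norm_smul]
    nlinarith [norm_inner_le_norm (𝕜 := ℂ) (y n) v, norm_nonneg (x n)]
  exact tsum_of_norm_bounded (h.summable.mul_right ‖v‖).hasSum hb |>.trans_eq
    (tsum_mul_right)

theorem traceNorm_le {T : H →L[ℂ] H} {x y : ℕ → H} (h : IsNuclearRep T x y) :
    traceNorm T ≤ ∑' n, ‖x n‖ * ‖y n‖ :=
  csInf_le ⟨0, by rintro _ ⟨x, y, -, rfl⟩; exact tsum_nonneg fun n => by positivity⟩
    ⟨x, y, h, rfl⟩

theorem le_traceNorm {T : H →L[ℂ] H} (hT : IsTraceClass T) {c : ℝ}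
    (hc : ∀ x y, IsNuclearRep T x y → c ≤ ∑' n, ‖x n‖ * ‖y n‖) : c ≤ traceNorm T := by
  obtain ⟨x, y, h⟩ := hT
  refine le_csInf ⟨_, x, y, h, rfl⟩ ?_
  rintro _ ⟨x, y, h, rfl⟩
  exact hc x y h

theorem traceNorm_nonneg (T : H →L[ℂ] H) : 0 ≤ traceNorm T :=
  Real.sInf_nonneg (by rintro _ ⟨x, y, -, rfl⟩; exact tsum_nonneg fun n => by positivity)

theorem traceNorm_add_le {T T' : H →L[ℂ] H} (hT : IsTraceClass T) (hT' : IsTraceClass T') :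
    traceNorm (T + T') ≤ traceNorm T + traceNorm T' := by
  rw [← sub_le_iff_le_add]
  refine le_traceNorm hT fun x y h => ?_
  rw [sub_le_comm]
  refine le_traceNorm hT' fun x' y' h' => ?_
  have := traceNorm_le (h.add h').1
  rw [(h.add h').2] at this
  linarith

theorem traceNorm_smul_le (c : ℂ) {T : H →L[ℂ] H} (hT : IsTraceClass T) :
    traceNorm (c • T) ≤ ‖c‖ * traceNorm T := by
  rcases eq_or_ne c 0 with rfl | hc
  · simpa using traceNorm_le (IsNuclearRep.zero (H := H))
  rw [← inv_mul_le_iff₀ (norm_pos_iff.2 hc)]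
  refine le_traceNorm hT fun x y h => ?_
  rw [inv_mul_le_iff₀ (norm_pos_iff.2 hc)]
  refine (traceNorm_le (h.smul c)).trans_eq ?_
  simp [norm_smul, mul_assoc, tsum_mul_left]

variable (H) in
/-- The subspace of trace class operators. -/
def traceClass : Submodule ℂ (H →L[ℂ] H) where
  carrier := {T | IsTraceClass T}
  add_mem' := by rintro _ _ ⟨x, y, h⟩ ⟨x', y', h'⟩; exact ⟨_, _, (h.add h').1⟩
  zero_mem' := ⟨_, _, IsNuclearRep.zero⟩
  smul_mem' := by rintro c _ ⟨x, y, h⟩; exact ⟨_, _, h.smul c⟩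

variable (H) in
/-- The space of trace class operators, normed by the trace norm. -/
def TraceClass : Type _ := ↥(traceClass H)

namespace TraceClass

instance : AddCommGroup (TraceClass H) := inferInstanceAs (AddCommGroup ↥(traceClass H))
instance : Module ℂ (TraceClass H) := inferInstanceAs (Module ℂ ↥(traceClass H))

/-- The underlying bounded operator. -/
def toOp (T : TraceClass H) : H →L[ℂ] H := (show ↥(traceClass H) from T).1

theorem isTraceClass (T : TraceClass H) : IsTraceClass T.toOp :=
  (show ↥(traceClass H) from T).2

instance : Norm (TraceClass H) := ⟨fun T => traceNorm T.toOp⟩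

theorem normCore : NormedSpace.Core ℂ (TraceClass H) where
  norm_nonneg T := traceNorm_nonneg _
  norm_smul c T := by
    change traceNorm (c • T.toOp) = ‖c‖ * traceNorm T.toOp
    refine le_antisymm (traceNorm_smul_le c T.isTraceClass) ?_
    rcases eq_or_ne c 0 with rfl | hc
    · simpa using traceNorm_nonneg _
    have h := traceNorm_smul_le c⁻¹ (T := c • T.toOp) ((traceClass H).smul_mem c T.isTraceClass)
    rw [smul_smul, inv_mul_cancel₀ hc, one_smul, norm_inv] at h
    rwa [← le_inv_mul_iff₀ (norm_pos_iff.2 hc)]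
  norm_triangle S T := traceNorm_add_le S.isTraceClass T.isTraceClass
  norm_eq_zero_iff T := by
    constructor
    · intro h
      have h1 : ‖T.toOp‖ ≤ traceNorm T.toOp :=
        le_traceNorm T.isTraceClass fun x y hr => hr.norm_le
      have h2 : traceNorm T.toOp = 0 := h
      exact Subtype.ext (norm_le_zero_iff.1 (h1.trans_eq h2))
    · rintro rfl
      refine le_antisymm ?_ (traceNorm_nonneg _)
      exact (traceNorm_le (IsNuclearRep.zero (H := H))).trans_eq (by simp)

instance : NormedAddCommGroup (TraceClass H) := NormedAddCommGroup.ofCore normCore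
instance : NormedSpace ℂ (TraceClass H) := NormedSpace.ofCore normCore

end TraceClass

/-- The trace `∑ᵢ ⟪eᵢ, T eᵢ⟫` along a Hilbert basis. For trace class `T` the sum converges
absolutely and does not depend on the basis. -/
def trace [CompleteSpace H] (T : H →L[ℂ] H) : ℂ :=
  ∑' e : (exists_hilbertBasis ℂ H).choose, ⟪(e : H), T e⟫_ℂ

end TraceClassOperators

section Wedge

variable {E F F' F'' : Type*} [NormedAddCommGroup E] [NormedSpace ℝ E]
  [NormedAddCommGroup F] [NormedSpace ℝ F] [NormedAddCommGroup F'] [NormedSpace ℝ F']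
  [NormedAddCommGroup F''] [NormedSpace ℝ F''] {p q n : ℕ}

/-- `(v₁, …, vₙ) ↦ B (α (v₁, …, vₚ)) (β (vₚ₊₁, …, vₙ))`, where `p + q = n`. -/
def tensorForm (B : F →L[ℝ] F' →L[ℝ] F'') (h : p + q = n) (α : E [⋀^Fin p]→L[ℝ] F)
    (β : E [⋀^Fin q]→L[ℝ] F') : ContinuousMultilinearMap ℝ (fun _ : Fin n => E) F'' where
  toFun v := B (α fun i => v (Fin.cast h (Fin.castAdd q i))) (β fun j => v (Fin.cast h (Fin.natAdd p j)))
  map_update_add' := by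
    subst h
    intro _ v i x y
    have hd : ‹DecidableEq (Fin (p + q))› = instDecidableEqFin _ := Subsingleton.elim _ _
    subst hd
    induction i using Fin.addCases with
    | left i =>
      have h1 : ∀ z, (fun k => Function.update v (Fin.castAdd q i) z (Fin.castAdd q k))
          = Function.update (fun k => v (Fin.castAdd q k)) i z := fun z => by
        funext k; simp [Function.update_apply]
      have h2 : ∀ z, (fun k => Function.update v (Fin.castAdd q i) z (Fin.natAdd p k))
          = fun k => v (Fin.natAdd p k) := fun z => by
        funext k; rw [Function.update_of_ne]; simp [Fin.ext_iff]; omega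
      simp [h1, h2]
    | right i =>
      have h1 : ∀ z, (fun k => Function.update v (Fin.natAdd p i) z (Fin.natAdd p k))
          = Function.update (fun k => v (Fin.natAdd p k)) i z := fun z => by
        funext k; simp [Function.update_apply]
      have h2 : ∀ z, (fun k => Function.update v (Fin.natAdd p i) z (Fin.castAdd q k))
          = fun k => v (Fin.castAdd q k) := fun z => by
        funext k; rw [Function.update_of_ne]; simp [Fin.ext_iff]; omega
      simp [h1, h2]
  map_update_smul' := by
    subst h
    intro _ v i c x
    have hd : ‹DecidableEq (Fin (p + q))› = instDecidableEqFin _ := Subsingleton.elim _ _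
    subst hd
    induction i using Fin.addCases with
    | left i =>
      have h1 : ∀ z, (fun k => Function.update v (Fin.castAdd q i) z (Fin.castAdd q k))
          = Function.update (fun k => v (Fin.castAdd q k)) i z := fun z => by
        funext k; simp [Function.update_apply]
      have h2 : ∀ z, (fun k => Function.update v (Fin.castAdd q i) z (Fin.natAdd p k))
          = fun k => v (Fin.natAdd p k) := fun z => by
        funext k; rw [Function.update_of_ne]; simp [Fin.ext_iff]; omega
      simp [h1, h2]
    | right i =>
      have h1 : ∀ z, (fun k => Function.update v (Fin.natAdd p i) z (Fin.natAdd p k))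
          = Function.update (fun k => v (Fin.natAdd p k)) i z := fun z => by
        funext k; simp [Function.update_apply]
      have h2 : ∀ z, (fun k => Function.update v (Fin.natAdd p i) z (Fin.castAdd q k))
          = fun k => v (Fin.castAdd q k) := fun z => by
        funext k; rw [Function.update_of_ne]; simp [Fin.ext_iff]; omega
      simp [h1, h2]
  cont := by
    have h1 : Continuous fun v : Fin n → E => α fun i => v (Fin.cast h (Fin.castAdd q i)) :=
      α.cont.comp (by fun_prop)
    have h2 : Continuous fun v : Fin n → E => β fun j => v (Fin.cast h (Fin.natAdd p j)) :=
      β.cont.comp (by fun_prop)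
    exact (B.continuous.comp h1).clm_apply h2

/-- The wedge product of vector-valued alternating forms along a bilinear map `B`:
`(α ∧ β) (v₁, …, vₙ) = (p! q!)⁻¹ ∑_σ sign σ • B (α (v_σ₁, …)) (β (v_σ₍ₚ₊₁₎, …))`. -/
def wedge (B : F →L[ℝ] F' →L[ℝ] F'') (h : p + q = n) (α : E [⋀^Fin p]→L[ℝ] F)
    (β : E [⋀^Fin q]→L[ℝ] F') : E [⋀^Fin n]→L[ℝ] F'' :=
  ((p.factorial * q.factorial : ℝ)⁻¹) • ContinuousMultilinearMap.alternatization (tensorForm B h α β)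

theorem wedge_add_right (B : F →L[ℝ] F' →L[ℝ] F'') (h : p + q = n) (α : E [⋀^Fin p]→L[ℝ] F)
    (β β' : E [⋀^Fin q]→L[ℝ] F') : wedge B h α (β + β') = wedge B h α β + wedge B h α β' := by
  have : tensorForm B h α (β + β') = tensorForm B h α β + tensorForm B h α β' := by
    ext v; exact map_add (B _) _ _
  rw [wedge, this, map_add, smul_add]; rfl

theorem wedge_smul_right (B : F →L[ℝ] F' →L[ℝ] F'') (h : p + q = n) (α : E [⋀^Fin p]→L[ℝ] F)
    (c : ℝ) (β : E [⋀^Fin q]→L[ℝ] F') : wedge B h α (c • β) = c • wedge B h α β := by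
  have : tensorForm B h α (c • β) = c • tensorForm B h α β := by
    ext v; exact map_smul (B _) _ _
  rw [wedge, this, wedge, smul_comm c]
  congr 1
  ext v
  simp [ContinuousMultilinearMap.alternatization_apply_apply, Finset.smul_sum, smul_comm c]

end Wedge

section Forms

/-- An `F`-valued form of degree `n` on a manifold `X` modelled on `E`: its value at `x` is
an alternating form on the tangent space at `x`, which is `E`. -/
abbrev Form (E X F : Type*) [NormedAddCommGroup E] [NormedSpace ℝ E] [NormedAddCommGroup F]
    [NormedSpace ℝ F] (n : ℕ) : Type _ := X → E [⋀^Fin n]→L[ℝ] F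

variable {E B X : Type*} [NormedAddCommGroup E] [NormedSpace ℝ E] [TopologicalSpace B]
  (I : ModelWithCorners ℝ E B) [TopologicalSpace X] [ChartedSpace B X]
  {E' B' X' : Type*} [NormedAddCommGroup E'] [NormedSpace ℝ E'] [TopologicalSpace B']
  (I' : ModelWithCorners ℝ E' B') [TopologicalSpace X'] [ChartedSpace B' X']
  {F : Type*} [NormedAddCommGroup F] [NormedSpace ℝ F] {n : ℕ}

/-- The pullback of a form along a map. -/
def pullback (g : X → X') (θ : Form E' X' F n) : Form E X F n :=
  fun x => (θ (g x)).compContinuousLinearMap (mfderiv I I' g x)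

/-- The expression of a form in the chart at `x₀`, a form on the model space. -/
def chartRep (θ : Form E X F n) (x₀ : X) : Form E E F n :=
  pullback 𝓘(ℝ, E) I (extChartAt I x₀).symm θ

/-- Smoothness of a form on an open set, in charts. -/
def IsSmoothOn (θ : Form E X F n) (s : Set X) : Prop :=
  ∀ x₀ : X, ContDiffOn ℝ ∞ (chartRep I θ x₀)
    ((extChartAt I x₀).target ∩ (extChartAt I x₀).symm ⁻¹' s)

/-- The exterior derivative, on manifolds without boundary, computed in the chart at each point. -/
def extD (θ : Form E X F n) : Form E X F (n + 1) :=
  fun x => (extDeriv (chartRep I θ x) (extChartAt I x x)).compContinuousLinearMap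
    (mfderiv I 𝓘(ℝ, E) (extChartAt I x) x)

/-- The differential of a vector-valued function, as a 1-form. -/
def dFun (g : X → F) : Form E X F 1 :=
  fun x => ContinuousAlternatingMap.ofSubsingleton ℝ E F (0 : Fin 1) (mfderiv I 𝓘(ℝ, F) g x)

theorem chartRep_add (θ θ' : Form E X F n) (x₀ : X) :
    chartRep I (θ + θ') x₀ = chartRep I θ x₀ + chartRep I θ' x₀ := rfl

theorem chartRep_smul (c : ℝ) (θ : Form E X F n) (x₀ : X) :
    chartRep I (c • θ) x₀ = c • chartRep I θ x₀ := rfl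

variable (X F n) in
/-- The space of smooth forms of degree `n` on `X`. -/
def SmoothForm : Submodule ℝ (Form E X F n) where
  carrier := {θ | IsSmoothOn I θ Set.univ}
  add_mem' h h' x₀ := by rw [chartRep_add]; exact (h x₀).add (h' x₀)
  zero_mem' x₀ := contDiffOn_const (c := (0 : E [⋀^Fin n]→L[ℝ] F))
  smul_mem' c _ h x₀ := by rw [chartRep_smul]; exact contDiffOn_const.smul (h x₀)

theorem SmoothForm.differentiableAt [I.Boundaryless] (θ : SmoothForm X I F n) (x : X) :
    DifferentiableAt ℝ (chartRep I θ.1 x) (extChartAt I x x) := by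
  have h := θ.2 x
  rw [Set.preimage_univ, Set.inter_univ] at h
  exact (h.contDiffAt (extChartAt_target_mem_nhds x)).differentiableAt (by simp)

theorem extD_add [I.Boundaryless] (θ θ' : SmoothForm X I F n) :
    extD I (θ + θ').1 = extD I θ.1 + extD I θ'.1 := by
  funext x
  have := extDeriv_add (SmoothForm.differentiableAt I θ x) (SmoothForm.differentiableAt I θ' x)
  simp only [extD, Pi.add_apply]
  rw [show chartRep I (θ + θ').1 x = chartRep I θ.1 x + chartRep I θ'.1 x from rfl, this]
  rfl

theorem extD_smul (c : ℝ) (θ : Form E X F n) : extD I (c • θ) = c • extD I θ := by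
  funext x
  simp only [extD, Pi.smul_apply]
  rw [chartRep_smul, extDeriv_smul]
  rfl

end Forms

section TwistedCohomology

variable {E X : Type*} [NormedAddCommGroup E] [NormedSpace ℝ E] [TopologicalSpace X]
  [ChartedSpace E X]

variable (E X) in
/-- Complex differential forms of mixed degree, `Ω^•(X)`. -/
def MixedForm : Type _ := ∀ n : ℕ, SmoothForm X 𝓘(ℝ, E) ℂ n

instance : AddCommGroup (MixedForm E X) :=
  inferInstanceAs (AddCommGroup (∀ n : ℕ, SmoothForm X 𝓘(ℝ, E) ℂ n))
instance : Module ℝ (MixedForm E X) :=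
  inferInstanceAs (Module ℝ (∀ n : ℕ, SmoothForm X 𝓘(ℝ, E) ℂ n))

theorem MixedForm.add_apply (θ θ' : MixedForm E X) (n : ℕ) : (θ + θ') n = θ n + θ' n := rfl
theorem MixedForm.smul_apply (c : ℝ) (θ : MixedForm E X) (n : ℕ) : (c • θ) n = c • θ n := rfl

/-- The components of `dθ - H ∧ θ`. -/
def twistedDFun (H : SmoothForm X 𝓘(ℝ, E) ℂ 3) (θ : MixedForm E X) : ∀ n : ℕ, Form E X ℂ n
  | 0 => 0
  | 1 => extD 𝓘(ℝ, E) (θ 0).1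
  | 2 => extD 𝓘(ℝ, E) (θ 1).1
  | n + 3 => extD 𝓘(ℝ, E) (θ (n + 2)).1 -
      fun x => wedge (ContinuousLinearMap.mul ℝ ℂ) (Nat.add_comm 3 n) (H.1 x) ((θ n).1 x)

/-- The twisted differential `δ_H θ = dθ - H ∧ θ`. -/
def twistedD (H : SmoothForm X 𝓘(ℝ, E) ℂ 3) : MixedForm E X →ₗ[ℝ] ∀ n : ℕ, Form E X ℂ n where
  toFun := twistedDFun H
  map_add' θ θ' := by
    funext n
    match n with
    | 0 => simp [twistedDFun]
    | 1 => exact extD_add _ _ _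
    | 2 => exact extD_add _ _ _
    | n + 3 =>
      simp only [twistedDFun, Pi.add_apply, MixedForm.add_apply]
      rw [extD_add]
      funext x
      simp only [Submodule.coe_add, Pi.add_apply, Pi.sub_apply, wedge_add_right]
      abel
  map_smul' c θ := by
    funext n
    match n with
    | 0 => simp [twistedDFun]
    | 1 => exact extD_smul _ _ _
    | 2 => exact extD_smul _ _ _
    | n + 3 =>
      simp only [twistedDFun, Pi.smul_apply, MixedForm.smul_apply, Submodule.coe_smul, extD_smul, RingHom.id_apply]
      funext x
      simp only [Pi.smul_apply, Pi.sub_apply, wedge_smul_right, smul_sub]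

variable (E X) in
/-- Mixed forms all of whose components have degree congruent to `r` modulo 2. -/
def parityForms (r : ℕ) : Submodule ℝ (MixedForm E X) where
  carrier := {θ | ∀ n, ¬ n ≡ r [MOD 2] → θ n = 0}
  add_mem' h h' n hn := by rw [MixedForm.add_apply, h n hn, h' n hn, add_zero]
  zero_mem' _ _ := rfl
  smul_mem' c _ h n hn := by rw [MixedForm.smul_apply, h n hn, smul_zero]

/-- Odd forms that are closed for `d - H`. -/
def closedOdd (H : SmoothForm X 𝓘(ℝ, E) ℂ 3) : Submodule ℝ (MixedForm E X) :=
  parityForms E X 1 ⊓ LinearMap.ker (twistedD H)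

/-- The components of a mixed form. -/
def components : MixedForm E X →ₗ[ℝ] ∀ n : ℕ, Form E X ℂ n where
  toFun θ n := (θ n).1
  map_add' _ _ := rfl
  map_smul' _ _ := rfl

/-- The closed odd forms `δ_H η` with `η` an even form. -/
def exactOdd (H : SmoothForm X 𝓘(ℝ, E) ℂ 3) : Submodule ℝ (closedOdd H) :=
  ((parityForms E X 0).map (twistedD H)).comap (components ∘ₗ (closedOdd H).subtype)

/-- The odd twisted cohomology `H^odd(X, H)`. -/
abbrev TwistedOdd (H : SmoothForm X 𝓘(ℝ, E) ℂ 3) : Type _ := closedOdd H ⧸ exactOdd H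

end TwistedCohomology

section PUBundles

variable (H : Type*) [NormedAddCommGroup H] [InnerProductSpace ℂ H] [CompleteSpace H]

/-- Bounded operators on `H`. -/
abbrev Op : Type _ := H →L[ℂ] H

/-- The unitary group `U(H)` with its norm topology, a Banach manifold. -/
abbrev U : Type _ := unitary (H →L[ℂ] H)

/-- The Lie algebra of `U(H)`. -/
abbrev LieU : Type _ := Skew (H →L[ℂ] H)

instance : NormedAddCommGroup (LieU H) := Submodule.normedAddCommGroup _
instance : NormedSpace ℝ (LieU H) := Submodule.normedSpace _

/-- The scalar unitary `e^{it}`. -/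
def phase (t : ℝ) : U H :=
  ⟨Complex.exp (t * Complex.I) • (1 : H →L[ℂ] H), by
    have h : star (Complex.exp (t * Complex.I)) * Complex.exp (t * Complex.I) = 1 := by
      rw [Complex.star_def, ← Complex.exp_conj, ← Complex.exp_add]; simp
    rw [Unitary.mem_iff]
    constructor
    · rw [star_smul, star_one, smul_mul_smul_comm, h, one_mul, one_smul]
    · rw [star_smul, star_one, smul_mul_smul_comm, mul_comm, h, one_mul, one_smul]⟩

variable {H}
variable {EM M EP P : Type*} [NormedAddCommGroup EM] [NormedSpace ℝ EM] [TopologicalSpace M]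
  [ChartedSpace EM M] [NormedAddCommGroup EP] [NormedSpace ℝ EP] [TopologicalSpace P]
  [ChartedSpace EP P]

variable (H EM M EP P) in
/-- A smooth principal `PU(H)` bundle `P → M`, where `PU(H) = U(H) / U(1)`. The right action of
`PU(H)` is given as an action of `U(H)` in which exactly the scalars fix points. -/
structure PUBundle where
  proj : P → M
  act : P → U H → P
  contMDiff_proj : ContMDiff 𝓘(ℝ, EP) 𝓘(ℝ, EM) ∞ proj
  contMDiff_act : ContMDiff (𝓘(ℝ, EP).prod 𝓘(ℝ, LieU H)) 𝓘(ℝ, EP) ∞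
    (fun x : P × U H => act x.1 x.2)
  act_one : ∀ p, act p 1 = p
  act_mul : ∀ p u v, act p (u * v) = act (act p u) v
  act_eq_self_iff : ∀ p u, act p u = p ↔ ∃ z : ℂ, (u : Op H) = z • (1 : Op H)
  proj_act : ∀ p u, proj (act p u) = proj p
  exists_act_eq : ∀ p q, proj p = proj q → ∃ u, act p u = q
  /-- Near every point of `M` there is a smooth section `σ` such that the inverse of
  `(x, [u]) ↦ σ(x) [u]` is smooth into `PU(H)`, that is, locally lifts smoothly to `U(H)`. -/
  locally_trivial : ∀ m : M, ∃ W : Set M, IsOpen W ∧ m ∈ W ∧ ∃ σ : M → P,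
    ContMDiffOn 𝓘(ℝ, EM) 𝓘(ℝ, EP) ∞ σ W ∧ (∀ x ∈ W, proj (σ x) = x) ∧
    ∀ p, proj p ∈ W → ∃ V : Set P, IsOpen V ∧ p ∈ V ∧ ∃ g : P → U H,
      ContMDiffOn 𝓘(ℝ, EP) 𝓘(ℝ, LieU H) ∞ g V ∧ ∀ q ∈ V, act (σ (proj q)) (g q) = q

variable (B : PUBundle H EM M EP P)

/-- The model with corners of `P × U(H)`. -/
abbrev modelPU (EP H : Type*) [NormedAddCommGroup EP] [NormedSpace ℝ EP] [NormedAddCommGroup H]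
    [InnerProductSpace ℂ H] [CompleteSpace H] :
    ModelWithCorners ℝ (EP × LieU H) (ModelProd EP (LieU H)) :=
  𝓘(ℝ, EP).prod 𝓘(ℝ, LieU H)

/-- The action map `P × U(H) → P`. -/
def PUBundle.actMap (x : P × U H) : P := B.act x.1 x.2

/-- A bundle gerbe connection `∇_L` on the lifting bundle gerbe `L → P^[2]`.

The fibre of the unit circle bundle of `L` over `(p₁, p₂)` is `{û ∈ U(H) | p₁ = p₂ û}`, and the
gerbe product is multiplication in `U(H)`. So the total space of the circle bundle is `P × U(H)`,
where `(p, û)` lies over `(p₁, p₂) = (p û, p)`; the projections `π₁, π₂ : P^[2] → P` pull back to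
`(p, û) ↦ p û` and `(p, û) ↦ p`. A connection on `L` is given by its connection 1-form `α` on
the circle bundle, `∇_L û = α ⊗ û`. -/
structure GerbeConnection where
  α : Form (EP × LieU H) (P × U H) ℂ 1
  smooth : IsSmoothOn (modelPU EP H) α Set.univ
  /-- `α` takes the value `i` on the generator of the `U(1)`-action. -/
  vertical : ∀ (p : P) (u : U H),
    pullback 𝓘(ℝ, ℝ) (modelPU EP H) (fun t : ℝ => (p, phase H t * u)) α 0 ![1] = Complex.I
  /-- `α` is `U(1)`-invariant. -/
  invariant : ∀ t : ℝ,
    pullback (modelPU EP H) (modelPU EP H) (fun x : P × U H => (x.1, phase H t * x.2)) α = α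
  /-- `∇_L` is compatible with the product `(p, u) (p u, v) = (p, u v)`. -/
  multiplicative :
    pullback (𝓘(ℝ, EP).prod (𝓘(ℝ, LieU H).prod 𝓘(ℝ, LieU H))) (modelPU EP H)
        (fun x : P × (U H × U H) => (x.1, x.2.1 * x.2.2)) α =
      pullback (𝓘(ℝ, EP).prod (𝓘(ℝ, LieU H).prod 𝓘(ℝ, LieU H))) (modelPU EP H)
        (fun x : P × (U H × U H) => (x.1, x.2.1)) α +
      pullback (𝓘(ℝ, EP).prod (𝓘(ℝ, LieU H).prod 𝓘(ℝ, LieU H))) (modelPU EP H)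
        (fun x : P × (U H × U H) => (B.act x.1 x.2.1, x.2.2)) α

variable {B}

/-- A curving `f` for `∇_L`: a 2-form on `P` with `F_L = π₁^* f - π₂^* f`. -/
structure GerbeConnection.Curving (nablaL : GerbeConnection B) where
  f : Form EP P ℂ 2
  smooth : IsSmoothOn 𝓘(ℝ, EP) f Set.univ
  curvature_eq : extD (modelPU EP H) nablaL.α =
    pullback (modelPU EP H) 𝓘(ℝ, EP) B.actMap f - pullback (modelPU EP H) 𝓘(ℝ, EP) Prod.fst f

/-- `Θ` is the 3-curvature of `(∇_L, f)`: `df = π^* Θ`. -/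
def GerbeConnection.Curving.IsThreeCurvature {nablaL : GerbeConnection B} (c : nablaL.Curving)
    (Θ : SmoothForm M 𝓘(ℝ, EM) ℂ 3) : Prop :=
  extD 𝓘(ℝ, EP) c.f = pullback 𝓘(ℝ, EP) 𝓘(ℝ, EM) B.proj Θ.1

end PUBundles

section Modules

variable {H : Type*} [NormedAddCommGroup H] [InnerProductSpace ℂ H] [CompleteSpace H]
variable {EM M EP P : Type*} [NormedAddCommGroup EM] [NormedSpace ℝ EM] [TopologicalSpace M]
  [ChartedSpace EM M] [NormedAddCommGroup EP] [NormedSpace ℝ EP] [TopologicalSpace P]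
  [ChartedSpace EP P]

/-- `g` takes values in `1 + (trace class)` on `s`, and `g - 1` is smooth for the trace norm. -/
def SmoothTrOn {E C X : Type*} [NormedAddCommGroup E] [NormedSpace ℝ E] [TopologicalSpace C]
    (I : ModelWithCorners ℝ E C) [TopologicalSpace X] [ChartedSpace C X] (g : X → Op H)
    (s : Set X) : Prop :=
  ∃ t : X → TraceClass H, ContMDiffOn I 𝓘(ℝ, TraceClass H) ∞ t s ∧ ∀ x ∈ s, g x = 1 + (t x).toOp

/-- A `U_tr` bundle gerbe module `E → P` for the lifting bundle gerbe: a Hilbert bundle with local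
trivialisations `E|_{V i} ≅ V i × H`, transition functions `v_i = g i j v_j` in `U_tr`, and an
action of `L`. The element `(p, û)` of `L` acts as a linear map `E_{p û} → E_p`, written
`ψ j i (p, û)` with respect to the trivialisations `i` at `p û` and `j` at `p`. That the reduction
to `U_tr` is preserved by frames `s ↦ û s û⁻¹` means that `ψ j i (p, û) û⁻¹` lies in `U_tr`. -/
structure UtrModule (B : PUBundle H EM M EP P) where
  ι : Type*
  V : ι → Set P
  isOpen : ∀ i, IsOpen (V i)
  cover : ∀ p, ∃ i, p ∈ V i
  g : ι → ι → P → Op H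
  g_tr : ∀ i j, SmoothTrOn 𝓘(ℝ, EP) (g i j) (V i ∩ V j)
  g_unitary : ∀ i j, ∀ p ∈ V i ∩ V j, g i j p ∈ unitary (Op H)
  g_self : ∀ i, ∀ p ∈ V i, g i i p = 1
  g_mul : ∀ i j k, ∀ p ∈ V i ∩ V j ∩ V k, g i j p * g j k p = g i k p
  ψ : ι → ι → P × U H → Op H
  ψ_tr : ∀ j i, SmoothTrOn (modelPU EP H) (fun x => ψ j i x * star (x.2 : Op H))
    {x | B.actMap x ∈ V i ∧ x.1 ∈ V j}
  ψ_unitary : ∀ j i x, B.actMap x ∈ V i → x.1 ∈ V j → ψ j i x ∈ unitary (Op H)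
  /-- Linearity in `L`. -/
  ψ_phase : ∀ j i p u (t : ℝ), B.act p u ∈ V i → p ∈ V j →
    ψ j i (p, phase H t * u) = Complex.exp (t * Complex.I) • ψ j i (p, u)
  /-- Compatibility with the transition functions. -/
  ψ_g : ∀ j' j i' i x, B.actMap x ∈ V i' ∩ V i → x.1 ∈ V j' ∩ V j →
    ψ j' i' x * g i' i (B.actMap x) = g j' j x.1 * ψ j i x
  /-- Compatibility with the product of `L`. -/
  ψ_mul : ∀ k j i p u v, B.act (B.act p u) v ∈ V i → B.act p u ∈ V j → p ∈ V k →
    ψ k j (p, u) * ψ j i (B.act p u, v) = ψ k i (p, u * v)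

variable {B : PUBundle H EM M EP P}

/-- A bundle gerbe module connection `∇_E`: in the trivialisation `i` it is `d + A i`, and
`π₁^* ∇_E ⊗ 1 + 1 ⊗ ∇_L = ψ⁻¹ π₂^* ∇_E ψ`. -/
structure ModuleConnection (E : UtrModule B) (nablaL : GerbeConnection B) where
  A : E.ι → Form EP P (Op H) 1
  smooth : ∀ i, IsSmoothOn 𝓘(ℝ, EP) (A i) (E.V i)
  transition : ∀ i j, ∀ p ∈ E.V i ∩ E.V j, ∀ v,
    E.g i j p * A j p v = dFun 𝓘(ℝ, EP) (E.g i j) p v + A i p v * E.g i j p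
  module : ∀ j i x, B.actMap x ∈ E.V i → x.1 ∈ E.V j → ∀ v,
    E.ψ j i x * pullback (modelPU EP H) 𝓘(ℝ, EP) B.actMap (A i) x v + nablaL.α x v • E.ψ j i x =
      dFun (modelPU EP H) (E.ψ j i) x v +
        pullback (modelPU EP H) 𝓘(ℝ, EP) Prod.fst (A j) x v * E.ψ j i x

/-- `φ`, given in the local trivialisations, is an automorphism of the module `E` (not necessarily
smooth) with `φ - 1` fibrewise trace class. -/
structure UtrModule.IsTrAut (E : UtrModule B) (φ : E.ι → P → Op H) : Prop where
  isUnit : ∀ i, ∀ p ∈ E.V i, IsUnit (φ i p)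
  traceClass : ∀ i, ∀ p ∈ E.V i, IsTraceClass (φ i p - 1)
  transition : ∀ i j, ∀ p ∈ E.V i ∩ E.V j, φ i p * E.g i j p = E.g i j p * φ j p
  module : ∀ j i x, B.actMap x ∈ E.V i → x.1 ∈ E.V j →
    φ j x.1 * E.ψ j i x = E.ψ j i x * φ i (B.actMap x)

/-- Smooth automorphisms `φ` of the module `E` with `φ - 1` trace class. -/
structure TrAut (E : UtrModule B) where
  φ : E.ι → P → Op H
  isTrAut : E.IsTrAut φ
  smooth : ∀ i, SmoothTrOn 𝓘(ℝ, EP) (φ i) (E.V i)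

/-- `φ₀` and `φ₁` are joined by a path of automorphisms `Φ t` of `E` with `Φ t - 1` trace class,
jointly continuous for the trace norm. -/
def TrAut.Homotopic {E : UtrModule B} (φ₀ φ₁ : TrAut E) : Prop :=
  ∃ Φ : unitInterval → E.ι → P → Op H, (∀ t, E.IsTrAut (Φ t)) ∧
    (∀ i, ∃ T : unitInterval × P → TraceClass H, ContinuousOn T (Set.univ ×ˢ E.V i) ∧
      ∀ t, ∀ p ∈ E.V i, Φ t i p = 1 + (T (t, p)).toOp) ∧
    ∀ i, ∀ p ∈ E.V i, Φ 0 i p = φ₀.φ i p ∧ Φ 1 i p = φ₁.φ i p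

/-- The curvature `dA + A ∧ A` of the connection `d + A`. -/
def curvature (A : Form EP P (Op H) 1) : Form EP P (Op H) 2 :=
  extD 𝓘(ℝ, EP) A + fun p => wedge (ContinuousLinearMap.mul ℝ (Op H)) rfl (A p) (A p)

/-- The operator-valued form `f I`. -/
def scalarForm {n : ℕ} (f : Form EP P ℂ n) : Form EP P (Op H) n :=
  fun p => ((ContinuousLinearMap.toSpanSingleton ℂ (1 : Op H)).restrictScalars
    ℝ).compContinuousAlternatingMap (f p)

/-- The `k`-th power of an operator-valued 2-form. -/
def formPow (F : Form EP P (Op H) 2) : ∀ k : ℕ, Form EP P (Op H) (2 * k)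
  | 0 => fun _ => ContinuousAlternatingMap.constOfIsEmpty ℝ EP (ι := Fin 0) 1
  | k + 1 => fun p => wedge (ContinuousLinearMap.mul ℝ (Op H)) rfl (formPow F k p) (F p)

namespace ModuleConnection

variable {E : UtrModule B} {nablaL : GerbeConnection B} (nabla : ModuleConnection E nablaL)
  (φ : TrAut E)

/-- The connection form `φ⁻¹ A φ + φ⁻¹ dφ` of `φ⁻¹ ∇_E φ`. -/
def gauge (i : E.ι) : Form EP P (Op H) 1 := fun p =>
  (ContinuousLinearMap.mulLeftRight ℝ (Op H) (Ring.inverse (φ.φ i p))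
      (φ.φ i p)).compContinuousAlternatingMap (nabla.A i p) +
    (ContinuousLinearMap.mul ℝ (Op H) (Ring.inverse (φ.φ i p))).compContinuousAlternatingMap
      (dFun 𝓘(ℝ, EP) (φ.φ i) p)

/-- `A(φ) = φ⁻¹ ∇_E φ - ∇_E`. -/
def diff (i : E.ι) : Form EP P (Op H) 1 := nabla.gauge φ i - nabla.A i

/-- The connection form of `∇_E(s) = s φ⁻¹ ∇_E φ + (1 - s) ∇_E`. -/
def path (s : ℝ) (i : E.ι) : Form EP P (Op H) 1 := s • nabla.gauge φ i + (1 - s) • nabla.A i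

/-- The component of degree `2k + 1` of `A(φ) exp(F_E(s) + f I)`. -/
def density (c : nablaL.Curving) (i : E.ι) (k : ℕ) (s : ℝ) : Form EP P (Op H) (2 * k + 1) :=
  fun p => ((k.factorial : ℝ)⁻¹) • wedge (ContinuousLinearMap.mul ℝ (Op H))
    (Nat.add_comm 1 (2 * k)) (nabla.diff φ i p)
    (formPow (curvature (nabla.path φ s i) + scalarForm c.f) k p)

/-- `ch` is an odd form on `M` whose lift to `P` is `∫₀¹ tr (A(φ) exp(F_E(s) + f I)) ds`. -/
def IsChForm (c : nablaL.Curving) (ch : MixedForm EM M) : Prop :=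
  ch ∈ parityForms EM M 1 ∧ ∀ (k : ℕ) (i : E.ι), ∀ p ∈ E.V i, ∀ v : Fin (2 * k + 1) → EP,
    pullback 𝓘(ℝ, EP) 𝓘(ℝ, EM) B.proj (ch (2 * k + 1)).1 p v =
      ∫ s in (0 : ℝ)..1, trace (nabla.density φ c i k s p v)

end ModuleConnection

end Modules

section KTheory

variable {H : Type*} [NormedAddCommGroup H] [InnerProductSpace ℂ H] [CompleteSpace H]
variable {EM M EP P : Type*} [NormedAddCommGroup EM] [NormedSpace ℝ EM] [TopologicalSpace M]
  [ChartedSpace EM M] [NormedAddCommGroup EP] [NormedSpace ℝ EP] [TopologicalSpace P]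
  [ChartedSpace EP P]

/-- `Φ` is a `PU(H)`-equivariant map from `P` to the group `GL_K` of invertible operators that
differ from the identity by a compact operator. -/
structure IsGLKMap (B : PUBundle H EM M EP P) (Φ : C(P, Op H)) : Prop where
  isUnit : ∀ p, IsUnit (Φ p)
  compact : ∀ p, IsCompactOperator (Φ p - 1 : Op H)
  equivariant : ∀ p u, Φ (B.act p u) = star (u : Op H) * Φ p * u

/-- Twisted K-theory `K^1(M, P) = [P, GL_K]^{PU(H)}`. -/
def K1 (B : PUBundle H EM M EP P) : Type _ :=
  Quot fun Φ Ψ : {Φ : C(P, Op H) // IsGLKMap B Φ} =>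
    ContinuousMap.HomotopicWith Φ.1 Ψ.1 (IsGLKMap B)

/-- An isomorphism of `E` with the trivial module `P × H`, on which `(p, û)` acts as
`û : H → H`. -/
structure ModuleTrivialization {B : PUBundle H EM M EP P} (E : UtrModule B) where
  τ : E.ι → P → Op H
  smooth : ∀ i, ContMDiffOn 𝓘(ℝ, EP) 𝓘(ℝ, Op H) ∞ (τ i) (E.V i)
  isUnit : ∀ i, ∀ p ∈ E.V i, IsUnit (τ i p)
  transition : ∀ i j, ∀ p ∈ E.V i ∩ E.V j, τ i p * E.g i j p = τ j p
  module : ∀ j i x, B.actMap x ∈ E.V i → x.1 ∈ E.V j →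
    τ j x.1 * E.ψ j i x = x.2 * τ i (B.actMap x)

/-- The equivariant map `Φ` is the automorphism `φ` of `E`, transported to the trivial module
by `τ`. So `Φ` represents the class `[E, φ]` in `K^1(M, P)`. -/
def ModuleTrivialization.Represents {B : PUBundle H EM M EP P} {E : UtrModule B}
    (τ : ModuleTrivialization E) (φ : TrAut E) (Φ : C(P, Op H)) : Prop :=
  ∀ i, ∀ p ∈ E.V i, Φ p * τ.τ i p = τ.τ i p * φ.φ i p

end KTheory

end OddChern

end

open OddChern

open scoped Manifold ContDiff Topology InnerProductSpace
open OddChern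

set_option linter.unusedSectionVars false

noncomputable section

namespace OddChern

section

section TraceClassLibrary

variable {H : Type*} [NormedAddCommGroup H] [InnerProductSpace ℂ H]

theorem IsNuclearRep.comp_left {T : H →L[ℂ] H} {x y : ℕ → H} (h : IsNuclearRep T x y)
    (a : H →L[ℂ] H) : IsNuclearRep (a * T) (fun n => a (x n)) y := by
  refine ⟨?_, fun v => ?_⟩
  · refine Summable.of_nonneg_of_le (fun n => by positivity) (fun n => ?_) (h.summable.mul_left ‖a‖)
    rw [← mul_assoc]
    exact mul_le_mul_of_nonneg_right (a.le_opNorm _) (norm_nonneg _)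
  · simpa using (h.hasSum v).mapL a

theorem IsNuclearRep.comp_right [CompleteSpace H] {T : H →L[ℂ] H} {x y : ℕ → H}
    (h : IsNuclearRep T x y) (a : H →L[ℂ] H) :
    IsNuclearRep (T * a) x (fun n => ContinuousLinearMap.adjoint a (y n)) := by
  refine ⟨?_, fun v => ?_⟩
  · refine Summable.of_nonneg_of_le (fun n => by positivity) (fun n => ?_) (h.summable.mul_left ‖a‖)
    have h1 := (ContinuousLinearMap.adjoint a).le_opNorm (y n)
    rw [LinearIsometryEquiv.norm_map] at h1
    nlinarith [norm_nonneg (x n)]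
  · simpa [ContinuousLinearMap.adjoint_inner_left] using h.hasSum (a v)

theorem traceNorm_mul_left_le {T : H →L[ℂ] H} (hT : IsTraceClass T) (a : H →L[ℂ] H) :
    traceNorm (a * T) ≤ ‖a‖ * traceNorm T := by
  rcases eq_or_ne ‖a‖ 0 with ha | ha
  · rw [norm_eq_zero.1 ha, zero_mul, norm_zero, zero_mul]
    exact (traceNorm_le (IsNuclearRep.zero (H := H))).trans_eq (by simp)
  have ha' : 0 < ‖a‖ := lt_of_le_of_ne (norm_nonneg _) (Ne.symm ha)
  rw [← inv_mul_le_iff₀ ha']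
  refine le_traceNorm hT fun x y h => ?_
  rw [inv_mul_le_iff₀ ha', ← tsum_mul_left]
  refine (traceNorm_le (h.comp_left a)).trans ?_
  refine (h.comp_left a).summable.tsum_le_tsum (fun n => ?_) (h.summable.mul_left _)
  rw [← mul_assoc]
  exact mul_le_mul_of_nonneg_right (a.le_opNorm _) (norm_nonneg _)

theorem traceNorm_mul_right_le [CompleteSpace H] {T : H →L[ℂ] H} (hT : IsTraceClass T)
    (a : H →L[ℂ] H) : traceNorm (T * a) ≤ traceNorm T * ‖a‖ := by
  rw [mul_comm (traceNorm T)]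
  rcases eq_or_ne ‖a‖ 0 with ha | ha
  · rw [norm_eq_zero.1 ha, mul_zero, norm_zero, zero_mul]
    exact (traceNorm_le (IsNuclearRep.zero (H := H))).trans_eq (by simp)
  have ha' : 0 < ‖a‖ := lt_of_le_of_ne (norm_nonneg _) (Ne.symm ha)
  rw [← inv_mul_le_iff₀ ha']
  refine le_traceNorm hT fun x y h => ?_
  rw [inv_mul_le_iff₀ ha', ← tsum_mul_left]
  refine (traceNorm_le (h.comp_right a)).trans ?_
  refine (h.comp_right a).summable.tsum_le_tsum (fun n => ?_) (h.summable.mul_left _)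
  have h1 := (ContinuousLinearMap.adjoint a).le_opNorm (y n)
  rw [LinearIsometryEquiv.norm_map] at h1
  nlinarith [norm_nonneg (x n)]

theorem IsTraceClass.mul_left {T : H →L[ℂ] H} (hT : IsTraceClass T) (a : H →L[ℂ] H) :
    IsTraceClass (a * T) := by
  obtain ⟨x, y, h⟩ := hT
  exact ⟨_, _, h.comp_left a⟩

theorem IsTraceClass.mul_right [CompleteSpace H] {T : H →L[ℂ] H} (hT : IsTraceClass T)
    (a : H →L[ℂ] H) : IsTraceClass (T * a) := by
  obtain ⟨x, y, h⟩ := hT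
  exact ⟨_, _, h.comp_right a⟩

namespace TraceClass

/-- A trace class operator as an element of the space of trace class operators. -/
def mk (T : H →L[ℂ] H) (hT : IsTraceClass T) : TraceClass H := (⟨T, hT⟩ : ↥(traceClass H))

@[simp] theorem toOp_mk (T : H →L[ℂ] H) (hT : IsTraceClass T) : (mk T hT).toOp = T := rfl

theorem toOp_injective : Function.Injective (toOp : TraceClass H → H →L[ℂ] H) :=
  fun _ _ h => Subtype.ext h

theorem norm_toOp_le (T : TraceClass H) : ‖T.toOp‖ ≤ ‖T‖ :=
  le_traceNorm T.isTraceClass fun _ _ hr => hr.norm_le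

/-- The inclusion of the trace class operators into the bounded operators. -/
def toOpL : TraceClass H →L[ℂ] (H →L[ℂ] H) :=
  LinearMap.mkContinuous ⟨⟨toOp, fun _ _ => rfl⟩, fun _ _ => rfl⟩ 1
    fun T => by rw [one_mul]; exact T.norm_toOp_le

/-- Left multiplication of trace class operators by bounded operators. -/
def lmul : (H →L[ℂ] H) →L[ℂ] TraceClass H →L[ℂ] TraceClass H :=
  LinearMap.mkContinuous₂
    (LinearMap.mk₂ ℂ (fun a T => mk (a * T.toOp) (T.isTraceClass.mul_left a))
      (fun _ _ _ => toOp_injective (add_mul _ _ _)) (fun _ _ _ => toOp_injective (smul_mul_assoc _ _ _))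
      (fun _ _ _ => toOp_injective (mul_add _ _ _)) (fun _ _ _ => toOp_injective (mul_smul_comm _ _ _)))
    1 fun a T => by rw [one_mul]; exact traceNorm_mul_left_le T.isTraceClass a

variable [CompleteSpace H]

/-- Right multiplication of trace class operators by bounded operators. -/
def rmul : TraceClass H →L[ℂ] (H →L[ℂ] H) →L[ℂ] TraceClass H :=
  LinearMap.mkContinuous₂
    (LinearMap.mk₂ ℂ (fun T a => mk (T.toOp * a) (T.isTraceClass.mul_right a))
      (fun _ _ _ => toOp_injective (add_mul _ _ _)) (fun _ _ _ => toOp_injective (smul_mul_assoc _ _ _))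
      (fun _ _ _ => toOp_injective (mul_add _ _ _)) (fun _ _ _ => toOp_injective (mul_smul_comm _ _ _)))
    1 fun T a => by rw [one_mul]; exact traceNorm_mul_right_le T.isTraceClass a

end TraceClass

theorem IsNuclearRep.hasSum_trace [CompleteSpace H] {T : H →L[ℂ] H} {x y : ℕ → H}
    (h : IsNuclearRep T x y) {ι : Type*} (b : HilbertBasis ι ℂ H) :
    HasSum (fun i => ⟪b i, T (b i)⟫_ℂ) (∑' n, ⟪y n, x n⟫_ℂ) := by
  have hrow : ∀ n, HasSum (fun i => ⟪y n, b i⟫_ℂ * ⟪b i, x n⟫_ℂ) ⟪y n, x n⟫_ℂ := fun n =>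
    b.hasSum_inner_mul_inner (y n) (x n)
  have hcol : ∀ i, HasSum (fun n => ⟪y n, b i⟫_ℂ * ⟪b i, x n⟫_ℂ) ⟪b i, T (b i)⟫_ℂ := fun i => by
    have := (h.hasSum (b i)).mapL (innerSL ℂ (b i))
    simpa [inner_smul_right] using this
  have hsq : ∀ z : H, HasSum (fun i => ‖⟪b i, z⟫_ℂ‖ ^ 2) (‖z‖ ^ 2) := fun z => by
    have h1 := b.hasSum_inner_mul_inner z z
    have h2 := (Complex.hasSum_re h1)
    rw [inner_self_eq_norm_sq_to_K] at h2
    convert h2 using 1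
    · funext i
      rw [← inner_conj_symm z (b i), RCLike.conj_mul]
      norm_cast
    · norm_cast
  have hcs : ∀ n, Summable (fun i => ‖⟪y n, b i⟫_ℂ * ⟪b i, x n⟫_ℂ‖) ∧
      ∑' i, ‖⟪y n, b i⟫_ℂ * ⟪b i, x n⟫_ℂ‖ ≤ ‖x n‖ * ‖y n‖ := fun n => by
    have hs : ∀ i, ‖⟪y n, b i⟫_ℂ * ⟪b i, x n⟫_ℂ‖ = ‖⟪b i, y n⟫_ℂ‖ * ‖⟪b i, x n⟫_ℂ‖ := fun i => by
      rw [norm_mul, norm_inner_symm]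
    simp_rw [hs]
    have hc := Real.inner_le_Lp_mul_Lq_tsum_of_nonneg (Real.HolderConjugate.two_two)
      (f := fun i => ‖⟪b i, y n⟫_ℂ‖) (g := fun i => ‖⟪b i, x n⟫_ℂ‖)
      (fun _ => norm_nonneg _) (fun _ => norm_nonneg _)
      (by simpa using (hsq (y n)).summable) (by simpa using (hsq (x n)).summable)
    refine ⟨(Real.summable_mul_of_Lp_Lq_of_nonneg (Real.HolderConjugate.two_two)
      (fun _ => norm_nonneg _) (fun _ => norm_nonneg _)
      (by simpa using (hsq (y n)).summable) (by simpa using (hsq (x n)).summable)),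
      hc.trans_eq ?_⟩
    simp only [Real.rpow_two, (hsq (y n)).tsum_eq, (hsq (x n)).tsum_eq, ← Real.sqrt_eq_rpow,
      Real.sqrt_sq (norm_nonneg _)]
    ring
  have hsum : Summable (fun q : ℕ × ι => ⟪y q.1, b q.2⟫_ℂ * ⟪b q.2, x q.1⟫_ℂ) := by
    refine Summable.of_norm ?_
    rw [summable_prod_of_nonneg (fun _ => norm_nonneg _)]
    refine ⟨fun n => (hcs n).1, ?_⟩
    exact Summable.of_nonneg_of_le (fun n => tsum_nonneg fun _ => norm_nonneg _)
      (fun n => (hcs n).2) h.summable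
  have h1 := hsum.hasSum.prod_fiberwise hrow
  have h2 := ((Equiv.prodComm ι ℕ).hasSum_iff.2 hsum.hasSum).prod_fiberwise hcol
  rw [h1.tsum_eq]
  exact h2

/-- The trace of a nuclear operator, computed from any nuclear representation. -/
theorem IsNuclearRep.trace_eq [CompleteSpace H] {T : H →L[ℂ] H} {x y : ℕ → H}
    (h : IsNuclearRep T x y) : trace T = ∑' n, ⟪y n, x n⟫_ℂ := by
  obtain ⟨b, hb⟩ := (exists_hilbertBasis ℂ H).choose_spec
  have := (h.hasSum_trace b).tsum_eq
  rw [hb] at this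
  exact this

theorem IsNuclearRep.summable_inner {T : H →L[ℂ] H} {x y : ℕ → H}
    (h : IsNuclearRep T x y) : Summable fun n => ⟪y n, x n⟫_ℂ :=
  Summable.of_norm (Summable.of_nonneg_of_le (fun _ => norm_nonneg _)
    (fun n => (norm_inner_le_norm (𝕜 := ℂ) (y n) (x n)).trans_eq (mul_comm _ _)) h.summable)

theorem trace_add [CompleteSpace H] {S T : H →L[ℂ] H} (hS : IsTraceClass S) (hT : IsTraceClass T) :
    trace (S + T) = trace S + trace T := by
  obtain ⟨x, y, h⟩ := hS
  obtain ⟨x', y', h'⟩ := hT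
  have h1 := hasSum_interleave h.summable_inner.hasSum h'.summable_inner.hasSum
  rw [← interleave_comp (fun a b => ⟪b, a⟫_ℂ)] at h1
  rw [(h.add h').1.trace_eq, h.trace_eq, h'.trace_eq, h1.tsum_eq]

theorem trace_smul [CompleteSpace H] (c : ℂ) {T : H →L[ℂ] H} (hT : IsTraceClass T) :
    trace (c • T) = c * trace T := by
  obtain ⟨x, y, h⟩ := hT
  rw [(h.smul c).trace_eq, h.trace_eq, ← tsum_mul_left]
  simp

theorem norm_trace_le [CompleteSpace H] {T : H →L[ℂ] H} (hT : IsTraceClass T) :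
    ‖trace T‖ ≤ traceNorm T := by
  refine le_traceNorm hT fun x y h => ?_
  rw [h.trace_eq]
  exact tsum_of_norm_bounded h.summable.hasSum fun n =>
    (norm_inner_le_norm (𝕜 := ℂ) (y n) (x n)).trans_eq (mul_comm _ _)

theorem trace_mul_comm [CompleteSpace H] {T : H →L[ℂ] H} (hT : IsTraceClass T) (a : H →L[ℂ] H) :
    trace (a * T) = trace (T * a) := by
  obtain ⟨x, y, h⟩ := hT
  rw [(h.comp_left a).trace_eq, (h.comp_right a).trace_eq]
  simp [ContinuousLinearMap.adjoint_inner_left]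

/-- The trace as a continuous linear functional on the trace class operators. -/
def TraceClass.trL [CompleteSpace H] : TraceClass H →L[ℂ] ℂ :=
  LinearMap.mkContinuous
    ⟨⟨fun T => trace T.toOp, fun S T => trace_add S.isTraceClass T.isTraceClass⟩,
      fun c T => trace_smul c T.isTraceClass⟩ 1
    fun T => by rw [one_mul]; exact norm_trace_le T.isTraceClass

@[simp] theorem TraceClass.trL_apply [CompleteSpace H] (T : TraceClass H) :
    TraceClass.trL T = trace T.toOp := rfl

theorem TraceClass.trL_lmul [CompleteSpace H] (a : H →L[ℂ] H) (T : TraceClass H) :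
    TraceClass.trL (TraceClass.lmul a T) = TraceClass.trL (TraceClass.rmul T a) :=
  trace_mul_comm T.isTraceClass a

theorem isTraceClass_rankOne (x y : H) : IsTraceClass (InnerProductSpace.rankOne ℂ x y) := by
  refine ⟨fun n => if n = 0 then x else 0, fun n => if n = 0 then y else 0, ?_, fun v => ?_⟩
  · exact summable_of_ne_finset_zero (s := {0}) fun n hn => by simp_all
  · convert hasSum_ite_eq 0 (InnerProductSpace.rankOne ℂ x y v) using 2 with n
    split_ifs <;> simp

theorem isTraceClass_of_finiteDimensional_range [CompleteSpace H] (V : Submodule ℂ H)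
    [FiniteDimensional ℂ V] : IsTraceClass V.starProjection := by
  have : V.starProjection = ∑ i, InnerProductSpace.rankOne ℂ
      (stdOrthonormalBasis ℂ V i : H) (stdOrthonormalBasis ℂ V i : H) := by
    ext v
    have := (stdOrthonormalBasis ℂ V).sum_repr' (V.orthogonalProjectionOnto v)
    have h2 := congrArg (Subtype.val) this
    rw [Submodule.starProjection_apply, ← h2]
    simp
  rw [this]
  exact (traceClass H).sum_mem fun i _ => isTraceClass_rankOne _ _

theorem IsCompactOperator.exists_isTraceClass_near [CompleteSpace H] {K : H →L[ℂ] H}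
    (hK : IsCompactOperator K) {ε : ℝ} (hε : 0 < ε) :
    ∃ T : TraceClass H, ‖T.toOp - K‖ < ε := by
  have hc := hK.isCompact_closure_image_closedBall (𝕜₁ := ℂ) 1
  obtain ⟨s, hsf, hs⟩ := Metric.totallyBounded_iff.1 (hc.totallyBounded.subset subset_closure) (ε / 2) (by positivity)
  let V : Submodule ℂ H := Submodule.span ℂ s
  have : FiniteDimensional ℂ V := FiniteDimensional.span_of_finite ℂ hsf
  refine ⟨TraceClass.mk (V.starProjection * K)
    ((isTraceClass_of_finiteDimensional_range V).mul_right K), ?_⟩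
  refine lt_of_le_of_lt (ContinuousLinearMap.opNorm_le_of_unit_norm (C := ε / 2) (by positivity) ?_)
    (by linarith)
  intro v hv
  have hmem : K v ∈ (K : H → H) '' Metric.closedBall 0 1 := ⟨v, by simp [hv], rfl⟩
  obtain ⟨z, hz, hzd⟩ := Set.mem_iUnion₂.1 (hs hmem)
  have h1 : ‖K v - V.starProjection (K v)‖ ≤ ‖K v - z‖ := by
    rw [V.starProjection_minimal]
    exact ciInf_le ⟨0, by rintro _ ⟨w, rfl⟩; exact norm_nonneg _⟩
      (⟨z, Submodule.subset_span hz⟩ : V)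
  simp only [TraceClass.toOp_mk, sub_apply]
  rw [norm_sub_rev]
  exact h1.trans (by rw [← dist_eq_norm]; exact (Metric.mem_ball.1 hzd).le)

theorem TraceClass.isCompactOperator [CompleteSpace H] (T : TraceClass H) :
    IsCompactOperator T.toOp := by
  obtain ⟨x, y, h⟩ := T.isTraceClass
  let S : ℕ → H →L[ℂ] H := fun N => ∑ n ∈ Finset.range N, InnerProductSpace.rankOne ℂ (x n) (y n)
  have hS : ∀ N v, S N v = ∑ n ∈ Finset.range N, ⟪y n, v⟫_ℂ • x n := fun N v => by simp [S]
  have hrep : ∀ N, IsNuclearRep (T.toOp - S N) (fun n => x (n + N)) (fun n => y (n + N)) := fun N =>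
    ⟨(summable_nat_add_iff N).2 h.summable, fun v => by
      have := (hasSum_nat_add_iff' N).2 (h.hasSum v)
      rwa [← hS] at this⟩
  have hlim : Filter.Tendsto S Filter.atTop (𝓝 T.toOp) := by
    rw [tendsto_iff_norm_sub_tendsto_zero]
    refine squeeze_zero (fun _ => norm_nonneg _) (fun N => ?_)
      (tendsto_sum_nat_add (fun n => ‖x n‖ * ‖y n‖))
    rw [norm_sub_rev]
    exact (hrep N).norm_le
  refine isCompactOperator_of_tendsto hlim (Filter.Eventually.of_forall fun N => ?_)
  refine Submodule.sum_mem (compactOperator (RingHom.id ℂ) H H) fun n _ => ?_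
  change IsCompactOperator (ContinuousLinearMap.toSpanSingleton ℂ (x n) ∘L innerSL ℂ (y n))
  have h0 : IsCompactOperator (ContinuousLinearMap.toSpanSingleton ℂ (x n)) :=
    isCompactOperator_of_locallyCompactSpace_rng
      (ContinuousLinearMap.toSpanSingleton ℂ (x n))
  exact h0.comp_clm (innerSL ℂ (y n))

end TraceClassLibrary

end

section

section WedgeAlgebra

theorem sum_perm_cons {E N : Type*} {n : ℕ} [AddCommGroup N] (T : (Fin (n + 1) → E) → N) (x : E)
    (w : Fin n → E) :
    ∑ σ : Equiv.Perm (Fin (n + 1)), Equiv.Perm.sign σ • T (fun i => (Fin.cons x w : Fin (n + 1) → E) (σ i)) =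
      ∑ j : Fin (n + 1), (-1 : ℤˣ) ^ (j : ℕ) • ∑ τ : Equiv.Perm (Fin n),
        Equiv.Perm.sign τ • T (j.insertNth x (fun i => w (τ i))) := by
  let e : Fin (n + 1) × Equiv.Perm (Fin n) → Equiv.Perm (Fin (n + 1)) := fun z =>
    Equiv.Perm.decomposeFin.symm (0, z.2) * z.1.cycleRange
  have he : Function.Bijective e := by
    rw [Fintype.bijective_iff_injective_and_card]
    refine ⟨?_, by simp [Fintype.card_perm, Nat.factorial_succ]⟩
    rintro ⟨j, τ⟩ ⟨j', τ'⟩ h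
    have hj : j = j' := by
      have h1 : (e (j', τ')) j = 0 := by
        rw [← h]; simp [e, Equiv.Perm.mul_apply]
      have h2 : (e (j', τ')) j' = 0 := by simp [e, Equiv.Perm.mul_apply]
      exact (e (j', τ')).injective (h1.trans h2.symm)
    subst hj
    have := Equiv.Perm.decomposeFin.symm.injective (mul_right_cancel h)
    simp_all
  rw [← Fintype.sum_equiv (Equiv.ofBijective e he)
    (fun z => Equiv.Perm.sign (e z) • T (fun i => (Fin.cons x w : Fin (n + 1) → E) (e z i))) _
    (fun z => rfl), Fintype.sum_prod_type]
  refine Finset.sum_congr rfl fun j _ => ?_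
  rw [Finset.smul_sum]
  refine Finset.sum_congr rfl fun τ _ => ?_
  have h1 : Equiv.Perm.sign (e (j, τ)) = (-1) ^ (j : ℕ) * Equiv.Perm.sign τ := by
    simp [e, Equiv.Perm.decomposeFin.symm_sign, mul_comm]
  have h2 : (fun i => (Fin.cons x w : Fin (n + 1) → E) (e (j, τ) i))
      = j.insertNth x (fun i => w (τ i)) := by
    rw [← Fin.cons_comp_cycleRange]
    funext i
    simp only [e, Equiv.Perm.mul_apply, Function.comp]
    refine Fin.cases ?_ (fun k => ?_) (j.cycleRange i)
    · simp
    · simp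
  rw [h1, h2, mul_smul]

variable {E E' F F' F'' : Type*} [NormedAddCommGroup E] [NormedSpace ℝ E]
  [NormedAddCommGroup E'] [NormedSpace ℝ E']
  [NormedAddCommGroup F] [NormedSpace ℝ F] [NormedAddCommGroup F'] [NormedSpace ℝ F']
  [NormedAddCommGroup F''] [NormedSpace ℝ F''] {p q n : ℕ}

theorem wedge_apply (B : F →L[ℝ] F' →L[ℝ] F'') (h : p + q = n) (α : E [⋀^Fin p]→L[ℝ] F)
    (β : E [⋀^Fin q]→L[ℝ] F') (v : Fin n → E) :
    wedge B h α β v = ((p.factorial * q.factorial : ℝ)⁻¹) • ∑ σ : Equiv.Perm (Fin n),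
      Equiv.Perm.sign σ • B (α fun i => v (σ (Fin.cast h (Fin.castAdd q i))))
        (β fun j => v (σ (Fin.cast h (Fin.natAdd p j)))) := by
  simp only [wedge, ContinuousAlternatingMap.smul_apply,
    ContinuousMultilinearMap.alternatization_apply_apply]
  rfl

theorem wedge_zero_left (B : F →L[ℝ] F' →L[ℝ] F'') (h : 0 + n = n) (α : E [⋀^Fin 0]→L[ℝ] F)
    (β : E [⋀^Fin n]→L[ℝ] F') :
    wedge B h α β = (B (α ![])).compContinuousAlternatingMap β := by
  ext v
  rw [wedge_apply]
  have : ∀ σ : Equiv.Perm (Fin n), Equiv.Perm.sign σ • B (α fun i => v (σ (Fin.cast h (Fin.castAdd n i))))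
        (β fun j => v (σ (Fin.cast h (Fin.natAdd 0 j)))) = B (α ![]) (β v) := fun σ => by
    have h1 : (fun j => v (σ (Fin.cast h (Fin.natAdd 0 j)))) = v ∘ σ := by
      funext j; simp
    rw [h1, show β (v ∘ σ) = _ from β.toAlternatingMap.map_perm v σ, Subsingleton.elim (fun i => v (σ (Fin.cast h (Fin.castAdd n i)))) ![]]
    rcases Int.units_eq_one_or (Equiv.Perm.sign σ) with h | h <;> simp [h]
  rw [Finset.sum_congr rfl fun σ _ => this σ]
  simp only [Finset.sum_const, Finset.card_univ, Fintype.card_perm, Fintype.card_fin,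
    Nat.factorial_zero, Nat.cast_one, one_mul, ← Nat.cast_smul_eq_nsmul ℝ, smul_smul]
  rw [inv_mul_cancel₀ (by positivity), one_smul]
  rfl

theorem wedge_zero_right (B : F →L[ℝ] F' →L[ℝ] F'') (h : n + 0 = n) (α : E [⋀^Fin n]→L[ℝ] F)
    (β : E [⋀^Fin 0]→L[ℝ] F') :
    wedge B h α β = (B.flip (β ![])).compContinuousAlternatingMap α := by
  ext v
  rw [wedge_apply]
  have : ∀ σ : Equiv.Perm (Fin n), Equiv.Perm.sign σ • B (α fun i => v (σ (Fin.cast h (Fin.castAdd 0 i))))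
        (β fun j => v (σ (Fin.cast h (Fin.natAdd n j)))) = B (α v) (β ![]) := fun σ => by
    have h1 : (fun j => v (σ (Fin.cast h (Fin.castAdd 0 j)))) = v ∘ σ := by
      funext j; simp
    rw [h1, show α (v ∘ σ) = _ from α.toAlternatingMap.map_perm v σ, Subsingleton.elim (fun i => v (σ (Fin.cast h (Fin.natAdd n i)))) ![]]
    rcases Int.units_eq_one_or (Equiv.Perm.sign σ) with h | h <;> simp [h]
  rw [Finset.sum_congr rfl fun σ _ => this σ]
  simp only [Finset.sum_const, Finset.card_univ, Fintype.card_perm, Fintype.card_fin,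
    Nat.factorial_zero, Nat.cast_one, mul_one, ← Nat.cast_smul_eq_nsmul ℝ, smul_smul]
  rw [inv_mul_cancel₀ (by positivity), one_smul]
  rfl

theorem wedge_cons_left_block (B : F →L[ℝ] F' →L[ℝ] F'') (h : p + 1 + q = n + 1) (h' : p + q = n)
    (α : E [⋀^Fin (p + 1)]→L[ℝ] F) (β : E [⋀^Fin q]→L[ℝ] F') (x : E) (w : Fin n → E)
    (i : Fin (p + 1)) :
    (-1 : ℤˣ) ^ (i : ℕ) • tensorForm B h α β ((Fin.cast h (Fin.castAdd q i)).insertNth x w) =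
      tensorForm B h' (α.curryLeft x) β w := by
  have h1 : (fun k => ((Fin.cast h (Fin.castAdd q i)).insertNth x w : Fin (n + 1) → E)
      (Fin.cast h (Fin.castAdd q k))) =
      i.insertNth x (fun k => w (Fin.cast h' (Fin.castAdd q k))) := by
    funext k
    refine Fin.succAboveCases i ?_ (fun l => ?_) k
    · simp
    · have : Fin.cast h (Fin.castAdd q (i.succAbove l)) =
          (Fin.cast h (Fin.castAdd q i)).succAbove (Fin.cast h' (Fin.castAdd q l)) := by
        ext; simp [Fin.succAbove, Fin.lt_def]; split_ifs <;> simp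
      rw [this]; simp
  have h2 : (fun k => ((Fin.cast h (Fin.castAdd q i)).insertNth x w : Fin (n + 1) → E)
      (Fin.cast h (Fin.natAdd (p + 1) k))) = fun k => w (Fin.cast h' (Fin.natAdd p k)) := by
    funext k
    have : Fin.cast h (Fin.natAdd (p + 1) k) =
          (Fin.cast h (Fin.castAdd q i)).succAbove (Fin.cast h' (Fin.natAdd p k)) := by
        ext; simp [Fin.succAbove, Fin.lt_def]; split_ifs <;> simp <;> omega
    rw [this]; simp
  change (-1 : ℤˣ) ^ (i : ℕ) • B (α _) (β _) = B (α.curryLeft x _) (β _)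
  rw [h1, h2, α.map_insertNth, ContinuousAlternatingMap.curryLeft_apply_apply]
  rcases Nat.even_or_odd (i : ℕ) with h | h <;> simp [h.neg_one_pow]

theorem wedge_cons_right_block (B : F →L[ℝ] F' →L[ℝ] F'') (h : p + (q + 1) = n + 1) (h' : p + q = n)
    (α : E [⋀^Fin p]→L[ℝ] F) (β : E [⋀^Fin (q + 1)]→L[ℝ] F') (x : E) (w : Fin n → E)
    (i : Fin (q + 1)) :
    (-1 : ℤˣ) ^ (i : ℕ) • tensorForm B h α β ((Fin.cast h (Fin.natAdd p i)).insertNth x w) =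
      tensorForm B h' α (β.curryLeft x) w := by
  have h1 : (fun k => ((Fin.cast h (Fin.natAdd p i)).insertNth x w : Fin (n + 1) → E)
      (Fin.cast h (Fin.natAdd p k))) =
      i.insertNth x (fun k => w (Fin.cast h' (Fin.natAdd p k))) := by
    funext k
    refine Fin.succAboveCases i ?_ (fun l => ?_) k
    · simp
    · have : Fin.cast h (Fin.natAdd p (i.succAbove l)) =
          (Fin.cast h (Fin.natAdd p i)).succAbove (Fin.cast h' (Fin.natAdd p l)) := by
        ext; simp [Fin.succAbove, Fin.lt_def]; split_ifs <;> simp <;> omega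
      rw [this]; simp
  have h2 : (fun k => ((Fin.cast h (Fin.natAdd p i)).insertNth x w : Fin (n + 1) → E)
      (Fin.cast h (Fin.castAdd (q + 1) k))) = fun k => w (Fin.cast h' (Fin.castAdd q k)) := by
    funext k
    have : Fin.cast h (Fin.castAdd (q + 1) k) =
          (Fin.cast h (Fin.natAdd p i)).succAbove (Fin.cast h' (Fin.castAdd q k)) := by
        ext; simp [Fin.succAbove, Fin.lt_def]; split_ifs <;> simp <;> omega
    rw [this]; simp
  change (-1 : ℤˣ) ^ (i : ℕ) • B (α _) (β _) = B (α _) (β.curryLeft x _)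
  rw [h1, h2, β.map_insertNth, ContinuousAlternatingMap.curryLeft_apply_apply]
  rcases Nat.even_or_odd (i : ℕ) with h | h <;> simp [h.neg_one_pow]

theorem wedge_apply_tensorForm (B : F →L[ℝ] F' →L[ℝ] F'') (h : p + q = n) (α : E [⋀^Fin p]→L[ℝ] F)
    (β : E [⋀^Fin q]→L[ℝ] F') (v : Fin n → E) :
    wedge B h α β v = ((p.factorial * q.factorial : ℝ)⁻¹) • ∑ σ : Equiv.Perm (Fin n),
      Equiv.Perm.sign σ • tensorForm B h α β (fun i => v (σ i)) := wedge_apply B h α β v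

theorem units_neg_one_pow_smul (k : ℕ) (z : F) : (-1 : ℤˣ) ^ k • z = (-1 : ℝ) ^ k • z := by
  rcases Nat.even_or_odd k with h | h <;> simp [h.neg_one_pow]

/-- The interior product is an antiderivation. -/
theorem curryLeft_wedge (B : F →L[ℝ] F' →L[ℝ] F'') (h : p + 1 + (q + 1) = n + 1)
    (h1 : p + (q + 1) = n) (h2 : p + 1 + q = n)
    (α : E [⋀^Fin (p + 1)]→L[ℝ] F) (β : E [⋀^Fin (q + 1)]→L[ℝ] F') (x : E) :
    (wedge B h α β).curryLeft x =
      wedge B h1 (α.curryLeft x) β + (-1 : ℝ) ^ (p + 1) • wedge B h2 α (β.curryLeft x) := by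
  ext w
  rw [ContinuousAlternatingMap.curryLeft_apply_apply, wedge_apply_tensorForm]
  have h0 := sum_perm_cons (fun v => tensorForm B h α β v) x w
  rw [show (Matrix.vecCons x w) = (Fin.cons x w : Fin (n + 1) → E) from rfl, h0,
    ← (finCongr h).sum_comp, Fin.sum_univ_add]
  simp only [finCongr_apply, Fin.val_cast, Fin.val_castAdd, Fin.val_natAdd, pow_add _ (p + 1),
    mul_smul, Finset.smul_sum (r := (-1 : ℤˣ) ^ (_ : ℕ)),
    smul_comm _ (Equiv.Perm.sign _), wedge_cons_left_block B h h1,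
    wedge_cons_right_block B h h2, Finset.sum_const, Finset.card_univ, Fintype.card_fin]
  simp only [ContinuousAlternatingMap.add_apply, ContinuousAlternatingMap.smul_apply,
    wedge_apply_tensorForm, units_neg_one_pow_smul, ← Nat.cast_smul_eq_nsmul ℝ, smul_add, smul_smul,
    ← Finset.smul_sum, smul_comm (Equiv.Perm.sign _) ((-1 : ℝ) ^ _)]
  congr 2
  · rw [Nat.factorial_succ p]; push_cast
    have := Nat.cast_add_one_ne_zero (R := ℝ) p
    have := Nat.cast_ne_zero (R := ℝ).2 p.factorial_ne_zero
    have := Nat.cast_ne_zero (R := ℝ).2 (q + 1).factorial_ne_zero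
    field_simp
  · rw [Nat.factorial_succ q]; push_cast
    have := Nat.cast_add_one_ne_zero (R := ℝ) q
    have := Nat.cast_ne_zero (R := ℝ).2 q.factorial_ne_zero
    have := Nat.cast_ne_zero (R := ℝ).2 (p + 1).factorial_ne_zero
    field_simp

theorem ext_curryLeft {η η' : E [⋀^Fin (n + 1)]→L[ℝ] F}
    (h : ∀ x, η.curryLeft x = η'.curryLeft x) : η = η' := by
  ext v
  have := congrArg (fun θ => θ (Fin.tail v)) (h (v 0))
  simp only [ContinuousAlternatingMap.curryLeft_apply_apply] at this
  rwa [show Matrix.vecCons (v 0) (Fin.tail v) = v from Fin.cons_self_tail v] at this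

theorem wedge_add_left (B : F →L[ℝ] F' →L[ℝ] F'') (h : p + q = n) (α α' : E [⋀^Fin p]→L[ℝ] F)
    (β : E [⋀^Fin q]→L[ℝ] F') : wedge B h (α + α') β = wedge B h α β + wedge B h α' β := by
  ext v
  simp [wedge_apply, ← smul_add, ← Finset.sum_add_distrib]

theorem wedge_smul_left (B : F →L[ℝ] F' →L[ℝ] F'') (h : p + q = n) (c : ℝ) (α : E [⋀^Fin p]→L[ℝ] F)
    (β : E [⋀^Fin q]→L[ℝ] F') : wedge B h (c • α) β = c • wedge B h α β := by
  ext v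
  simp only [wedge_apply, ContinuousAlternatingMap.smul_apply, map_smul, smul_apply,
    smul_comm _ c, ← Finset.smul_sum]

theorem wedge_bound (B : F →L[ℝ] F' →L[ℝ] F'') (h : p + q = n) (α : E [⋀^Fin p]→L[ℝ] F)
    (β : E [⋀^Fin q]→L[ℝ] F') :
    ‖wedge B h α β‖ ≤ ((p.factorial * q.factorial : ℝ)⁻¹ * n.factorial * ‖B‖) * ‖α‖ * ‖β‖ := by
  refine ContinuousAlternatingMap.opNorm_le_bound _ (by positivity) fun v => ?_
  rw [wedge_apply, norm_smul, Real.norm_of_nonneg (by positivity)]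
  have hb : ∀ σ : Equiv.Perm (Fin n),
      ‖Equiv.Perm.sign σ • B (α fun i => v (σ (Fin.cast h (Fin.castAdd q i))))
        (β fun j => v (σ (Fin.cast h (Fin.natAdd p j))))‖ ≤ ‖B‖ * ‖α‖ * ‖β‖ * ∏ i, ‖v i‖ := fun σ => by
    have h1 : ‖Equiv.Perm.sign σ • B (α fun i => v (σ (Fin.cast h (Fin.castAdd q i))))
        (β fun j => v (σ (Fin.cast h (Fin.natAdd p j))))‖ =
        ‖B (α fun i => v (σ (Fin.cast h (Fin.castAdd q i))))
        (β fun j => v (σ (Fin.cast h (Fin.natAdd p j))))‖ := by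
      rcases Int.units_eq_one_or (Equiv.Perm.sign σ) with h | h <;> simp [h]
    rw [h1]
    have h2 : ∏ i, ‖v i‖ = (∏ i, ‖v (σ (Fin.cast h (Fin.castAdd q i)))‖) *
        ∏ j, ‖v (σ (Fin.cast h (Fin.natAdd p j)))‖ := by
      rw [← Equiv.prod_comp σ, ← (finCongr h).prod_comp, Fin.prod_univ_add]; rfl
    rw [h2]
    refine (B.le_opNorm₂ _ _).trans ?_
    have h3 := α.le_opNorm fun i => v (σ (Fin.cast h (Fin.castAdd q i)))
    have h4 := β.le_opNorm fun j => v (σ (Fin.cast h (Fin.natAdd p j)))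
    calc _ ≤ ‖B‖ * (‖α‖ * ∏ i, ‖v (σ (Fin.cast h (Fin.castAdd q i)))‖) *
          (‖β‖ * ∏ j, ‖v (σ (Fin.cast h (Fin.natAdd p j)))‖) := by gcongr
      _ = _ := by ring
  refine (mul_le_mul_of_nonneg_left (norm_sum_le_of_le _ fun σ _ => hb σ) (by positivity)).trans_eq ?_
  rw [Finset.sum_const, Finset.card_univ, Fintype.card_perm, Fintype.card_fin, nsmul_eq_mul]
  ring

/-- The wedge product as a continuous bilinear map. -/
def wedgeL (B : F →L[ℝ] F' →L[ℝ] F'') (h : p + q = n) :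
    (E [⋀^Fin p]→L[ℝ] F) →L[ℝ] (E [⋀^Fin q]→L[ℝ] F') →L[ℝ] E [⋀^Fin n]→L[ℝ] F'' :=
  LinearMap.mkContinuous₂
    (LinearMap.mk₂ ℝ (wedge B h) (wedge_add_left B h) (fun c α β => wedge_smul_left B h c α β)
      (wedge_add_right B h) (fun c α β => wedge_smul_right B h α c β))
    ((p.factorial * q.factorial : ℝ)⁻¹ * n.factorial * ‖B‖) fun α β => wedge_bound B h α β

@[simp] theorem wedgeL_apply (B : F →L[ℝ] F' →L[ℝ] F'') (h : p + q = n) (α : E [⋀^Fin p]→L[ℝ] F)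
    (β : E [⋀^Fin q]→L[ℝ] F') : wedgeL B h α β = wedge B h α β := rfl

theorem wedge_compContinuousLinearMap (B : F →L[ℝ] F' →L[ℝ] F'') (h : p + q = n)
    (α : E [⋀^Fin p]→L[ℝ] F) (β : E [⋀^Fin q]→L[ℝ] F') (L : E' →L[ℝ] E) :
    (wedge B h α β).compContinuousLinearMap L =
      wedge B h (α.compContinuousLinearMap L) (β.compContinuousLinearMap L) := by
  ext v
  simp only [ContinuousAlternatingMap.compContinuousLinearMap_apply, wedge_apply]
  rfl

section Bilinear

variable {G G' G'' : Type*} [NormedAddCommGroup G] [NormedSpace ℝ G] [NormedAddCommGroup G']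
  [NormedSpace ℝ G'] [NormedAddCommGroup G''] [NormedSpace ℝ G'']

theorem comp_wedge_eq {B : F →L[ℝ] F' →L[ℝ] F''} {C : G →L[ℝ] G' →L[ℝ] G''} (h : p + q = n)
    (S : F →L[ℝ] G) (S' : F' →L[ℝ] G') (S'' : F'' →L[ℝ] G'')
    (hS : ∀ a b, S'' (B a b) = C (S a) (S' b))
    (α : E [⋀^Fin p]→L[ℝ] F) (β : E [⋀^Fin q]→L[ℝ] F') :
    S''.compContinuousAlternatingMap (wedge B h α β) =
      wedge C h (S.compContinuousAlternatingMap α) (S'.compContinuousAlternatingMap β) := by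
  ext v
  simp only [ContinuousLinearMap.compContinuousAlternatingMap_coe, Function.comp_apply, wedge_apply,
    map_smul, map_sum]
  congr 1
  refine Finset.sum_congr rfl fun σ _ => ?_
  rw [← hS]
  rcases Int.units_eq_one_or (Equiv.Perm.sign σ) with h | h <;> simp [h]

theorem comp_wedge {B : F →L[ℝ] F' →L[ℝ] F''} {C : F →L[ℝ] F' →L[ℝ] G''} (h : p + q = n)
    (S : F'' →L[ℝ] G'') (hS : ∀ a b, S (B a b) = C a b)
    (α : E [⋀^Fin p]→L[ℝ] F) (β : E [⋀^Fin q]→L[ℝ] F') :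
    S.compContinuousAlternatingMap (wedge B h α β) = wedge C h α β :=
  comp_wedge_eq h (ContinuousLinearMap.id ℝ F) (ContinuousLinearMap.id ℝ F') S hS α β

theorem comp_wedge_left {B : F →L[ℝ] F' →L[ℝ] F''} {C : G →L[ℝ] F' →L[ℝ] G''} (h : p + q = n)
    (S : F →L[ℝ] G) (S'' : F'' →L[ℝ] G'') (hS : ∀ a b, S'' (B a b) = C (S a) b)
    (α : E [⋀^Fin p]→L[ℝ] F) (β : E [⋀^Fin q]→L[ℝ] F') :
    S''.compContinuousAlternatingMap (wedge B h α β) =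
      wedge C h (S.compContinuousAlternatingMap α) β :=
  comp_wedge_eq h S (ContinuousLinearMap.id ℝ F') S'' hS α β

theorem comp_wedge_right {B : F →L[ℝ] F' →L[ℝ] F''} {C : F →L[ℝ] G' →L[ℝ] G''} (h : p + q = n)
    (S' : F' →L[ℝ] G') (S'' : F'' →L[ℝ] G'') (hS : ∀ a b, S'' (B a b) = C a (S' b))
    (α : E [⋀^Fin p]→L[ℝ] F) (β : E [⋀^Fin q]→L[ℝ] F') :
    S''.compContinuousAlternatingMap (wedge B h α β) =
      wedge C h α (S'.compContinuousAlternatingMap β) :=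
  comp_wedge_eq h (ContinuousLinearMap.id ℝ F) S' S'' hS α β

theorem wedge_comp_left (C : G →L[ℝ] F' →L[ℝ] F'') {B : F →L[ℝ] F' →L[ℝ] F''} (h : p + q = n)
    (S : F →L[ℝ] G) (hS : ∀ a b, B a b = C (S a) b)
    (α : E [⋀^Fin p]→L[ℝ] F) (β : E [⋀^Fin q]→L[ℝ] F') :
    wedge C h (S.compContinuousAlternatingMap α) β = wedge B h α β :=
  (comp_wedge_left h S (ContinuousLinearMap.id ℝ F'') hS α β).symm

theorem wedge_comp_right (C : F →L[ℝ] G' →L[ℝ] F'') {B : F →L[ℝ] F' →L[ℝ] F''} (h : p + q = n)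
    (S' : F' →L[ℝ] G') (hS : ∀ a b, B a b = C a (S' b))
    (α : E [⋀^Fin p]→L[ℝ] F) (β : E [⋀^Fin q]→L[ℝ] F') :
    wedge C h α (S'.compContinuousAlternatingMap β) = wedge B h α β :=
  (comp_wedge_right h S' (ContinuousLinearMap.id ℝ F'') hS α β).symm

end Bilinear

end WedgeAlgebra

end

section

section WedgeIdentities

variable {E F F' F'' : Type*} [NormedAddCommGroup E] [NormedSpace ℝ E]
  [NormedAddCommGroup F] [NormedSpace ℝ F] [NormedAddCommGroup F'] [NormedSpace ℝ F']
  [NormedAddCommGroup F''] [NormedSpace ℝ F''] {p q n : ℕ}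

/-- The wedge product is associative. -/
theorem wedge_assoc {G₁ G₂ G₃ : Type*} [NormedAddCommGroup G₁] [NormedSpace ℝ G₁]
    [NormedAddCommGroup G₂] [NormedSpace ℝ G₂] [NormedAddCommGroup G₃] [NormedSpace ℝ G₃]
    {B₁₂ : F →L[ℝ] F' →L[ℝ] G₁} {B : G₁ →L[ℝ] F'' →L[ℝ] G₃} {B₂₃ : F' →L[ℝ] F'' →L[ℝ] G₂}
    {B' : F →L[ℝ] G₂ →L[ℝ] G₃} (hB : ∀ a b c, B (B₁₂ a b) c = B' a (B₂₃ b c))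
    {p q r m m' n : ℕ} (h₁₂ : p + q = m) (h : m + r = n) (h₂₃ : q + r = m') (h' : p + m' = n)
    (α : E [⋀^Fin p]→L[ℝ] F) (β : E [⋀^Fin q]→L[ℝ] F') (γ : E [⋀^Fin r]→L[ℝ] F'') :
    wedge B h (wedge B₁₂ h₁₂ α β) γ = wedge B' h' α (wedge B₂₃ h₂₃ β γ) := by
  induction n generalizing p q r m m' with
  | zero =>
    obtain rfl : p = 0 := by omega
    obtain rfl : q = 0 := by omega
    obtain rfl : r = 0 := by omega
    obtain rfl : m = 0 := by omega
    obtain rfl : m' = 0 := by omega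
    simp only [wedge_zero_left]
    ext v
    exact hB _ _ _
  | succ n ih =>
    rcases p with _ | p
    · obtain rfl : q = m := by omega
      obtain rfl : m' = n + 1 := by omega
      rw [wedge_zero_left, wedge_zero_left,
        comp_wedge_left (C := B) h₂₃ (B₁₂ (α ![])) (B' (α ![])) (fun a b => (hB _ _ _).symm)]
    rcases q with _ | q
    · obtain rfl : p + 1 = m := by omega
      obtain rfl : r = m' := by omega
      rw [wedge_zero_left, wedge_zero_right]
      rw [wedge_comp_left (B := B ∘L (B₁₂.flip (β ![]))) B h _ (fun a b => rfl),
        wedge_comp_right (B := B ∘L (B₁₂.flip (β ![]))) B' h' _ (fun a b => hB _ _ _)]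
    rcases r with _ | r
    · obtain rfl : m = n + 1 := by omega
      obtain rfl : q + 1 = m' := by omega
      rw [wedge_zero_right, wedge_zero_right,
        comp_wedge_right (C := B') h₁₂ (B₂₃.flip (γ ![])) (B.flip (γ ![])) (fun a b => hB _ _ _)]
    obtain ⟨m, rfl⟩ : ∃ k, m = k + 1 := ⟨m - 1, by omega⟩
    obtain ⟨m', rfl⟩ : ∃ k, m' = k + 1 := ⟨m' - 1, by omega⟩
    refine ext_curryLeft fun x => ?_
    rw [curryLeft_wedge B h (by omega) (by omega), curryLeft_wedge B' h' (by omega) (by omega),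
      curryLeft_wedge B₁₂ h₁₂ (by omega) (by omega), curryLeft_wedge B₂₃ h₂₃ (by omega) (by omega),
      wedge_add_left, wedge_add_right, wedge_smul_left, wedge_smul_right,
      ih (show p + (q + 1) = m by omega) (by omega) (show q + 1 + (r + 1) = m' + 1 by omega)
        (by omega),
      ih (show p + 1 + q = m by omega) (by omega) (show q + (r + 1) = m' by omega) (by omega),
      ih (show p + 1 + (q + 1) = m + 1 by omega) (by omega) (show q + 1 + r = m' by omega)
        (by omega), smul_add, smul_smul, ← pow_add, add_assoc]
    congr 3
    rw [← h₁₂]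

/-- The wedge product is graded commutative. -/
theorem wedge_comm (B : F →L[ℝ] F' →L[ℝ] F'') (h : p + q = n) (h' : q + p = n)
    (α : E [⋀^Fin p]→L[ℝ] F) (β : E [⋀^Fin q]→L[ℝ] F') :
    wedge B h α β = (-1 : ℝ) ^ (p * q) • wedge B.flip h' β α := by
  induction n generalizing p q with
  | zero =>
    obtain rfl : p = 0 := by omega
    obtain rfl : q = 0 := by omega
    rw [wedge_zero_left, wedge_zero_right, zero_mul, pow_zero, one_smul,
      ContinuousLinearMap.flip_flip]
  | succ n ih =>
    rcases p with _ | p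
    · obtain rfl : q = n + 1 := by omega
      rw [wedge_zero_left, wedge_zero_right, zero_mul, pow_zero, one_smul,
        ContinuousLinearMap.flip_flip]
    rcases q with _ | q
    · obtain rfl : p = n := by omega
      rw [wedge_zero_left, wedge_zero_right, mul_zero, pow_zero, one_smul]
    refine ext_curryLeft fun x => ?_
    rw [ContinuousAlternatingMap.curryLeft_smul, smul_apply,
      curryLeft_wedge B h (by omega) (by omega), curryLeft_wedge B.flip h' (by omega) (by omega),
      ih (by omega) (by omega), ih (p := p + 1) (by omega) (by omega), smul_add, smul_smul, smul_smul,
      ← pow_add, ← pow_add, add_comm]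
    congr 2
    · rw [show (p + 1) * (q + 1) = (p + 1) + (p + 1) * q by ring]
    · rw [show (p + 1) * (q + 1) + (q + 1) = p * (q + 1) + 2 * (q + 1) by ring, pow_add _ _ (2 * _),
        pow_mul _ 2]
      simp

/-- Interior product with a fixed vector, as a continuous linear map. -/
def iotaL (x : E) : (E [⋀^Fin (n + 1)]→L[ℝ] F) →L[ℝ] E [⋀^Fin n]→L[ℝ] F :=
  (ContinuousLinearMap.apply ℝ _ x) ∘L
    (ContinuousAlternatingMap.curryLeftLI (𝕜 := ℝ) (E := E) (F := F) (n := n)).toContinuousLinearMap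

@[simp] theorem iotaL_apply (x : E) (α : E [⋀^Fin (n + 1)]→L[ℝ] F) :
    iotaL x α = α.curryLeft x := rfl

open ContinuousAlternatingMap in
theorem curryLeft_alternatizeUncurryFin (f : E →L[ℝ] E [⋀^Fin (n + 1)]→L[ℝ] F) (x : E) :
    (alternatizeUncurryFin f).curryLeft x =
      f x - alternatizeUncurryFin (iotaL x ∘L f) := by
  ext v
  simp only [curryLeft_apply_apply, alternatizeUncurryFin_apply, Fin.sum_univ_succ (n := n + 1),
    ContinuousAlternatingMap.sub_apply]
  rw [sub_eq_add_neg, ← Finset.sum_neg_distrib]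
  congr 1
  · simp
  · refine Finset.sum_congr rfl fun i _ => ?_
    have : (i.succ.removeNth (Matrix.vecCons x v)) = Matrix.vecCons x (i.removeNth v) := by
      funext k
      refine Fin.cases ?_ (fun l => ?_) k
      · simp [Fin.removeNth]
      · simp [Fin.removeNth]
    simp [this, pow_succ]

open ContinuousAlternatingMap in
theorem curryLeft_alternatizeUncurryFin_zero (f : E →L[ℝ] E [⋀^Fin 0]→L[ℝ] F) (x : E) :
    (alternatizeUncurryFin f).curryLeft x = f x := by
  ext v
  simp [curryLeft_apply_apply, alternatizeUncurryFin_apply]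

open ContinuousAlternatingMap in
theorem comp_alternatizeUncurryFin (S : F →L[ℝ] F') (f : E →L[ℝ] E [⋀^Fin n]→L[ℝ] F)
    (g : E →L[ℝ] E [⋀^Fin n]→L[ℝ] F') (h : ∀ x, g x = S.compContinuousAlternatingMap (f x)) :
    alternatizeUncurryFin g = S.compContinuousAlternatingMap (alternatizeUncurryFin f) := by
  ext v
  simp [alternatizeUncurryFin_apply, h]

open ContinuousAlternatingMap in
theorem alternatizeUncurryFin_wedge_left (B : F →L[ℝ] F' →L[ℝ] F'') (h : p + q = n)
    (h' : p + 1 + q = n + 1) (f : E →L[ℝ] E [⋀^Fin p]→L[ℝ] F) (β : E [⋀^Fin q]→L[ℝ] F') :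
    alternatizeUncurryFin ((wedgeL B h).flip β ∘L f) = wedge B h' (alternatizeUncurryFin f) β := by
  induction n generalizing p q with
  | zero =>
    obtain rfl : p = 0 := by omega
    obtain rfl : q = 0 := by omega
    rw [wedge_zero_right]
    exact comp_alternatizeUncurryFin _ _ _ fun x => wedge_zero_right _ _ _ _
  | succ n ih =>
    rcases q with _ | q
    · obtain rfl : p = n + 1 := by omega
      rw [wedge_zero_right]
      exact comp_alternatizeUncurryFin _ _ _ fun x => wedge_zero_right _ _ _ _
    refine ext_curryLeft fun x => ?_
    rw [curryLeft_alternatizeUncurryFin, curryLeft_wedge B h' (by omega) (by omega)]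
    rcases p with _ | p
    · obtain rfl : q = n := by omega
      have h1 : iotaL x ∘L (wedgeL B h).flip β ∘L f =
          (wedgeL B (by omega)).flip (β.curryLeft x) ∘L f := by
        ext1 y
        change (wedge B h (f y) β).curryLeft x = wedge B _ (f y) (β.curryLeft x)
        rw [wedge_zero_left, wedge_zero_left]
        rfl
      rw [h1, ih _ (by omega), curryLeft_alternatizeUncurryFin_zero]
      simp [sub_eq_add_neg]
    · have e1 : p + (q + 1) = n := by omega
      have e2 : p + 1 + q = n := by omega
      have h1 : iotaL x ∘L (wedgeL B h).flip β ∘L f =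
          (wedgeL B e1).flip β ∘L (iotaL x ∘L f) +
            (-1 : ℝ) ^ (p + 1) • ((wedgeL B e2).flip (β.curryLeft x) ∘L f) := by
        ext1 y
        change (wedge B h (f y) β).curryLeft x = wedge B e1 ((f y).curryLeft x) β +
          (-1 : ℝ) ^ (p + 1) • wedge B e2 (f y) (β.curryLeft x)
        exact curryLeft_wedge B h e1 e2 (f y) β x
      have h2 : wedge B h ((alternatizeUncurryFin f).curryLeft x) β = wedge B h (f x) β -
          wedge B h (alternatizeUncurryFin (iotaL x ∘L f)) β := by
        rw [curryLeft_alternatizeUncurryFin, sub_eq_add_neg, wedge_add_left,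
          ← neg_one_smul ℝ (alternatizeUncurryFin (iotaL x ∘L f)), wedge_smul_left, neg_one_smul,
          sub_eq_add_neg]
      rw [h1, alternatizeUncurryFin_add, alternatizeUncurryFin_smul, ih e1 (by omega),
        ih e2 (by omega), h2, pow_succ _ (p + 1), mul_neg_one, neg_smul]
      change wedge B h (f x) β - _ = _
      abel

open ContinuousAlternatingMap in
theorem alternatizeUncurryFin_wedge_right (B : F →L[ℝ] F' →L[ℝ] F'') (h : p + q = n)
    (h' : p + (q + 1) = n + 1) (α : E [⋀^Fin p]→L[ℝ] F) (g : E →L[ℝ] E [⋀^Fin q]→L[ℝ] F') :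
    alternatizeUncurryFin (wedgeL B h α ∘L g) =
      (-1 : ℝ) ^ p • wedge B h' α (alternatizeUncurryFin g) := by
  have h1 : wedgeL B h α ∘L g = (-1 : ℝ) ^ (p * q) • ((wedgeL B.flip (by omega)).flip α ∘L g) := by
    ext1 y
    exact wedge_comm B h (by omega) α (g y)
  rw [h1, alternatizeUncurryFin_smul, alternatizeUncurryFin_wedge_left _ _ (by omega),
    wedge_comm B.flip (by omega) h', smul_smul, ContinuousLinearMap.flip_flip, ← pow_add]
  congr 1
  rw [show p * q + (q + 1) * p = p + 2 * (p * q) by ring, pow_add, pow_mul]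
  simp

/-- The Leibniz rule for the exterior derivative. -/
theorem extDeriv_wedge (B : F →L[ℝ] F' →L[ℝ] F'') (h : p + q = n) (h₁ : p + 1 + q = n + 1)
    (h₂ : p + (q + 1) = n + 1) {α : E → E [⋀^Fin p]→L[ℝ] F} {β : E → E [⋀^Fin q]→L[ℝ] F'} {x : E}
    (hα : DifferentiableAt ℝ α x) (hβ : DifferentiableAt ℝ β x) :
    extDeriv (fun y => wedge B h (α y) (β y)) x =
      wedge B h₁ (extDeriv α x) (β x) + (-1 : ℝ) ^ p • wedge B h₂ (α x) (extDeriv β x) := by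
  have hd : fderiv ℝ (fun y => wedge B h (α y) (β y)) x =
      (wedgeL B h).flip (β x) ∘L fderiv ℝ α x + wedgeL B h (α x) ∘L fderiv ℝ β x := by
    rw [show (fun y => wedge B h (α y) (β y)) = fun y => wedgeL B h (α y) (β y) from rfl,
      (wedgeL B h).fderiv_of_bilinear hα hβ, add_comm]
    rfl
  rw [extDeriv, hd, ContinuousAlternatingMap.alternatizeUncurryFin_add,
    alternatizeUncurryFin_wedge_left B h h₁, alternatizeUncurryFin_wedge_right B h h₂]
  rfl

/-- The exterior derivative commutes with linear maps on the values. -/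
theorem extDeriv_comp (S : F →L[ℝ] F') {α : E → E [⋀^Fin n]→L[ℝ] F} {x : E}
    (hα : DifferentiableAt ℝ α x) :
    extDeriv (fun y => S.compContinuousAlternatingMap (α y)) x =
      S.compContinuousAlternatingMap (extDeriv α x) := by
  refine comp_alternatizeUncurryFin S _ _ fun y => ?_
  have h := ((ContinuousLinearMap.compContinuousAlternatingMapCLM ℝ E F F' (Fin n) S).hasFDerivAt.comp
    x hα.hasFDerivAt).fderiv
  exact congrArg (fun L => L y) h

theorem wedge_one_one (B : F →L[ℝ] F' →L[ℝ] F'') (α : E [⋀^Fin 1]→L[ℝ] F)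
    (β : E [⋀^Fin 1]→L[ℝ] F') (v : Fin 2 → E) :
    wedge B rfl α β v = B (α ![v 0]) (β ![v 1]) - B (α ![v 1]) (β ![v 0]) := by
  have h := congrArg (fun θ => θ ![v 1])
    (curryLeft_wedge B (n := 1) (p := 0) (q := 0) rfl rfl rfl α β (v 0))
  simp only [ContinuousAlternatingMap.curryLeft_apply_apply, wedge_zero_left, wedge_zero_right] at h
  rw [show Matrix.vecCons (v 0) ![v 1] = v by ext i; fin_cases i <;> rfl] at h
  rw [h]
  simp [sub_eq_add_neg]

theorem extDeriv_one {α : E → E [⋀^Fin 1]→L[ℝ] F} {x : E} (v : Fin 2 → E) :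
    extDeriv α x v = fderiv ℝ α x (v 0) ![v 1] - fderiv ℝ α x (v 1) ![v 0] := by
  rw [extDeriv, ContinuousAlternatingMap.alternatizeUncurryFin_apply, Fin.sum_univ_two]
  have h0 : Fin.removeNth 0 v = ![v 1] := by ext i; fin_cases i; rfl
  have h1 : Fin.removeNth 1 v = ![v 0] := by ext i; fin_cases i; rfl
  simp [h0, h1, sub_eq_add_neg]

end WedgeIdentities

end

section

section TraceAlgebras

/-- A real algebra `A` with an ideal `T` and a trace on `T`, given by continuous bilinear maps. -/
structure TraceAlgebra (A T : Type*) [NormedAddCommGroup A] [NormedSpace ℝ A]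
    [NormedAddCommGroup T] [NormedSpace ℝ T] where
  mul : A →L[ℝ] A →L[ℝ] A
  one : A
  lm : A →L[ℝ] T →L[ℝ] T
  rm : T →L[ℝ] A →L[ℝ] T
  incl : T →L[ℝ] A
  tr : T →L[ℝ] ℂ
  scal : ℂ →L[ℝ] A
  smulA : ℂ →L[ℝ] A →L[ℝ] A
  smulT : ℂ →L[ℝ] T →L[ℝ] T
  mul_assoc : ∀ a b c, mul (mul a b) c = mul a (mul b c)
  one_mul : ∀ a, mul one a = a
  mul_one : ∀ a, mul a one = a
  incl_injective : Function.Injective incl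
  incl_lm : ∀ a t, incl (lm a t) = mul a (incl t)
  incl_rm : ∀ t a, incl (rm t a) = mul (incl t) a
  tr_lm : ∀ a t, tr (lm a t) = tr (rm t a)
  scal_mul : ∀ c a, mul (scal c) a = smulA c a
  mul_scal : ∀ a c, mul a (scal c) = smulA c a
  incl_smulT : ∀ c t, incl (smulT c t) = smulA c (incl t)
  tr_smulT : ∀ c t, tr (smulT c t) = c * tr t

variable {A T : Type*} [NormedAddCommGroup A] [NormedSpace ℝ A] [NormedAddCommGroup T]
  [NormedSpace ℝ T] (𝒯 : TraceAlgebra A T)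
variable {E : Type*} [NormedAddCommGroup E] [NormedSpace ℝ E] {p q n : ℕ}

namespace TraceAlgebra

/-- The ring structure underlying a trace algebra. -/
abbrev ring : Ring A :=
  { (inferInstance : AddCommGroup A) with
    mul := fun a b => 𝒯.mul a b
    one := 𝒯.one
    mul_assoc := 𝒯.mul_assoc
    one_mul := 𝒯.one_mul
    mul_one := 𝒯.mul_one
    left_distrib := fun a b c => (𝒯.mul a).map_add b c
    right_distrib := fun a b c => congrArg (fun L => L c) (𝒯.mul.map_add a b)
    zero_mul := fun a => congrArg (fun L => L a) 𝒯.mul.map_zero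
    mul_zero := fun a => (𝒯.mul a).map_zero }

/-- The trace vanishes on `φ⁻¹ X φ - X` if `φ = 1 + t` with `t` in the ideal. -/
theorem tr_conj_sub {t S : T} {X φ ψ : A} (hφ : φ = 𝒯.one + 𝒯.incl t) (h1 : 𝒯.mul ψ φ = 𝒯.one)
    (h2 : 𝒯.mul φ ψ = 𝒯.one) (hS : 𝒯.incl S = 𝒯.mul (𝒯.mul ψ X) φ - X) : 𝒯.tr S = 0 := by
  have hc : 𝒯.mul ψ (𝒯.incl t) = 𝒯.mul (𝒯.incl t) ψ := by
    have e1 : 𝒯.incl t = φ - 𝒯.one := by rw [hφ]; abel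
    rw [e1, map_sub, map_sub, sub_apply, h1, h2, 𝒯.mul_one, 𝒯.one_mul]
  have hS' : S = 𝒯.lm (𝒯.mul ψ X) t - 𝒯.rm (𝒯.lm ψ t) X := by
    apply 𝒯.incl_injective
    have e2 : 𝒯.mul (𝒯.mul ψ φ) X = X := by rw [h1, 𝒯.one_mul]
    rw [hS, map_sub, 𝒯.incl_lm, 𝒯.incl_rm, 𝒯.incl_lm]
    nth_rw 2 [← e2]
    rw [hφ]
    simp only [map_add, add_apply, 𝒯.mul_one]
    abel
  rw [hS', map_sub, ← 𝒯.tr_lm, sub_eq_zero]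
  have e3 : 𝒯.lm X (𝒯.lm ψ t) = 𝒯.rm (𝒯.lm X t) ψ := by
    apply 𝒯.incl_injective
    rw [𝒯.incl_lm, 𝒯.incl_lm, 𝒯.incl_rm, 𝒯.incl_lm, hc, 𝒯.mul_assoc]
  have e4 : 𝒯.lm (𝒯.mul ψ X) t = 𝒯.lm ψ (𝒯.lm X t) := by
    apply 𝒯.incl_injective
    rw [𝒯.incl_lm, 𝒯.incl_lm, 𝒯.incl_lm, 𝒯.mul_assoc]
  rw [e3, e4, 𝒯.tr_lm]

theorem incl_comp_injective :
    Function.Injective fun α : E [⋀^Fin n]→L[ℝ] T => 𝒯.incl.compContinuousAlternatingMap α := by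
  intro α β h
  ext1 v
  exact 𝒯.incl_injective (congrArg (fun θ => θ v) h)

theorem incl_comp_wedge_rm (h : p + q = n) (α : E [⋀^Fin p]→L[ℝ] T) (β : E [⋀^Fin q]→L[ℝ] A) :
    𝒯.incl.compContinuousAlternatingMap (wedge 𝒯.rm h α β) =
      wedge 𝒯.mul h (𝒯.incl.compContinuousAlternatingMap α) β :=
  comp_wedge_left h _ _ 𝒯.incl_rm α β

theorem incl_comp_wedge_lm (h : p + q = n) (α : E [⋀^Fin p]→L[ℝ] A) (β : E [⋀^Fin q]→L[ℝ] T) :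
    𝒯.incl.compContinuousAlternatingMap (wedge 𝒯.lm h α β) =
      wedge 𝒯.mul h α (𝒯.incl.compContinuousAlternatingMap β) :=
  comp_wedge_right h _ _ 𝒯.incl_lm α β

/-- The trace is graded cyclic. -/
theorem tr_comp_wedge_cyclic (h : p + q = n) (h' : q + p = n)
    (α : E [⋀^Fin p]→L[ℝ] T) (β : E [⋀^Fin q]→L[ℝ] A) :
    𝒯.tr.compContinuousAlternatingMap (wedge 𝒯.rm h α β) =
      (-1 : ℝ) ^ (p * q) • 𝒯.tr.compContinuousAlternatingMap (wedge 𝒯.lm h' β α) := by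
  have h1 := comp_wedge (B := 𝒯.rm) (C := (ContinuousLinearMap.compL ℝ _ _ _ 𝒯.tr) ∘L 𝒯.rm) h 𝒯.tr
    (fun _ _ => rfl) α β
  have h2 := comp_wedge (B := 𝒯.lm) (C := ((ContinuousLinearMap.compL ℝ _ _ _ 𝒯.tr) ∘L 𝒯.rm).flip)
    h' 𝒯.tr (fun a b => 𝒯.tr_lm a b) β α
  rw [h1, h2, ← wedge_comm]

/-- Powers of an algebra-valued alternating 2-form. -/
def altPow (G : E [⋀^Fin 2]→L[ℝ] A) : ∀ k : ℕ, E [⋀^Fin (2 * k)]→L[ℝ] A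
  | 0 => ContinuousAlternatingMap.constOfIsEmpty ℝ E (ι := Fin 0) 𝒯.one
  | k + 1 => wedge 𝒯.mul rfl (altPow G k) G

theorem wedge_mul_assoc {p q r m m' n : ℕ} (h₁₂ : p + q = m) (h : m + r = n) (h₂₃ : q + r = m')
    (h' : p + m' = n) (α : E [⋀^Fin p]→L[ℝ] A) (β : E [⋀^Fin q]→L[ℝ] A)
    (γ : E [⋀^Fin r]→L[ℝ] A) :
    wedge 𝒯.mul h (wedge 𝒯.mul h₁₂ α β) γ = wedge 𝒯.mul h' α (wedge 𝒯.mul h₂₃ β γ) :=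
  wedge_assoc 𝒯.mul_assoc h₁₂ h h₂₃ h' α β γ

theorem wedge_rm_assoc {p q r m m' n : ℕ} (h₁₂ : p + q = m) (h : m + r = n) (h₂₃ : q + r = m')
    (h' : p + m' = n) (α : E [⋀^Fin p]→L[ℝ] T) (β : E [⋀^Fin q]→L[ℝ] A)
    (γ : E [⋀^Fin r]→L[ℝ] A) :
    wedge 𝒯.rm h (wedge 𝒯.rm h₁₂ α β) γ = wedge 𝒯.rm h' α (wedge 𝒯.mul h₂₃ β γ) :=
  wedge_assoc (fun a b c => 𝒯.incl_injective (by simp only [𝒯.incl_rm, 𝒯.mul_assoc]))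
    h₁₂ h h₂₃ h' α β γ

theorem wedge_lm_rm_assoc {p q r m m' n : ℕ} (h₁₂ : p + q = m) (h : m + r = n)
    (h₂₃ : q + r = m') (h' : p + m' = n) (α : E [⋀^Fin p]→L[ℝ] A)
    (β : E [⋀^Fin q]→L[ℝ] T) (γ : E [⋀^Fin r]→L[ℝ] A) :
    wedge 𝒯.rm h (wedge 𝒯.lm h₁₂ α β) γ = wedge 𝒯.lm h' α (wedge 𝒯.rm h₂₃ β γ) :=
  wedge_assoc (fun a b c => 𝒯.incl_injective (by simp only [𝒯.incl_rm, 𝒯.incl_lm, 𝒯.mul_assoc]))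
    h₁₂ h h₂₃ h' α β γ

theorem wedge_altPow_zero_right (h : n + 2 * 0 = n) (α : E [⋀^Fin n]→L[ℝ] A)
    (G : E [⋀^Fin 2]→L[ℝ] A) : wedge 𝒯.mul h α (𝒯.altPow G 0) = α := by
  rw [wedge_zero_right]
  ext1 v
  exact 𝒯.mul_one (α v)

theorem wedge_rm_altPow_zero (h : n + 2 * 0 = n) (α : E [⋀^Fin n]→L[ℝ] T)
    (G : E [⋀^Fin 2]→L[ℝ] A) : wedge 𝒯.rm h α (𝒯.altPow G 0) = α := by
  rw [wedge_zero_right]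
  ext1 v
  exact 𝒯.incl_injective ((𝒯.incl_rm _ _).trans (𝒯.mul_one _))

theorem wedge_altPow_zero_left (h : 2 * 0 + n = n) (α : E [⋀^Fin n]→L[ℝ] A)
    (G : E [⋀^Fin 2]→L[ℝ] A) : wedge 𝒯.mul h (𝒯.altPow G 0) α = α := by
  rw [wedge_zero_left]
  ext1 v
  exact 𝒯.one_mul (α v)

theorem altPow_add (G : E [⋀^Fin 2]→L[ℝ] A) (k l m : ℕ) (h : 2 * k + 2 * l = 2 * m) :
    wedge 𝒯.mul h (𝒯.altPow G k) (𝒯.altPow G l) = 𝒯.altPow G m := by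
  induction l generalizing m with
  | zero =>
    obtain rfl : k = m := by omega
    exact 𝒯.wedge_altPow_zero_right _ _ _
  | succ l ih =>
    obtain ⟨m, rfl⟩ : ∃ j, m = j + 1 := ⟨m - 1, by omega⟩
    change wedge 𝒯.mul h (𝒯.altPow G k) (wedge 𝒯.mul _ (𝒯.altPow G l) G) =
      wedge 𝒯.mul _ (𝒯.altPow G m) G
    rw [← ih m (by omega), wedge_mul_assoc]

theorem altPow_one (G : E [⋀^Fin 2]→L[ℝ] A) : 𝒯.altPow G 1 = G :=
  𝒯.wedge_altPow_zero_left rfl G G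

theorem altPow_comp (S : A →L[ℝ] A) (h1 : S 𝒯.one = 𝒯.one)
    (hS : ∀ a b, S (𝒯.mul a b) = 𝒯.mul (S a) (S b))
    (G : E [⋀^Fin 2]→L[ℝ] A) (k : ℕ) :
    𝒯.altPow (S.compContinuousAlternatingMap G) k =
      S.compContinuousAlternatingMap (𝒯.altPow G k) := by
  induction k with
  | zero => ext1 v; exact h1.symm
  | succ k ih => rw [altPow, ih, altPow, comp_wedge_eq rfl S S S hS]

theorem altPow_compContinuousLinearMap {E' : Type*} [NormedAddCommGroup E'] [NormedSpace ℝ E']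
    (L : E' →L[ℝ] E) (G : E [⋀^Fin 2]→L[ℝ] A) (k : ℕ) :
    (𝒯.altPow G k).compContinuousLinearMap L = 𝒯.altPow (G.compContinuousLinearMap L) k := by
  induction k with
  | zero => rfl
  | succ k ih => rw [altPow, wedge_compContinuousLinearMap, ih]; rfl

/-- The multiple `β ⊗ 1` of the identity. -/
def scalarAlt (β : E [⋀^Fin n]→L[ℝ] ℂ) : E [⋀^Fin n]→L[ℝ] A :=
  𝒯.scal.compContinuousAlternatingMap β

theorem wedge_scalarAlt_left (h : p + q = n) (β : E [⋀^Fin p]→L[ℝ] ℂ) (α : E [⋀^Fin q]→L[ℝ] A) :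
    wedge 𝒯.mul h (𝒯.scalarAlt β) α = wedge 𝒯.smulA h β α :=
  wedge_comp_left 𝒯.mul h _ (fun c a => (𝒯.scal_mul c a).symm) β α

theorem wedge_scalarAlt_right (h : p + q = n) (α : E [⋀^Fin p]→L[ℝ] A) (β : E [⋀^Fin q]→L[ℝ] ℂ) :
    wedge 𝒯.mul h α (𝒯.scalarAlt β) = wedge 𝒯.smulA.flip h α β :=
  wedge_comp_right 𝒯.mul h _ (fun a c => (𝒯.mul_scal a c).symm) α β

theorem wedge_rm_scalarAlt (h : p + q = n) (α : E [⋀^Fin p]→L[ℝ] T)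
    (β : E [⋀^Fin q]→L[ℝ] ℂ) :
    wedge 𝒯.rm h α (𝒯.scalarAlt β) = wedge 𝒯.smulT.flip h α β :=
  wedge_comp_right 𝒯.rm h _ (fun a c => 𝒯.incl_injective (by
    rw [ContinuousLinearMap.flip_apply, 𝒯.incl_smulT, 𝒯.incl_rm, 𝒯.mul_scal])) α β

/-- Scalar forms commute with forms of even degree. -/
theorem wedge_scalarAlt_comm (h : p + q = n) (h' : q + p = n) (hp : Even (p * q))
    (α : E [⋀^Fin p]→L[ℝ] A) (β : E [⋀^Fin q]→L[ℝ] ℂ) :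
    wedge 𝒯.mul h α (𝒯.scalarAlt β) = wedge 𝒯.mul h' (𝒯.scalarAlt β) α := by
  rw [wedge_scalarAlt_right, wedge_scalarAlt_left, wedge_comm _ h h', hp.neg_one_pow,
    one_smul, ContinuousLinearMap.flip_flip]

/-- A scalar form can be moved out of a trace. -/
theorem tr_comp_wedge_scalarAlt {r m m' : ℕ} (h₂₃ : q + r = m) (h : p + m = n) (h₁₃ : p + r = m')
    (h' : q + m' = n) (α : E [⋀^Fin p]→L[ℝ] T) (β : E [⋀^Fin q]→L[ℝ] ℂ)
    (γ : E [⋀^Fin r]→L[ℝ] A) :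
    𝒯.tr.compContinuousAlternatingMap
        (wedge 𝒯.rm h α (wedge 𝒯.mul h₂₃ (𝒯.scalarAlt β) γ)) =
      (-1 : ℝ) ^ (p * q) • wedge (ContinuousLinearMap.mul ℝ ℂ) h' β
        (𝒯.tr.compContinuousAlternatingMap (wedge 𝒯.rm h₁₃ α γ)) := by
  rw [← 𝒯.wedge_rm_assoc rfl (by omega) h₂₃ h, wedge_rm_scalarAlt,
    wedge_comm 𝒯.smulT.flip rfl (by omega), ContinuousLinearMap.flip_flip, wedge_smul_left,
    wedge_assoc (B₂₃ := 𝒯.rm) (B' := 𝒯.smulT) (fun a b c => 𝒯.incl_injective (by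
      rw [𝒯.incl_rm, 𝒯.incl_smulT, 𝒯.incl_smulT, 𝒯.incl_rm, ← 𝒯.scal_mul, ← 𝒯.scal_mul,
        𝒯.mul_assoc])) _ _ h₁₃ h',
    ← comp_wedge_right (B := 𝒯.smulT) (C := ContinuousLinearMap.mul ℝ ℂ) h' 𝒯.tr 𝒯.tr
      (fun a b => 𝒯.tr_smulT a b)]
  ext v
  simp

end TraceAlgebra

end TraceAlgebras

end

section

section ContDiffForms

variable {E F F' F'' : Type*} [NormedAddCommGroup E] [NormedSpace ℝ E]
  [NormedAddCommGroup F] [NormedSpace ℝ F] [NormedAddCommGroup F'] [NormedSpace ℝ F']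
  [NormedAddCommGroup F''] [NormedSpace ℝ F''] {p q n : ℕ}

theorem ContDiffAt.extDeriv {α : E → E [⋀^Fin n]→L[ℝ] F} {x : E} (h : ContDiffAt ℝ ∞ α x) :
    ContDiffAt ℝ ∞ (extDeriv α) x := by
  have h1 : ContDiff ℝ ∞ (ContinuousAlternatingMap.alternatizeUncurryFinCLM ℝ E F (n := n)) :=
    ContinuousLinearMap.contDiff _
  exact h1.contDiffAt.comp x (h.fderiv_right (m := ∞) (by simp))

theorem ContDiffAt.wedge {X : Type*} [NormedAddCommGroup X] [NormedSpace ℝ X]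
    (B : F →L[ℝ] F' →L[ℝ] F'') (h : p + q = n)
    {α : X → E [⋀^Fin p]→L[ℝ] F} {β : X → E [⋀^Fin q]→L[ℝ] F'} {x : X}
    (hα : ContDiffAt ℝ ∞ α x) (hβ : ContDiffAt ℝ ∞ β x) :
    ContDiffAt ℝ ∞ (fun y => wedge B h (α y) (β y)) x := by
  have h1 : ContDiff ℝ ∞ (wedgeL (E := E) B h) := ContinuousLinearMap.contDiff _
  exact (h1.contDiffAt.comp x hα).clm_apply hβ

theorem ContDiffAt.compAlternating {X : Type*} [NormedAddCommGroup X] [NormedSpace ℝ X]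
    {S : X → F →L[ℝ] F'} {α : X → E [⋀^Fin n]→L[ℝ] F} {x : X} (hS : ContDiffAt ℝ ∞ S x)
    (hα : ContDiffAt ℝ ∞ α x) :
    ContDiffAt ℝ ∞ (fun y => (S y).compContinuousAlternatingMap (α y)) x := by
  have h1 : ContDiff ℝ ∞ (ContinuousLinearMap.compContinuousAlternatingMapCLM ℝ E F F' (ι := Fin n)) :=
    ContinuousLinearMap.contDiff _
  exact (h1.contDiffAt.comp x hS).clm_apply hα

theorem ContDiffAt.differentiableAt' {α : E → F} {x : E} (h : ContDiffAt ℝ ∞ α x) :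
    DifferentiableAt ℝ α x := h.differentiableAt (by simp)

theorem wedge_zero_left' (B : F →L[ℝ] F' →L[ℝ] F'') (h : p + q = n) (β : E [⋀^Fin q]→L[ℝ] F') :
    wedge B h (0 : E [⋀^Fin p]→L[ℝ] F) β = 0 := by
  simpa using wedge_smul_left B h 0 (0 : E [⋀^Fin p]→L[ℝ] F) β

theorem wedge_zero_right' (B : F →L[ℝ] F' →L[ℝ] F'') (h : p + q = n) (α : E [⋀^Fin p]→L[ℝ] F) :
    wedge B h α (0 : E [⋀^Fin q]→L[ℝ] F') = 0 := by
  simpa using wedge_smul_right B h α 0 (0 : E [⋀^Fin q]→L[ℝ] F')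

theorem wedge_sub_right (B : F →L[ℝ] F' →L[ℝ] F'') (h : p + q = n) (α : E [⋀^Fin p]→L[ℝ] F)
    (β β' : E [⋀^Fin q]→L[ℝ] F') : wedge B h α (β - β') = wedge B h α β - wedge B h α β' :=
  (wedgeL B h α).map_sub β β'

theorem wedge_sub_left (B : F →L[ℝ] F' →L[ℝ] F'') (h : p + q = n) (α α' : E [⋀^Fin p]→L[ℝ] F)
    (β : E [⋀^Fin q]→L[ℝ] F') : wedge B h (α - α') β = wedge B h α β - wedge B h α' β :=
((wedgeL (E := E) B h).flip β).map_sub α α'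

theorem compAlternating_add (S : F →L[ℝ] F') (α β : E [⋀^Fin n]→L[ℝ] F) :
    S.compContinuousAlternatingMap (α + β) =
      S.compContinuousAlternatingMap α + S.compContinuousAlternatingMap β := by
  ext v; simp

theorem compAlternating_sub (S : F →L[ℝ] F') (α β : E [⋀^Fin n]→L[ℝ] F) :
    S.compContinuousAlternatingMap (α - β) =
      S.compContinuousAlternatingMap α - S.compContinuousAlternatingMap β := by
  ext v; simp

theorem compAlternating_smul (S : F →L[ℝ] F') (c : ℝ) (α : E [⋀^Fin n]→L[ℝ] F) :
    S.compContinuousAlternatingMap (c • α) = c • S.compContinuousAlternatingMap α := by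
  ext v; simp

theorem compAlternating_zero (S : F →L[ℝ] F') :
    S.compContinuousAlternatingMap (0 : E [⋀^Fin n]→L[ℝ] F) = 0 := by
  ext v; simp

end ContDiffForms

namespace TraceAlgebra

variable {A T : Type*} [NormedAddCommGroup A] [NormedSpace ℝ A] [NormedAddCommGroup T]
  [NormedSpace ℝ T] (𝒯 : TraceAlgebra A T)
variable {E : Type*} [NormedAddCommGroup E] [NormedSpace ℝ E] {p q n : ℕ}

theorem contDiff_altPow (k : ℕ) :
    ContDiff ℝ ∞ (fun G : E [⋀^Fin 2]→L[ℝ] A => 𝒯.altPow G k) := by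
  induction k with
  | zero => exact contDiff_const
  | succ k ih =>
    exact contDiff_iff_contDiffAt.2 fun G => ContDiffAt.wedge _ _ ih.contDiffAt contDiffAt_id

/-- The curvature `da + a ∧ a` on a vector space. -/
def curv (a : E → E [⋀^Fin 1]→L[ℝ] A) (x : E) : E [⋀^Fin 2]→L[ℝ] A :=
  extDeriv a x + wedge 𝒯.mul rfl (a x) (a x)

theorem contDiffAt_curv {a : E → E [⋀^Fin 1]→L[ℝ] A} {x : E} (ha : ContDiffAt ℝ ∞ a x) :
    ContDiffAt ℝ ∞ (𝒯.curv a) x :=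
  (ContDiffAt.extDeriv ha).add (ContDiffAt.wedge _ _ ha ha)

/-- The Bianchi identity for `F + f`. -/
theorem extDeriv_curv_add {a : E → E [⋀^Fin 1]→L[ℝ] A} {f : E → E [⋀^Fin 2]→L[ℝ] ℂ} {x : E}
    (ha : ContDiffAt ℝ ∞ a x) (hf : DifferentiableAt ℝ f x) :
    extDeriv (fun y => 𝒯.curv a y + 𝒯.scalarAlt (f y)) x =
      𝒯.scalarAlt (extDeriv f x) +
        wedge 𝒯.mul rfl (𝒯.curv a x + 𝒯.scalarAlt (f x)) (a x) -
        wedge 𝒯.mul rfl (a x) (𝒯.curv a x + 𝒯.scalarAlt (f x)) := by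
  have ha' : ContDiffAt ℝ ∞ (extDeriv a) x := ContDiffAt.extDeriv ha
  have hw : DifferentiableAt ℝ (fun y => wedge 𝒯.mul rfl (a y) (a y) : E → E [⋀^Fin 2]→L[ℝ] A) x :=
    (ContDiffAt.wedge _ _ ha ha).differentiableAt'
  have hs : DifferentiableAt ℝ (fun y => 𝒯.scalarAlt (f y)) x :=
    ((ContinuousLinearMap.compContinuousAlternatingMapCLM ℝ E ℂ A (Fin 2)
      𝒯.scal).differentiableAt).comp x hf
  have h1 : extDeriv (fun y => 𝒯.curv a y + 𝒯.scalarAlt (f y)) x =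
      extDeriv (extDeriv a) x + extDeriv (fun y => wedge 𝒯.mul rfl (a y) (a y)) x +
        extDeriv (fun y => 𝒯.scalarAlt (f y)) x := by
    have e1 := extDeriv_fun_add ha'.differentiableAt' hw
    have e2 := extDeriv_fun_add (ha'.differentiableAt'.fun_add hw) hs
    rw [← e1, ← e2]
    rfl
  have h2 : extDeriv (fun y => 𝒯.scalarAlt (f y)) x = 𝒯.scalarAlt (extDeriv f x) :=
    extDeriv_comp _ hf
  rw [h1, extDeriv_extDeriv_apply ha (by
      rw [minSmoothness_of_isRCLikeNormedField]; exact WithTop.coe_le_coe.2 le_top), h2,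
    extDeriv_wedge 𝒯.mul rfl rfl rfl ha.differentiableAt' ha.differentiableAt', curv]
  rw [wedge_add_left, wedge_add_left, wedge_add_right, wedge_add_right,
    𝒯.wedge_mul_assoc rfl rfl rfl rfl,
    𝒯.wedge_scalarAlt_comm (p := 1) (q := 2) (n := 3) rfl rfl (by decide) (a x) (f x)]
  simp only [pow_one, neg_smul, one_smul, zero_add]
  abel

/-- The terms of `d (G ^ k)` that contain the derivative `β` of the scalar part of `G`. -/
def scalarTerm (G : E [⋀^Fin 2]→L[ℝ] A) (β : E [⋀^Fin 3]→L[ℝ] ℂ) :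
    ∀ k : ℕ, E [⋀^Fin (2 * k + 1)]→L[ℝ] A
  | 0 => 0
  | k + 1 => (k + 1 : ℝ) • wedge 𝒯.mul (by omega) (𝒯.scalarAlt β) (𝒯.altPow G k)

theorem extDeriv_altPow {G : E → E [⋀^Fin 2]→L[ℝ] A} {x : E} (hG : DifferentiableAt ℝ G x)
    {β : E [⋀^Fin 3]→L[ℝ] ℂ} {a : E [⋀^Fin 1]→L[ℝ] A}
    (hd : extDeriv G x = 𝒯.scalarAlt β + wedge 𝒯.mul rfl (G x) a - wedge 𝒯.mul rfl a (G x))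
    (k : ℕ) :
    extDeriv (fun y => 𝒯.altPow (G y) k) x = 𝒯.scalarTerm (G x) β k +
      wedge 𝒯.mul rfl (𝒯.altPow (G x) k) a -
      wedge 𝒯.mul (Nat.add_comm 1 (2 * k)) a (𝒯.altPow (G x) k) := by
  have hpow : ∀ k, DifferentiableAt ℝ (fun y => 𝒯.altPow (G y) k) x := fun k =>
    ((𝒯.contDiff_altPow k).contDiffAt.differentiableAt').comp x hG
  induction k with
  | zero =>
    rw [𝒯.wedge_altPow_zero_left, 𝒯.wedge_altPow_zero_right, scalarTerm]
    simp only [zero_add, sub_self]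
    have : fderiv ℝ (fun y => 𝒯.altPow (G y) 0) x = 0 := by
      change fderiv ℝ (fun y => ContinuousAlternatingMap.constOfIsEmpty ℝ E (ι := Fin 0) 𝒯.one) x = 0
      simp
    rw [extDeriv, this]
    ext v
    simp [ContinuousAlternatingMap.alternatizeUncurryFin_apply]
  | succ k ih =>
    have h1 : (fun y => 𝒯.altPow (G y) (k + 1)) = fun y => wedge 𝒯.mul rfl (𝒯.altPow (G y) k) (G y) :=
      rfl
    have e3 : 2 * k + 3 = 2 * (k + 1) + 1 := by omega
    have e3' : 3 + 2 * k = 2 * (k + 1) + 1 := by omega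
    have e12 : 2 * k + 1 + 2 = 2 * (k + 1) + 1 := by omega
    rw [h1, extDeriv_wedge 𝒯.mul rfl e12 e3 (hpow k) hG, ih, hd, (even_two_mul k).neg_one_pow,
      one_smul]
    have hS : wedge 𝒯.mul e12 (𝒯.scalarTerm (G x) β k) (G x) +
        wedge 𝒯.mul e3 (𝒯.altPow (G x) k) (𝒯.scalarAlt β) = 𝒯.scalarTerm (G x) β (k + 1) := by
      rw [𝒯.wedge_scalarAlt_comm e3 e3' ((even_two_mul k).mul_right 3)]
      rcases k with _ | k
      · simp [scalarTerm, wedge_zero_left']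
      · rw [scalarTerm, scalarTerm, wedge_smul_left, 𝒯.wedge_mul_assoc _ _ rfl e3']
        change _ • wedge 𝒯.mul _ (𝒯.scalarAlt β) (𝒯.altPow (G x) (k + 1)) +
          wedge 𝒯.mul _ (𝒯.scalarAlt β) (𝒯.altPow (G x) (k + 1)) = _
        push_cast
        module
    rw [← hS, wedge_sub_left, wedge_add_left, wedge_sub_right, wedge_add_right,
      𝒯.wedge_mul_assoc rfl e12 rfl e3, 𝒯.wedge_mul_assoc (Nat.add_comm 1 (2 * k)) e12 rfl (by omega),
      ← 𝒯.wedge_mul_assoc (p := 2 * k) (q := 2) (r := 1) rfl rfl rfl e3]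
    change _ = _ + wedge 𝒯.mul _ (wedge 𝒯.mul _ (𝒯.altPow (G x) k) (G x)) a -
      wedge 𝒯.mul _ a (wedge 𝒯.mul _ (𝒯.altPow (G x) k) (G x))
    abel

/-- The differential of `tr (δ ∧ G ^ k)` for `G = F + f`. -/
theorem extDeriv_tr_wedge_altPow {a : E → E [⋀^Fin 1]→L[ℝ] A} {f : E → E [⋀^Fin 2]→L[ℝ] ℂ}
    {δ : E → E [⋀^Fin 1]→L[ℝ] T} {x : E} (ha : ContDiffAt ℝ ∞ a x) (hf : ContDiffAt ℝ ∞ f x)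
    (hδ : ContDiffAt ℝ ∞ δ x) (k : ℕ) (h2 : 2 + 2 * k = 2 * k + 1 + 1) :
    extDeriv (fun y => 𝒯.tr.compContinuousAlternatingMap
        (wedge 𝒯.rm (Nat.add_comm 1 (2 * k)) (δ y) (𝒯.altPow (𝒯.curv a y + 𝒯.scalarAlt (f y)) k))) x =
      𝒯.tr.compContinuousAlternatingMap (wedge 𝒯.rm h2
        (extDeriv δ x + wedge 𝒯.lm rfl (a x) (δ x) + wedge 𝒯.rm rfl (δ x) (a x))
        (𝒯.altPow (𝒯.curv a x + 𝒯.scalarAlt (f x)) k)) -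
      𝒯.tr.compContinuousAlternatingMap (wedge 𝒯.rm (by omega) (δ x)
        (𝒯.scalarTerm (𝒯.curv a x + 𝒯.scalarAlt (f x)) (extDeriv f x) k)) := by
  have hG : ContDiffAt ℝ ∞ (fun y => 𝒯.curv a y + 𝒯.scalarAlt (f y)) x :=
    (𝒯.contDiffAt_curv ha).add (ContDiffAt.compAlternating contDiffAt_const hf)
  have hpow : ContDiffAt ℝ ∞ (fun y => 𝒯.altPow (𝒯.curv a y + 𝒯.scalarAlt (f y)) k) x :=
    (𝒯.contDiff_altPow k).contDiffAt.comp x hG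
  rw [extDeriv_comp _ (ContDiffAt.wedge _ _ hδ hpow).differentiableAt',
    extDeriv_wedge 𝒯.rm (Nat.add_comm 1 (2 * k)) h2 (by omega) hδ.differentiableAt' hpow.differentiableAt',
    𝒯.extDeriv_altPow hG.differentiableAt' (𝒯.extDeriv_curv_add ha hf.differentiableAt')]
  set G := 𝒯.curv a x + 𝒯.scalarAlt (f x)
  have e1 : 1 + (2 * k + 1) = 2 * k + 1 + 1 := by omega
  have hcyc : 𝒯.tr.compContinuousAlternatingMap
      (wedge 𝒯.rm e1 (δ x) (wedge 𝒯.mul rfl (𝒯.altPow G k) (a x))) =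
      - 𝒯.tr.compContinuousAlternatingMap
        (wedge 𝒯.rm h2 (wedge 𝒯.lm rfl (a x) (δ x)) (𝒯.altPow G k)) := by
    rw [← 𝒯.wedge_rm_assoc (Nat.add_comm 1 (2 * k)) rfl rfl e1,
      𝒯.tr_comp_wedge_cyclic rfl (by omega), 𝒯.wedge_lm_rm_assoc rfl h2 (Nat.add_comm 1 (2 * k)) e1]
    rw [Odd.neg_one_pow ⟨k, by ring⟩]
    module
  have hcyc' : wedge 𝒯.rm e1 (δ x) (wedge 𝒯.mul (Nat.add_comm 1 (2 * k)) (a x) (𝒯.altPow G k)) =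
      wedge 𝒯.rm h2 (wedge 𝒯.rm rfl (δ x) (a x)) (𝒯.altPow G k) :=
    (𝒯.wedge_rm_assoc rfl h2 (Nat.add_comm 1 (2 * k)) e1 _ _ _).symm
  rw [compAlternating_add, compAlternating_smul, wedge_sub_right, wedge_add_right,
    compAlternating_sub, compAlternating_add, hcyc, hcyc', wedge_add_left, wedge_add_left,
    compAlternating_add, compAlternating_add, pow_one]
  module

theorem tr_wedge_scalarTerm_succ (G : E [⋀^Fin 2]→L[ℝ] A) (β : E [⋀^Fin 3]→L[ℝ] ℂ)
    (δ : E [⋀^Fin 1]→L[ℝ] T) (k : ℕ) (h : 1 + (2 * (k + 1) + 1) = n) (h' : 3 + (2 * k + 1) = n) :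
    𝒯.tr.compContinuousAlternatingMap (wedge 𝒯.rm h δ (𝒯.scalarTerm G β (k + 1))) =
      -((k + 1 : ℝ) • wedge (ContinuousLinearMap.mul ℝ ℂ) h' β
        (𝒯.tr.compContinuousAlternatingMap
          (wedge 𝒯.rm (Nat.add_comm 1 (2 * k)) δ (𝒯.altPow G k)))) := by
  rw [scalarTerm, wedge_smul_right, compAlternating_smul,
    𝒯.tr_comp_wedge_scalarAlt _ h (Nat.add_comm 1 (2 * k)) h']
  norm_num

end TraceAlgebra

end

section

section ParametricIntegrals

universe u

variable {E V : Type u} [NormedAddCommGroup E] [NormedSpace ℝ E] [NormedAddCommGroup V]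
  [NormedSpace ℝ V] {O : Set E} {F : E → ℝ → V}

theorem hasFDerivAt_slice {x : E} {s : ℝ} (h : ContDiffAt ℝ ∞ (Function.uncurry F) (x, s)) :
    HasFDerivAt (fun y => F y s)
      (fderiv ℝ (Function.uncurry F) (x, s) ∘L ContinuousLinearMap.inl ℝ E ℝ) x :=
  HasFDerivAt.comp (g := Function.uncurry F) (f := fun y => (y, s)) x
    (h.differentiableAt (by simp)).hasFDerivAt (hasFDerivAt_prodMk_left x s)

theorem contDiffAt_fderiv_slice (hO : IsOpen O)
    (hF : ∀ x ∈ O, ∀ s, ContDiffAt ℝ ∞ (Function.uncurry F) (x, s)) {x : E} (hx : x ∈ O) (s : ℝ) :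
    ContDiffAt ℝ ∞ (Function.uncurry fun y r => fderiv ℝ (fun z => F z r) y) (x, s) := by
  have h1 : ContDiffAt ℝ ∞ (fun z : E × ℝ => fderiv ℝ (Function.uncurry F) z ∘L
      ContinuousLinearMap.inl ℝ E ℝ) (x, s) :=
    ((hF x hx s).fderiv_right (m := ∞) (by simp)).clm_comp contDiffAt_const
  refine h1.congr_of_eventuallyEq ?_
  have : ∀ᶠ z : E × ℝ in 𝓝 (x, s), z.1 ∈ O := continuousAt_fst (hO.mem_nhds hx)
  filter_upwards [this] with z hz
  exact (hasFDerivAt_slice (hF z.1 hz z.2)).fderiv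

theorem continuous_slice (hF : ∀ x ∈ O, ∀ s, ContDiffAt ℝ ∞ (Function.uncurry F) (x, s)) {x : E}
    (hx : x ∈ O) : Continuous (F x) :=
  continuous_iff_continuousAt.2 fun s =>
    (hF x hx s).continuousAt.comp (f := fun r => (x, r)) (by fun_prop)

/-- Differentiation under the integral sign. -/
theorem hasFDerivAt_integral_of_contDiffAt (hO : IsOpen O)
    (hF : ∀ x ∈ O, ∀ s, ContDiffAt ℝ ∞ (Function.uncurry F) (x, s)) {x : E} (hx : x ∈ O) :
    HasFDerivAt (fun y => ∫ s in (0 : ℝ)..1, F y s)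
      (∫ s in (0 : ℝ)..1, fderiv ℝ (fun y => F y s) x) x := by
  have hF' := fun x hx s => contDiffAt_fderiv_slice hO hF (x := x) hx s
  have hc : Continuous fun s => fderiv ℝ (fun y => F y s) x := continuous_slice hF' hx
  have hev : ∀ᶠ y in 𝓝 x, ∀ s ∈ Set.Icc (0 : ℝ) 1, y ∈ O ∧
      ‖fderiv ℝ (fun y => F y s) y‖ < ‖fderiv ℝ (fun y => F y s) x‖ + 1 := by
    refine isCompact_Icc.eventually_forall_of_forall_eventually fun s _ => ?_
    have h1 : ∀ᶠ z : E × ℝ in 𝓝 (x, s), z.1 ∈ O := continuousAt_fst (hO.mem_nhds hx)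
    have h2 : ContinuousAt (fun z : E × ℝ => ‖fderiv ℝ (fun y => F y z.2) z.1‖) (x, s) :=
      (hF' x hx s).continuousAt.norm
    have h3 : ContinuousAt (fun z : E × ℝ => ‖fderiv ℝ (fun y => F y z.2) x‖ + 1) (x, s) :=
      ((hc.comp continuous_snd).norm.add continuous_const).continuousAt
    exact h1.and (h2.eventually_lt h3 (by simp))
  obtain ⟨ε, hε, hball⟩ := Metric.eventually_nhds_iff_ball.1 hev
  have hIoc : ∀ s ∈ Set.uIoc (0 : ℝ) 1, s ∈ Set.Icc (0 : ℝ) 1 := fun s hs => by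
    rw [Set.uIoc_of_le zero_le_one] at hs; exact ⟨hs.1.le, hs.2⟩
  refine intervalIntegral.hasFDerivAt_integral_of_dominated_of_fderiv_le (𝕜 := ℝ)
    (F := F) (F' := fun y s => fderiv ℝ (fun z => F z s) y) (bound := fun s => ‖fderiv ℝ (fun y => F y s) x‖ + 1) (Metric.ball_mem_nhds x hε) ?_ ?_ ?_ ?_ ?_ ?_
  · filter_upwards [hO.mem_nhds hx] with y hy
    exact (continuous_slice hF hy).aestronglyMeasurable
  · exact (continuous_slice hF hx).intervalIntegrable _ _
  · exact hc.aestronglyMeasurable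
  · exact Filter.Eventually.of_forall fun s hs y hy => (hball y hy s (hIoc s hs)).2.le
  · exact (hc.norm.add continuous_const).intervalIntegrable _ _
  · exact Filter.Eventually.of_forall fun s hs y hy =>
      (hasFDerivAt_slice (hF y (hball y hy s (hIoc s hs)).1 s)).differentiableAt.hasFDerivAt

theorem contDiffOn_integral_of_contDiffAt (hO : IsOpen O)
    (hF : ∀ x ∈ O, ∀ s, ContDiffAt ℝ ∞ (Function.uncurry F) (x, s)) :
    ContDiffOn ℝ ∞ (fun y => ∫ s in (0 : ℝ)..1, F y s) O := by
  refine contDiffOn_infty.2 fun n => ?_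
  induction n generalizing V with
  | zero =>
    exact contDiffOn_zero.2 fun x hx =>
      (hasFDerivAt_integral_of_contDiffAt hO hF hx).continuousAt.continuousWithinAt
  | succ n ih =>
    rw [Nat.cast_add, Nat.cast_one, contDiffOn_succ_iff_fderiv_of_isOpen hO]
    refine ⟨fun x hx => (hasFDerivAt_integral_of_contDiffAt hO hF
      hx).differentiableAt.differentiableWithinAt, by simp, ?_⟩
    exact (ih fun x hx s => contDiffAt_fderiv_slice hO hF hx s).congr fun x hx =>
      (hasFDerivAt_integral_of_contDiffAt hO hF hx).fderiv

theorem clm_integral_fderiv {V' : Type*} [NormedAddCommGroup V'] [NormedSpace ℝ V']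
    [CompleteSpace V] [CompleteSpace V'] (hO : IsOpen O)
    (hF : ∀ x ∈ O, ∀ s, ContDiffAt ℝ ∞ (Function.uncurry F) (x, s)) {x : E} (hx : x ∈ O)
    (S : (E →L[ℝ] V) →L[ℝ] V') :
    S (∫ s in (0 : ℝ)..1, fderiv ℝ (fun y => F y s) x) =
      ∫ s in (0 : ℝ)..1, S (fderiv ℝ (fun y => F y s) x) := by
  have hc : Continuous fun s => fderiv ℝ (fun y => F y s) x :=
    continuous_slice (fun x hx s => contDiffAt_fderiv_slice hO hF hx s) hx
  exact (S.intervalIntegral_comp_comm (hc.intervalIntegrable 0 1)).symm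

theorem extDeriv_integral {E : Type u} [NormedAddCommGroup E] [NormedSpace ℝ E] {V : Type}
    [NormedAddCommGroup V] [NormedSpace ℝ V] [CompleteSpace V] {O : Set E} {n : ℕ}
    {F : E → ℝ → E [⋀^Fin n]→L[ℝ] V} (hO : IsOpen O)
    (hF : ∀ x ∈ O, ∀ s, ContDiffAt ℝ ∞ (Function.uncurry F) (x, s)) {x : E} (hx : x ∈ O) :
    extDeriv (fun y => ∫ s in (0 : ℝ)..1, F y s) x =
      ∫ s in (0 : ℝ)..1, extDeriv (fun y => F y s) x := by
  rw [extDeriv, (hasFDerivAt_integral_of_contDiffAt hO hF hx).fderiv]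
  exact clm_integral_fderiv hO hF hx (ContinuousAlternatingMap.alternatizeUncurryFinCLM ℝ E V)

end ParametricIntegrals

namespace TraceAlgebra

variable {A T : Type*} [NormedAddCommGroup A] [NormedSpace ℝ A] [NormedAddCommGroup T]
  [NormedSpace ℝ T] (𝒯 : TraceAlgebra A T)
variable {E : Type*} [NormedAddCommGroup E] [NormedSpace ℝ E] {p q n : ℕ}

/-- The trace class form `(G + X) ^ k - G ^ k`. -/
def diffPow (G : E [⋀^Fin 2]→L[ℝ] A) (X : E [⋀^Fin 2]→L[ℝ] T) : ∀ k : ℕ, E [⋀^Fin (2 * k)]→L[ℝ] T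
  | 0 => 0
  | k + 1 => wedge 𝒯.rm rfl (diffPow G X k) (G + 𝒯.incl.compContinuousAlternatingMap X) +
      wedge 𝒯.lm rfl (𝒯.altPow G k) X

theorem incl_comp_diffPow (G : E [⋀^Fin 2]→L[ℝ] A) (X : E [⋀^Fin 2]→L[ℝ] T) (k : ℕ) :
    𝒯.incl.compContinuousAlternatingMap (𝒯.diffPow G X k) =
      𝒯.altPow (G + 𝒯.incl.compContinuousAlternatingMap X) k - 𝒯.altPow G k := by
  induction k with
  | zero =>
    rw [diffPow, compAlternating_zero]
    exact (sub_self _).symm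
  | succ k ih =>
    rw [diffPow, compAlternating_add, incl_comp_wedge_rm, incl_comp_wedge_lm, ih, altPow, altPow,
      wedge_sub_left]
    rw [wedge_add_right 𝒯.mul rfl (𝒯.altPow G k)]
    abel

theorem diffPow_zero (G : E [⋀^Fin 2]→L[ℝ] A) (k : ℕ) : 𝒯.diffPow G 0 k = 0 := by
  apply 𝒯.incl_comp_injective
  simp only [incl_comp_diffPow, compAlternating_zero, add_zero, sub_self]

/-- The trace class form `∑ G ^ i Y G ^ (k - 1 - i)`. -/
def dPow (G : E [⋀^Fin 2]→L[ℝ] A) (Y : E [⋀^Fin 2]→L[ℝ] T) : ∀ k : ℕ, E [⋀^Fin (2 * k)]→L[ℝ] T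
  | 0 => 0
  | k + 1 => wedge 𝒯.rm rfl (dPow G Y k) G + wedge 𝒯.lm rfl (𝒯.altPow G k) Y

theorem wedge_rm_incl (h : p + q = n) (α : E [⋀^Fin p]→L[ℝ] T) (β : E [⋀^Fin q]→L[ℝ] T) :
    wedge 𝒯.rm h α (𝒯.incl.compContinuousAlternatingMap β) =
      wedge 𝒯.lm h (𝒯.incl.compContinuousAlternatingMap α) β := by
  apply 𝒯.incl_comp_injective
  simp only [incl_comp_wedge_rm, incl_comp_wedge_lm]

theorem hasDerivAt_diffPow (G : E [⋀^Fin 2]→L[ℝ] A) {X : ℝ → E [⋀^Fin 2]→L[ℝ] T}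
    {Y : E [⋀^Fin 2]→L[ℝ] T} {s : ℝ} (hX : HasDerivAt X Y s) (k : ℕ) :
    HasDerivAt (fun r => 𝒯.diffPow G (X r) k)
      (𝒯.dPow (G + 𝒯.incl.compContinuousAlternatingMap (X s)) Y k) s := by
  induction k with
  | zero => exact hasDerivAt_const s _
  | succ k ih =>
    have hi : HasDerivAt (fun r => G + 𝒯.incl.compContinuousAlternatingMap (X r))
        (𝒯.incl.compContinuousAlternatingMap Y) s :=
      ((ContinuousLinearMap.compContinuousAlternatingMapCLM ℝ E T A (Fin 2)
        𝒯.incl).hasFDerivAt.comp_hasDerivAt s hX).const_add G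
    have h1 : HasDerivAt (fun r => wedgeL (E := E) 𝒯.rm (show 2 * k + 2 = 2 * (k + 1) from rfl)
        (𝒯.diffPow G (X r) k) (G + 𝒯.incl.compContinuousAlternatingMap (X r)))
        (wedge 𝒯.rm (show 2 * k + 2 = 2 * (k + 1) from rfl) (𝒯.diffPow G (X s) k)
            (𝒯.incl.compContinuousAlternatingMap Y) +
          wedge 𝒯.rm (show 2 * k + 2 = 2 * (k + 1) from rfl)
            (𝒯.dPow (G + 𝒯.incl.compContinuousAlternatingMap (X s)) Y k)
            (G + 𝒯.incl.compContinuousAlternatingMap (X s))) s :=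
      (wedgeL (E := E) 𝒯.rm (show 2 * k + 2 = 2 * (k + 1) from rfl)).hasDerivAt_of_bilinear
        (fun _ => ih) (fun _ => hi)
    have h2 : HasDerivAt (fun r => wedgeL (E := E) 𝒯.lm (show 2 * k + 2 = 2 * (k + 1) from rfl)
        (𝒯.altPow G k) (X r)) (wedge 𝒯.lm (show 2 * k + 2 = 2 * (k + 1) from rfl)
          (𝒯.altPow G k) Y) s :=
      (wedgeL (E := E) 𝒯.lm (show 2 * k + 2 = 2 * (k + 1) from rfl)
        (𝒯.altPow G k)).hasFDerivAt.comp_hasDerivAt s hX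
    refine (h1.add h2).congr_deriv ?_
    rw [wedge_rm_incl, incl_comp_diffPow, wedge_sub_left, dPow]
    abel

theorem tr_wedge_dPow (G : E [⋀^Fin 2]→L[ℝ] A) (Y : E [⋀^Fin 2]→L[ℝ] T) (k l m : ℕ)
    (h : 2 * k + 2 * l = n) (h' : 2 + 2 * m = n) :
    𝒯.tr.compContinuousAlternatingMap (wedge 𝒯.rm h (𝒯.dPow G Y k) (𝒯.altPow G l)) =
      (k : ℝ) • 𝒯.tr.compContinuousAlternatingMap (wedge 𝒯.rm h' Y (𝒯.altPow G m)) := by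
  induction k generalizing l with
  | zero =>
    rw [dPow, wedge_zero_left', compAlternating_zero]
    ext v
    simp
  | succ k ih =>
    have e1 : 2 * k + 2 * (l + 1) = n := by omega
    have hG : wedge 𝒯.mul (show 2 + 2 * l = 2 * (l + 1) by omega) G (𝒯.altPow G l) =
        𝒯.altPow G (l + 1) := by
      have := 𝒯.altPow_add G 1 l (l + 1) (by omega)
      rwa [altPow_one] at this
    have h1 : wedge 𝒯.rm h (wedge 𝒯.rm rfl (𝒯.dPow G Y k) G) (𝒯.altPow G l) =
        wedge 𝒯.rm e1 (𝒯.dPow G Y k) (𝒯.altPow G (l + 1)) := by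
      rw [𝒯.wedge_rm_assoc _ h (show 2 + 2 * l = 2 * (l + 1) by omega) e1, hG]
    have e2 : 2 * k + (2 + 2 * l) = n := by omega
    have e2' : 2 + 2 * l + 2 * k = n := by omega
    have h2 : 𝒯.tr.compContinuousAlternatingMap
        (wedge 𝒯.rm h (wedge 𝒯.lm rfl (𝒯.altPow G k) Y) (𝒯.altPow G l)) =
        𝒯.tr.compContinuousAlternatingMap (wedge 𝒯.rm h' Y (𝒯.altPow G m)) := by
      rw [𝒯.wedge_lm_rm_assoc rfl h rfl e2]
      have h3 := 𝒯.tr_comp_wedge_cyclic e2' e2 (wedge 𝒯.rm rfl Y (𝒯.altPow G l)) (𝒯.altPow G k)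
      rw [((even_two_mul k).mul_left _).neg_one_pow, one_smul] at h3
      rw [← h3, 𝒯.wedge_rm_assoc rfl e2' (show 2 * l + 2 * k = 2 * m by omega) h', altPow_add]
    rw [dPow, wedge_add_left, compAlternating_add, h1, ih _ e1, h2]
    push_cast
    module

/-- If `G + X 1` is conjugate to `G` by an invertible element of `1 + T`, then
`∫₀¹ tr (X' (G + X) ^ k) = 0`. -/
theorem integral_tr_wedge_altPow_eq_zero {t : T} {φ ψ : A} (hφ : φ = 𝒯.one + 𝒯.incl t)
    (h1 : 𝒯.mul ψ φ = 𝒯.one) (h2 : 𝒯.mul φ ψ = 𝒯.one) (G : E [⋀^Fin 2]→L[ℝ] A)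
    {X Y : ℝ → E [⋀^Fin 2]→L[ℝ] T} (hX : ∀ s, HasDerivAt X (Y s) s) (hY : Continuous Y)
    (h0 : X 0 = 0)
    (hconj : G + 𝒯.incl.compContinuousAlternatingMap (X 1) =
      (𝒯.mul ψ ∘L 𝒯.mul.flip φ).compContinuousAlternatingMap G) (k : ℕ) (h : 2 + 2 * k = n) :
    ∫ s in (0 : ℝ)..1, 𝒯.tr.compContinuousAlternatingMap (wedge 𝒯.rm h (Y s)
      (𝒯.altPow (G + 𝒯.incl.compContinuousAlternatingMap (X s)) k)) = 0 := by
  obtain rfl : n = 2 * (k + 1) := by omega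
  set J := fun s => 𝒯.tr.compContinuousAlternatingMap (wedge 𝒯.rm h (Y s)
      (𝒯.altPow (G + 𝒯.incl.compContinuousAlternatingMap (X s)) k)) with hJ
  set W := fun s => 𝒯.tr.compContinuousAlternatingMap (𝒯.diffPow G (X s) (k + 1)) with hW
  have hd : ∀ s, HasDerivAt W ((k + 1 : ℝ) • J s) s := fun s => by
    have h3 := 𝒯.tr_wedge_dPow (G + 𝒯.incl.compContinuousAlternatingMap (X s)) (Y s) (k + 1) 0 k
      rfl h
    rw [wedge_rm_altPow_zero] at h3
    push_cast at h3
    rw [hJ, ← h3]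
    exact (ContinuousLinearMap.compContinuousAlternatingMapCLM ℝ E T ℂ (Fin (2 * (k + 1)))
        𝒯.tr).hasFDerivAt.comp_hasDerivAt s (𝒯.hasDerivAt_diffPow G (hX s) (k + 1))
  have hXc : Continuous X := continuous_iff_continuousAt.2 fun s => (hX s).continuousAt
  have hGc : Continuous fun s => G + 𝒯.incl.compContinuousAlternatingMap (X s) :=
    continuous_const.add ((ContinuousLinearMap.compContinuousAlternatingMapCLM ℝ E T A (Fin 2)
      𝒯.incl).continuous.comp hXc)
  have hJc : Continuous J := by
    have h4 : Continuous fun s => wedgeL (E := E) 𝒯.rm h (Y s)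
        (𝒯.altPow (G + 𝒯.incl.compContinuousAlternatingMap (X s)) k) :=
      ((wedgeL (E := E) 𝒯.rm h).continuous.comp hY).clm_apply
        ((𝒯.contDiff_altPow k).continuous.comp hGc)
    exact (ContinuousLinearMap.compContinuousAlternatingMapCLM ℝ E T ℂ (Fin (2 * (k + 1)))
        𝒯.tr).continuous.comp h4
  have hInt := intervalIntegral.integral_eq_sub_of_hasDerivAt (fun s _ => hd s)
    ((hJc.const_smul (k + 1 : ℝ)).intervalIntegrable 0 1)
  have hW0 : W 0 = 0 := by rw [hW]; simp only [h0, diffPow_zero, compAlternating_zero]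
  have hW1 : W 1 = 0 := by
    ext v
    refine 𝒯.tr_conj_sub hφ h1 h2 (X := 𝒯.altPow G (k + 1) v) ?_
    have h5 := congrArg (fun θ => θ v) (𝒯.incl_comp_diffPow G (X 1) (k + 1))
    refine h5.trans ?_
    have hS : ∀ a b, (𝒯.mul ψ ∘L 𝒯.mul.flip φ) (𝒯.mul a b) =
        𝒯.mul ((𝒯.mul ψ ∘L 𝒯.mul.flip φ) a) ((𝒯.mul ψ ∘L 𝒯.mul.flip φ) b) := fun a b => by
      change 𝒯.mul ψ (𝒯.mul (𝒯.mul a b) φ) = 𝒯.mul (𝒯.mul ψ (𝒯.mul a φ)) (𝒯.mul ψ (𝒯.mul b φ))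
      simp only [𝒯.mul_assoc]
      rw [← 𝒯.mul_assoc φ ψ, h2, 𝒯.one_mul]
    have h1' : (𝒯.mul ψ ∘L 𝒯.mul.flip φ) 𝒯.one = 𝒯.one := by
      change 𝒯.mul ψ (𝒯.mul 𝒯.one φ) = _
      rw [𝒯.one_mul, h1]
    rw [hconj, 𝒯.altPow_comp _ h1' hS, 𝒯.mul_assoc]
    rfl
  rw [hW0, hW1, sub_self, intervalIntegral.integral_smul] at hInt
  exact (smul_eq_zero.1 hInt).resolve_left (by positivity)

end TraceAlgebra

end

section

namespace TraceAlgebra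

universe u

variable {A T : Type*} [NormedAddCommGroup A] [NormedSpace ℝ A] [NormedAddCommGroup T]
  [NormedSpace ℝ T] (𝒯 : TraceAlgebra A T)
variable {E : Type u} [NormedAddCommGroup E] [NormedSpace ℝ E] {p q n : ℕ}

section ChernForm

/-- The path of connections `a + s δ`. -/
def pathForm (a : E → E [⋀^Fin 1]→L[ℝ] A) (δ : E → E [⋀^Fin 1]→L[ℝ] T) (s : ℝ) (x : E) :
    E [⋀^Fin 1]→L[ℝ] A :=
  a x + s • 𝒯.incl.compContinuousAlternatingMap (δ x)

/-- The covariant derivative `dδ + a δ + δ a`. -/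
def covD (a : E → E [⋀^Fin 1]→L[ℝ] A) (δ : E → E [⋀^Fin 1]→L[ℝ] T) (x : E) :
    E [⋀^Fin 2]→L[ℝ] T :=
  extDeriv δ x + wedge 𝒯.lm rfl (a x) (δ x) + wedge 𝒯.rm rfl (δ x) (a x)

/-- The form `δ ∧ δ`. -/
def sqForm (δ : E → E [⋀^Fin 1]→L[ℝ] T) (x : E) : E [⋀^Fin 2]→L[ℝ] T :=
  wedge 𝒯.rm rfl (δ x) (𝒯.incl.compContinuousAlternatingMap (δ x))

variable {a : E → E [⋀^Fin 1]→L[ℝ] A} {δ : E → E [⋀^Fin 1]→L[ℝ] T} {f : E → E [⋀^Fin 2]→L[ℝ] ℂ}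
  {x : E}

theorem contDiffAt_incl_comp {X : Type*} [NormedAddCommGroup X] [NormedSpace ℝ X]
    {δ : X → E [⋀^Fin n]→L[ℝ] T} {x : X}
    (hδ : ContDiffAt ℝ ∞ δ x) :
    ContDiffAt ℝ ∞ (fun y => 𝒯.incl.compContinuousAlternatingMap (δ y)) x :=
  ContDiffAt.compAlternating contDiffAt_const hδ

theorem contDiffAt_pathForm (ha : ContDiffAt ℝ ∞ a x) (hδ : ContDiffAt ℝ ∞ δ x) (s : ℝ) :
    ContDiffAt ℝ ∞ (𝒯.pathForm a δ s) x :=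
  ha.add (contDiffAt_const.fun_smul (𝒯.contDiffAt_incl_comp hδ))

theorem contDiffAt_covD (ha : ContDiffAt ℝ ∞ a x) (hδ : ContDiffAt ℝ ∞ δ x) :
    ContDiffAt ℝ ∞ (𝒯.covD a δ) x :=
  ((ContDiffAt.extDeriv hδ).add (ContDiffAt.wedge _ _ ha hδ)).add (ContDiffAt.wedge _ _ hδ ha)

theorem contDiffAt_sqForm (hδ : ContDiffAt ℝ ∞ δ x) : ContDiffAt ℝ ∞ (𝒯.sqForm δ) x :=
  ContDiffAt.wedge _ _ hδ (𝒯.contDiffAt_incl_comp hδ)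

theorem curv_pathForm (ha : ContDiffAt ℝ ∞ a x) (hδ : ContDiffAt ℝ ∞ δ x) (s : ℝ) :
    𝒯.curv (𝒯.pathForm a δ s) x = 𝒯.curv a x +
      𝒯.incl.compContinuousAlternatingMap (s • 𝒯.covD a δ x + s ^ 2 • 𝒯.sqForm δ x) := by
  have hi := (𝒯.contDiffAt_incl_comp hδ).differentiableAt'
  have h1 : extDeriv (𝒯.pathForm a δ s) x = extDeriv a x +
      s • 𝒯.incl.compContinuousAlternatingMap (extDeriv δ x) := by
    have e1 := extDeriv_fun_add ha.differentiableAt' (hi.fun_const_smul s)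
    have e2 : extDeriv (fun y => s • 𝒯.incl.compContinuousAlternatingMap (δ y)) x =
        s • extDeriv (fun y => 𝒯.incl.compContinuousAlternatingMap (δ y)) x := extDeriv_fun_smul _ _
    rw [← extDeriv_comp 𝒯.incl hδ.differentiableAt', ← e2, ← e1]
    rfl
  rw [curv, h1, curv, pathForm, covD, sqForm]
  simp only [wedge_add_left, wedge_add_right, wedge_smul_left, wedge_smul_right,
    compAlternating_add, compAlternating_smul, incl_comp_wedge_lm, incl_comp_wedge_rm]
  module

theorem covD_pathForm (s : ℝ) :
    extDeriv δ x + wedge 𝒯.lm rfl (𝒯.pathForm a δ s x) (δ x) +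
      wedge 𝒯.rm rfl (δ x) (𝒯.pathForm a δ s x) =
      𝒯.covD a δ x + (2 * s) • 𝒯.sqForm δ x := by
  rw [pathForm, covD, sqForm]
  simp only [wedge_add_left, wedge_add_right, wedge_smul_left, wedge_smul_right, ← wedge_rm_incl]
  module

/-- The form `tr (δ exp (F_s + f))` in degree `2 * k + 1`. -/
def chDensity (a : E → E [⋀^Fin 1]→L[ℝ] A) (δ : E → E [⋀^Fin 1]→L[ℝ] T)
    (f : E → E [⋀^Fin 2]→L[ℝ] ℂ) (k : ℕ) (x : E) (s : ℝ) : E [⋀^Fin (2 * k + 1)]→L[ℝ] ℂ :=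
  (k.factorial : ℝ)⁻¹ • 𝒯.tr.compContinuousAlternatingMap (wedge 𝒯.rm (Nat.add_comm 1 (2 * k))
    (δ x) (𝒯.altPow (𝒯.curv (𝒯.pathForm a δ s) x + 𝒯.scalarAlt (f x)) k))

/-- The form `∫₀¹ tr (δ exp (F_s + f)) ds` in degree `2 * k + 1`. -/
def chForm (a : E → E [⋀^Fin 1]→L[ℝ] A) (δ : E → E [⋀^Fin 1]→L[ℝ] T)
    (f : E → E [⋀^Fin 2]→L[ℝ] ℂ) (k : ℕ) (x : E) : E [⋀^Fin (2 * k + 1)]→L[ℝ] ℂ :=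
  ∫ s in (0 : ℝ)..1, 𝒯.chDensity a δ f k x s

variable {O : Set E}

theorem contDiffAt_comp_fst {V : Type*} [NormedAddCommGroup V] [NormedSpace ℝ V] {w : E → V}
    {x : E} {s : ℝ} (h : ContDiffAt ℝ ∞ w x) : ContDiffAt ℝ ∞ (fun z : E × ℝ => w z.1) (x, s) :=
  ContDiffAt.comp (g := w) (f := Prod.fst) (x, s) h contDiffAt_fst

theorem contDiffAt_chDensity (hO : IsOpen O) (ha : ∀ x ∈ O, ContDiffAt ℝ ∞ a x)
    (hδ : ∀ x ∈ O, ContDiffAt ℝ ∞ δ x) (hf : ∀ x ∈ O, ContDiffAt ℝ ∞ f x) (k : ℕ)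
    (hx : x ∈ O) (s : ℝ) :
    ContDiffAt ℝ ∞ (Function.uncurry (𝒯.chDensity a δ f k)) (x, s) := by
  have hG : ContDiffAt ℝ ∞ (fun z : E × ℝ => 𝒯.curv a z.1 +
      𝒯.incl.compContinuousAlternatingMap (z.2 • 𝒯.covD a δ z.1 + z.2 ^ 2 • 𝒯.sqForm δ z.1) +
      𝒯.scalarAlt (f z.1)) (x, s) :=
    ((contDiffAt_comp_fst (𝒯.contDiffAt_curv (ha x hx))).add (𝒯.contDiffAt_incl_comp
      ((contDiffAt_snd.fun_smul (contDiffAt_comp_fst (𝒯.contDiffAt_covD (ha x hx) (hδ x hx)))).add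
        ((contDiffAt_snd.pow 2).fun_smul (contDiffAt_comp_fst (𝒯.contDiffAt_sqForm (hδ x hx))))))).add
      (contDiffAt_comp_fst (ContDiffAt.compAlternating contDiffAt_const (hf x hx)))
  have h1 := contDiffAt_const (c := (k.factorial : ℝ)⁻¹) |>.fun_smul
    (ContDiffAt.compAlternating (contDiffAt_const (c := 𝒯.tr)) (ContDiffAt.wedge 𝒯.rm (Nat.add_comm 1 (2 * k))
    (contDiffAt_comp_fst (hδ x hx)) ((𝒯.contDiff_altPow k).contDiffAt.comp (x, s) hG)))
  refine h1.congr_of_eventuallyEq ?_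
  have : ∀ᶠ z : E × ℝ in 𝓝 (x, s), z.1 ∈ O := continuousAt_fst (hO.mem_nhds hx)
  filter_upwards [this] with z hz
  rw [Function.uncurry, chDensity, curv_pathForm 𝒯 (ha _ hz) (hδ _ hz)]
  rfl

theorem contDiffOn_chForm (hO : IsOpen O) (ha : ∀ x ∈ O, ContDiffAt ℝ ∞ a x)
    (hδ : ∀ x ∈ O, ContDiffAt ℝ ∞ δ x) (hf : ∀ x ∈ O, ContDiffAt ℝ ∞ f x) (k : ℕ) :
    ContDiffOn ℝ ∞ (𝒯.chForm a δ f k) O :=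
  contDiffOn_integral_of_contDiffAt hO fun _ hx s => 𝒯.contDiffAt_chDensity hO ha hδ hf k hx s

theorem conj_scalarAlt {φ ψ : A} (h1 : 𝒯.mul ψ φ = 𝒯.one) (f : E [⋀^Fin n]→L[ℝ] ℂ) :
    (𝒯.mul ψ ∘L 𝒯.mul.flip φ).compContinuousAlternatingMap (𝒯.scalarAlt f) = 𝒯.scalarAlt f := by
  ext v
  change 𝒯.mul ψ (𝒯.mul (𝒯.scal (f v)) φ) = 𝒯.scal (f v)
  rw [𝒯.scal_mul, ← 𝒯.mul_scal, ← 𝒯.mul_assoc, h1, 𝒯.one_mul]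

theorem extDeriv_chDensity (ha : ContDiffAt ℝ ∞ a x)
    (hδ : ContDiffAt ℝ ∞ δ x) (hf : ContDiffAt ℝ ∞ f x) (k : ℕ) (s : ℝ)
    (h2 : 2 + 2 * k = 2 * k + 1 + 1) :
    extDeriv (fun y => 𝒯.chDensity a δ f k y s) x = (k.factorial : ℝ)⁻¹ •
      (𝒯.tr.compContinuousAlternatingMap (wedge 𝒯.rm h2
        (𝒯.covD a δ x + (2 * s) • 𝒯.sqForm δ x)
        (𝒯.altPow (𝒯.curv a x + 𝒯.scalarAlt (f x) +
          𝒯.incl.compContinuousAlternatingMap (s • 𝒯.covD a δ x + s ^ 2 • 𝒯.sqForm δ x)) k)) -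
      𝒯.tr.compContinuousAlternatingMap (wedge 𝒯.rm (by omega) (δ x)
        (𝒯.scalarTerm (𝒯.curv (𝒯.pathForm a δ s) x + 𝒯.scalarAlt (f x)) (extDeriv f x) k))) := by
  have h1 := 𝒯.extDeriv_tr_wedge_altPow (𝒯.contDiffAt_pathForm ha hδ s) hf hδ k h2
  have h3 : extDeriv (fun y => 𝒯.chDensity a δ f k y s) x = (k.factorial : ℝ)⁻¹ • _ :=
    extDeriv_fun_smul _ _
  rw [h3, h1, covD_pathForm, 𝒯.curv_pathForm ha hδ,
    add_right_comm (𝒯.curv a x)]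

/-- The part of the differential of the Chern form that does not involve `df` vanishes. -/
theorem integral_covD_eq_zero {t : T} {φ ψ : A} (hφ : φ = 𝒯.one + 𝒯.incl t)
    (h1 : 𝒯.mul ψ φ = 𝒯.one) (h2 : 𝒯.mul φ ψ = 𝒯.one) (ha : ContDiffAt ℝ ∞ a x)
    (hδ : ContDiffAt ℝ ∞ δ x)
    (hconj : 𝒯.curv (𝒯.pathForm a δ 1) x =
      (𝒯.mul ψ ∘L 𝒯.mul.flip φ).compContinuousAlternatingMap (𝒯.curv a x)) (k : ℕ)
    (h : 2 + 2 * k = n) :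
    ∫ s in (0 : ℝ)..1, 𝒯.tr.compContinuousAlternatingMap (wedge 𝒯.rm h
        (𝒯.covD a δ x + (2 * s) • 𝒯.sqForm δ x)
        (𝒯.altPow (𝒯.curv a x + 𝒯.scalarAlt (f x) +
          𝒯.incl.compContinuousAlternatingMap (s • 𝒯.covD a δ x + s ^ 2 • 𝒯.sqForm δ x)) k)) = 0 := by
  refine 𝒯.integral_tr_wedge_altPow_eq_zero hφ h1 h2 (𝒯.curv a x + 𝒯.scalarAlt (f x))
    (X := fun s => s • 𝒯.covD a δ x + s ^ 2 • 𝒯.sqForm δ x)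
    (Y := fun s => 𝒯.covD a δ x + (2 * s) • 𝒯.sqForm δ x) (fun s => ?_) (by fun_prop) (by simp)
    ?_ k h
  · have e1 := (hasDerivAt_id s).smul_const (𝒯.covD a δ x)
    have e2 := (hasDerivAt_pow 2 s).smul_const (𝒯.sqForm δ x)
    exact (e1.fun_add e2).congr_deriv (by simp)
  · rw [curv_pathForm 𝒯 ha hδ] at hconj
    simp only [one_smul, one_pow] at hconj ⊢
    rw [add_right_comm, hconj, compAlternating_add, conj_scalarAlt 𝒯 h1]

theorem continuous_integrand (hO : IsOpen O) (ha : ∀ x ∈ O, ContDiffAt ℝ ∞ a x)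
    (hδ : ∀ x ∈ O, ContDiffAt ℝ ∞ δ x) (hf : ∀ x ∈ O, ContDiffAt ℝ ∞ f x) (k : ℕ)
    (hx : x ∈ O) : Continuous fun s => 𝒯.chDensity a δ f k x s :=
  continuous_slice (fun _ hx s => 𝒯.contDiffAt_chDensity hO ha hδ hf k hx s) hx

theorem continuous_covD_integrand (k : ℕ) (h : 2 + 2 * k = n) :
    Continuous fun s : ℝ => 𝒯.tr.compContinuousAlternatingMap (wedge 𝒯.rm h
        (𝒯.covD a δ x + (2 * s) • 𝒯.sqForm δ x)
        (𝒯.altPow (𝒯.curv a x + 𝒯.scalarAlt (f x) +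
          𝒯.incl.compContinuousAlternatingMap (s • 𝒯.covD a δ x + s ^ 2 • 𝒯.sqForm δ x)) k)) := by
  refine continuous_iff_continuousAt.2 fun s => ContDiffAt.continuousAt (𝕜 := ℝ) (n := ∞) ?_
  refine ContDiffAt.compAlternating contDiffAt_const (ContDiffAt.wedge _ _ (by fun_prop) ?_)
  refine (𝒯.contDiff_altPow k).contDiffAt.comp s (contDiffAt_const.add
    (𝒯.contDiffAt_incl_comp (by fun_prop)))

/-- The Chern form is closed for the twisted differential. -/
theorem extDeriv_chForm {t : T} {φ ψ : A} (hφ : φ = 𝒯.one + 𝒯.incl t)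
    (h1 : 𝒯.mul ψ φ = 𝒯.one) (h2 : 𝒯.mul φ ψ = 𝒯.one) (hO : IsOpen O)
    (ha : ∀ x ∈ O, ContDiffAt ℝ ∞ a x)
    (hδ : ∀ x ∈ O, ContDiffAt ℝ ∞ δ x) (hf : ∀ x ∈ O, ContDiffAt ℝ ∞ f x) (hx : x ∈ O)
    (hconj : 𝒯.curv (𝒯.pathForm a δ 1) x =
      (𝒯.mul ψ ∘L 𝒯.mul.flip φ).compContinuousAlternatingMap (𝒯.curv a x)) :
    extDeriv (𝒯.chForm a δ f 0) x = 0 ∧ ∀ k (h : 3 + (2 * k + 1) = 2 * (k + 1) + 1 + 1),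
      extDeriv (𝒯.chForm a δ f (k + 1)) x =
        wedge (ContinuousLinearMap.mul ℝ ℂ) h (extDeriv f x) (𝒯.chForm a δ f k x) := by
  have hd : ∀ k, extDeriv (𝒯.chForm a δ f k) x =
      ∫ s in (0 : ℝ)..1, extDeriv (fun y => 𝒯.chDensity a δ f k y s) x := fun k =>
    extDeriv_integral hO (fun _ hx s => 𝒯.contDiffAt_chDensity hO ha hδ hf k hx s) hx
  constructor
  · rw [hd]
    have e : ∀ s : ℝ, extDeriv (fun y => 𝒯.chDensity a δ f 0 y s) x = _ := fun s =>
      𝒯.extDeriv_chDensity (ha x hx) (hδ x hx) (hf x hx) 0 s rfl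
    simp only [e, scalarTerm, wedge_zero_right', compAlternating_zero, sub_zero]
    rw [intervalIntegral.integral_smul,
      𝒯.integral_covD_eq_zero hφ h1 h2 (ha x hx) (hδ x hx) hconj 0 rfl]
    ext v
    simp
  · intro k h
    rw [hd]
    have e2 : 2 + 2 * (k + 1) = 2 * (k + 1) + 1 + 1 := by omega
    have e : ∀ s : ℝ, extDeriv (fun y => 𝒯.chDensity a δ f (k + 1) y s) x =
        ((k + 1).factorial : ℝ)⁻¹ • 𝒯.tr.compContinuousAlternatingMap (wedge 𝒯.rm e2
          (𝒯.covD a δ x + (2 * s) • 𝒯.sqForm δ x)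
          (𝒯.altPow (𝒯.curv a x + 𝒯.scalarAlt (f x) +
            𝒯.incl.compContinuousAlternatingMap (s • 𝒯.covD a δ x + s ^ 2 • 𝒯.sqForm δ x)) (k + 1))) +
        wedgeL (ContinuousLinearMap.mul ℝ ℂ) h (extDeriv f x) (𝒯.chDensity a δ f k x s) := fun s => by
      rw [𝒯.extDeriv_chDensity (ha x hx) (hδ x hx) (hf x hx) (k + 1) s e2,
        𝒯.tr_wedge_scalarTerm_succ _ _ _ k _ h, wedgeL_apply, chDensity, wedge_smul_right,
        smul_sub, sub_eq_add_neg, smul_neg, neg_neg, smul_smul, Nat.factorial_succ]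
      congr 2
      push_cast
      field_simp
    simp only [e]
    have hc1 : Continuous fun s : ℝ => ((k + 1).factorial : ℝ)⁻¹ • 𝒯.tr.compContinuousAlternatingMap
        (wedge 𝒯.rm e2
          (𝒯.covD a δ x + (2 * s) • 𝒯.sqForm δ x)
          (𝒯.altPow (𝒯.curv a x + 𝒯.scalarAlt (f x) +
            𝒯.incl.compContinuousAlternatingMap (s • 𝒯.covD a δ x + s ^ 2 • 𝒯.sqForm δ x)) (k + 1))) :=
      (𝒯.continuous_covD_integrand (k + 1) e2).fun_const_smul _
    have hc2 := 𝒯.continuous_integrand hO ha hδ hf k hx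
    have hc3 : Continuous fun s => wedgeL (ContinuousLinearMap.mul ℝ ℂ) h (extDeriv f x)
        (𝒯.chDensity a δ f k x s) :=
      (wedgeL (ContinuousLinearMap.mul ℝ ℂ) h (extDeriv f x)).continuous.comp hc2
    rw [intervalIntegral.integral_add (hc1.intervalIntegrable 0 1) (hc3.intervalIntegrable 0 1),
      intervalIntegral.integral_smul,
      𝒯.integral_covD_eq_zero hφ h1 h2 (ha x hx) (hδ x hx) hconj (k + 1) e2,
      ContinuousLinearMap.intervalIntegral_comp_comm _ (hc2.intervalIntegrable 0 1), wedgeL_apply]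
    change _ + _ = wedge _ h (extDeriv f x) (∫ s in (0 : ℝ)..1, 𝒯.chDensity a δ f k x s)
    ext v
    simp

end ChernForm

end TraceAlgebra

end

section

section GaugeAlgebra

variable {R : Type*} [Ring R]

theorem gauge_curvature_identity {g a₀ a₁ a₀' a₁' g₀ g₁ b₀ b₁ a₀₁ a₁₀ a₀₁' a₁₀' b₀₁ b₁₀ s : R}
    (h₀ : g * a₀' = g₀ + a₀ * g - b₀ * g) (h₁ : g * a₁' = g₁ + a₁ * g - b₁ * g)
    (h₀₁ : g₀ * a₁' + g * a₀₁' = s + (a₀₁ * g + a₁ * g₀) - (b₀₁ * g + b₁ * g₀))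
    (h₁₀ : g₁ * a₀' + g * a₁₀' = s + (a₁₀ * g + a₀ * g₁) - (b₁₀ * g + b₀ * g₁))
    (hb₀ : b₀ * a₁ = a₁ * b₀) (hb₁ : b₁ * a₀ = a₀ * b₁) (hb : b₀ * b₁ = b₁ * b₀) :
    g * (a₀₁' - a₁₀' + (a₀' * a₁' - a₁' * a₀')) =
      (a₀₁ - a₁₀ + (a₀ * a₁ - a₁ * a₀)) * g - (b₀₁ - b₁₀) * g := by
  have e₀₁ : g * a₀₁' = s + (a₀₁ * g + a₁ * g₀) - (b₀₁ * g + b₁ * g₀) - g₀ * a₁' := by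
    rw [← h₀₁]; abel
  have e₁₀ : g * a₁₀' = s + (a₁₀ * g + a₀ * g₁) - (b₁₀ * g + b₀ * g₁) - g₁ * a₀' := by
    rw [← h₁₀]; abel
  have k₀ : g * (a₀' * a₁') = g₀ * a₁' + a₀ * (g₁ + a₁ * g - b₁ * g) - b₀ * (g₁ + a₁ * g - b₁ * g) := by
    rw [← mul_assoc, h₀, ← h₁]; noncomm_ring
  have k₁ : g * (a₁' * a₀') = g₁ * a₀' + a₁ * (g₀ + a₀ * g - b₀ * g) - b₁ * (g₀ + a₀ * g - b₀ * g) := by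
    rw [← mul_assoc, h₁, ← h₀]; noncomm_ring
  rw [mul_add, mul_sub, mul_sub, e₀₁, e₁₀, k₀, k₁]
  simp only [mul_sub, mul_add, ← mul_assoc, hb₀, hb₁, hb]
  noncomm_ring

theorem gauge_diff_identity {g a a' g₀ b τ τ' τ₀ τ₀' δ δ' ψ : R}
    (hψ : ψ * (1 + τ) = 1) (hg : g * τ' = τ * g) (hd : g₀ * τ' + g * τ₀' = τ₀ * g + τ * g₀)
    (hδ : (1 + τ) * δ = τ₀ + a * τ - τ * a) (hδ' : (1 + τ') * δ' = τ₀' + a' * τ' - τ' * a')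
    (ha : g * a' = g₀ + a * g - b * g) (hb : b * τ = τ * b) : g * δ' = δ * g := by
  have h1 : (1 + τ) * (g * δ') = (1 + τ) * (δ * g) := by
    have e1 : (1 + τ) * (g * δ') = g * ((1 + τ') * δ') := by
      rw [← mul_assoc, ← mul_assoc, mul_add, hg]; noncomm_ring
    have e2 : g * τ₀' = τ₀ * g + τ * g₀ - g₀ * τ' := by rw [← hd]; abel
    rw [e1, hδ', mul_sub, mul_add, e2, ← mul_assoc (1 + τ), hδ, ← mul_assoc, ha, ← mul_assoc, hg,
      mul_assoc τ, ha, sub_mul, add_mul, mul_assoc a, hg, mul_assoc b, hg]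
    simp only [mul_sub, mul_add, ← mul_assoc, hb]
    noncomm_ring
  have h2 := congrArg (ψ * ·) h1
  simpa only [← mul_assoc, hψ, one_mul] using h2

end GaugeAlgebra

namespace TraceAlgebra

universe u

variable {A T : Type*} [NormedAddCommGroup A] [NormedSpace ℝ A] [NormedAddCommGroup T]
  [NormedSpace ℝ T] (𝒯 : TraceAlgebra A T)
variable {E : Type u} [NormedAddCommGroup E] [NormedSpace ℝ E] {p q n : ℕ}

/-- The difference `φ⁻¹ (d + a) φ - (d + a)` for `φ = 1 + t` with inverse `ψ`. -/
def diffT (a : E → E [⋀^Fin 1]→L[ℝ] A) (t : E → T) (ψ : E → A) (x : E) : E [⋀^Fin 1]→L[ℝ] T :=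
  (𝒯.lm (ψ x)).compContinuousAlternatingMap
    (ContinuousAlternatingMap.ofSubsingleton ℝ E T (0 : Fin 1) (fderiv ℝ t x) +
      (𝒯.lm.flip (t x)).compContinuousAlternatingMap (a x) -
      (𝒯.rm (t x)).compContinuousAlternatingMap (a x))

/-- `d + a'` is the transform of `d + a` by `g`, up to the scalar form `β`. -/
def IsGauge (a a' : E → E [⋀^Fin 1]→L[ℝ] A) (g : E → A) (β : E → E [⋀^Fin 1]→L[ℝ] ℂ) (x : E) :
    Prop :=
  ∀ v : Fin 1 → E, 𝒯.mul (g x) (a' x v) =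
    fderiv ℝ g x (v 0) + 𝒯.mul (a x v) (g x) - 𝒯.smulA (β x v) (g x)

variable {a a' : E → E [⋀^Fin 1]→L[ℝ] A} {g : E → A} {β : E → E [⋀^Fin 1]→L[ℝ] ℂ} {x : E}
  {t t' : E → T} {ψ ψ' : E → A} {f f' : E → E [⋀^Fin 2]→L[ℝ] ℂ}

theorem fderiv_mul_apply {X : Type*} [NormedAddCommGroup X] [NormedSpace ℝ X]
    {V W Z : Type*} [NormedAddCommGroup V] [NormedSpace ℝ V] [NormedAddCommGroup W]
    [NormedSpace ℝ W] [NormedAddCommGroup Z] [NormedSpace ℝ Z] (B : V →L[ℝ] W →L[ℝ] Z)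
    {v : X → V} {w : X → W} {x : X}
    (hv : DifferentiableAt ℝ v x) (hw : DifferentiableAt ℝ w x) (e : X) :
    fderiv ℝ (fun y => B (v y) (w y)) x e = B (fderiv ℝ v x e) (w x) + B (v x) (fderiv ℝ w x e) := by
  rw [B.fderiv_of_bilinear hv hw]
  simp [add_comm]

theorem differentiableAt_apply {V : Type*} [NormedAddCommGroup V] [NormedSpace ℝ V]
    {θ : E → E [⋀^Fin n]→L[ℝ] V} (h : DifferentiableAt ℝ θ x) (v : Fin n → E) :
    DifferentiableAt ℝ (fun y => θ y v) x :=
  (ContinuousAlternatingMap.apply ℝ E V v).differentiableAt.comp x h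

theorem fderiv_apply {V : Type*} [NormedAddCommGroup V] [NormedSpace ℝ V]
    {θ : E → E [⋀^Fin n]→L[ℝ] V} (h : DifferentiableAt ℝ θ x) (v : Fin n → E) (e : E) :
    fderiv ℝ (fun y => θ y v) x e = fderiv ℝ θ x e v := by
  have := (((ContinuousAlternatingMap.apply ℝ E V v).hasFDerivAt).comp x h.hasFDerivAt).fderiv
  exact congrArg (fun L => L e) this

theorem isGauge_fderiv (ha : ContDiffAt ℝ ∞ a x) (ha' : ContDiffAt ℝ ∞ a' x)
    (hg : ContDiffAt ℝ ∞ g x) (hβ : ContDiffAt ℝ ∞ β x) (h : ∀ᶠ y in 𝓝 x, 𝒯.IsGauge a a' g β y)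
    (v w : E) :
    𝒯.mul (fderiv ℝ g x v) (a' x ![w]) + 𝒯.mul (g x) (fderiv ℝ a' x v ![w]) =
      fderiv ℝ (fderiv ℝ g) x v w +
        (𝒯.mul (fderiv ℝ a x v ![w]) (g x) + 𝒯.mul (a x ![w]) (fderiv ℝ g x v)) -
        (𝒯.smulA (fderiv ℝ β x v ![w]) (g x) + 𝒯.smulA (β x ![w]) (fderiv ℝ g x v)) := by
  have hev : (fun y => 𝒯.mul (g y) (a' y ![w])) =ᶠ[𝓝 x] fun y =>
      fderiv ℝ g y w + 𝒯.mul (a y ![w]) (g y) - 𝒯.smulA (β y ![w]) (g y) := by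
    filter_upwards [h] with y hy
    exact hy ![w]
  have hd := congrArg (fun L => L v) (hev.fderiv_eq (𝕜 := ℝ))
  have hg1 : DifferentiableAt ℝ (fun y => fderiv ℝ g y w) x :=
    ((hg.fderiv_right (m := ∞) (by simp)).differentiableAt').clm_apply (by fun_prop)
  have e1 := fderiv_mul_apply 𝒯.mul hg.differentiableAt'
    (differentiableAt_apply ha'.differentiableAt' ![w]) v
  have e2 := fderiv_mul_apply 𝒯.mul
    (differentiableAt_apply ha.differentiableAt' ![w]) hg.differentiableAt' v
  have e3 := fderiv_mul_apply 𝒯.smulA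
    (differentiableAt_apply hβ.differentiableAt' ![w]) hg.differentiableAt' v
  have d2 : DifferentiableAt ℝ (fun y => 𝒯.mul (a y ![w]) (g y)) x :=
    (𝒯.mul.hasFDerivAt_of_bilinear (differentiableAt_apply ha.differentiableAt' ![w]).hasFDerivAt
      hg.differentiableAt'.hasFDerivAt).differentiableAt
  have d3 : DifferentiableAt ℝ (fun y => 𝒯.smulA (β y ![w]) (g y)) x :=
    (𝒯.smulA.hasFDerivAt_of_bilinear (differentiableAt_apply hβ.differentiableAt' ![w]).hasFDerivAt
      hg.differentiableAt'.hasFDerivAt).differentiableAt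
  have e0 : fderiv ℝ (fun y => fderiv ℝ g y w) x v = fderiv ℝ (fderiv ℝ g) x v w := by
    rw [fderiv_clm_apply ((hg.fderiv_right (m := ∞) (by simp)).differentiableAt') (by fun_prop)]
    simp
  rw [fderiv_fun_sub (hg1.fun_add d2) d3, fderiv_fun_add hg1 d2] at hd
  simp only [sub_apply, add_apply, e1, e2, e3, e0, fderiv_apply ha.differentiableAt',
    fderiv_apply ha'.differentiableAt', fderiv_apply hβ.differentiableAt'] at hd
  exact hd

/-- The transformation law of the curvature. -/
theorem isGauge_curv (ha : ContDiffAt ℝ ∞ a x) (ha' : ContDiffAt ℝ ∞ a' x)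
    (hg : ContDiffAt ℝ ∞ g x) (hβ : ContDiffAt ℝ ∞ β x) (h : ∀ᶠ y in 𝓝 x, 𝒯.IsGauge a a' g β y)
    (v : Fin 2 → E) :
    𝒯.mul (g x) (𝒯.curv a' x v) =
      𝒯.mul (𝒯.curv a x v) (g x) - 𝒯.smulA (extDeriv β x v) (g x) := by
  have h₀₁ := isGauge_fderiv 𝒯 ha ha' hg hβ h (v 0) (v 1)
  have h₁₀ := isGauge_fderiv 𝒯 ha ha' hg hβ h (v 1) (v 0)
  have hsymm : fderiv ℝ (fderiv ℝ g) x (v 1) (v 0) = fderiv ℝ (fderiv ℝ g) x (v 0) (v 1) :=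
    (hg.isSymmSndFDerivAt (by
      rw [minSmoothness_of_isRCLikeNormedField]; exact WithTop.coe_le_coe.2 le_top)).eq _ _
  rw [hsymm] at h₁₀
  have h₀ := h.self_of_nhds ![v 0]
  have h₁ := h.self_of_nhds ![v 1]
  have hcomm : ∀ (c : ℂ) (b : A), 𝒯.mul (𝒯.scal c) b = 𝒯.mul b (𝒯.scal c) := fun c b => by
    rw [𝒯.scal_mul, 𝒯.mul_scal]
  simp only [← 𝒯.scal_mul] at h₀₁ h₁₀ h₀ h₁
  let _ := 𝒯.ring
  have key := gauge_curvature_identity (R := A) h₀ h₁ h₀₁ h₁₀ (hcomm _ _) (hcomm _ _) (hcomm _ _)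
  simp only [TraceAlgebra.curv, ContinuousAlternatingMap.add_apply, wedge_one_one, extDeriv_one,
    ← 𝒯.scal_mul, map_sub 𝒯.scal]
  exact key

theorem mul_incl_diffT (hψ : 𝒯.mul (𝒯.one + 𝒯.incl (t x)) (ψ x) = 𝒯.one) (v : Fin 1 → E) :
    𝒯.mul (𝒯.one + 𝒯.incl (t x)) (𝒯.incl (𝒯.diffT a t ψ x v)) =
      𝒯.incl (fderiv ℝ t x (v 0)) + 𝒯.mul (a x v) (𝒯.incl (t x)) - 𝒯.mul (𝒯.incl (t x)) (a x v) := by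
  change 𝒯.mul _ (𝒯.incl (𝒯.lm (ψ x) (fderiv ℝ t x (v 0) + 𝒯.lm (a x v) (t x) - 𝒯.rm (t x) (a x v)))) = _
  rw [𝒯.incl_lm, ← 𝒯.mul_assoc, hψ, 𝒯.one_mul, map_sub, map_add, 𝒯.incl_lm, 𝒯.incl_rm]

theorem contDiffAt_diffT (ha : ContDiffAt ℝ ∞ a x) (ht : ContDiffAt ℝ ∞ t x)
    (hψ : ContDiffAt ℝ ∞ ψ x) : ContDiffAt ℝ ∞ (𝒯.diffT a t ψ) x := by
  have h0 : ContDiff ℝ ∞ (ContinuousAlternatingMap.ofSubsingletonLIE (𝕜 := ℝ) (E := E) (F := T) (0 : Fin 1)) :=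
    LinearIsometryEquiv.contDiff _
  have h1 : ContDiff ℝ ∞ 𝒯.lm := 𝒯.lm.contDiff
  have h2 : ContDiff ℝ ∞ 𝒯.rm := 𝒯.rm.contDiff
  have h3 : ContDiff ℝ ∞ 𝒯.lm.flip := 𝒯.lm.flip.contDiff
  exact ContDiffAt.compAlternating (h1.contDiffAt.comp x hψ)
    (((h0.contDiffAt.comp x (ht.fderiv_right (m := ∞) (by simp))).add
      (ContDiffAt.compAlternating (h3.contDiffAt.comp x ht) ha)).sub
      (ContDiffAt.compAlternating (h2.contDiffAt.comp x ht) ha))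

theorem mul_incl_diffT_of_isGauge (hx : 𝒯.IsGauge a a' g β x) (hg : ContDiffAt ℝ ∞ g x)
    (ht : ContDiffAt ℝ ∞ t x) (ht' : ContDiffAt ℝ ∞ t' x)
    (htg : ∀ᶠ y in 𝓝 x, 𝒯.mul (g y) (𝒯.incl (t' y)) = 𝒯.mul (𝒯.incl (t y)) (g y))
    (hψ : 𝒯.mul (𝒯.one + 𝒯.incl (t x)) (ψ x) = 𝒯.one)
    (hψl : 𝒯.mul (ψ x) (𝒯.one + 𝒯.incl (t x)) = 𝒯.one)
    (hψ' : 𝒯.mul (𝒯.one + 𝒯.incl (t' x)) (ψ' x) = 𝒯.one) (v : Fin 1 → E) :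
    𝒯.mul (g x) (𝒯.incl (𝒯.diffT a' t' ψ' x v)) = 𝒯.mul (𝒯.incl (𝒯.diffT a t ψ x v)) (g x) := by
  have hd := congrArg (fun L => L (v 0)) (Filter.EventuallyEq.fderiv_eq (𝕜 := ℝ)
    (f := fun y => 𝒯.mul (𝒯.incl (t y)) (g y)) (f₁ := fun y => 𝒯.mul (g y) (𝒯.incl (t' y))) htg)
  have hi : DifferentiableAt ℝ (fun y => 𝒯.incl (t y)) x :=
    𝒯.incl.differentiableAt.comp x ht.differentiableAt'
  have hi' : DifferentiableAt ℝ (fun y => 𝒯.incl (t' y)) x :=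
    𝒯.incl.differentiableAt.comp x ht'.differentiableAt'
  have ei : fderiv ℝ (fun y => 𝒯.incl (t y)) x (v 0) = 𝒯.incl (fderiv ℝ t x (v 0)) :=
    congrArg (fun L => L (v 0)) (𝒯.incl.hasFDerivAt.comp x ht.differentiableAt'.hasFDerivAt).fderiv
  have ei' : fderiv ℝ (fun y => 𝒯.incl (t' y)) x (v 0) = 𝒯.incl (fderiv ℝ t' x (v 0)) :=
    congrArg (fun L => L (v 0)) (𝒯.incl.hasFDerivAt.comp x ht'.differentiableAt'.hasFDerivAt).fderiv
  simp only [fderiv_mul_apply 𝒯.mul hg.differentiableAt' hi',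
    fderiv_mul_apply 𝒯.mul hi hg.differentiableAt', ei, ei'] at hd
  have hv := hx v
  rw [← 𝒯.scal_mul] at hv
  let _ := 𝒯.ring
  exact gauge_diff_identity (R := A) hψl htg.self_of_nhds hd (𝒯.mul_incl_diffT hψ v)
    (𝒯.mul_incl_diffT hψ' v) hv (by
      change 𝒯.mul _ _ = 𝒯.mul _ _
      rw [𝒯.scal_mul, 𝒯.mul_scal])

theorem isGauge_pathForm {δ δ' : E → E [⋀^Fin 1]→L[ℝ] T} (hx : 𝒯.IsGauge a a' g β x)
    (hδ : ∀ v, 𝒯.mul (g x) (𝒯.incl (δ' x v)) = 𝒯.mul (𝒯.incl (δ x v)) (g x)) (s : ℝ) :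
    𝒯.IsGauge (𝒯.pathForm a δ s) (𝒯.pathForm a' δ' s) g β x := fun v => by
  change 𝒯.mul (g x) (a' x v + s • 𝒯.incl (δ' x v)) = fderiv ℝ g x (v 0) +
    𝒯.mul (a x v + s • 𝒯.incl (δ x v)) (g x) - 𝒯.smulA (β x v) (g x)
  rw [map_add, map_smul, hδ, hx v, map_add, map_smul, add_apply, smul_apply]
  abel

/-- The end point of the path `a + s δ` is the transform of `a` by `φ = 1 + t`. -/
theorem isGauge_diffT (ht : ContDiffAt ℝ ∞ t x)
    (hψ : 𝒯.mul (𝒯.one + 𝒯.incl (t x)) (ψ x) = 𝒯.one) :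
    𝒯.IsGauge a (𝒯.pathForm a (𝒯.diffT a t ψ) 1) (fun y => 𝒯.one + 𝒯.incl (t y)) 0 x := fun v => by
  have e : fderiv ℝ (fun y => 𝒯.one + 𝒯.incl (t y)) x (v 0) = 𝒯.incl (fderiv ℝ t x (v 0)) := by
    rw [fderiv_const_add]
    exact congrArg (fun L => L (v 0))
      (𝒯.incl.hasFDerivAt.comp x ht.differentiableAt'.hasFDerivAt).fderiv
  change 𝒯.mul (𝒯.one + 𝒯.incl (t x)) (a x v + (1 : ℝ) • 𝒯.incl (𝒯.diffT a t ψ x v)) = _ +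
    𝒯.mul (a x v) (𝒯.one + 𝒯.incl (t x)) - 𝒯.smulA (0 : ℂ) _
  rw [e, one_smul, map_add, mul_incl_diffT 𝒯 hψ, map_add 𝒯.mul, add_apply, 𝒯.one_mul,
    map_add (𝒯.mul (a x v)), 𝒯.mul_one, map_zero]
  simp only [zero_apply]
  abel

theorem curv_pathForm_one (ha : ContDiffAt ℝ ∞ a x) (ht : ∀ᶠ y in 𝓝 x, ContDiffAt ℝ ∞ t y)
    (hψd : ContDiffAt ℝ ∞ ψ x)
    (hψ : ∀ᶠ y in 𝓝 x, 𝒯.mul (𝒯.one + 𝒯.incl (t y)) (ψ y) = 𝒯.one)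
    (hψl : 𝒯.mul (ψ x) (𝒯.one + 𝒯.incl (t x)) = 𝒯.one) :
    𝒯.curv (𝒯.pathForm a (𝒯.diffT a t ψ) 1) x =
      (𝒯.mul (ψ x) ∘L 𝒯.mul.flip (𝒯.one + 𝒯.incl (t x))).compContinuousAlternatingMap
        (𝒯.curv a x) := by
  have ht' := ht.self_of_nhds
  have hδ := 𝒯.contDiffAt_diffT ha ht' hψd
  have hi : ContDiff ℝ ∞ 𝒯.incl := 𝒯.incl.contDiff
  ext1 v
  have h1 := isGauge_curv 𝒯 (β := 0) ha (𝒯.contDiffAt_pathForm ha hδ 1)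
    (contDiffAt_const.add (hi.contDiffAt.comp x ht')) contDiffAt_const
    (by filter_upwards [ht, hψ] with y hy hy'; exact 𝒯.isGauge_diffT hy hy') v
  have h0 : extDeriv (0 : E → E [⋀^Fin 1]→L[ℝ] ℂ) x v = 0 := by
    rw [extDeriv_one, fderiv_zero]; simp
  rw [h0, map_zero, zero_apply, sub_zero] at h1
  have h2 := congrArg (𝒯.mul (ψ x)) h1
  rw [← 𝒯.mul_assoc] at h2
  rw [show 𝒯.mul (ψ x) (𝒯.one + (𝒯.incl ∘ t) x) = 𝒯.one from hψl, 𝒯.one_mul] at h2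
  exact h2

/-- Conjugation on the ideal. -/
def conjT (h g : A) : T →L[ℝ] T := 𝒯.lm h ∘L 𝒯.rm.flip g

theorem tr_comp_wedge_conj {h g : A} (h1 : 𝒯.mul h g = 𝒯.one) (h2 : 𝒯.mul g h = 𝒯.one)
    (δ : E [⋀^Fin 1]→L[ℝ] T) (G : E [⋀^Fin 2]→L[ℝ] A) (k : ℕ) (hn : 1 + 2 * k = n) :
    𝒯.tr.compContinuousAlternatingMap (wedge 𝒯.rm hn ((𝒯.conjT h g).compContinuousAlternatingMap δ)
      (𝒯.altPow ((𝒯.mul h ∘L 𝒯.mul.flip g).compContinuousAlternatingMap G) k)) =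
    𝒯.tr.compContinuousAlternatingMap (wedge 𝒯.rm hn δ (𝒯.altPow G k)) := by
  have hS : ∀ a b, (𝒯.mul h ∘L 𝒯.mul.flip g) (𝒯.mul a b) =
      𝒯.mul ((𝒯.mul h ∘L 𝒯.mul.flip g) a) ((𝒯.mul h ∘L 𝒯.mul.flip g) b) := fun a b => by
    change 𝒯.mul h (𝒯.mul (𝒯.mul a b) g) = 𝒯.mul (𝒯.mul h (𝒯.mul a g)) (𝒯.mul h (𝒯.mul b g))
    simp only [𝒯.mul_assoc]
    rw [← 𝒯.mul_assoc g h, h2, 𝒯.one_mul]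
  have hone : (𝒯.mul h ∘L 𝒯.mul.flip g) 𝒯.one = 𝒯.one := by
    change 𝒯.mul h (𝒯.mul 𝒯.one g) = _
    rw [𝒯.one_mul, h1]
  rw [𝒯.altPow_comp _ hone hS, ← comp_wedge_eq (B := 𝒯.rm) hn (𝒯.conjT h g)
    (𝒯.mul h ∘L 𝒯.mul.flip g) (𝒯.conjT h g)]
  · ext v
    change 𝒯.tr (𝒯.lm h (𝒯.rm _ g)) = 𝒯.tr _
    rw [𝒯.tr_lm]
    congr 1
    apply 𝒯.incl_injective
    rw [𝒯.incl_rm, 𝒯.incl_rm, 𝒯.mul_assoc, h2, 𝒯.mul_one]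
  · intro t b
    change 𝒯.lm h (𝒯.rm (𝒯.rm t b) g) = 𝒯.rm (𝒯.lm h (𝒯.rm t g)) (𝒯.mul h (𝒯.mul b g))
    apply 𝒯.incl_injective
    simp only [𝒯.incl_rm, 𝒯.incl_lm, 𝒯.mul_assoc]
    rw [← 𝒯.mul_assoc g h, h2, 𝒯.one_mul]

/-- The Chern form does not change under a gauge transformation. -/
theorem chForm_eq_of_isGauge {δ δ' : E → E [⋀^Fin 1]→L[ℝ] T} (ha : ContDiffAt ℝ ∞ a x)
    (ha' : ContDiffAt ℝ ∞ a' x) (hδd : ContDiffAt ℝ ∞ δ x) (hδd' : ContDiffAt ℝ ∞ δ' x)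
    (hg : ContDiffAt ℝ ∞ g x) (hβ : ContDiffAt ℝ ∞ β x)
    (h : ∀ᶠ y in 𝓝 x, 𝒯.IsGauge a a' g β y)
    (hδ : ∀ᶠ y in 𝓝 x, ∀ v, 𝒯.mul (g y) (𝒯.incl (δ' y v)) = 𝒯.mul (𝒯.incl (δ y v)) (g y))
    {h₀ : A} (h1 : 𝒯.mul h₀ (g x) = 𝒯.one) (h2 : 𝒯.mul (g x) h₀ = 𝒯.one)
    (hf : f' x = f x + extDeriv β x) (k : ℕ) :
    𝒯.chForm a' δ' f' k x = 𝒯.chForm a δ f k x := by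
  unfold chForm chDensity
  congr 1
  funext s
  have hcurv : 𝒯.curv (𝒯.pathForm a' δ' s) x + 𝒯.scalarAlt (f' x) =
      (𝒯.mul h₀ ∘L 𝒯.mul.flip (g x)).compContinuousAlternatingMap
        (𝒯.curv (𝒯.pathForm a δ s) x + 𝒯.scalarAlt (f x)) := by
    rw [compAlternating_add, conj_scalarAlt 𝒯 h1]
    ext1 v
    have h3 := isGauge_curv 𝒯 (𝒯.contDiffAt_pathForm ha hδd s) (𝒯.contDiffAt_pathForm ha' hδd' s)
      hg hβ (by filter_upwards [h, hδ] with y hy hy'; exact isGauge_pathForm 𝒯 hy hy' s) v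
    have h4 := congrArg (𝒯.mul h₀) h3
    rw [← 𝒯.mul_assoc, h1, 𝒯.one_mul, map_sub, ← 𝒯.mul_scal,
      ← 𝒯.mul_assoc h₀ (g x) (𝒯.scal _), h1, 𝒯.one_mul] at h4
    change 𝒯.curv (𝒯.pathForm a' δ' s) x v + 𝒯.scal (f' x v) =
      𝒯.mul h₀ (𝒯.mul (𝒯.curv (𝒯.pathForm a δ s) x v) (g x)) + 𝒯.scal (f x v)
    rw [h4, hf, ContinuousAlternatingMap.add_apply, map_add]
    abel
  have hδx : δ' x = (𝒯.conjT h₀ (g x)).compContinuousAlternatingMap (δ x) := by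
    ext1 v
    apply 𝒯.incl_injective
    change _ = 𝒯.incl (𝒯.lm h₀ (𝒯.rm (δ x v) (g x)))
    rw [𝒯.incl_lm, 𝒯.incl_rm, ← hδ.self_of_nhds v, ← 𝒯.mul_assoc, h1, 𝒯.one_mul]
  rw [hcurv, hδx, tr_comp_wedge_conj 𝒯 h1 h2]

end TraceAlgebra

end

section

section HomotopyFormula

universe u

variable {E : Type u} [NormedAddCommGroup E] [NormedSpace ℝ E] {n : ℕ} {O : Set E}

theorem two_le_infty : minSmoothness ℝ 2 ≤ (∞ : WithTop ℕ∞) := by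
  rw [minSmoothness_of_isRCLikeNormedField]; exact WithTop.coe_le_coe.2 le_top

theorem extDeriv_pb {E' V : Type*} [NormedAddCommGroup E'] [NormedSpace ℝ E']
    [NormedAddCommGroup V] [NormedSpace ℝ V] {θ : E → E [⋀^Fin n]→L[ℝ] V} {κ : E' → E} {x : E'}
    (hθ : DifferentiableAt ℝ θ (κ x)) (hκ : ContDiffAt ℝ ∞ κ x) :
    extDeriv (fun y => (θ (κ y)).compContinuousLinearMap (fderiv ℝ κ y)) x =
      (extDeriv θ (κ x)).compContinuousLinearMap (fderiv ℝ κ x) :=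
  extDeriv_pullback hθ hκ two_le_infty

theorem iota_extDeriv {F : Type*} [NormedAddCommGroup F] [NormedSpace ℝ F]
    {w : E → E [⋀^Fin (n + 1)]→L[ℝ] F} {z : E} (hw : DifferentiableAt ℝ w z) (e : E) :
    extDeriv (fun y => iotaL e (w y)) z = fderiv ℝ w z e - (extDeriv w z).curryLeft e := by
  have h1 : fderiv ℝ (fun y => iotaL e (w y)) z = iotaL e ∘L fderiv ℝ w z :=
    ((iotaL (n := n) (F := F) e).hasFDerivAt.comp z hw.hasFDerivAt).fderiv
  rw [extDeriv, h1, extDeriv, curryLeft_alternatizeUncurryFin]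
  abel

/-- The operator `ι_{∂/∂r}`, followed by restriction to the slice. -/
def sliceIota : ((E × ℝ) [⋀^Fin (n + 1)]→L[ℝ] ℂ) →L[ℝ] (E [⋀^Fin n]→L[ℝ] ℂ) :=
  ContinuousAlternatingMap.compContinuousLinearMapCLM (ContinuousLinearMap.inl ℝ E ℝ) ∘L
    iotaL ((0 : E), (1 : ℝ))

theorem sliceIota_apply (w : (E × ℝ) [⋀^Fin (n + 1)]→L[ℝ] ℂ) :
    sliceIota w = (w.curryLeft ((0 : E), (1 : ℝ))).compContinuousLinearMap
      (ContinuousLinearMap.inl ℝ E ℝ) := rfl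

/-- Fibre integration of forms on `E × [0, 1]`. -/
def fiberInt (w : E × ℝ → (E × ℝ) [⋀^Fin (n + 1)]→L[ℝ] ℂ) (x : E) : E [⋀^Fin n]→L[ℝ] ℂ :=
  ∫ r in (0 : ℝ)..1, sliceIota (w (x, r))

variable {w : E × ℝ → (E × ℝ) [⋀^Fin (n + 1)]→L[ℝ] ℂ}

theorem contDiffAt_sliceIota {z : E × ℝ} (hw : ContDiffAt ℝ ∞ w z) :
    ContDiffAt ℝ ∞ (fun y => sliceIota (w y)) z := by
  have h : ContDiff ℝ ∞ (sliceIota (E := E) (n := n)) := ContinuousLinearMap.contDiff _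
  exact h.contDiffAt.comp z hw

theorem contDiffOn_fiberInt (hO : IsOpen O) (hw : ∀ x ∈ O, ∀ r, ContDiffAt ℝ ∞ w (x, r)) :
    ContDiffOn ℝ ∞ (fiberInt w) O :=
  contDiffOn_integral_of_contDiffAt hO fun x hx s => contDiffAt_sliceIota (hw x hx s)

/-- The homotopy formula. -/
theorem extDeriv_fiberInt (hO : IsOpen O) (hw : ∀ x ∈ O, ∀ r, ContDiffAt ℝ ∞ w (x, r)) {x : E}
    (hx : x ∈ O) :
    extDeriv (fiberInt w) x = (w (x, 1)).compContinuousLinearMap (ContinuousLinearMap.inl ℝ E ℝ) -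
      (w (x, 0)).compContinuousLinearMap (ContinuousLinearMap.inl ℝ E ℝ) -
      fiberInt (extDeriv w) x := by
  have h1 := extDeriv_integral (F := fun y s => sliceIota (w (y, s))) hO
    (fun x hx s => contDiffAt_sliceIota (hw x hx s)) hx
  let J : ((E × ℝ) [⋀^Fin (n + 1)]→L[ℝ] ℂ) →L[ℝ] (E [⋀^Fin (n + 1)]→L[ℝ] ℂ) :=
    ContinuousAlternatingMap.compContinuousLinearMapCLM (ContinuousLinearMap.inl ℝ E ℝ)
  have h2 : ∀ r : ℝ, extDeriv (fun y => sliceIota (w (y, r))) x =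
      J (fderiv ℝ w (x, r) (0, 1)) - sliceIota (extDeriv w (x, r)) := fun r => by
    have hw' := (hw x hx r)
    have h3 : ContDiffAt ℝ ∞ (fun y : E => (y, r)) x := by fun_prop
    have hi : ContDiff ℝ ∞ (iotaL (n := n) (F := ℂ) ((0 : E), (1 : ℝ))) :=
      ContinuousLinearMap.contDiff _
    have h4 := extDeriv_pb (θ := fun z => iotaL ((0 : E), (1 : ℝ)) (w z))
      (κ := fun y : E => (y, r)) (x := x) ((hi.contDiffAt.comp (x, r) hw').differentiableAt') h3
    have h5 : ∀ y : E, fderiv ℝ (fun y : E => (y, r)) y = ContinuousLinearMap.inl ℝ E ℝ := fun y =>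
      (hasFDerivAt_prodMk_left y r).fderiv
    simp only [h5] at h4
    rw [iota_extDeriv hw'.differentiableAt'] at h4
    exact h4
  have h6 : ∀ r : ℝ, HasDerivAt (fun r => J (w (x, r))) (J (fderiv ℝ w (x, r) (0, 1))) r :=
    fun r => by
    have h7 : HasDerivAt (fun r : ℝ => (x, r)) ((0 : E), (1 : ℝ)) r :=
      (hasDerivAt_const r x).prodMk (hasDerivAt_id r)
    exact J.hasFDerivAt.comp_hasDerivAt r
      (HasFDerivAt.comp_hasDerivAt r (hw x hx r).differentiableAt'.hasFDerivAt h7)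
  have hline : Continuous fun r : ℝ => (x, r) := by fun_prop
  have hc1 : Continuous fun r : ℝ => J (fderiv ℝ w (x, r) (0, 1)) := by
    refine J.continuous.comp (continuous_iff_continuousAt.2 fun r => ?_)
    have h8 : ContDiffAt ℝ ∞ (fun z => fderiv ℝ w z (0, 1)) (x, r) :=
      ((hw x hx r).fderiv_right (m := ∞) (by simp)).clm_apply contDiffAt_const
    exact h8.continuousAt.comp hline.continuousAt
  have hc2 : Continuous fun r : ℝ => sliceIota (extDeriv w (x, r)) := by
    refine continuous_iff_continuousAt.2 fun r => ?_
    have h8 := contDiffAt_sliceIota (ContDiffAt.extDeriv (hw x hx r))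
    exact h8.continuousAt.comp hline.continuousAt
  have h9 := intervalIntegral.integral_eq_sub_of_hasDerivAt (a := 0) (b := 1) (fun r _ => h6 r)
    (hc1.intervalIntegrable 0 1)
  refine h1.trans ?_
  simp only [h2]
  rw [intervalIntegral.integral_sub (hc1.intervalIntegrable 0 1) (hc2.intervalIntegrable 0 1), h9]
  rfl

theorem continuous_sliceIota (hw : ∀ x ∈ O, ∀ r, ContDiffAt ℝ ∞ w (x, r)) {x : E} (hx : x ∈ O) :
    Continuous fun r : ℝ => sliceIota (w (x, r)) :=
  continuous_iff_continuousAt.2 fun r => (contDiffAt_sliceIota (hw x hx r)).continuousAt.comp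
    (f := fun r : ℝ => (x, r)) (by fun_prop)

/-- Fibre integration of a product with a form that has no component along the fibre. -/
theorem fiberInt_wedge {v : E × ℝ → (E × ℝ) [⋀^Fin (n + 4)]→L[ℝ] ℂ}
    (hw : ∀ x ∈ O, ∀ r, ContDiffAt ℝ ∞ w (x, r)) {x : E} (hx : x ∈ O)
    (β : E [⋀^Fin 3]→L[ℝ] ℂ) (h : 3 + (n + 1) = n + 4) (h' : 3 + n = n + 3)
    (hv : ∀ r, v (x, r) = wedge (ContinuousLinearMap.mul ℝ ℂ) h
      (β.compContinuousLinearMap (ContinuousLinearMap.fst ℝ E ℝ)) (w (x, r))) :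
    fiberInt v x = -wedge (ContinuousLinearMap.mul ℝ ℂ) h' β (fiberInt w x) := by
  have h1 : ∀ r, sliceIota (v (x, r)) =
      -wedgeL (ContinuousLinearMap.mul ℝ ℂ) h' β (sliceIota (w (x, r))) := fun r => by
    have e : (β.compContinuousLinearMap (ContinuousLinearMap.fst ℝ E ℝ)).curryLeft
        ((0 : E), (1 : ℝ)) = 0 := by
      ext u
      rw [ContinuousAlternatingMap.curryLeft_apply_apply,
        ContinuousAlternatingMap.compContinuousLinearMap_apply]
      exact β.map_coord_zero (i := 0) rfl
    rw [hv, sliceIota_apply, curryLeft_wedge (p := 2) (q := n) _ h (by omega) (by omega), e,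
      wedge_zero_left', zero_add]
    have e2 : (β.compContinuousLinearMap (ContinuousLinearMap.fst ℝ E ℝ)).compContinuousLinearMap
        (ContinuousLinearMap.inl ℝ E ℝ) = β := by ext; rfl
    ext u
    have e3 := congrArg (fun θ => θ u) (wedge_compContinuousLinearMap (ContinuousLinearMap.mul ℝ ℂ) h'
      (β.compContinuousLinearMap (ContinuousLinearMap.fst ℝ E ℝ))
      ((w (x, r)).curryLeft ((0 : E), (1 : ℝ))) (ContinuousLinearMap.inl ℝ E ℝ))
    rw [e2] at e3
    simp only [ContinuousAlternatingMap.compContinuousLinearMap_apply] at e3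
    simp only [ContinuousAlternatingMap.compContinuousLinearMap_apply,
      ContinuousAlternatingMap.smul_apply, e3, ContinuousAlternatingMap.neg_apply, wedgeL_apply,
      sliceIota_apply]
    norm_num
  unfold fiberInt
  simp only [h1]
  rw [intervalIntegral.integral_neg, ContinuousLinearMap.intervalIntegral_comp_comm _
    ((continuous_sliceIota hw hx).intervalIntegrable 0 1), wedgeL_apply]

end HomotopyFormula

namespace TraceAlgebra

variable {A T : Type*} [NormedAddCommGroup A] [NormedSpace ℝ A] [NormedAddCommGroup T]
  [NormedSpace ℝ T] (𝒯 : TraceAlgebra A T)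
variable {E E' : Type*} [NormedAddCommGroup E] [NormedSpace ℝ E] [NormedAddCommGroup E']
  [NormedSpace ℝ E'] {n : ℕ}

def pb {V : Type*} [NormedAddCommGroup V] [NormedSpace ℝ V] (κ : E' → E)
    (θ : E → E [⋀^Fin n]→L[ℝ] V) (x : E') : E' [⋀^Fin n]→L[ℝ] V :=
  (θ (κ x)).compContinuousLinearMap (fderiv ℝ κ x)

variable {κ : E' → E} {x : E'} {a : E → E [⋀^Fin 1]→L[ℝ] A} {δ : E → E [⋀^Fin 1]→L[ℝ] T}
  {f : E → E [⋀^Fin 2]→L[ℝ] ℂ}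

theorem pathForm_pb (s : ℝ) :
    𝒯.pathForm (pb κ a) (pb κ δ) s = pb κ (𝒯.pathForm a δ s) := by
  funext y; ext v; rfl

theorem curv_pb (hκ : ContDiffAt ℝ ∞ κ x) (ha : ContDiffAt ℝ ∞ a (κ x)) :
    𝒯.curv (pb κ a) x = (𝒯.curv a (κ x)).compContinuousLinearMap (fderiv ℝ κ x) := by
  have h := extDeriv_pb (θ := a) ha.differentiableAt' hκ
  change extDeriv (fun y => (a (κ y)).compContinuousLinearMap (fderiv ℝ κ y)) x + _ = _
  rw [h, pb, ← wedge_compContinuousLinearMap]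
  rfl

theorem chDensity_pb (hκ : ContDiffAt ℝ ∞ κ x) (ha : ContDiffAt ℝ ∞ a (κ x))
    (hδ : ContDiffAt ℝ ∞ δ (κ x)) (k : ℕ) (s : ℝ) :
    𝒯.chDensity (pb κ a) (pb κ δ) (pb κ f) k x s =
      (𝒯.chDensity a δ f k (κ x) s).compContinuousLinearMap (fderiv ℝ κ x) := by
  have h1 : 𝒯.curv (𝒯.pathForm (pb κ a) (pb κ δ) s) x + 𝒯.scalarAlt (pb κ f x) =
      (𝒯.curv (𝒯.pathForm a δ s) (κ x) + 𝒯.scalarAlt (f (κ x))).compContinuousLinearMap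
        (fderiv ℝ κ x) := by
    rw [pathForm_pb, curv_pb 𝒯 hκ (𝒯.contDiffAt_pathForm ha hδ s)]
    rfl
  rw [chDensity, h1, ← altPow_compContinuousLinearMap]
  change _ • 𝒯.tr.compContinuousAlternatingMap (wedge 𝒯.rm _
    ((δ (κ x)).compContinuousLinearMap (fderiv ℝ κ x)) _) = _
  rw [← wedge_compContinuousLinearMap]
  rfl

theorem continuous_chDensity {x : E} (ha : ContDiffAt ℝ ∞ a x) (hδ : ContDiffAt ℝ ∞ δ x) (k : ℕ) :
    Continuous (𝒯.chDensity a δ f k x) := by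
  refine continuous_iff_continuousAt.2 fun s => ContDiffAt.continuousAt (𝕜 := ℝ) (n := ∞) ?_
  unfold chDensity
  simp only [𝒯.curv_pathForm ha hδ]
  refine ContDiffAt.fun_smul contDiffAt_const (ContDiffAt.compAlternating contDiffAt_const
    (ContDiffAt.wedge _ _ contDiffAt_const ((𝒯.contDiff_altPow k).contDiffAt.comp s
      ((contDiffAt_const.add (𝒯.contDiffAt_incl_comp (by fun_prop))).add contDiffAt_const))))

theorem chForm_pb (hκ : ContDiffAt ℝ ∞ κ x) (ha : ContDiffAt ℝ ∞ a (κ x))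
    (hδ : ContDiffAt ℝ ∞ δ (κ x)) (k : ℕ) :
    𝒯.chForm (pb κ a) (pb κ δ) (pb κ f) k x =
      (𝒯.chForm a δ f k (κ x)).compContinuousLinearMap (fderiv ℝ κ x) := by
  unfold chForm
  simp only [𝒯.chDensity_pb hκ ha hδ]
  exact (ContinuousAlternatingMap.compContinuousLinearMapCLM (𝕜 := ℝ) (ι := Fin (2 * k + 1)) (F := ℂ)
    (fderiv ℝ κ x)).intervalIntegral_comp_comm ((𝒯.continuous_chDensity ha hδ k).intervalIntegrable 0 1)

theorem chForm_apply {x : E} (ha : ContDiffAt ℝ ∞ a x) (hδ : ContDiffAt ℝ ∞ δ x) (k : ℕ)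
    (v : Fin (2 * k + 1) → E) :
    𝒯.chForm a δ f k x v = ∫ s in (0 : ℝ)..1, 𝒯.chDensity a δ f k x s v :=
  ((ContinuousAlternatingMap.apply ℝ E ℂ v).intervalIntegral_comp_comm
    ((𝒯.continuous_chDensity ha hδ k).intervalIntegrable 0 1)).symm

theorem diffT_pb {t : E → T} {ψ : E → A} (hκ : DifferentiableAt ℝ κ x)
    (ht : DifferentiableAt ℝ t (κ x)) :
    𝒯.diffT (pb κ a) (fun y => t (κ y)) (fun y => ψ (κ y)) x = pb κ (𝒯.diffT a t ψ) x := by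
  have h : fderiv ℝ (fun y => t (κ y)) x = fderiv ℝ t (κ x) ∘L fderiv ℝ κ x := fderiv_comp x ht hκ
  rw [diffT, h]
  rfl

/-- The Chern form depends only on the germs of the data. -/
theorem chForm_congr {x : E} {a a' : E → E [⋀^Fin 1]→L[ℝ] A} {δ δ' : E → E [⋀^Fin 1]→L[ℝ] T}
    {f f' : E → E [⋀^Fin 2]→L[ℝ] ℂ} (ha : a =ᶠ[𝓝 x] a') (hδ : δ =ᶠ[𝓝 x] δ') (hf : f x = f' x)
    (k : ℕ) : 𝒯.chForm a δ f k x = 𝒯.chForm a' δ' f' k x := by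
  unfold chForm chDensity
  congr 1
  funext s
  have h1 : 𝒯.pathForm a δ s =ᶠ[𝓝 x] 𝒯.pathForm a' δ' s := by
    filter_upwards [ha, hδ] with y h1 h2
    rw [pathForm, pathForm, h1, h2]
  have h2 : 𝒯.curv (𝒯.pathForm a δ s) x = 𝒯.curv (𝒯.pathForm a' δ' s) x := by
    rw [curv, curv, Filter.EventuallyEq.extDeriv_eq h1, h1.eq_of_nhds]
  rw [h2, hδ.eq_of_nhds, hf]

end TraceAlgebra

end

section

section AlternatingComp

variable {E E' F : Type*} [NormedAddCommGroup E] [NormedSpace ℝ E] [NormedAddCommGroup E']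
  [NormedSpace ℝ E'] [NormedAddCommGroup F] [NormedSpace ℝ F] {n : ℕ}

/-- The normalised alternatization, a projection onto the alternating maps. -/
def alternatizeL :
    (ContinuousMultilinearMap ℝ (fun _ : Fin n => E) F) →L[ℝ] (E [⋀^Fin n]→L[ℝ] F) :=
  LinearMap.mkContinuous
    { toFun := fun f => (n.factorial : ℝ)⁻¹ • ContinuousMultilinearMap.alternatization f
      map_add' := fun f g => by rw [map_add, smul_add]
      map_smul' := fun c f => by
        rw [RingHom.id_apply, smul_comm c]
        congr 1
        ext v
        simp [ContinuousMultilinearMap.alternatization_apply_apply, Finset.smul_sum, smul_comm c] }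
    1 fun f => by
      rw [one_mul]
      refine ContinuousAlternatingMap.opNorm_le_bound _ (norm_nonneg _) fun v => ?_
      change ‖(n.factorial : ℝ)⁻¹ • ContinuousMultilinearMap.alternatization f v‖ ≤ _
      rw [ContinuousMultilinearMap.alternatization_apply_apply, norm_smul,
        Real.norm_of_nonneg (by positivity), inv_mul_le_iff₀ (by positivity)]
      refine (norm_sum_le _ _).trans ?_
      have hb : ∀ σ : Equiv.Perm (Fin n), ‖Equiv.Perm.sign σ • f fun i => v (σ i)‖ ≤
          ‖f‖ * ∏ i, ‖v i‖ := fun σ => by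
        have h1 : ‖Equiv.Perm.sign σ • f fun i => v (σ i)‖ = ‖f fun i => v (σ i)‖ := by
          rcases Int.units_eq_one_or (Equiv.Perm.sign σ) with h | h <;> rw [h] <;> simp
        rw [h1]
        refine (f.le_opNorm _).trans_eq ?_
        rw [Equiv.prod_comp σ fun i => ‖v i‖]
      refine (Finset.sum_le_sum fun σ _ => hb σ).trans_eq ?_
      simp [Fintype.card_perm]

theorem alternatizeL_coe (η : E [⋀^Fin n]→L[ℝ] F) :
    alternatizeL η.toContinuousMultilinearMap = η := by
  ext v
  change (n.factorial : ℝ)⁻¹ • ContinuousMultilinearMap.alternatization η.toContinuousMultilinearMap v = η v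
  rw [ContinuousMultilinearMap.alternatization_apply_apply]
  have hb : ∀ σ : Equiv.Perm (Fin n), Equiv.Perm.sign σ • η.toContinuousMultilinearMap (v ∘ σ) =
      η v := fun σ => by
    have h1 : η.toContinuousMultilinearMap (v ∘ σ) = Equiv.Perm.sign σ • η v :=
      η.toAlternatingMap.map_perm v σ
    rw [h1, smul_smul, Int.units_mul_self, one_smul]
  rw [Finset.sum_congr rfl fun σ _ => hb σ]
  simp only [Finset.sum_const, Finset.card_univ, Fintype.card_perm, Fintype.card_fin]
  rw [← Nat.cast_smul_eq_nsmul ℝ, smul_smul, inv_mul_cancel₀ (by positivity), one_smul]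

theorem ContDiffAt.compLinear {X : Type*} [NormedAddCommGroup X] [NormedSpace ℝ X]
    {η : X → E [⋀^Fin n]→L[ℝ] F} {L : X → E' →L[ℝ] E} {x : X} (hη : ContDiffAt ℝ ∞ η x)
    (hL : ContDiffAt ℝ ∞ L x) :
    ContDiffAt ℝ ∞ (fun y => (η y).compContinuousLinearMap (L y)) x := by
  have h1 : ContDiff ℝ ∞ (ContinuousAlternatingMap.toContinuousMultilinearMapLI
      (𝕜 := ℝ) (E := E) (F := F) (ι := Fin n)) :=
    LinearIsometry.contDiff _
  have h2 := (ContinuousMultilinearMap.compContinuousLinearMapContinuousMultilinear ℝ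
    (fun _ : Fin n => E') (fun _ : Fin n => E) F).contDiff (n := ∞)
  have h3 : ContDiffAt ℝ ∞ (fun y => (fun _ : Fin n => L y)) x := contDiffAt_pi.2 fun _ => hL
  have h4 := (h2.contDiffAt.comp x h3).clm_apply (h1.contDiffAt.comp x hη)
  have h5 : ContDiff ℝ ∞ (alternatizeL (E := E') (F := F) (n := n)) :=
    ContinuousLinearMap.contDiff _
  refine (h5.contDiffAt.comp x h4).congr_of_eventuallyEq (Filter.Eventually.of_forall fun y => ?_)
  exact (alternatizeL_coe ((η y).compContinuousLinearMap (L y))).symm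

end AlternatingComp

section PullbackToVectorSpaces

variable {E B X : Type*} [NormedAddCommGroup E] [NormedSpace ℝ E] [TopologicalSpace B]
  {I : ModelWithCorners ℝ E B} [TopologicalSpace X] [ChartedSpace B X]
  {E' B' X' : Type*} [NormedAddCommGroup E'] [NormedSpace ℝ E'] [TopologicalSpace B']
  {I' : ModelWithCorners ℝ E' B'} [TopologicalSpace X'] [ChartedSpace B' X']
  {E'' B'' X'' : Type*} [NormedAddCommGroup E''] [NormedSpace ℝ E''] [TopologicalSpace B'']
  {I'' : ModelWithCorners ℝ E'' B''} [TopologicalSpace X''] [ChartedSpace B'' X'']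
  {V : Type*} [NormedAddCommGroup V] [NormedSpace ℝ V] {n : ℕ}
  {F : Type*} [NormedAddCommGroup F] [NormedSpace ℝ F]

theorem pullback_comp_apply {κ : X → X'} {g : X' → X''} {x : X} (θ : Form E'' X'' V n)
    (hg : MDifferentiableAt I' I'' g (κ x)) (hκ : MDifferentiableAt I I' κ x) :
    pullback I I'' (fun y => g (κ y)) θ x = pullback I I' κ (pullback I' I'' g θ) x := by
  have h : mfderiv I I'' (fun y => g (κ y)) x = mfderiv I' I'' g (κ x) ∘L mfderiv I I' κ x :=
    mfderiv_comp x hg hκ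
  rw [pullback, h]
  rfl

theorem pullback_congr {γ γ' : X → X'} {x : X} (h : γ =ᶠ[𝓝 x] γ') (θ : Form E' X' V n) :
    pullback I I' γ θ =ᶠ[𝓝 x] pullback I I' γ' θ := by
  filter_upwards [h.eventuallyEq_nhds] with y hy
  have h1 : mfderiv I I' γ y = mfderiv I I' γ' y := hy.mfderiv_eq
  have h2 := hy.eq_of_nhds
  unfold pullback
  rw [h1, h2]

theorem ContMDiffAt.mdifferentiableAt' {γ : X → X'} {x : X} (h : ContMDiffAt I I' ∞ γ x) :
    MDifferentiableAt I I' γ x := h.mdifferentiableAt (by simp)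

variable [IsManifold I ∞ X] [I.Boundaryless]

theorem contMDiffAt_extChartAt_symm {x₀ : X} {y : E} (hy : y ∈ (extChartAt I x₀).target) :
    ContMDiffAt 𝓘(ℝ, E) I ∞ (extChartAt I x₀).symm y :=
  (contMDiffOn_extChartAt_symm x₀).contMDiffAt ((isOpen_extChartAt_target x₀).mem_nhds hy)

theorem contMDiffAt_extChartAt_of_mem {x₀ x : X} (hx : x ∈ (extChartAt I x₀).source) :
    ContMDiffAt I 𝓘(ℝ, E) ∞ (extChartAt I x₀) x :=
  contMDiffAt_extChartAt' (by rwa [extChartAt_source] at hx)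

theorem pullback_eq_chartRep {γ : F → X} {x : F} {x₀ : X} (θ : Form E X V n)
    (hγ : ∀ᶠ y in 𝓝 x, ContMDiffAt 𝓘(ℝ, F) I ∞ γ y) (hx : γ x ∈ (extChartAt I x₀).source) :
    pullback 𝓘(ℝ, F) I γ θ =ᶠ[𝓝 x] fun y => (chartRep I θ x₀
      (extChartAt I x₀ (γ y))).compContinuousLinearMap
        (fderiv ℝ (fun z => extChartAt I x₀ (γ z)) y) := by
  have hsrc : ∀ᶠ y in 𝓝 x, γ y ∈ (extChartAt I x₀).source :=
    hγ.self_of_nhds.continuousAt ((isOpen_extChartAt_source x₀).mem_nhds hx)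
  filter_upwards [hγ, hsrc.eventually_nhds] with y hy hs
  have hsy := hs.self_of_nhds
  have hχ : MDifferentiableAt 𝓘(ℝ, F) 𝓘(ℝ, E) (fun z => extChartAt I x₀ (γ z)) y :=
    ((contMDiffAt_extChartAt_of_mem hsy).mdifferentiableAt').comp y (hy.mdifferentiableAt')
  have hsym := (contMDiffAt_extChartAt_symm (I := I)
    ((extChartAt I x₀).map_source hsy)).mdifferentiableAt'
  have hev : γ =ᶠ[𝓝 y] fun z => (extChartAt I x₀).symm (extChartAt I x₀ (γ z)) := by
    filter_upwards [hs] with z hz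
    exact ((extChartAt I x₀).left_inv hz).symm
  rw [(pullback_congr (I := 𝓘(ℝ, F)) (I' := I) hev θ).eq_of_nhds,
    pullback_comp_apply (I' := 𝓘(ℝ, E)) (g := (extChartAt I x₀).symm)
      (κ := fun z => extChartAt I x₀ (γ z)) θ hsym hχ, ← mfderiv_eq_fderiv]
  rfl

theorem contDiffAt_chartComp {γ : F → X} {x : F} {x₀ : X} (hγ : ContMDiffAt 𝓘(ℝ, F) I ∞ γ x)
    (hx : γ x ∈ (extChartAt I x₀).source) :
    ContDiffAt ℝ ∞ (fun z => extChartAt I x₀ (γ z)) x :=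
  contMDiffAt_iff_contDiffAt.1 ((contMDiffAt_extChartAt_of_mem hx).comp x hγ)

theorem IsSmoothOn.contDiffAt_chartRep {θ : Form E X V n} {s : Set X} (hθ : IsSmoothOn I θ s)
    (hs : IsOpen s) {x x₀ : X} (hx : x ∈ s) (hx₀ : x ∈ (extChartAt I x₀).source) :
    ContDiffAt ℝ ∞ (chartRep I θ x₀) (extChartAt I x₀ x) := by
  refine (hθ x₀).contDiffAt (Filter.inter_mem (extChartAt_target_mem_nhds' ((extChartAt I x₀).map_source hx₀)) ?_)
  have h := (contMDiffAt_extChartAt_symm (I := I)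
    ((extChartAt I x₀).map_source hx₀)).continuousAt
  exact h (by rw [(extChartAt I x₀).left_inv hx₀]; exact hs.mem_nhds hx)

theorem contDiffAt_pullback {θ : Form E X V n} {s : Set X} (hθ : IsSmoothOn I θ s)
    (hs : IsOpen s) {γ : F → X} {x : F} (hγ : ∀ᶠ y in 𝓝 x, ContMDiffAt 𝓘(ℝ, F) I ∞ γ y)
    (hx : γ x ∈ s) : ContDiffAt ℝ ∞ (pullback 𝓘(ℝ, F) I γ θ) x := by
  have h0 := mem_extChartAt_source (I := I) (γ x)
  have h1 := contDiffAt_chartComp hγ.self_of_nhds h0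
  refine ContDiffAt.congr_of_eventuallyEq ?_ (pullback_eq_chartRep θ hγ h0)
  exact ContDiffAt.compLinear
    (ContDiffAt.comp x (hθ.contDiffAt_chartRep hs hx h0) h1)
    (h1.fderiv_right (m := ∞) (by simp))

/-- The exterior derivative commutes with pullbacks. -/
theorem extDeriv_pullback_eq {θ : Form E X V n} {s : Set X} (hθ : IsSmoothOn I θ s)
    (hs : IsOpen s) {γ : F → X} {x : F} (hγ : ∀ᶠ y in 𝓝 x, ContMDiffAt 𝓘(ℝ, F) I ∞ γ y)
    (hx : γ x ∈ s) :
    extDeriv (pullback 𝓘(ℝ, F) I γ θ) x = pullback 𝓘(ℝ, F) I γ (extD I θ) x := by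
  have h0 := mem_extChartAt_source (I := I) (γ x)
  have h1 := contDiffAt_chartComp hγ.self_of_nhds h0
  have h2 := hθ.contDiffAt_chartRep hs hx h0
  rw [(pullback_eq_chartRep θ hγ h0).extDeriv_eq, extDeriv_pb (θ := chartRep I θ (γ x))
      (κ := fun z => extChartAt I (γ x) (γ z)) h2.differentiableAt' h1,
    ← mfderiv_eq_fderiv]
  have h3 : mfderiv 𝓘(ℝ, F) 𝓘(ℝ, E) (fun z => extChartAt I (γ x) (γ z)) x =
      mfderiv I 𝓘(ℝ, E) (extChartAt I (γ x)) (γ x) ∘L mfderiv 𝓘(ℝ, F) I γ x :=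
    mfderiv_comp x (contMDiffAt_extChartAt_of_mem h0).mdifferentiableAt'
      hγ.self_of_nhds.mdifferentiableAt'
  rw [h3]
  rfl

end PullbackToVectorSpaces

section OperatorTraceAlgebra

variable (H : Type*) [NormedAddCommGroup H] [InnerProductSpace ℂ H] [CompleteSpace H]

/-- A complex bilinear map, as a real bilinear map. -/
def realBilin {V W Z : Type*} [NormedAddCommGroup V] [NormedSpace ℂ V] [NormedSpace ℝ V]
    [IsScalarTower ℝ ℂ V] [NormedAddCommGroup W] [NormedSpace ℂ W] [NormedSpace ℝ W]
    [IsScalarTower ℝ ℂ W] [NormedAddCommGroup Z] [NormedSpace ℂ Z] [NormedSpace ℝ Z]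
    [IsScalarTower ℝ ℂ Z] (B : V →L[ℂ] W →L[ℂ] Z) : V →L[ℝ] W →L[ℝ] Z :=
  LinearMap.mkContinuous₂
    (LinearMap.mk₂ ℝ (fun v w => B v w) (fun v v' w => by simp) (fun c v w => by
        rw [← IsScalarTower.algebraMap_smul ℂ c v, map_smul, smul_apply,
          IsScalarTower.algebraMap_smul])
      (fun v w w' => by simp) (fun c v w => by
        rw [← IsScalarTower.algebraMap_smul ℂ c w, map_smul, IsScalarTower.algebraMap_smul]))
    ‖B‖ fun v w => B.le_opNorm₂ v w

/-- The bounded operators with the ideal of trace class operators. -/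
def opTA : TraceAlgebra (Op H) (TraceClass H) where
  mul := ContinuousLinearMap.mul ℝ (Op H)
  one := 1
  lm := realBilin TraceClass.lmul
  rm := realBilin TraceClass.rmul
  incl := TraceClass.toOpL.restrictScalars ℝ
  tr := TraceClass.trL.restrictScalars ℝ
  scal := (ContinuousLinearMap.toSpanSingleton ℂ (1 : Op H)).restrictScalars ℝ
  smulA := realBilin (ContinuousLinearMap.lsmul ℂ ℂ)
  smulT := realBilin (ContinuousLinearMap.lsmul ℂ ℂ)
  mul_assoc := mul_assoc
  one_mul := one_mul
  mul_one := mul_one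
  incl_injective := TraceClass.toOp_injective
  incl_lm _ _ := rfl
  incl_rm _ _ := rfl
  tr_lm := TraceClass.trL_lmul
  scal_mul c a := smul_one_mul c a
  mul_scal a c := mul_smul_one c a
  incl_smulT _ _ := rfl
  tr_smulT c t := TraceClass.trL.map_smul c t

end OperatorTraceAlgebra

end

section

section UnitaryCoe

variable {A : Type*} [CStarAlgebra A]

theorem contDiff_cayleyInv : ContDiff ℝ ∞ (fun X : Skew A => (cayleyInv X : A)) := by
  refine contDiff_iff_contDiffAt.2 fun X => ?_
  have hs : ContDiffAt ℝ ∞ (fun X : Skew A => (X : A)) X :=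
    (skewAdjoint.submodule ℝ A).subtypeL.contDiff.contDiffAt
  exact (contDiffAt_const.add hs).mul
    (ContDiffAt.comp (f := fun X : Skew A => 1 - (X : A)) X
      (contDiffAt_inverse X.isUnit_one_sub) (contDiffAt_const.sub hs))

/-- The inclusion of the unitary group into the algebra is smooth. -/
theorem contMDiff_unitary_coe :
    ContMDiff 𝓘(ℝ, Skew A) 𝓘(ℝ, A) ∞ (fun u : unitary A => (u : A)) := by
  intro u₀
  have h1 : ContDiff ℝ ∞ (fun X : Skew A => (u₀ : A) * (cayleyInv X : A)) :=
    contDiff_const.mul contDiff_cayleyInv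
  have h2 : ContMDiffAt 𝓘(ℝ, Skew A) 𝓘(ℝ, Skew A) ∞ (extChartAt 𝓘(ℝ, Skew A) u₀) u₀ :=
    contMDiffAt_extChartAt
  have h3 := (h1.contMDiff.contMDiffAt (x := extChartAt 𝓘(ℝ, Skew A) u₀ u₀)).comp u₀ h2
  refine h3.congr_of_eventuallyEq ?_
  filter_upwards [extChartAt_source_mem_nhds (I := 𝓘(ℝ, Skew A)) u₀] with u hu
  rw [extChartAt_source] at hu
  have hu' : u₀⁻¹ * u ∈ (cayley : OpenPartialHomeomorph (unitary A) (Skew A)).source := hu.2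
  change (u : A) = (u₀ : A) * (cayleyInv (cayleyFun (u₀⁻¹ * u)) : A)
  have h4 : cayleyInv (cayleyFun (u₀⁻¹ * u)) = u₀⁻¹ * u := cayley.left_inv hu'
  rw [h4, ← Submonoid.coe_mul, mul_inv_cancel_left]

end UnitaryCoe

variable {H : Type*} [NormedAddCommGroup H] [InnerProductSpace ℂ H] [CompleteSpace H]
variable {EM M EP P : Type*} [NormedAddCommGroup EM] [NormedSpace ℝ EM] [TopologicalSpace M]
  [ChartedSpace EM M] [NormedAddCommGroup EP] [NormedSpace ℝ EP] [TopologicalSpace P]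
  [ChartedSpace EP P]
variable {B : PUBundle H EM M EP P} {nablaL : GerbeConnection B}
variable {F : Type*} [NormedAddCommGroup F] [NormedSpace ℝ F]

/-- A smooth path of automorphisms of a module that differ from the identity by trace class
operators. -/
structure AutPath (E : UtrModule B) where
  T : E.ι → P × ℝ → TraceClass H
  smooth : ∀ i, ContMDiffOn (𝓘(ℝ, EP).prod 𝓘(ℝ, ℝ)) 𝓘(ℝ, TraceClass H) ∞ (T i) (E.V i ×ˢ Set.univ)
  isTrAut : ∀ r, E.IsTrAut fun i p => 1 + (T i (p, r)).toOp

section Along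

variable {E : UtrModule B} (nabla₀ nabla₁ : ModuleConnection E nablaL) (Φ : AutPath E)
  (c : nablaL.Curving)

/-- The connection `(1 - τ) ∇₀ + τ ∇₁` along a map. -/
def aAlong (i : E.ι) (γ : F → P) (τ : F → ℝ) (x : F) : F [⋀^Fin 1]→L[ℝ] Op H :=
  (1 - τ x) • pullback 𝓘(ℝ, F) 𝓘(ℝ, EP) γ (nabla₀.A i) x +
    τ x • pullback 𝓘(ℝ, F) 𝓘(ℝ, EP) γ (nabla₁.A i) x

/-- The path of automorphisms along a map. -/
def tAlong (i : E.ι) (γ : F → P) (τ : F → ℝ) (x : F) : TraceClass H := Φ.T i (γ x, τ x)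

/-- The inverse of the automorphism along a map. -/
def invAlong (i : E.ι) (γ : F → P) (τ : F → ℝ) (x : F) : Op H :=
  Ring.inverse (1 + (tAlong Φ i γ τ x).toOp)

/-- The difference of the connection and its transform, along a map. -/
def diffAlong (i : E.ι) (γ : F → P) (τ : F → ℝ) : F → F [⋀^Fin 1]→L[ℝ] TraceClass H :=
  (opTA H).diffT (aAlong nabla₀ nabla₁ i γ τ) (tAlong Φ i γ τ) (invAlong Φ i γ τ)

/-- The Chern form along a map. -/
def chAlong (i : E.ι) (γ : F → P) (τ : F → ℝ) (k : ℕ) (x : F) :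
    F [⋀^Fin (2 * k + 1)]→L[ℝ] ℂ :=
  (opTA H).chForm (aAlong nabla₀ nabla₁ i γ τ) (diffAlong nabla₀ nabla₁ Φ i γ τ)
    (pullback 𝓘(ℝ, F) 𝓘(ℝ, EP) γ c.f) k x

variable {nabla₀ nabla₁ Φ c} {γ : F → P} {τ : F → ℝ} {x : F} {i : E.ι}

theorem contDiffAt_aAlong [IsManifold 𝓘(ℝ, EP) ∞ P]
    (hγ : ∀ᶠ y in 𝓝 x, ContMDiffAt 𝓘(ℝ, F) 𝓘(ℝ, EP) ∞ γ y) (hτ : ContDiffAt ℝ ∞ τ x)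
    (hx : γ x ∈ E.V i) : ContDiffAt ℝ ∞ (aAlong nabla₀ nabla₁ i γ τ) x :=
  ((contDiffAt_const.sub hτ).smul (contDiffAt_pullback (nabla₀.smooth i) (E.isOpen i) hγ hx)).add
    (hτ.smul (contDiffAt_pullback (nabla₁.smooth i) (E.isOpen i) hγ hx))

theorem contDiffAt_tAlong (hγ : ContMDiffAt 𝓘(ℝ, F) 𝓘(ℝ, EP) ∞ γ x) (hτ : ContDiffAt ℝ ∞ τ x)
    (hx : γ x ∈ E.V i) : ContDiffAt ℝ ∞ (tAlong Φ i γ τ) x := by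
  have h1 : ContMDiffAt (𝓘(ℝ, EP).prod 𝓘(ℝ, ℝ)) 𝓘(ℝ, TraceClass H) ∞ (Φ.T i) (γ x, τ x) :=
    (Φ.smooth i).contMDiffAt (((E.isOpen i).prod isOpen_univ).mem_nhds ⟨hx, Set.mem_univ _⟩)
  have h2 : ContMDiffAt 𝓘(ℝ, F) (𝓘(ℝ, EP).prod 𝓘(ℝ, ℝ)) ∞ (fun y => (γ y, τ y)) x :=
    hγ.prodMk hτ.contMDiffAt
  exact contMDiffAt_iff_contDiffAt.1 (h1.comp x h2)

theorem isUnit_tAlong (hx : γ x ∈ E.V i) : IsUnit (1 + (tAlong Φ i γ τ x).toOp) :=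
  (Φ.isTrAut (τ x)).isUnit i (γ x) hx

theorem contDiffAt_invAlong (hγ : ContMDiffAt 𝓘(ℝ, F) 𝓘(ℝ, EP) ∞ γ x) (hτ : ContDiffAt ℝ ∞ τ x)
    (hx : γ x ∈ E.V i) : ContDiffAt ℝ ∞ (invAlong Φ i γ τ) x := by
  have h0 : ContDiff ℝ ∞ (opTA H).incl := (opTA H).incl.contDiff
  have h1 : ContDiffAt ℝ ∞ (fun y => (1 : Op H) + (tAlong Φ i γ τ y).toOp) x :=
    contDiffAt_const.add (h0.contDiffAt.comp x (contDiffAt_tAlong hγ hτ hx))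
  exact ContDiffAt.comp (g := (Ring.inverse : Op H → Op H)) x
    (contDiffAt_inverse (isUnit_tAlong hx)) h1

theorem mul_invAlong (hx : γ x ∈ E.V i) :
    (opTA H).mul ((opTA H).one + (opTA H).incl (tAlong Φ i γ τ x)) (invAlong Φ i γ τ x) =
      (opTA H).one :=
  Ring.mul_inverse_cancel _ (isUnit_tAlong hx)

theorem invAlong_mul (hx : γ x ∈ E.V i) :
    (opTA H).mul (invAlong Φ i γ τ x) ((opTA H).one + (opTA H).incl (tAlong Φ i γ τ x)) =
      (opTA H).one :=
  Ring.inverse_mul_cancel _ (isUnit_tAlong hx)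

variable [IsManifold 𝓘(ℝ, EP) ∞ P]

theorem contDiffAt_diffAlong
    (hγ : ∀ᶠ y in 𝓝 x, ContMDiffAt 𝓘(ℝ, F) 𝓘(ℝ, EP) ∞ γ y) (hτ : ContDiffAt ℝ ∞ τ x)
    (hx : γ x ∈ E.V i) : ContDiffAt ℝ ∞ (diffAlong nabla₀ nabla₁ Φ i γ τ) x :=
  (opTA H).contDiffAt_diffT (contDiffAt_aAlong hγ hτ hx)
    (contDiffAt_tAlong hγ.self_of_nhds hτ hx) (contDiffAt_invAlong hγ.self_of_nhds hτ hx)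

theorem contDiffAt_fAlong (hγ : ∀ᶠ y in 𝓝 x, ContMDiffAt 𝓘(ℝ, F) 𝓘(ℝ, EP) ∞ γ y) :
    ContDiffAt ℝ ∞ (pullback 𝓘(ℝ, F) 𝓘(ℝ, EP) γ c.f) x :=
  contDiffAt_pullback c.smooth isOpen_univ hγ (Set.mem_univ _)

theorem eventually_mem_V (hγ : ContinuousAt γ x) (hx : γ x ∈ E.V i) : ∀ᶠ y in 𝓝 x, γ y ∈ E.V i :=
  hγ ((E.isOpen i).mem_nhds hx)

theorem exists_open_along (hγ : ∀ᶠ y in 𝓝 x, ContMDiffAt 𝓘(ℝ, F) 𝓘(ℝ, EP) ∞ γ y)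
    (hτ : ∀ᶠ y in 𝓝 x, ContDiffAt ℝ ∞ τ y) (hx : γ x ∈ E.V i) :
    ∃ O : Set F, IsOpen O ∧ x ∈ O ∧ ∀ y ∈ O, (∀ᶠ z in 𝓝 y, ContMDiffAt 𝓘(ℝ, F) 𝓘(ℝ, EP) ∞ γ z) ∧
      (∀ᶠ z in 𝓝 y, ContDiffAt ℝ ∞ τ z) ∧ ∀ᶠ z in 𝓝 y, γ z ∈ E.V i := by
  obtain ⟨O, hO, hOo, hxO⟩ := eventually_nhds_iff.1
    ((hγ.and hτ).and (eventually_mem_V hγ.self_of_nhds.continuousAt hx))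
  refine ⟨O, hOo, hxO, fun y hy => ?_⟩
  have h1 : ∀ᶠ z in 𝓝 y, z ∈ O := hOo.mem_nhds hy
  exact ⟨h1.mono fun z hz => (hO z hz).1.1, h1.mono fun z hz => (hO z hz).1.2,
    h1.mono fun z hz => (hO z hz).2⟩

theorem contDiffAt_chAlong (hγ : ∀ᶠ y in 𝓝 x, ContMDiffAt 𝓘(ℝ, F) 𝓘(ℝ, EP) ∞ γ y)
    (hτ : ∀ᶠ y in 𝓝 x, ContDiffAt ℝ ∞ τ y) (hx : γ x ∈ E.V i) (k : ℕ) :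
    ContDiffAt ℝ ∞ (chAlong nabla₀ nabla₁ Φ c i γ τ k) x := by
  obtain ⟨O, hO, hxO, h⟩ := exists_open_along hγ hτ hx
  refine ContDiffOn.contDiffAt ((opTA H).contDiffOn_chForm hO (fun y hy => ?_) (fun y hy => ?_)
    (fun y hy => ?_) k) (hO.mem_nhds hxO)
  · exact contDiffAt_aAlong (h y hy).1 (h y hy).2.1.self_of_nhds (h y hy).2.2.self_of_nhds
  · exact contDiffAt_diffAlong (h y hy).1 (h y hy).2.1.self_of_nhds (h y hy).2.2.self_of_nhds
  · exact contDiffAt_fAlong (h y hy).1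

theorem extDeriv_chAlong (hγ : ∀ᶠ y in 𝓝 x, ContMDiffAt 𝓘(ℝ, F) 𝓘(ℝ, EP) ∞ γ y)
    (hτ : ∀ᶠ y in 𝓝 x, ContDiffAt ℝ ∞ τ y) (hx : γ x ∈ E.V i) :
    extDeriv (chAlong nabla₀ nabla₁ Φ c i γ τ 0) x = 0 ∧
      ∀ k (h : 3 + (2 * k + 1) = 2 * (k + 1) + 1 + 1),
      extDeriv (chAlong nabla₀ nabla₁ Φ c i γ τ (k + 1)) x =
        wedge (ContinuousLinearMap.mul ℝ ℂ) h
          (pullback 𝓘(ℝ, F) 𝓘(ℝ, EP) γ (extD 𝓘(ℝ, EP) c.f) x)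
          (chAlong nabla₀ nabla₁ Φ c i γ τ k x) := by
  obtain ⟨O, hO, hxO, h⟩ := exists_open_along hγ hτ hx
  rw [← extDeriv_pullback_eq c.smooth isOpen_univ hγ (Set.mem_univ _)]
  refine (opTA H).extDeriv_chForm (t := tAlong Φ i γ τ x)
    (φ := (opTA H).one + (opTA H).incl (tAlong Φ i γ τ x)) (ψ := invAlong Φ i γ τ x) rfl
    (invAlong_mul hx) (mul_invAlong hx) hO (fun y hy => ?_) (fun y hy => ?_)
    (fun y hy => ?_) hxO ?_
  · exact contDiffAt_aAlong (h y hy).1 (h y hy).2.1.self_of_nhds (h y hy).2.2.self_of_nhds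
  · exact contDiffAt_diffAlong (h y hy).1 (h y hy).2.1.self_of_nhds (h y hy).2.2.self_of_nhds
  · exact contDiffAt_fAlong (h y hy).1
  · refine (opTA H).curv_pathForm_one (contDiffAt_aAlong hγ hτ.self_of_nhds hx) ?_
      (contDiffAt_invAlong hγ.self_of_nhds hτ.self_of_nhds hx) ?_ (invAlong_mul hx)
    · filter_upwards [hO.mem_nhds hxO] with y hy
      exact contDiffAt_tAlong (h y hy).1.self_of_nhds (h y hy).2.1.self_of_nhds
        (h y hy).2.2.self_of_nhds
    · filter_upwards [hO.mem_nhds hxO] with y hy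
      exact mul_invAlong (h y hy).2.2.self_of_nhds

theorem eventually_pullback_comp {F' : Type*} [NormedAddCommGroup F'] [NormedSpace ℝ F']
    {κ : F' → F} {x : F'} {n : ℕ} {V : Type*} [NormedAddCommGroup V] [NormedSpace ℝ V]
    (θ : Form EP P V n) (hκ : ∀ᶠ y in 𝓝 x, ContDiffAt ℝ ∞ κ y)
    (hγ : ∀ᶠ y in 𝓝 (κ x), ContMDiffAt 𝓘(ℝ, F) 𝓘(ℝ, EP) ∞ γ y) :
    ∀ᶠ y in 𝓝 x, pullback 𝓘(ℝ, F') 𝓘(ℝ, EP) (fun y => γ (κ y)) θ y =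
      TraceAlgebra.pb κ (pullback 𝓘(ℝ, F) 𝓘(ℝ, EP) γ θ) y := by
  filter_upwards [hκ, hκ.self_of_nhds.continuousAt.eventually hγ] with y h1 h2
  rw [pullback_comp_apply (I' := 𝓘(ℝ, F)) (g := γ) (κ := κ) θ h2.mdifferentiableAt'
    h1.contMDiffAt.mdifferentiableAt', pullback, mfderiv_eq_fderiv]
  rfl

/-- The Chern form along a map is natural. -/
theorem chAlong_comp {F' : Type*} [NormedAddCommGroup F'] [NormedSpace ℝ F'] {κ : F' → F} {x : F'}
    (hκ : ∀ᶠ y in 𝓝 x, ContDiffAt ℝ ∞ κ y)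
    (hγ : ∀ᶠ y in 𝓝 (κ x), ContMDiffAt 𝓘(ℝ, F) 𝓘(ℝ, EP) ∞ γ y)
    (hτ : ∀ᶠ y in 𝓝 (κ x), ContDiffAt ℝ ∞ τ y) (hx : γ (κ x) ∈ E.V i) (k : ℕ) :
    chAlong nabla₀ nabla₁ Φ c i (fun y => γ (κ y)) (fun y => τ (κ y)) k x =
      (chAlong nabla₀ nabla₁ Φ c i γ τ k (κ x)).compContinuousLinearMap (fderiv ℝ κ x) := by
  have hκc := hκ.self_of_nhds.continuousAt
  have hV : ∀ᶠ z in 𝓝 (κ x), γ z ∈ E.V i := eventually_mem_V hγ.self_of_nhds.continuousAt hx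
  have hp₀ := eventually_pullback_comp (nabla₀.A i) hκ hγ
  have hp₁ := eventually_pullback_comp (nabla₁.A i) hκ hγ
  have hpf := eventually_pullback_comp c.f hκ hγ
  have ha : ∀ᶠ y in 𝓝 x, aAlong nabla₀ nabla₁ i (fun y => γ (κ y)) (fun y => τ (κ y)) y =
      TraceAlgebra.pb κ (aAlong nabla₀ nabla₁ i γ τ) y := by
    filter_upwards [hp₀, hp₁] with y h1 h2
    rw [aAlong, h1, h2]
    rfl
  have hδ : ∀ᶠ y in 𝓝 x, diffAlong nabla₀ nabla₁ Φ i (fun y => γ (κ y)) (fun y => τ (κ y)) y =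
      TraceAlgebra.pb κ (diffAlong nabla₀ nabla₁ Φ i γ τ) y := by
    filter_upwards [ha, hκ, hκc.eventually hγ, hκc.eventually hτ, hκc.eventually hV]
      with y h1 h2 h3 h4 h5
    have h6 := (opTA H).diffT_pb (a := aAlong nabla₀ nabla₁ i γ τ) (ψ := invAlong Φ i γ τ)
      h2.differentiableAt' (contDiffAt_tAlong (Φ := Φ) h3 h4 h5).differentiableAt'
    rw [diffAlong, diffAlong, ← h6, TraceAlgebra.diffT, TraceAlgebra.diffT, h1]
    rfl
  rw [chAlong, (opTA H).chForm_congr ha hδ hpf.self_of_nhds k]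
  exact (opTA H).chForm_pb hκ.self_of_nhds (contDiffAt_aAlong hγ hτ.self_of_nhds hx)
    (contDiffAt_diffAlong hγ hτ.self_of_nhds hx) k

end Along

end

section

variable {H : Type*} [NormedAddCommGroup H] [InnerProductSpace ℂ H] [CompleteSpace H]
variable {EM M EP P : Type*} [NormedAddCommGroup EM] [NormedSpace ℝ EM] [TopologicalSpace M]
  [ChartedSpace EM M] [NormedAddCommGroup EP] [NormedSpace ℝ EP] [TopologicalSpace P]
  [ChartedSpace EP P]
variable {B : PUBundle H EM M EP P} {nablaL : GerbeConnection B}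
variable {F : Type*} [NormedAddCommGroup F] [NormedSpace ℝ F]

theorem contMDiff_toOp : ContMDiff 𝓘(ℝ, TraceClass H) 𝓘(ℝ, Op H) ∞ (TraceClass.toOp (H := H)) := by
  have h : ContDiff ℝ ∞ (opTA H).incl := (opTA H).incl.contDiff
  exact h.contMDiff

theorem SmoothTrOn.contMDiffOn {E C X : Type*} [NormedAddCommGroup E] [NormedSpace ℝ E]
    [TopologicalSpace C] {I : ModelWithCorners ℝ E C} [TopologicalSpace X] [ChartedSpace C X]
    {g : X → Op H} {s : Set X} (h : SmoothTrOn I g s) : ContMDiffOn I 𝓘(ℝ, Op H) ∞ g s := by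
  obtain ⟨t, ht, hg⟩ := h
  have h1 : ContMDiffOn I 𝓘(ℝ, Op H) ∞ (fun x => (1 : Op H) + (t x).toOp) s :=
    contMDiffOn_const.add (contMDiff_toOp.comp_contMDiffOn ht)
  exact h1.congr hg

theorem contMDiff_snd_coe :
    ContMDiff (modelPU EP H) 𝓘(ℝ, Op H) ∞ (fun x : P × U H => (x.2 : Op H)) :=
  contMDiff_unitary_coe.comp contMDiff_snd

theorem PUBundle.contMDiff_actMap : ContMDiff (modelPU EP H) 𝓘(ℝ, EP) ∞ B.actMap :=
  B.contMDiff_act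

theorem UtrModule.isOpen_psi_domain (E : UtrModule B) (j i : E.ι) :
    IsOpen {x : P × U H | B.actMap x ∈ E.V i ∧ x.1 ∈ E.V j} :=
  ((E.isOpen i).preimage B.contMDiff_actMap.continuous).inter ((E.isOpen j).preimage continuous_fst)

theorem UtrModule.contMDiffAt_psi (E : UtrModule B) {j i : E.ι} {x : P × U H}
    (hi : B.actMap x ∈ E.V i) (hj : x.1 ∈ E.V j) :
    ContMDiffAt (modelPU EP H) 𝓘(ℝ, Op H) ∞ (E.ψ j i) x := by
  have h1 := (E.ψ_tr j i).contMDiffOn.contMDiffAt ((E.isOpen_psi_domain j i).mem_nhds ⟨hi, hj⟩)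
  have h2 : ContMDiffAt (modelPU EP H) 𝓘(ℝ, Op H) ∞ (fun x => E.ψ j i x * star (x.2 : Op H) * x.2) x :=
    (contDiff_mul (𝕜 := ℝ) (𝔸 := Op H)).contMDiff.contMDiffAt.comp x
      (h1.prodMk_space contMDiff_snd_coe.contMDiffAt)
  refine h2.congr_of_eventuallyEq (Filter.Eventually.of_forall fun y => ?_)
  change E.ψ j i y = E.ψ j i y * star (y.2 : Op H) * y.2
  rw [mul_assoc, Unitary.coe_star_mul_self, mul_one]

section Invariance

variable {E : UtrModule B} {nabla₀ nabla₁ : ModuleConnection E nablaL} {Φ : AutPath E}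
  {c : nablaL.Curving} {γ γ' : F → P} {τ : F → ℝ} {x : F} {i j : E.ι} {u : F → U H}

theorem chAlong_congr (h : γ =ᶠ[𝓝 x] γ') (k : ℕ) :
    chAlong nabla₀ nabla₁ Φ c i γ τ k x = chAlong nabla₀ nabla₁ Φ c i γ' τ k x := by
  have ha : aAlong nabla₀ nabla₁ i γ τ =ᶠ[𝓝 x] aAlong nabla₀ nabla₁ i γ' τ := by
    filter_upwards [pullback_congr (I := 𝓘(ℝ, F)) (I' := 𝓘(ℝ, EP)) h (nabla₀.A i),
      pullback_congr (I := 𝓘(ℝ, F)) (I' := 𝓘(ℝ, EP)) h (nabla₁.A i)] with y h0 h1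
    rw [aAlong, h0, h1, aAlong]
  have hδ : diffAlong nabla₀ nabla₁ Φ i γ τ =ᶠ[𝓝 x] diffAlong nabla₀ nabla₁ Φ i γ' τ := by
    filter_upwards [ha, h.eventuallyEq_nhds] with y h0 h1
    have h2 : tAlong Φ i γ τ =ᶠ[𝓝 y] tAlong Φ i γ' τ := by
      filter_upwards [h1] with z hz
      rw [tAlong, hz, tAlong]
    rw [diffAlong, diffAlong, TraceAlgebra.diffT, TraceAlgebra.diffT, h0, h2.fderiv_eq,
      h2.eq_of_nhds, invAlong, invAlong, h2.eq_of_nhds]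
  exact (opTA H).chForm_congr ha hδ (pullback_congr (I := 𝓘(ℝ, F)) (I' := 𝓘(ℝ, EP)) h c.f).eq_of_nhds k

variable [IsManifold 𝓘(ℝ, EP) ∞ P]

theorem isGauge_act (hγ : ContMDiffAt 𝓘(ℝ, F) 𝓘(ℝ, EP) ∞ γ x)
    (hu : ContMDiffAt 𝓘(ℝ, F) 𝓘(ℝ, LieU H) ∞ u x) (hj : γ x ∈ E.V j)
    (hi : B.act (γ x) (u x) ∈ E.V i) :
    (opTA H).IsGauge (aAlong nabla₀ nabla₁ j γ τ)
      (aAlong nabla₀ nabla₁ i (fun y => B.act (γ y) (u y)) τ) (fun y => E.ψ j i (γ y, u y))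
      (pullback 𝓘(ℝ, F) (modelPU EP H) (fun y => (γ y, u y)) nablaL.α) x := by
  intro v
  have hζ : ContMDiffAt 𝓘(ℝ, F) (modelPU EP H) ∞ (fun y => (γ y, u y)) x := hγ.prodMk hu
  have hψ := E.contMDiffAt_psi (x := (γ x, u x)) hi hj
  have e1 (θ : Form EP P (Op H) 1) : pullback 𝓘(ℝ, F) 𝓘(ℝ, EP) (fun y => B.act (γ y) (u y)) θ x =
      pullback 𝓘(ℝ, F) (modelPU EP H) (fun y => (γ y, u y))
        (pullback (modelPU EP H) 𝓘(ℝ, EP) B.actMap θ) x :=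
    pullback_comp_apply (κ := fun y => (γ y, u y)) (g := B.actMap) θ
      B.contMDiff_actMap.contMDiffAt.mdifferentiableAt' hζ.mdifferentiableAt'
  have e2 (θ : Form EP P (Op H) 1) : pullback 𝓘(ℝ, F) 𝓘(ℝ, EP) γ θ x =
      pullback 𝓘(ℝ, F) (modelPU EP H) (fun y => (γ y, u y))
        (pullback (modelPU EP H) 𝓘(ℝ, EP) Prod.fst θ) x :=
    pullback_comp_apply (κ := fun y => (γ y, u y)) (g := Prod.fst) θ
      contMDiff_fst.contMDiffAt.mdifferentiableAt' hζ.mdifferentiableAt'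
  have e3 : fderiv ℝ (fun y => E.ψ j i (γ y, u y)) x (v 0) =
      dFun (modelPU EP H) (E.ψ j i) (γ x, u x)
        (mfderiv 𝓘(ℝ, F) (modelPU EP H) (fun y => (γ y, u y)) x ∘ v) := by
    rw [← mfderiv_eq_fderiv]
    have := mfderiv_comp (I' := modelPU EP H) (g := E.ψ j i) (f := fun y => (γ y, u y)) x
      hψ.mdifferentiableAt' hζ.mdifferentiableAt'
    exact congrArg (fun L => L (v 0)) this
  have m0 := nabla₀.module j i (γ x, u x) hi hj
    (mfderiv 𝓘(ℝ, F) (modelPU EP H) (fun y => (γ y, u y)) x ∘ v)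
  have m1 := nabla₁.module j i (γ x, u x) hi hj
    (mfderiv 𝓘(ℝ, F) (modelPU EP H) (fun y => (γ y, u y)) x ∘ v)
  rw [e3]
  unfold aAlong
  rw [e1, e1, e2, e2]
  change E.ψ j i (γ x, u x) * ((1 - τ x) • pullback (modelPU EP H) 𝓘(ℝ, EP) B.actMap (nabla₀.A i)
      (γ x, u x) (mfderiv 𝓘(ℝ, F) (modelPU EP H) (fun y => (γ y, u y)) x ∘ v) +
      τ x • pullback (modelPU EP H) 𝓘(ℝ, EP) B.actMap (nabla₁.A i)
      (γ x, u x) (mfderiv 𝓘(ℝ, F) (modelPU EP H) (fun y => (γ y, u y)) x ∘ v)) = _ +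
      ((1 - τ x) • pullback (modelPU EP H) 𝓘(ℝ, EP) Prod.fst (nabla₀.A j)
      (γ x, u x) (mfderiv 𝓘(ℝ, F) (modelPU EP H) (fun y => (γ y, u y)) x ∘ v) +
      τ x • pullback (modelPU EP H) 𝓘(ℝ, EP) Prod.fst (nabla₁.A j)
      (γ x, u x) (mfderiv 𝓘(ℝ, F) (modelPU EP H) (fun y => (γ y, u y)) x ∘ v)) *
      E.ψ j i (γ x, u x) - nablaL.α (γ x, u x)
        (mfderiv 𝓘(ℝ, F) (modelPU EP H) (fun y => (γ y, u y)) x ∘ v) • E.ψ j i (γ x, u x)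
  rw [mul_add, add_mul, mul_smul_comm, mul_smul_comm, smul_mul_assoc, smul_mul_assoc,
    eq_sub_of_add_eq m0, eq_sub_of_add_eq m1]
  module

/-- The Chern form along a map does not change under the action of `U(H)`. -/
theorem chAlong_act (hγ : ∀ᶠ y in 𝓝 x, ContMDiffAt 𝓘(ℝ, F) 𝓘(ℝ, EP) ∞ γ y)
    (hu : ∀ᶠ y in 𝓝 x, ContMDiffAt 𝓘(ℝ, F) 𝓘(ℝ, LieU H) ∞ u y)
    (hτ : ∀ᶠ y in 𝓝 x, ContDiffAt ℝ ∞ τ y) (hj : γ x ∈ E.V j)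
    (hi : B.act (γ x) (u x) ∈ E.V i) (k : ℕ) :
    chAlong nabla₀ nabla₁ Φ c i (fun y => B.act (γ y) (u y)) τ k x =
      chAlong nabla₀ nabla₁ Φ c j γ τ k x := by
  have hζ : ∀ᶠ y in 𝓝 x, ContMDiffAt 𝓘(ℝ, F) (modelPU EP H) ∞ (fun y => (γ y, u y)) y := by
    filter_upwards [hγ, hu] with y h1 h2 using h1.prodMk h2
  have hγ' : ∀ᶠ y in 𝓝 x, ContMDiffAt 𝓘(ℝ, F) 𝓘(ℝ, EP) ∞ (fun y => B.act (γ y) (u y)) y := by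
    filter_upwards [hζ] with y h
    exact B.contMDiff_actMap.contMDiffAt.comp y h
  have hjev := eventually_mem_V hγ.self_of_nhds.continuousAt hj
  have hiev := eventually_mem_V (γ := fun y => B.act (γ y) (u y)) hγ'.self_of_nhds.continuousAt hi
  have hψ := E.contMDiffAt_psi (x := (γ x, u x)) hi hj
  have hg : ContDiffAt ℝ ∞ (fun y => E.ψ j i (γ y, u y)) x :=
    contMDiffAt_iff_contDiffAt.1 (hψ.comp x hζ.self_of_nhds)
  have hgev : ∀ᶠ y in 𝓝 x, ContDiffAt ℝ ∞ (fun y => E.ψ j i (γ y, u y)) y := by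
    filter_upwards [hζ, hjev, hiev] with y h1 h2 h3
    exact contMDiffAt_iff_contDiffAt.1 ((E.contMDiffAt_psi (x := (γ y, u y)) h3 h2).comp y h1)
  have hgauge : ∀ᶠ y in 𝓝 x, (opTA H).IsGauge (aAlong nabla₀ nabla₁ j γ τ)
      (aAlong nabla₀ nabla₁ i (fun y => B.act (γ y) (u y)) τ) (fun y => E.ψ j i (γ y, u y))
      (pullback 𝓘(ℝ, F) (modelPU EP H) (fun y => (γ y, u y)) nablaL.α) y := by
    filter_upwards [hγ, hu, hjev, hiev] with y h1 h2 h3 h4 using isGauge_act h1 h2 h3 h4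
  have htg : ∀ᶠ y in 𝓝 x, (opTA H).mul (E.ψ j i (γ y, u y))
      ((opTA H).incl (tAlong Φ i (fun y => B.act (γ y) (u y)) τ y)) =
      (opTA H).mul ((opTA H).incl (tAlong Φ j γ τ y)) (E.ψ j i (γ y, u y)) := by
    filter_upwards [hjev, hiev] with y h1 h2
    have h3 := (Φ.isTrAut (τ y)).module j i (γ y, u y) h2 h1
    rw [add_mul, mul_add, one_mul, mul_one] at h3
    exact (add_left_cancel h3).symm
  have hδ : ∀ᶠ y in 𝓝 x, ∀ v, (opTA H).mul (E.ψ j i (γ y, u y))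
      ((opTA H).incl (diffAlong nabla₀ nabla₁ Φ i (fun y => B.act (γ y) (u y)) τ y v)) =
      (opTA H).mul ((opTA H).incl (diffAlong nabla₀ nabla₁ Φ j γ τ y v)) (E.ψ j i (γ y, u y)) := by
    filter_upwards [hgauge, hgev, hγ, hγ', hτ, hjev, hiev, htg.eventually_nhds] with
      y h1 h2 h3 h4 h5 h6 h7 h8 v
    exact (opTA H).mul_incl_diffT_of_isGauge h1 h2 (contDiffAt_tAlong h3 h5 h6)
      (contDiffAt_tAlong h4 h5 h7) h8 (mul_invAlong h6) (invAlong_mul h6) (mul_invAlong h7) v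
  have huni := E.ψ_unitary j i (γ x, u x) hi hj
  refine (opTA H).chForm_eq_of_isGauge (h₀ := star (E.ψ j i (γ x, u x)))
    (contDiffAt_aAlong hγ hτ.self_of_nhds hj) (contDiffAt_aAlong hγ' hτ.self_of_nhds hi)
    (contDiffAt_diffAlong hγ hτ.self_of_nhds hj) (contDiffAt_diffAlong hγ' hτ.self_of_nhds hi) hg
    (contDiffAt_pullback nablaL.smooth isOpen_univ hζ (Set.mem_univ _)) hgauge hδ
    (Unitary.star_mul_self_of_mem huni) (Unitary.mul_star_self_of_mem huni) ?_ k
  rw [extDeriv_pullback_eq nablaL.smooth isOpen_univ hζ (Set.mem_univ _), c.curvature_eq]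
  have e1 : pullback 𝓘(ℝ, F) 𝓘(ℝ, EP) (fun y => B.act (γ y) (u y)) c.f x =
      pullback 𝓘(ℝ, F) (modelPU EP H) (fun y => (γ y, u y))
        (pullback (modelPU EP H) 𝓘(ℝ, EP) B.actMap c.f) x :=
    pullback_comp_apply (κ := fun y => (γ y, u y)) (g := B.actMap) c.f
      B.contMDiff_actMap.contMDiffAt.mdifferentiableAt' hζ.self_of_nhds.mdifferentiableAt'
  have e2 : pullback 𝓘(ℝ, F) 𝓘(ℝ, EP) γ c.f x =
      pullback 𝓘(ℝ, F) (modelPU EP H) (fun y => (γ y, u y))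
        (pullback (modelPU EP H) 𝓘(ℝ, EP) Prod.fst c.f) x :=
    pullback_comp_apply (κ := fun y => (γ y, u y)) (g := Prod.fst) c.f
      contMDiff_fst.contMDiffAt.mdifferentiableAt' hζ.self_of_nhds.mdifferentiableAt'
  rw [e1, e2]
  exact (add_sub_cancel _ _).symm

theorem PUBundle.exists_act_section (B : PUBundle H EM M EP P) {γ : F → P} {x : F}
    (hγ : ∀ᶠ y in 𝓝 x, ContMDiffAt 𝓘(ℝ, F) 𝓘(ℝ, EP) ∞ γ y) {W : Set M}
    {σ : M → P} (hσ : ∀ p, B.proj p ∈ W → ∃ V : Set P, IsOpen V ∧ p ∈ V ∧ ∃ g : P → U H,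
      ContMDiffOn 𝓘(ℝ, EP) 𝓘(ℝ, LieU H) ∞ g V ∧ ∀ q ∈ V, B.act (σ (B.proj q)) (g q) = q)
    (hx : B.proj (γ x) ∈ W) :
    ∃ u : F → U H, (∀ᶠ y in 𝓝 x, ContMDiffAt 𝓘(ℝ, F) 𝓘(ℝ, LieU H) ∞ u y) ∧
      (fun y => B.act (σ (B.proj (γ y))) (u y)) =ᶠ[𝓝 x] γ := by
  obtain ⟨V, hV, hxV, g, hg, h⟩ := hσ _ hx
  have hev : ∀ᶠ y in 𝓝 x, γ y ∈ V := hγ.self_of_nhds.continuousAt (hV.mem_nhds hxV)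
  refine ⟨fun y => g (γ y), ?_, ?_⟩
  · filter_upwards [hev, hγ] with y h1 h2
    exact (hg.contMDiffAt (hV.mem_nhds h1)).comp y h2
  · filter_upwards [hev] with y h1 using h _ h1

/-- The Chern form along a map to `P` depends only on its projection to `M`. -/
theorem chAlong_eq_of_proj (hγ : ∀ᶠ y in 𝓝 x, ContMDiffAt 𝓘(ℝ, F) 𝓘(ℝ, EP) ∞ γ y)
    (hγ' : ∀ᶠ y in 𝓝 x, ContMDiffAt 𝓘(ℝ, F) 𝓘(ℝ, EP) ∞ γ' y)
    (hτ : ∀ᶠ y in 𝓝 x, ContDiffAt ℝ ∞ τ y)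
    (hp : (fun y => B.proj (γ y)) =ᶠ[𝓝 x] fun y => B.proj (γ' y))
    (hi : γ x ∈ E.V i) (hj : γ' x ∈ E.V j) (k : ℕ) :
    chAlong nabla₀ nabla₁ Φ c i γ τ k x = chAlong nabla₀ nabla₁ Φ c j γ' τ k x := by
  obtain ⟨W, hW, hxW, σ, hσ, -, hσ'⟩ := B.locally_trivial (B.proj (γ x))
  have hev : ∀ᶠ y in 𝓝 x, B.proj (γ y) ∈ W :=
    (B.contMDiff_proj.continuous.continuousAt.comp hγ.self_of_nhds.continuousAt) (hW.mem_nhds hxW)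
  have hρ : ∀ᶠ y in 𝓝 x, ContMDiffAt 𝓘(ℝ, F) 𝓘(ℝ, EP) ∞ (fun y => σ (B.proj (γ y))) y := by
    filter_upwards [hγ, hev] with y h1 h2
    exact (hσ.contMDiffAt (hW.mem_nhds h2)).comp y (B.contMDiff_proj.contMDiffAt.comp y h1)
  have hxW' : B.proj (γ' x) ∈ W := by
    have : B.proj (γ x) = B.proj (γ' x) := hp.eq_of_nhds
    rwa [← this]
  obtain ⟨u, hu, he⟩ := B.exists_act_section hγ hσ' hxW
  obtain ⟨u', hu', he'⟩ := B.exists_act_section hγ' hσ' hxW'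
  have he'' : (fun y => B.act (σ (B.proj (γ y))) (u' y)) =ᶠ[𝓝 x] γ' := by
    filter_upwards [he', hp] with y h1 h2
    rw [h2, h1]
  obtain ⟨l, hl⟩ := E.cover (σ (B.proj (γ x)))
  have h1 := chAlong_act (nabla₀ := nabla₀) (nabla₁ := nabla₁) (Φ := Φ) (c := c) (i := i) hρ hu hτ hl
    (by have : B.act (σ (B.proj (γ x))) (u x) = γ x := he.eq_of_nhds; rwa [this]) k
  have h2 := chAlong_act (nabla₀ := nabla₀) (nabla₁ := nabla₁) (Φ := Φ) (c := c) (i := j) hρ hu' hτ hl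
    (by have : B.act (σ (B.proj (γ x))) (u' x) = γ' x := he''.eq_of_nhds; rwa [this]) k
  rw [← chAlong_congr he, h1, ← h2, chAlong_congr he'']

end Invariance

end

section

section Charts

variable {E B X : Type*} [NormedAddCommGroup E] [NormedSpace ℝ E] [TopologicalSpace B]
  {I : ModelWithCorners ℝ E B} [TopologicalSpace X] [ChartedSpace B X]
  {F : Type*} [NormedAddCommGroup F] [NormedSpace ℝ F]
  {V : Type*} [NormedAddCommGroup V] [NormedSpace ℝ V] {n : ℕ}

/-- `γ` is smooth near `x`. -/
def SmoothNear (I : ModelWithCorners ℝ E B) (γ : F → X) (x : F) : Prop :=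
  ∀ᶠ y in 𝓝 x, ContMDiffAt 𝓘(ℝ, F) I ∞ γ y

theorem SmoothNear.comp {F' : Type*} [NormedAddCommGroup F'] [NormedSpace ℝ F'] {γ : F → X}
    {κ : F' → F} {x : F'} (h : SmoothNear I γ (κ x)) (hκ : ∀ᶠ y in 𝓝 x, ContDiffAt ℝ ∞ κ y) :
    SmoothNear I (fun y => γ (κ y)) x := by
  filter_upwards [hκ, hκ.self_of_nhds.continuousAt.eventually h] with y h1 h2
  exact ContMDiffAt.comp y h2 h1.contMDiffAt

variable [IsManifold I ∞ X] [I.Boundaryless]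

theorem smoothNear_extChartAt_symm (m : X) {y : E} (hy : y ∈ (extChartAt I m).target) :
    SmoothNear I (extChartAt I m).symm y := by
  filter_upwards [(isOpen_extChartAt_target m).mem_nhds hy] with z hz
  exact contMDiffAt_extChartAt_symm hz

theorem SmoothNear.chart_comp {γ : F → X} {x : F} (hγ : SmoothNear I γ x) {x₀ : X}
    (hx : γ x ∈ (extChartAt I x₀).source) :
    ∀ᶠ y in 𝓝 x, ContDiffAt ℝ ∞ (fun z => extChartAt I x₀ (γ z)) y := by
  have hsrc : ∀ᶠ y in 𝓝 x, γ y ∈ (extChartAt I x₀).source :=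
    hγ.self_of_nhds.continuousAt ((isOpen_extChartAt_source x₀).mem_nhds hx)
  filter_upwards [hγ, hsrc] with y h1 h2 using contDiffAt_chartComp h1 h2

theorem mfderiv_extChartAt_symm_comp (m : X) :
    mfderiv 𝓘(ℝ, E) I (extChartAt I m).symm (extChartAt I m m) ∘L
      mfderiv I 𝓘(ℝ, E) (extChartAt I m) m = ContinuousLinearMap.id ℝ E := by
  have h0 := mem_extChartAt_source (I := I) m
  have h1 := (contMDiffAt_extChartAt_symm (I := I)
    ((extChartAt I m).map_source h0)).mdifferentiableAt'
  have h2 := (contMDiffAt_extChartAt_of_mem (I := I) h0).mdifferentiableAt'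
  have h3 := mfderiv_comp m h1 h2
  have h4 : (extChartAt I m).symm ∘ extChartAt I m =ᶠ[𝓝 m] id := by
    filter_upwards [extChartAt_source_mem_nhds (I := I) m] with y hy
    exact (extChartAt I m).left_inv hy
  have h5 : mfderiv I I ((extChartAt I m).symm ∘ extChartAt I m) m = mfderiv I I id m := h4.mfderiv_eq
  have h6 : mfderiv I I (id : X → X) m = ContinuousLinearMap.id ℝ E := mfderiv_id
  exact (h3.symm.trans h5).trans h6

/-- A form is determined at a point by its expression in a chart. -/
theorem eq_of_pullback_chart_eq {θ θ' : Form E X V n} {m : X}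
    (h : pullback 𝓘(ℝ, E) I (extChartAt I m).symm θ (extChartAt I m m) =
      pullback 𝓘(ℝ, E) I (extChartAt I m).symm θ' (extChartAt I m m)) : θ m = θ' m := by
  have h1 := congrArg (fun η : E [⋀^Fin n]→L[ℝ] V =>
    η.compContinuousLinearMap (mfderiv I 𝓘(ℝ, E) (extChartAt I m) m)) h
  have key (η : Form E X V n) : (pullback 𝓘(ℝ, E) I (extChartAt I m).symm η
      (extChartAt I m m)).compContinuousLinearMap (mfderiv I 𝓘(ℝ, E) (extChartAt I m) m) = η m := by
    have h2 := mfderiv_extChartAt_symm_comp (I := I) m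
    have h3 : (extChartAt I m).symm (extChartAt I m m) = m := extChartAt_to_inv m
    unfold pullback
    ext v
    change η ((extChartAt I m).symm (extChartAt I m m)) (fun i =>
      (mfderiv 𝓘(ℝ, E) I (extChartAt I m).symm (extChartAt I m m) ∘L
      mfderiv I 𝓘(ℝ, E) (extChartAt I m) m) (v i)) = _
    rw [h2, h3]
    rfl
  exact (key θ).symm.trans (h1.trans (key θ'))

end Charts

variable {H : Type*} [NormedAddCommGroup H] [InnerProductSpace ℂ H] [CompleteSpace H]
variable {EM M EP P : Type*} [NormedAddCommGroup EM] [NormedSpace ℝ EM] [TopologicalSpace M]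
  [ChartedSpace EM M] [NormedAddCommGroup EP] [NormedSpace ℝ EP] [TopologicalSpace P]
  [ChartedSpace EP P] [IsManifold 𝓘(ℝ, EM) ∞ M]
variable {B : PUBundle H EM M EP P}
variable {F : Type*} [NormedAddCommGroup F] [NormedSpace ℝ F] {n : ℕ}

variable (B) in
theorem PUBundle.smoothNear_proj {γ : F → P} {x : F} (h : SmoothNear 𝓘(ℝ, EP) γ x) :
    SmoothNear 𝓘(ℝ, EM) (fun y => B.proj (γ y)) x := by
  filter_upwards [h] with y hy
  exact B.contMDiff_proj.contMDiffAt.comp y hy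

variable (B) in
/-- Local sections of `P`, in a chart of `M`. -/
theorem PUBundle.exists_chart_section (m : M) : ∃ s : EM → P,
    SmoothNear 𝓘(ℝ, EP) s (extChartAt 𝓘(ℝ, EM) m m) ∧
    (fun y => B.proj (s y)) =ᶠ[𝓝 (extChartAt 𝓘(ℝ, EM) m m)] (extChartAt 𝓘(ℝ, EM) m).symm := by
  obtain ⟨W, hW, hmW, σ, hσ, hσ', -⟩ := B.locally_trivial m
  have h0 := smoothNear_extChartAt_symm (I := 𝓘(ℝ, EM)) m (mem_extChartAt_target m)
  have hev : ∀ᶠ y in 𝓝 (extChartAt 𝓘(ℝ, EM) m m), (extChartAt 𝓘(ℝ, EM) m).symm y ∈ W :=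
    h0.self_of_nhds.continuousAt (hW.mem_nhds (by rwa [extChartAt_to_inv]))
  refine ⟨fun y => σ ((extChartAt 𝓘(ℝ, EM) m).symm y), ?_, ?_⟩
  · filter_upwards [h0, hev] with y h1 h2
    exact (hσ.contMDiffAt (hW.mem_nhds h2)).comp y h1
  · filter_upwards [hev] with y h1 using hσ' _ h1

/-- Forms on `M` are determined by their pullbacks along smooth maps to `P`. -/
theorem form_ext_of_plots {V : Type*} [NormedAddCommGroup V] [NormedSpace ℝ V] {θ θ' : Form EM M V n}
    (h : ∀ (s : EM → P) (x : EM), SmoothNear 𝓘(ℝ, EP) s x →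
      pullback 𝓘(ℝ, EM) 𝓘(ℝ, EM) (fun y => B.proj (s y)) θ x =
        pullback 𝓘(ℝ, EM) 𝓘(ℝ, EM) (fun y => B.proj (s y)) θ' x) : θ = θ' := by
  funext m
  obtain ⟨s, hs, hs'⟩ := B.exists_chart_section m
  apply eq_of_pullback_chart_eq (I := 𝓘(ℝ, EM))
  rw [← (pullback_congr hs' θ).eq_of_nhds, ← (pullback_congr hs' θ').eq_of_nhds]
  exact h s _ hs

/-- A compatible family of forms along the smooth maps to `P` descends to a form on `M`. -/
theorem exists_descended_form (Q : (EM → P) → EM → EM [⋀^Fin n]→L[ℝ] ℂ)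
    (hQ : ∀ (γ γ' : EM → P) (κ : EM → EM) (x : EM), SmoothNear 𝓘(ℝ, EP) γ x →
      SmoothNear 𝓘(ℝ, EP) γ' (κ x) → (∀ᶠ y in 𝓝 x, ContDiffAt ℝ ∞ κ y) →
      (∀ᶠ y in 𝓝 x, B.proj (γ y) = B.proj (γ' (κ y))) →
      Q γ x = (Q γ' (κ x)).compContinuousLinearMap (fderiv ℝ κ x))
    (hs : ∀ (γ : EM → P) (x : EM), SmoothNear 𝓘(ℝ, EP) γ x → ContDiffAt ℝ ∞ (Q γ) x) :
    ∃ θ : SmoothForm M 𝓘(ℝ, EM) ℂ n, ∀ (γ : EM → P) (x : EM), SmoothNear 𝓘(ℝ, EP) γ x →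
      pullback 𝓘(ℝ, EM) 𝓘(ℝ, EM) (fun y => B.proj (γ y)) θ.1 x = Q γ x := by
  choose s hs1 hs2 using fun m => B.exists_chart_section m
  let θ : Form EM M ℂ n := fun m => (Q (s m) (extChartAt 𝓘(ℝ, EM) m m)).compContinuousLinearMap
    (mfderiv 𝓘(ℝ, EM) 𝓘(ℝ, EM) (extChartAt 𝓘(ℝ, EM) m) m)
  have hθ : ∀ (γ : EM → P) (x : EM), SmoothNear 𝓘(ℝ, EP) γ x →
      pullback 𝓘(ℝ, EM) 𝓘(ℝ, EM) (fun y => B.proj (γ y)) θ x = Q γ x := by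
    intro γ x hγ
    have hπ := B.smoothNear_proj hγ
    have h0 := mem_extChartAt_source (I := 𝓘(ℝ, EM)) (B.proj (γ x))
    have hκ := hπ.chart_comp (x₀ := B.proj (γ x)) h0
    have hsrc : ∀ᶠ y in 𝓝 x, B.proj (γ y) ∈ (extChartAt 𝓘(ℝ, EM) (B.proj (γ x))).source :=
      hπ.self_of_nhds.continuousAt ((isOpen_extChartAt_source _).mem_nhds h0)
    have hx := hQ γ (s (B.proj (γ x))) (fun z => extChartAt 𝓘(ℝ, EM) (B.proj (γ x)) (B.proj (γ z))) x
      hγ (hs1 _) hκ (by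
        filter_upwards [hsrc, hκ.self_of_nhds.continuousAt.eventually (hs2 (B.proj (γ x)))]
          with y h1 h2
        rw [h2, (extChartAt 𝓘(ℝ, EM) (B.proj (γ x))).left_inv h1])
    rw [hx, ← mfderiv_eq_fderiv]
    have h3 : mfderiv 𝓘(ℝ, EM) 𝓘(ℝ, EM) (fun z => extChartAt 𝓘(ℝ, EM) (B.proj (γ x)) (B.proj (γ z))) x =
        mfderiv 𝓘(ℝ, EM) 𝓘(ℝ, EM) (extChartAt 𝓘(ℝ, EM) (B.proj (γ x))) (B.proj (γ x)) ∘L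
          mfderiv 𝓘(ℝ, EM) 𝓘(ℝ, EM) (fun y => B.proj (γ y)) x :=
      mfderiv_comp x (contMDiffAt_extChartAt_of_mem h0).mdifferentiableAt'
        hπ.self_of_nhds.mdifferentiableAt'
    rw [h3]
    rfl
  refine ⟨⟨θ, fun m₀ y hy => ?_⟩, hθ⟩
  have hy : y ∈ (extChartAt 𝓘(ℝ, EM) m₀).target := hy.1
  apply ContDiffAt.contDiffWithinAt
  obtain ⟨W, hW, hmW, σ, hσ, hσ', -⟩ := B.locally_trivial ((extChartAt 𝓘(ℝ, EM) m₀).symm y)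
  have h0 := smoothNear_extChartAt_symm (I := 𝓘(ℝ, EM)) m₀ hy
  have hev : ∀ᶠ z in 𝓝 y, (extChartAt 𝓘(ℝ, EM) m₀).symm z ∈ W :=
    h0.self_of_nhds.continuousAt (hW.mem_nhds hmW)
  have hρ : SmoothNear 𝓘(ℝ, EP) (fun z => σ ((extChartAt 𝓘(ℝ, EM) m₀).symm z)) y := by
    filter_upwards [h0, hev] with y h1 h2
    exact (hσ.contMDiffAt (hW.mem_nhds h2)).comp y h1
  refine (hs _ y hρ).congr_of_eventuallyEq ?_
  filter_upwards [hρ.eventually_nhds, hev.eventually_nhds] with z h1 h2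
  rw [← hθ _ z h1, chartRep]
  refine (pullback_congr (I := 𝓘(ℝ, EM)) (I' := 𝓘(ℝ, EM)) ?_ θ).eq_of_nhds
  filter_upwards [h2] with w hw using (hσ' _ hw).symm

/-- The pullback of a descended form along a smooth map to `P`. -/
theorem pullback_descended_form {Q : (EM → P) → EM → EM [⋀^Fin n]→L[ℝ] ℂ} {θ : Form EM M ℂ n}
    (hθ : ∀ (γ : EM → P) (x : EM), SmoothNear 𝓘(ℝ, EP) γ x →
      pullback 𝓘(ℝ, EM) 𝓘(ℝ, EM) (fun y => B.proj (γ y)) θ x = Q γ x)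
    {γ : F → P} {x : F} (hγ : SmoothNear 𝓘(ℝ, EP) γ x) {q : F [⋀^Fin n]→L[ℝ] ℂ}
    (hQ : ∀ (γ' : EM → P) (κ : F → EM), 
      SmoothNear 𝓘(ℝ, EP) γ' (κ x) → (∀ᶠ y in 𝓝 x, ContDiffAt ℝ ∞ κ y) →
      (∀ᶠ y in 𝓝 x, B.proj (γ y) = B.proj (γ' (κ y))) →
      q = (Q γ' (κ x)).compContinuousLinearMap (fderiv ℝ κ x)) :
    pullback 𝓘(ℝ, F) 𝓘(ℝ, EM) (fun y => B.proj (γ y)) θ x = q := by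
  have hπ := B.smoothNear_proj hγ
  have h0 := mem_extChartAt_source (I := 𝓘(ℝ, EM)) (B.proj (γ x))
  have hκ := hπ.chart_comp (x₀ := B.proj (γ x)) h0
  have hsrc : ∀ᶠ y in 𝓝 x, B.proj (γ y) ∈ (extChartAt 𝓘(ℝ, EM) (B.proj (γ x))).source :=
    hπ.self_of_nhds.continuousAt ((isOpen_extChartAt_source _).mem_nhds h0)
  obtain ⟨s, hs1, hs2⟩ := B.exists_chart_section (B.proj (γ x))
  have hev : ∀ᶠ y in 𝓝 x, B.proj (γ y) =
      B.proj (s (extChartAt 𝓘(ℝ, EM) (B.proj (γ x)) (B.proj (γ y)))) := by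
    filter_upwards [hsrc, hκ.self_of_nhds.continuousAt.eventually hs2] with y h1 h2
    rw [h2, (extChartAt 𝓘(ℝ, EM) (B.proj (γ x))).left_inv h1]
  rw [hQ s _ hs1 hκ hev, ← hθ s _ hs1, (pullback_congr (I := 𝓘(ℝ, F)) (I' := 𝓘(ℝ, EM)) hev θ).eq_of_nhds,
    pullback_comp_apply (I' := 𝓘(ℝ, EM)) (g := fun y => B.proj (s y))
      (κ := fun y => extChartAt 𝓘(ℝ, EM) (B.proj (γ x)) (B.proj (γ y))) θ
      (B.smoothNear_proj hs1).self_of_nhds.mdifferentiableAt'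
      hκ.self_of_nhds.contMDiffAt.mdifferentiableAt', ← mfderiv_eq_fderiv]
  rfl

end

section

section FiberIntegration

variable {E E' : Type*} [NormedAddCommGroup E] [NormedSpace ℝ E] [NormedAddCommGroup E']
  [NormedSpace ℝ E'] {n : ℕ}

theorem sliceIota_comp (L : E' →L[ℝ] E) (w : (E × ℝ) [⋀^Fin (n + 1)]→L[ℝ] ℂ) :
    sliceIota (w.compContinuousLinearMap (L.prodMap (ContinuousLinearMap.id ℝ ℝ))) =
      (sliceIota w).compContinuousLinearMap L := by
  ext v
  rw [sliceIota_apply, sliceIota_apply]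
  simp only [ContinuousAlternatingMap.compContinuousLinearMap_apply,
    ContinuousAlternatingMap.curryLeft_apply_apply]
  congr 1
  funext i
  refine Fin.cases ?_ (fun j => ?_) i
  · simp
  · simp

theorem fiberInt_comp {w : E × ℝ → (E × ℝ) [⋀^Fin (n + 1)]→L[ℝ] ℂ}
    {w' : E' × ℝ → (E' × ℝ) [⋀^Fin (n + 1)]→L[ℝ] ℂ} {x : E'} {y : E} (L : E' →L[ℝ] E)
    (hw : Continuous fun r : ℝ => sliceIota (w (y, r)))
    (h : ∀ r, w' (x, r) =
      (w (y, r)).compContinuousLinearMap (L.prodMap (ContinuousLinearMap.id ℝ ℝ))) :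
    fiberInt w' x = (fiberInt w y).compContinuousLinearMap L := by
  unfold fiberInt
  simp only [h, sliceIota_comp]
  let K : (E [⋀^Fin n]→L[ℝ] ℂ) →L[ℝ] (E' [⋀^Fin n]→L[ℝ] ℂ) :=
    ContinuousAlternatingMap.compContinuousLinearMapCLM L
  exact K.intervalIntegral_comp_comm (hw.intervalIntegrable 0 1)

end FiberIntegration

variable {H : Type*} [NormedAddCommGroup H] [InnerProductSpace ℂ H] [CompleteSpace H]
variable {EM M EP P : Type*} [NormedAddCommGroup EM] [NormedSpace ℝ EM] [TopologicalSpace M]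
  [ChartedSpace EM M] [NormedAddCommGroup EP] [NormedSpace ℝ EP] [TopologicalSpace P]
  [ChartedSpace EP P] [IsManifold 𝓘(ℝ, EM) ∞ M] [IsManifold 𝓘(ℝ, EP) ∞ P]
variable {B : PUBundle H EM M EP P} {nablaL : GerbeConnection B}
variable {F : Type*} [NormedAddCommGroup F] [NormedSpace ℝ F]
variable {F' : Type*} [NormedAddCommGroup F'] [NormedSpace ℝ F']

section Plots

variable {E : UtrModule B} (nabla₀ nabla₁ : ModuleConnection E nablaL) (Φ : AutPath E)
  (c : nablaL.Curving)

/-- The Chern form along a map, for the path parameter `r`. -/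
def chPlot (r : ℝ) (k : ℕ) (γ : F → P) (x : F) : F [⋀^Fin (2 * k + 1)]→L[ℝ] ℂ :=
  chAlong nabla₀ nabla₁ Φ c (E.cover (γ x)).choose γ (fun _ => r) k x

/-- The transgression form along a map. -/
def etaPlot (k : ℕ) (γ : F → P) (x : F) : F [⋀^Fin (2 * k)]→L[ℝ] ℂ :=
  fiberInt (chAlong nabla₀ nabla₁ Φ c (E.cover (γ x)).choose (fun z : F × ℝ => γ z.1)
    (fun z => z.2) k) x

variable {nabla₀ nabla₁ Φ c} {γ : F → P} {x : F} {i : E.ι}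

theorem chPlot_eq {r : ℝ} (hγ : SmoothNear 𝓘(ℝ, EP) γ x) (hi : γ x ∈ E.V i) (k : ℕ) :
    chPlot nabla₀ nabla₁ Φ c r k γ x = chAlong nabla₀ nabla₁ Φ c i γ (fun _ => r) k x :=
  chAlong_eq_of_proj hγ hγ (Filter.Eventually.of_forall fun _ => contDiffAt_const)
    Filter.EventuallyEq.rfl (E.cover (γ x)).choose_spec hi k

theorem chPlot_eventuallyEq {r : ℝ} (hγ : SmoothNear 𝓘(ℝ, EP) γ x) (hi : γ x ∈ E.V i) (k : ℕ) :
    chPlot nabla₀ nabla₁ Φ c r k γ =ᶠ[𝓝 x] chAlong nabla₀ nabla₁ Φ c i γ (fun _ => r) k := by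
  filter_upwards [hγ.eventually_nhds, eventually_mem_V hγ.self_of_nhds.continuousAt hi]
    with y h1 h2 using chPlot_eq h1 h2 k

theorem chPlot_comp {r : ℝ} {γ' : F' → P} {κ : F → F'} (hγ : SmoothNear 𝓘(ℝ, EP) γ x)
    (hγ' : SmoothNear 𝓘(ℝ, EP) γ' (κ x)) (hκ : ∀ᶠ y in 𝓝 x, ContDiffAt ℝ ∞ κ y)
    (hp : ∀ᶠ y in 𝓝 x, B.proj (γ y) = B.proj (γ' (κ y))) (k : ℕ) :
    chPlot nabla₀ nabla₁ Φ c r k γ x =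
      (chPlot nabla₀ nabla₁ Φ c r k γ' (κ x)).compContinuousLinearMap (fderiv ℝ κ x) := by
  have hc : ∀ {G : Type _} [NormedAddCommGroup G] [NormedSpace ℝ G] {y : G},
    ∀ᶠ z in 𝓝 y, ContDiffAt ℝ ∞ (fun _ : G => r) z :=
      Filter.Eventually.of_forall fun _ => contDiffAt_const
  rw [chPlot, chAlong_eq_of_proj hγ (SmoothNear.comp hγ' hκ) hc hp (E.cover (γ x)).choose_spec
    (E.cover (γ' (κ x))).choose_spec k]
  exact chAlong_comp (τ := fun _ => r) hκ hγ' (Filter.Eventually.of_forall fun _ => contDiffAt_const)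
    (E.cover (γ' (κ x))).choose_spec k

theorem contDiffAt_chPlot {r : ℝ} (hγ : SmoothNear 𝓘(ℝ, EP) γ x) (k : ℕ) :
    ContDiffAt ℝ ∞ (chPlot nabla₀ nabla₁ Φ c r k γ) x := by
  obtain ⟨i, hi⟩ := E.cover (γ x)
  exact (contDiffAt_chAlong hγ (Filter.Eventually.of_forall fun _ => contDiffAt_const) hi
    k).congr_of_eventuallyEq (chPlot_eventuallyEq hγ hi k)

theorem SmoothNear.fst (hγ : SmoothNear 𝓘(ℝ, EP) γ x) (r : ℝ) :
    SmoothNear 𝓘(ℝ, EP) (fun z : F × ℝ => γ z.1) (x, r) :=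
  SmoothNear.comp (κ := fun z : F × ℝ => z.1) hγ
    (Filter.Eventually.of_forall fun _ => contDiff_fst.contDiffAt)

theorem eventually_contDiffAt_snd {z : F × ℝ} :
    ∀ᶠ y in 𝓝 z, ContDiffAt ℝ ∞ (fun z : F × ℝ => z.2) y :=
  Filter.Eventually.of_forall fun _ => contDiff_snd.contDiffAt

theorem contDiffAt_chAlong_cylinder (hγ : SmoothNear 𝓘(ℝ, EP) γ x) (hi : γ x ∈ E.V i) (k : ℕ)
    (r : ℝ) : ContDiffAt ℝ ∞ (chAlong nabla₀ nabla₁ Φ c i (fun z : F × ℝ => γ z.1)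
      (fun z => z.2) k) (x, r) :=
  contDiffAt_chAlong (hγ.fst r) eventually_contDiffAt_snd hi k

theorem exists_open_smoothNear (hγ : SmoothNear 𝓘(ℝ, EP) γ x) (hi : γ x ∈ E.V i) :
    ∃ O : Set F, IsOpen O ∧ x ∈ O ∧ ∀ y ∈ O, SmoothNear 𝓘(ℝ, EP) γ y ∧ γ y ∈ E.V i := by
  obtain ⟨O, hO, hOo, hxO⟩ := eventually_nhds_iff.1
    (hγ.eventually_nhds.and (eventually_mem_V hγ.self_of_nhds.continuousAt hi))
  exact ⟨O, hOo, hxO, hO⟩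

theorem etaPlot_eq (hγ : SmoothNear 𝓘(ℝ, EP) γ x) (hi : γ x ∈ E.V i) (k : ℕ) :
    etaPlot nabla₀ nabla₁ Φ c k γ x =
      fiberInt (chAlong nabla₀ nabla₁ Φ c i (fun z : F × ℝ => γ z.1) (fun z => z.2) k) x := by
  unfold etaPlot fiberInt
  congr 1
  funext r
  rw [chAlong_eq_of_proj (hγ.fst r) (hγ.fst r) eventually_contDiffAt_snd Filter.EventuallyEq.rfl
    (E.cover (γ x)).choose_spec hi k]

theorem etaPlot_eventuallyEq (hγ : SmoothNear 𝓘(ℝ, EP) γ x) (hi : γ x ∈ E.V i) (k : ℕ) :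
    etaPlot nabla₀ nabla₁ Φ c k γ =ᶠ[𝓝 x]
      fiberInt (chAlong nabla₀ nabla₁ Φ c i (fun z : F × ℝ => γ z.1) (fun z => z.2) k) := by
  filter_upwards [hγ.eventually_nhds, eventually_mem_V hγ.self_of_nhds.continuousAt hi]
    with y h1 h2 using etaPlot_eq h1 h2 k

theorem etaPlot_comp {γ' : F' → P} {κ : F → F'} (hγ : SmoothNear 𝓘(ℝ, EP) γ x)
    (hγ' : SmoothNear 𝓘(ℝ, EP) γ' (κ x)) (hκ : ∀ᶠ y in 𝓝 x, ContDiffAt ℝ ∞ κ y)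
    (hp : ∀ᶠ y in 𝓝 x, B.proj (γ y) = B.proj (γ' (κ y))) (k : ℕ) :
    etaPlot nabla₀ nabla₁ Φ c k γ x =
      (etaPlot nabla₀ nabla₁ Φ c k γ' (κ x)).compContinuousLinearMap (fderiv ℝ κ x) := by
  have hi' := (E.cover (γ' (κ x))).choose_spec
  refine fiberInt_comp (fderiv ℝ κ x) (continuous_iff_continuousAt.2 fun r =>
    (contDiffAt_sliceIota (contDiffAt_chAlong_cylinder hγ' hi' k r)).continuousAt.comp
    (f := fun r : ℝ => (κ x, r)) (by fun_prop)) fun r => ?_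
  have hfst : Filter.Tendsto (fun z : F × ℝ => z.1) (𝓝 (x, r)) (𝓝 x) := continuous_fst.continuousAt
  have hκ2 : ∀ᶠ z in 𝓝 (x, r), ContDiffAt ℝ ∞ (fun z : F × ℝ => (κ z.1, z.2)) z := by
    filter_upwards [hfst.eventually hκ] with z hz
    exact (ContDiffAt.comp z hz contDiff_fst.contDiffAt).prodMk contDiff_snd.contDiffAt
  rw [chAlong_eq_of_proj (γ' := fun z : F × ℝ => γ' (κ z.1)) (hγ.fst r)
    (SmoothNear.fst (SmoothNear.comp hγ' hκ) r) eventually_contDiffAt_snd (hfst.eventually hp)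
    (E.cover (γ x)).choose_spec hi' k]
  have h1 := chAlong_comp (nabla₀ := nabla₀) (nabla₁ := nabla₁) (Φ := Φ) (c := c)
    (γ := fun z : F' × ℝ => γ' z.1) (τ := fun z : F' × ℝ => z.2)
    (κ := fun z : F × ℝ => (κ z.1, z.2)) (x := (x, r)) hκ2 (SmoothNear.fst hγ' r)
    eventually_contDiffAt_snd hi' k
  have h2 : fderiv ℝ (fun z : F × ℝ => (κ z.1, z.2)) (x, r) =
      (fderiv ℝ κ x).prodMap (ContinuousLinearMap.id ℝ ℝ) :=
    (HasFDerivAt.prodMap (x, r) hκ.self_of_nhds.differentiableAt'.hasFDerivAt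
      (hasFDerivAt_id r)).fderiv
  rw [h2] at h1
  exact h1

theorem contDiffAt_etaPlot (hγ : SmoothNear 𝓘(ℝ, EP) γ x) (k : ℕ) :
    ContDiffAt ℝ ∞ (etaPlot nabla₀ nabla₁ Φ c k γ) x := by
  obtain ⟨i, hi⟩ := E.cover (γ x)
  obtain ⟨O, hO, hxO, h⟩ := exists_open_smoothNear hγ hi
  exact ((contDiffOn_fiberInt hO fun y hy r =>
    contDiffAt_chAlong_cylinder (h y hy).1 (h y hy).2 k r).contDiffAt
      (hO.mem_nhds hxO)).congr_of_eventuallyEq (etaPlot_eventuallyEq hγ hi k)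

theorem extDeriv_chPlot {r : ℝ} (hγ : SmoothNear 𝓘(ℝ, EP) γ x) :
    extDeriv (chPlot nabla₀ nabla₁ Φ c r 0 γ) x = 0 ∧
      ∀ k (h : 3 + (2 * k + 1) = 2 * (k + 1) + 1 + 1),
      extDeriv (chPlot nabla₀ nabla₁ Φ c r (k + 1) γ) x =
        wedge (ContinuousLinearMap.mul ℝ ℂ) h
          (pullback 𝓘(ℝ, F) 𝓘(ℝ, EP) γ (extD 𝓘(ℝ, EP) c.f) x)
          (chPlot nabla₀ nabla₁ Φ c r k γ x) := by
  obtain ⟨i, hi⟩ := E.cover (γ x)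
  have h1 := extDeriv_chAlong (nabla₀ := nabla₀) (nabla₁ := nabla₁) (Φ := Φ) (c := c) (τ := fun _ => r)
    hγ (Filter.Eventually.of_forall fun _ => contDiffAt_const) hi
  refine ⟨?_, fun k h => ?_⟩
  · rw [(chPlot_eventuallyEq hγ hi 0).extDeriv_eq, h1.1]
  · rw [(chPlot_eventuallyEq hγ hi (k + 1)).extDeriv_eq, h1.2, chPlot_eq hγ hi]

theorem chAlong_slice (hγ : SmoothNear 𝓘(ℝ, EP) γ x) (hi : γ x ∈ E.V i) (k : ℕ) (r : ℝ) :
    (chAlong nabla₀ nabla₁ Φ c i (fun z : F × ℝ => γ z.1) (fun z => z.2) k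
      (x, r)).compContinuousLinearMap (ContinuousLinearMap.inl ℝ F ℝ) =
      chPlot nabla₀ nabla₁ Φ c r k γ x := by
  have h := chAlong_comp (nabla₀ := nabla₀) (nabla₁ := nabla₁) (Φ := Φ) (c := c) (i := i)
    (γ := fun z : F × ℝ => γ z.1) (τ := fun z : F × ℝ => z.2) (κ := fun y : F => (y, r)) (x := x)
    (Filter.Eventually.of_forall fun _ => by fun_prop) (hγ.fst r) eventually_contDiffAt_snd hi k
  rw [(hasFDerivAt_prodMk_left x r).fderiv] at h
  rw [chPlot_eq hγ hi, ← h]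

/-- The transgression formula along a map. -/
theorem extDeriv_etaPlot (hγ : SmoothNear 𝓘(ℝ, EP) γ x) :
    extDeriv (etaPlot nabla₀ nabla₁ Φ c 0 γ) x = chPlot nabla₀ nabla₁ Φ c 1 0 γ x -
      chPlot nabla₀ nabla₁ Φ c 0 0 γ x ∧
    ∀ k (h : 3 + 2 * k = 2 * (k + 1) + 1),
      extDeriv (etaPlot nabla₀ nabla₁ Φ c (k + 1) γ) x =
        chPlot nabla₀ nabla₁ Φ c 1 (k + 1) γ x - chPlot nabla₀ nabla₁ Φ c 0 (k + 1) γ x +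
        wedge (ContinuousLinearMap.mul ℝ ℂ) h
          (pullback 𝓘(ℝ, F) 𝓘(ℝ, EP) γ (extD 𝓘(ℝ, EP) c.f) x)
          (etaPlot nabla₀ nabla₁ Φ c k γ x) := by
  obtain ⟨i, hi⟩ := E.cover (γ x)
  obtain ⟨O, hO, hxO, h⟩ := exists_open_smoothNear hγ hi
  have hd (k : ℕ) := extDeriv_fiberInt hO (fun y hy r => contDiffAt_chAlong_cylinder
    (nabla₀ := nabla₀) (nabla₁ := nabla₁) (Φ := Φ) (c := c) (h y hy).1 (h y hy).2 k r) hxO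
  have hcl (r : ℝ) := extDeriv_chAlong (nabla₀ := nabla₀) (nabla₁ := nabla₁) (Φ := Φ) (c := c)
    (hγ.fst r) eventually_contDiffAt_snd hi
  refine ⟨?_, fun k hk => ?_⟩
  · rw [(etaPlot_eventuallyEq hγ hi 0).extDeriv_eq, hd, chAlong_slice hγ hi, chAlong_slice hγ hi]
    have h0 : fiberInt (extDeriv (chAlong nabla₀ nabla₁ Φ c i (fun z : F × ℝ => γ z.1)
        (fun z => z.2) 0)) x = 0 := by
      unfold fiberInt
      simp only [(hcl _).1, map_zero, intervalIntegral.integral_zero]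
    rw [h0, sub_zero]
  · rw [(etaPlot_eventuallyEq hγ hi (k + 1)).extDeriv_eq, hd, chAlong_slice hγ hi,
      chAlong_slice hγ hi, etaPlot_eq hγ hi]
    have h1 : fiberInt (n := 2 * k + 3) (extDeriv (chAlong nabla₀ nabla₁ Φ c i (fun z : F × ℝ => γ z.1)
        (fun z => z.2) (k + 1))) x = _ :=
      fiberInt_wedge (n := 2 * k) (fun y hy r => contDiffAt_chAlong_cylinder
      (nabla₀ := nabla₀) (nabla₁ := nabla₁) (Φ := Φ) (c := c) (h y hy).1 (h y hy).2 k r) hxO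
      (pullback 𝓘(ℝ, F) 𝓘(ℝ, EP) γ (extD 𝓘(ℝ, EP) c.f) x) (by omega) (by omega) fun r => by
        have e1 := (hcl r).2 k (by omega)
        have e2 := (eventually_pullback_comp (κ := fun z : F × ℝ => z.1) (x := (x, r))
          (extD 𝓘(ℝ, EP) c.f) (Filter.Eventually.of_forall fun _ => contDiff_fst.contDiffAt)
          hγ).self_of_nhds
        have e3 : fderiv ℝ (fun z : F × ℝ => z.1) (x, r) = ContinuousLinearMap.fst ℝ F ℝ :=
          hasFDerivAt_fst.fderiv
        rw [TraceAlgebra.pb, e3] at e2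
        rw [e2] at e1
        exact e1
    rw [show fiberInt (extDeriv (chAlong nabla₀ nabla₁ Φ c i (fun z : F × ℝ => γ z.1)
        (fun z => z.2) (k + 1))) x = _ from h1, sub_neg_eq_add]

end Plots

end

section

section MixedForms

variable {E X : Type*} [NormedAddCommGroup E] [NormedSpace ℝ E] [TopologicalSpace X]
  [ChartedSpace E X]

/-- The odd mixed form with given components. -/
def oddMixed (θ : ∀ k, SmoothForm X 𝓘(ℝ, E) ℂ (2 * k + 1)) : MixedForm E X := fun n =>
  if h : n = 2 * (n / 2) + 1 then
    cast (congrArg (fun n => ↥(SmoothForm X 𝓘(ℝ, E) ℂ n)) h.symm) (θ (n / 2)) else 0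

theorem oddMixed_odd (θ : ∀ k, SmoothForm X 𝓘(ℝ, E) ℂ (2 * k + 1)) (k : ℕ) :
    oddMixed θ (2 * k + 1) = θ k := by
  have h : (2 * k + 1) / 2 = k := by omega
  rw [oddMixed, dif_pos (by omega)]
  apply eq_of_heq
  refine (cast_heq _ _).trans ?_
  rw [h]

theorem oddMixed_even (θ : ∀ k, SmoothForm X 𝓘(ℝ, E) ℂ (2 * k + 1)) (k : ℕ) :
    oddMixed θ (2 * k) = 0 := by
  rw [oddMixed, dif_neg (by omega)]

/-- The even mixed form with given components. -/
def evenMixed (θ : ∀ k, SmoothForm X 𝓘(ℝ, E) ℂ (2 * k)) : MixedForm E X := fun n =>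
  if h : n = 2 * (n / 2) then
    cast (congrArg (fun n => ↥(SmoothForm X 𝓘(ℝ, E) ℂ n)) h.symm) (θ (n / 2)) else 0

theorem evenMixed_even (θ : ∀ k, SmoothForm X 𝓘(ℝ, E) ℂ (2 * k)) (k : ℕ) :
    evenMixed θ (2 * k) = θ k := by
  have h : (2 * k) / 2 = k := by omega
  rw [evenMixed, dif_pos (by omega)]
  apply eq_of_heq
  refine (cast_heq _ _).trans ?_
  rw [h]

theorem evenMixed_odd (θ : ∀ k, SmoothForm X 𝓘(ℝ, E) ℂ (2 * k)) (k : ℕ) :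
    evenMixed θ (2 * k + 1) = 0 := by
  rw [evenMixed, dif_neg (by omega)]

theorem mem_parityForms_one {θ : MixedForm E X} :
    θ ∈ parityForms E X 1 ↔ ∀ k, θ (2 * k) = 0 := by
  refine ⟨fun h k => h _ (by simp [Nat.ModEq]), fun h n hn => ?_⟩
  obtain ⟨k, rfl | rfl⟩ : ∃ k, n = 2 * k ∨ n = 2 * k + 1 := ⟨n / 2, by omega⟩
  · exact h k
  · exact absurd (by simp [Nat.ModEq, Nat.add_mod]) hn

theorem mem_parityForms_zero {θ : MixedForm E X} :
    θ ∈ parityForms E X 0 ↔ ∀ k, θ (2 * k + 1) = 0 := by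
  refine ⟨fun h k => h _ (by simp [Nat.ModEq, Nat.add_mod]), fun h n hn => ?_⟩
  obtain ⟨k, rfl | rfl⟩ : ∃ k, n = 2 * k ∨ n = 2 * k + 1 := ⟨n / 2, by omega⟩
  · exact absurd (by simp [Nat.ModEq]) hn
  · exact h k

theorem extD_zero_form {n : ℕ} :
    extD 𝓘(ℝ, E) ((0 : SmoothForm X 𝓘(ℝ, E) ℂ n) : Form E X ℂ n) = 0 := by
  have h := extD_smul (X := X) 𝓘(ℝ, E) 0 ((0 : SmoothForm X 𝓘(ℝ, E) ℂ n) : Form E X ℂ n)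
  simpa using h

theorem twistedD_odd_eq_zero {Θ : SmoothForm X 𝓘(ℝ, E) ℂ 3} {θ : MixedForm E X}
    (hθ : ∀ k, θ (2 * k) = 0) (h0 : extD 𝓘(ℝ, E) (θ 1).1 = 0)
    (hs : ∀ k (h : 3 + (2 * k + 1) = 2 * (k + 1) + 1 + 1),
      extD 𝓘(ℝ, E) (θ (2 * (k + 1) + 1)).1 = fun m =>
        wedge (ContinuousLinearMap.mul ℝ ℂ) h (Θ.1 m) ((θ (2 * k + 1)).1 m)) :
    twistedD Θ θ = 0 := by
  funext n
  match n with
  | 0 => rfl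
  | 1 =>
    change extD 𝓘(ℝ, E) (θ 0).1 = 0
    rw [show θ 0 = 0 from hθ 0]
    exact extD_zero_form
  | 2 => exact h0
  | n + 3 =>
    change extD 𝓘(ℝ, E) (θ (n + 2)).1 - _ = 0
    obtain ⟨k, rfl | rfl⟩ : ∃ k, n = 2 * k ∨ n = 2 * k + 1 := ⟨n / 2, by omega⟩
    · rw [show θ (2 * k + 2) = 0 from hθ (k + 1), hθ k, extD_zero_form]
      funext x
      have e : wedge (ContinuousLinearMap.mul ℝ ℂ) (Nat.add_comm 3 (2 * k)) (Θ.1 x)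
        (0 : E [⋀^Fin (2 * k)]→L[ℝ] ℂ) = 0 := wedge_zero_right' _ _ _
      exact sub_eq_zero.2 e.symm
    · exact sub_eq_zero.2 (hs k (by omega))

theorem twistedD_even_eq {Θ : SmoothForm X 𝓘(ℝ, E) ℂ 3} {θ η : MixedForm E X}
    (hθ : ∀ k, θ (2 * k) = 0) (hη : ∀ k, η (2 * k + 1) = 0)
    (h0 : extD 𝓘(ℝ, E) (η 0).1 = (θ 1).1)
    (hs : ∀ k (h : 3 + 2 * k = 2 * (k + 1) + 1),
      extD 𝓘(ℝ, E) (η (2 * (k + 1))).1 = fun m => (θ (2 * (k + 1) + 1)).1 m +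
        wedge (ContinuousLinearMap.mul ℝ ℂ) h (Θ.1 m) ((η (2 * k)).1 m)) :
    twistedD Θ η = components θ := by
  funext n
  match n with
  | 0 => exact (congrArg Subtype.val (hθ 0)).symm
  | 1 => exact h0
  | 2 =>
    change extD 𝓘(ℝ, E) (η 1).1 = (θ 2).1
    rw [show η 1 = 0 from hη 0, show θ 2 = 0 from hθ 1]
    exact extD_zero_form
  | n + 3 =>
    change extD 𝓘(ℝ, E) (η (n + 2)).1 - _ = (θ (n + 3)).1
    obtain ⟨k, rfl | rfl⟩ : ∃ k, n = 2 * k ∨ n = 2 * k + 1 := ⟨n / 2, by omega⟩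
    · rw [sub_eq_iff_eq_add]
      exact hs k (by omega)
    · rw [show η (2 * k + 1 + 2) = 0 from hη (k + 1), hη k,
        show θ (2 * k + 1 + 3) = 0 from hθ (k + 2), extD_zero_form]
      funext x
      have e : wedge (ContinuousLinearMap.mul ℝ ℂ) (Nat.add_comm 3 (2 * k + 1)) (Θ.1 x)
        (0 : E [⋀^Fin (2 * k + 1)]→L[ℝ] ℂ) = 0 := wedge_zero_right' _ _ _
      exact sub_eq_zero.2 e.symm

theorem mkQ_eq_of_twistedD {Θ : SmoothForm X 𝓘(ℝ, E) ℂ 3} {θ θ' : closedOdd Θ} {η : MixedForm E X}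
    (hη : η ∈ parityForms E X 0) (h : twistedD Θ η = components (θ.1 - θ'.1)) :
    (exactOdd Θ).mkQ θ = (exactOdd Θ).mkQ θ' := by
  rw [← sub_eq_zero, ← map_sub, Submodule.mkQ_apply, Submodule.Quotient.mk_eq_zero]
  exact ⟨η, hη, h⟩

end MixedForms

variable {H : Type*} [NormedAddCommGroup H] [InnerProductSpace ℂ H] [CompleteSpace H]
variable {EM M EP P : Type*} [NormedAddCommGroup EM] [NormedSpace ℝ EM] [TopologicalSpace M]
  [ChartedSpace EM M] [NormedAddCommGroup EP] [NormedSpace ℝ EP] [TopologicalSpace P]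
  [ChartedSpace EP P] [IsManifold 𝓘(ℝ, EM) ∞ M] [IsManifold 𝓘(ℝ, EP) ∞ P]
variable {B : PUBundle H EM M EP P} {nablaL : GerbeConnection B}
variable {F : Type*} [NormedAddCommGroup F] [NormedSpace ℝ F]

section Descent

variable {E : UtrModule B} (nabla₀ nabla₁ : ModuleConnection E nablaL) (Φ : AutPath E)
  (c : nablaL.Curving)

theorem exists_chM (r : ℝ) (k : ℕ) : ∃ θ : SmoothForm M 𝓘(ℝ, EM) ℂ (2 * k + 1),
    ∀ (γ : EM → P) (x : EM), SmoothNear 𝓘(ℝ, EP) γ x →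
      pullback 𝓘(ℝ, EM) 𝓘(ℝ, EM) (fun y => B.proj (γ y)) θ.1 x =
        chPlot nabla₀ nabla₁ Φ c r k γ x :=
  exists_descended_form _ (fun _ _ _ _ h1 h2 h3 h4 => chPlot_comp h1 h2 h3 h4 k)
    fun _ _ h => contDiffAt_chPlot h k

/-- The Chern form on `M`, for the path parameter `r`. -/
def chM (r : ℝ) (k : ℕ) : SmoothForm M 𝓘(ℝ, EM) ℂ (2 * k + 1) :=
  (exists_chM nabla₀ nabla₁ Φ c r k).choose

theorem exists_etaM (k : ℕ) : ∃ θ : SmoothForm M 𝓘(ℝ, EM) ℂ (2 * k),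
    ∀ (γ : EM → P) (x : EM), SmoothNear 𝓘(ℝ, EP) γ x →
      pullback 𝓘(ℝ, EM) 𝓘(ℝ, EM) (fun y => B.proj (γ y)) θ.1 x =
        etaPlot nabla₀ nabla₁ Φ c k γ x :=
  exists_descended_form _ (fun _ _ _ _ h1 h2 h3 h4 => etaPlot_comp h1 h2 h3 h4 k)
    fun _ _ h => contDiffAt_etaPlot h k

/-- The transgression form on `M`. -/
def etaM (k : ℕ) : SmoothForm M 𝓘(ℝ, EM) ℂ (2 * k) := (exists_etaM nabla₀ nabla₁ Φ c k).choose

theorem pullback_chM {r : ℝ} {k : ℕ} {γ : F → P} {x : F} (hγ : SmoothNear 𝓘(ℝ, EP) γ x) :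
    pullback 𝓘(ℝ, F) 𝓘(ℝ, EM) (fun y => B.proj (γ y)) (chM nabla₀ nabla₁ Φ c r k).1 x =
      chPlot nabla₀ nabla₁ Φ c r k γ x :=
  pullback_descended_form (exists_chM nabla₀ nabla₁ Φ c r k).choose_spec hγ
    fun _ _ h2 h3 h4 => chPlot_comp hγ h2 h3 h4 k

theorem pullback_etaM {k : ℕ} {γ : EM → P} {x : EM} (hγ : SmoothNear 𝓘(ℝ, EP) γ x) :
    pullback 𝓘(ℝ, EM) 𝓘(ℝ, EM) (fun y => B.proj (γ y)) (etaM nabla₀ nabla₁ Φ c k).1 x =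
      etaPlot nabla₀ nabla₁ Φ c k γ x :=
  (exists_etaM nabla₀ nabla₁ Φ c k).choose_spec γ x hγ

theorem pullback_extD_eq {n : ℕ} {θ : SmoothForm M 𝓘(ℝ, EM) ℂ n}
    {Q : EM → EM [⋀^Fin n]→L[ℝ] ℂ} {γ : EM → P} {x : EM} (hγ : SmoothNear 𝓘(ℝ, EP) γ x)
    (h : ∀ y, SmoothNear 𝓘(ℝ, EP) γ y →
      pullback 𝓘(ℝ, EM) 𝓘(ℝ, EM) (fun y => B.proj (γ y)) θ.1 y = Q y) :
    pullback 𝓘(ℝ, EM) 𝓘(ℝ, EM) (fun y => B.proj (γ y)) (extD 𝓘(ℝ, EM) θ.1) x = extDeriv Q x := by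
  rw [← extDeriv_pullback_eq θ.2 isOpen_univ (B.smoothNear_proj hγ) (Set.mem_univ _)]
  refine Filter.EventuallyEq.extDeriv_eq ?_
  filter_upwards [hγ.eventually_nhds] with y hy using h y hy

variable {c} {Θ : SmoothForm M 𝓘(ℝ, EM) ℂ 3}

theorem pullback_threeCurvature (hΘ : c.IsThreeCurvature Θ) {γ : EM → P} {x : EM} (hγ : SmoothNear 𝓘(ℝ, EP) γ x) :
    pullback 𝓘(ℝ, EM) 𝓘(ℝ, EP) γ (extD 𝓘(ℝ, EP) c.f) x =
      pullback 𝓘(ℝ, EM) 𝓘(ℝ, EM) (fun y => B.proj (γ y)) Θ.1 x := by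
  rw [hΘ]
  exact (pullback_comp_apply (I' := 𝓘(ℝ, EP)) (g := B.proj) (κ := γ) Θ.1
    B.contMDiff_proj.contMDiffAt.mdifferentiableAt' hγ.self_of_nhds.mdifferentiableAt').symm

theorem extD_chM_zero (r : ℝ) : extD 𝓘(ℝ, EM) (chM nabla₀ nabla₁ Φ c r 0).1 = 0 := by
  refine form_ext_of_plots (B := B) fun γ x hγ => ?_
  rw [pullback_extD_eq hγ fun y hy => pullback_chM nabla₀ nabla₁ Φ c (r := r) hy,
    (extDeriv_chPlot hγ).1]
  rfl

theorem extD_chM_succ (hΘ : c.IsThreeCurvature Θ) (r : ℝ) (k : ℕ) (h : 3 + (2 * k + 1) = 2 * (k + 1) + 1 + 1) :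
    extD 𝓘(ℝ, EM) (chM nabla₀ nabla₁ Φ c r (k + 1)).1 = fun m =>
      wedge (ContinuousLinearMap.mul ℝ ℂ) h (Θ.1 m) ((chM nabla₀ nabla₁ Φ c r k).1 m) := by
  refine form_ext_of_plots (B := B) fun γ x hγ => ?_
  rw [pullback_extD_eq hγ fun y hy => pullback_chM nabla₀ nabla₁ Φ c (r := r) hy,
    (extDeriv_chPlot hγ).2 k h, ← pullback_chM nabla₀ nabla₁ Φ c (r := r) hγ,
    pullback_threeCurvature hΘ hγ]
  exact (wedge_compContinuousLinearMap _ h _ _ _).symm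

theorem extD_etaM_zero : extD 𝓘(ℝ, EM) (etaM nabla₀ nabla₁ Φ c 0).1 =
    (chM nabla₀ nabla₁ Φ c 1 0).1 - (chM nabla₀ nabla₁ Φ c 0 0).1 := by
  refine form_ext_of_plots (B := B) fun γ x hγ => ?_
  rw [pullback_extD_eq hγ fun y hy => pullback_etaM nabla₀ nabla₁ Φ c hy,
    (extDeriv_etaPlot hγ).1, ← pullback_chM nabla₀ nabla₁ Φ c hγ, ← pullback_chM nabla₀ nabla₁ Φ c hγ]
  rfl

theorem extD_etaM_succ (hΘ : c.IsThreeCurvature Θ) (k : ℕ) (h : 3 + 2 * k = 2 * (k + 1) + 1) :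
    extD 𝓘(ℝ, EM) (etaM nabla₀ nabla₁ Φ c (k + 1)).1 = fun m =>
      ((chM nabla₀ nabla₁ Φ c 1 (k + 1)).1 m - (chM nabla₀ nabla₁ Φ c 0 (k + 1)).1 m) +
        wedge (ContinuousLinearMap.mul ℝ ℂ) h (Θ.1 m) ((etaM nabla₀ nabla₁ Φ c k).1 m) := by
  refine form_ext_of_plots (B := B) fun γ x hγ => ?_
  rw [pullback_extD_eq hγ fun y hy => pullback_etaM nabla₀ nabla₁ Φ c hy,
    (extDeriv_etaPlot hγ).2 k h, ← pullback_chM nabla₀ nabla₁ Φ c hγ,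
    ← pullback_chM nabla₀ nabla₁ Φ c hγ, ← pullback_etaM nabla₀ nabla₁ Φ c hγ,
    pullback_threeCurvature hΘ hγ]
  have e := wedge_compContinuousLinearMap (ContinuousLinearMap.mul ℝ ℂ) h (Θ.1 (B.proj (γ x)))
    ((etaM nabla₀ nabla₁ Φ c k).1 (B.proj (γ x)))
    (show EM →L[ℝ] EM from mfderiv 𝓘(ℝ, EM) 𝓘(ℝ, EM) (fun y => B.proj (γ y)) x)
  unfold pullback
  exact congrArg _ e.symm

/-- The Chern form on `M` as a closed odd form. -/
def chClosed (hΘ : c.IsThreeCurvature Θ) (r : ℝ) : closedOdd Θ :=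
  ⟨oddMixed (chM nabla₀ nabla₁ Φ c r), mem_parityForms_one.2 (oddMixed_even _), by
    refine twistedD_odd_eq_zero (oddMixed_even _) ?_ fun k h => ?_
    · rw [show oddMixed (chM nabla₀ nabla₁ Φ c r) 1 = _ from oddMixed_odd _ 0]
      exact extD_chM_zero nabla₀ nabla₁ Φ r
    · rw [oddMixed_odd, oddMixed_odd]
      exact extD_chM_succ nabla₀ nabla₁ Φ hΘ r k h⟩

theorem mkQ_chClosed_eq (hΘ : c.IsThreeCurvature Θ) : (exactOdd Θ).mkQ (chClosed nabla₀ nabla₁ Φ hΘ 1) =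
    (exactOdd Θ).mkQ (chClosed nabla₀ nabla₁ Φ hΘ 0) := by
  have ho (k : ℕ) : (oddMixed (chM nabla₀ nabla₁ Φ c 1) - oddMixed (chM nabla₀ nabla₁ Φ c 0))
      (2 * k + 1) = chM nabla₀ nabla₁ Φ c 1 k - chM nabla₀ nabla₁ Φ c 0 k := by
    change oddMixed _ _ - oddMixed _ _ = _
    rw [oddMixed_odd, oddMixed_odd]
  refine mkQ_eq_of_twistedD (η := evenMixed (etaM nabla₀ nabla₁ Φ c))
    (mem_parityForms_zero.2 (evenMixed_odd _))
    (twistedD_even_eq (fun k => ?_) (evenMixed_odd _) ?_ fun k h => ?_)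
  · change oddMixed _ _ - oddMixed _ _ = 0
    rw [oddMixed_even, oddMixed_even, sub_zero]
  · rw [show evenMixed (etaM nabla₀ nabla₁ Φ c) 0 = _ from evenMixed_even _ 0,
      extD_etaM_zero nabla₀ nabla₁ Φ]
    exact congrArg Subtype.val (ho 0).symm
  · rw [evenMixed_even, evenMixed_even, extD_etaM_succ nabla₀ nabla₁ Φ hΘ k h]
    have := congrArg Subtype.val (ho (k + 1))
    funext m
    exact congrArg (· + _) (congrFun this m).symm

end Descent

end

section

variable {H : Type*} [NormedAddCommGroup H] [InnerProductSpace ℂ H] [CompleteSpace H]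
variable {EM M EP P : Type*} [NormedAddCommGroup EM] [NormedSpace ℝ EM] [TopologicalSpace M]
  [ChartedSpace EM M] [NormedAddCommGroup EP] [NormedSpace ℝ EP] [TopologicalSpace P]
  [ChartedSpace EP P]
variable {B : PUBundle H EM M EP P} {nablaL : GerbeConnection B}
variable {F : Type*} [NormedAddCommGroup F] [NormedSpace ℝ F]

theorem UtrModule.IsTrAut.congr {E : UtrModule B} {φ φ' : E.ι → P → Op H} (h : E.IsTrAut φ)
    (he : ∀ i, ∀ p ∈ E.V i, φ i p = φ' i p) : E.IsTrAut φ' where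
  isUnit i p hp := he i p hp ▸ h.isUnit i p hp
  traceClass i p hp := he i p hp ▸ h.traceClass i p hp
  transition i j p hp := by
    rw [← he i p hp.1, ← he j p hp.2, h.transition i j p hp]
  module j i x hi hj := by
    rw [← he i _ hi, ← he j _ hj, h.module j i x hi hj]

/-- The constant path at an automorphism. -/
def TrAut.constPath {E : UtrModule B} (φ : TrAut E) : AutPath E where
  T i z := (φ.smooth i).choose z.1
  smooth i := (φ.smooth i).choose_spec.1.comp contMDiffOn_fst fun _ h => h.1
  isTrAut _ := φ.isTrAut.congr fun i => (φ.smooth i).choose_spec.2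

theorem TrAut.constPath_spec {E : UtrModule B} (φ : TrAut E) (r : ℝ) (i : E.ι) (p : P)
    (hp : p ∈ E.V i) : φ.φ i p = 1 + (φ.constPath.T i (p, r)).toOp :=
  (φ.smooth i).choose_spec.2 p hp

/-- The trace class valued form `(1 + t)⁻¹ (dt + [A, t])`. -/
def trDiff (A : Form EP P (Op H) 1) (t : P → TraceClass H) : Form EP P (TraceClass H) 1 := fun p =>
  ((opTA H).lm (Ring.inverse (1 + (t p).toOp))).compContinuousAlternatingMap
    (dFun 𝓘(ℝ, EP) t p + ((opTA H).lm.flip (t p)).compContinuousAlternatingMap (A p) -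
      ((opTA H).rm (t p)).compContinuousAlternatingMap (A p))

theorem pullback_trDiff {A : Form EP P (Op H) 1} {t : P → TraceClass H} {γ : F → P} {x : F}
    (ht : MDifferentiableAt 𝓘(ℝ, EP) 𝓘(ℝ, TraceClass H) t (γ x))
    (hγ : MDifferentiableAt 𝓘(ℝ, F) 𝓘(ℝ, EP) γ x) :
    pullback 𝓘(ℝ, F) 𝓘(ℝ, EP) γ (trDiff A t) x =
      (opTA H).diffT (pullback 𝓘(ℝ, F) 𝓘(ℝ, EP) γ A) (fun y => t (γ y))
        (fun y => Ring.inverse (1 + (t (γ y)).toOp)) x := by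
  have h : fderiv ℝ (fun y => t (γ y)) x =
      mfderiv 𝓘(ℝ, EP) 𝓘(ℝ, TraceClass H) t (γ x) ∘L mfderiv 𝓘(ℝ, F) 𝓘(ℝ, EP) γ x := by
    rw [← mfderiv_eq_fderiv]
    exact mfderiv_comp x ht hγ
  rw [TraceAlgebra.diffT, h]
  rfl

theorem toOp_trDiff {A : Form EP P (Op H) 1} {t : P → TraceClass H} {φ : P → Op H} {p : P}
    (ht : MDifferentiableAt 𝓘(ℝ, EP) 𝓘(ℝ, TraceClass H) t p)
    (hφ : φ =ᶠ[𝓝 p] fun q => 1 + (t q).toOp) (hu : IsUnit (φ p)) (v : Fin 1 → EP) :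
    (trDiff A t p v).toOp = Ring.inverse (φ p) * A p v * φ p +
      Ring.inverse (φ p) * dFun 𝓘(ℝ, EP) φ p v - A p v := by
  have h1 : mfderiv 𝓘(ℝ, EP) 𝓘(ℝ, Op H) φ p =
      (opTA H).incl ∘L mfderiv 𝓘(ℝ, EP) 𝓘(ℝ, TraceClass H) t p := by
    have h2 : HasFDerivAt (fun T : TraceClass H => (1 : Op H) + T.toOp) (opTA H).incl (t p) :=
      (opTA H).incl.hasFDerivAt.const_add _
    have h4 : mfderiv 𝓘(ℝ, EP) 𝓘(ℝ, Op H) φ p =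
        mfderiv 𝓘(ℝ, EP) 𝓘(ℝ, Op H) ((fun T : TraceClass H => (1 : Op H) + T.toOp) ∘ t) p :=
      hφ.mfderiv_eq
    rw [h4, mfderiv_comp (I' := 𝓘(ℝ, TraceClass H)) p h2.differentiableAt.mdifferentiableAt ht,
      mfderiv_eq_fderiv, h2.fderiv]
    rfl
  have hp := hφ.eq_of_nhds
  have h3 : dFun 𝓘(ℝ, EP) φ p v = (dFun 𝓘(ℝ, EP) t p v).toOp := congrArg (fun L => L (v 0)) h1
  change Ring.inverse (1 + (t p).toOp) * ((dFun 𝓘(ℝ, EP) t p v).toOp + A p v * (t p).toOp -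
    (t p).toOp * A p v) = _
  have e : (t p).toOp = φ p - 1 := by rw [hp]; abel
  rw [h3, ← hp, e]
  have e2 := Ring.inverse_mul_cancel _ hu
  calc _ = Ring.inverse (φ p) * A p v * φ p + Ring.inverse (φ p) * (dFun 𝓘(ℝ, EP) t p v).toOp -
      (Ring.inverse (φ p) * φ p) * A p v := by noncomm_ring
    _ = _ := by rw [e2, one_mul]

theorem formPow_comp {G : Form EP P (Op H) 2} {p : P} (k : ℕ) :
    formPow G k p = (opTA H).altPow (G p) k := by
  induction k with
  | zero => rfl
  | succ k ih => exact congrArg (fun η => wedge (ContinuousLinearMap.mul ℝ (Op H)) rfl η (G p)) ih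

section Density

variable [IsManifold 𝓘(ℝ, EP) ∞ P]
variable {E : UtrModule B} {nabla : ModuleConnection E nablaL} {φ : TrAut E}
  {nabla₀ nabla₁ : ModuleConnection E nablaL} {Φ : AutPath E} {c : nablaL.Curving} {r : ℝ}

/-- The path of connections and automorphisms passes through `(∇, φ)` at the parameter `r`. -/
structure PassesThrough (nabla₀ nabla₁ : ModuleConnection E nablaL) (Φ : AutPath E) (r : ℝ)
    (nabla : ModuleConnection E nablaL) (φ : TrAut E) : Prop where
  conn : ∀ i, (1 - r) • nabla₀.A i + r • nabla₁.A i = nabla.A i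
  aut : ∀ i, ∀ p ∈ E.V i, φ.φ i p = 1 + (Φ.T i (p, r)).toOp

theorem passesThrough_constPath (nabla : ModuleConnection E nablaL) (φ : TrAut E) :
    PassesThrough nabla nabla φ.constPath 0 nabla φ :=
  ⟨fun i => by simp, φ.constPath_spec 0⟩

variable {i : E.ι} {γ : F → P} {x : F}

theorem AutPath.contMDiffAt (Φ : AutPath E) {p : P} (hp : p ∈ E.V i) (r : ℝ) :
    ContMDiffAt 𝓘(ℝ, EP) 𝓘(ℝ, TraceClass H) ∞ (fun p => Φ.T i (p, r)) p := by
  have h1 : ContMDiffAt (𝓘(ℝ, EP).prod 𝓘(ℝ, ℝ)) 𝓘(ℝ, TraceClass H) ∞ (Φ.T i) (p, r) :=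
    (Φ.smooth i).contMDiffAt (((E.isOpen i).prod isOpen_univ).mem_nhds ⟨hp, Set.mem_univ _⟩)
  exact h1.comp p (contMDiffAt_id.prodMk contMDiffAt_const)

theorem PassesThrough.aAlong_eq (h : PassesThrough nabla₀ nabla₁ Φ r nabla φ) (y : F) :
    aAlong nabla₀ nabla₁ i γ (fun _ => r) y = pullback 𝓘(ℝ, F) 𝓘(ℝ, EP) γ (nabla.A i) y := by
  rw [← h.conn]
  rfl

theorem PassesThrough.pullback_trDiff (h : PassesThrough nabla₀ nabla₁ Φ r nabla φ)
    (hγ : ContMDiffAt 𝓘(ℝ, F) 𝓘(ℝ, EP) ∞ γ x) (hi : γ x ∈ E.V i) :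
    pullback 𝓘(ℝ, F) 𝓘(ℝ, EP) γ (trDiff (nabla.A i) (fun p => Φ.T i (p, r))) x =
      diffAlong nabla₀ nabla₁ Φ i γ (fun _ => r) x := by
  rw [OddChern.pullback_trDiff (Φ.contMDiffAt hi r).mdifferentiableAt' hγ.mdifferentiableAt',
    diffAlong, TraceAlgebra.diffT, TraceAlgebra.diffT, h.aAlong_eq]
  rfl

theorem PassesThrough.toOp_trDiff (h : PassesThrough nabla₀ nabla₁ Φ r nabla φ) {p : P}
    (hi : p ∈ E.V i) (v : Fin 1 → EP) :
    (trDiff (nabla.A i) (fun p => Φ.T i (p, r)) p v).toOp = nabla.diff φ i p v := by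
  refine (OddChern.toOp_trDiff (Φ.contMDiffAt hi r).mdifferentiableAt' ?_
    (φ.isTrAut.isUnit i p hi) v).trans rfl
  filter_upwards [(E.isOpen i).mem_nhds hi] with q hq using h.aut i q hq

theorem isSmoothOn_of_pullback {V : Type*} [NormedAddCommGroup V] [NormedSpace ℝ V] {n : ℕ}
    {θ : Form EP P V n} {s : Set P}
    (h : ∀ (γ : EP → P) (x : EP), SmoothNear 𝓘(ℝ, EP) γ x → γ x ∈ s →
      ContDiffAt ℝ ∞ (pullback 𝓘(ℝ, EP) 𝓘(ℝ, EP) γ θ) x) : IsSmoothOn 𝓘(ℝ, EP) θ s :=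
  fun x₀ y hy => (h _ y (smoothNear_extChartAt_symm x₀ hy.1) hy.2).contDiffWithinAt

theorem contDiffAt_aAlong_const (hγ : SmoothNear 𝓘(ℝ, EP) γ x) (hi : γ x ∈ E.V i) :
    ContDiffAt ℝ ∞ (aAlong nabla₀ nabla₁ i γ (fun _ => r)) x :=
  contDiffAt_aAlong hγ contDiffAt_const hi

theorem contDiffAt_diffAlong_const (hγ : SmoothNear 𝓘(ℝ, EP) γ x) (hi : γ x ∈ E.V i) :
    ContDiffAt ℝ ∞ (diffAlong nabla₀ nabla₁ Φ i γ (fun _ => r)) x :=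
  contDiffAt_diffAlong hγ contDiffAt_const hi

theorem PassesThrough.isSmoothOn_trDiff (h : PassesThrough nabla₀ nabla₁ Φ r nabla φ) :
    IsSmoothOn 𝓘(ℝ, EP) (trDiff (nabla.A i) (fun p => Φ.T i (p, r))) (E.V i) := by
  refine isSmoothOn_of_pullback fun γ x hγ hi => ?_
  refine (contDiffAt_diffAlong_const (nabla₀ := nabla₀) (nabla₁ := nabla₁) (Φ := Φ) (r := r)
    hγ hi).congr_of_eventuallyEq ?_
  filter_upwards [hγ, eventually_mem_V hγ.self_of_nhds.continuousAt hi] with y h1 h2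
  exact h.pullback_trDiff h1 h2

theorem PassesThrough.pullback_path (h : PassesThrough nabla₀ nabla₁ Φ r nabla φ)
    (hγ : ContMDiffAt 𝓘(ℝ, F) 𝓘(ℝ, EP) ∞ γ x) (hi : γ x ∈ E.V i) (s : ℝ) :
    pullback 𝓘(ℝ, F) 𝓘(ℝ, EP) γ (nabla.path φ s i) x =
      (opTA H).pathForm (aAlong nabla₀ nabla₁ i γ (fun _ => r))
        (diffAlong nabla₀ nabla₁ Φ i γ (fun _ => r)) s x := by
  ext1 v
  change s • nabla.gauge φ i (γ x) (mfderiv 𝓘(ℝ, F) 𝓘(ℝ, EP) γ x ∘ v) +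
    (1 - s) • nabla.A i (γ x) (mfderiv 𝓘(ℝ, F) 𝓘(ℝ, EP) γ x ∘ v) =
    aAlong nabla₀ nabla₁ i γ (fun _ => r) x v +
      s • (diffAlong nabla₀ nabla₁ Φ i γ (fun _ => r) x v).toOp
  rw [h.aAlong_eq, ← h.pullback_trDiff hγ hi]
  have e := h.toOp_trDiff hi (mfderiv 𝓘(ℝ, F) 𝓘(ℝ, EP) γ x ∘ v)
  change _ = nabla.A i (γ x) (mfderiv 𝓘(ℝ, F) 𝓘(ℝ, EP) γ x ∘ v) + s •
    (trDiff (nabla.A i) (fun p => Φ.T i (p, r)) (γ x) (mfderiv 𝓘(ℝ, F) 𝓘(ℝ, EP) γ x ∘ v)).toOp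
  rw [e]
  change _ = _ + s • (nabla.gauge φ i (γ x) (mfderiv 𝓘(ℝ, F) 𝓘(ℝ, EP) γ x ∘ v) -
    nabla.A i (γ x) (mfderiv 𝓘(ℝ, F) 𝓘(ℝ, EP) γ x ∘ v))
  module

theorem PassesThrough.pullback_path_eventuallyEq (h : PassesThrough nabla₀ nabla₁ Φ r nabla φ)
    (hγ : SmoothNear 𝓘(ℝ, EP) γ x) (hi : γ x ∈ E.V i) (s : ℝ) :
    pullback 𝓘(ℝ, F) 𝓘(ℝ, EP) γ (nabla.path φ s i) =ᶠ[𝓝 x]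
      (opTA H).pathForm (aAlong nabla₀ nabla₁ i γ (fun _ => r))
        (diffAlong nabla₀ nabla₁ Φ i γ (fun _ => r)) s := by
  filter_upwards [hγ, eventually_mem_V hγ.self_of_nhds.continuousAt hi] with y h1 h2
  exact h.pullback_path h1 h2 s

theorem PassesThrough.isSmoothOn_path (h : PassesThrough nabla₀ nabla₁ Φ r nabla φ) (s : ℝ) :
    IsSmoothOn 𝓘(ℝ, EP) (nabla.path φ s i) (E.V i) :=
  isSmoothOn_of_pullback fun _ _ hγ hi =>
    ((opTA H).contDiffAt_pathForm (contDiffAt_aAlong_const hγ hi)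
      (contDiffAt_diffAlong_const hγ hi) s).congr_of_eventuallyEq
        (h.pullback_path_eventuallyEq hγ hi s)

theorem PassesThrough.pullback_curvature (h : PassesThrough nabla₀ nabla₁ Φ r nabla φ)
    (hγ : SmoothNear 𝓘(ℝ, EP) γ x) (hi : γ x ∈ E.V i) (s : ℝ) :
    pullback 𝓘(ℝ, F) 𝓘(ℝ, EP) γ (curvature (nabla.path φ s i)) x =
      (opTA H).curv ((opTA H).pathForm (aAlong nabla₀ nabla₁ i γ (fun _ => r))
        (diffAlong nabla₀ nabla₁ Φ i γ (fun _ => r)) s) x := by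
  have h1 := extDeriv_pullback_eq (h.isSmoothOn_path s) (E.isOpen i) hγ hi
  have h2 := h.pullback_path_eventuallyEq hγ hi s
  rw [TraceAlgebra.curv, ← h2.extDeriv_eq, ← h2.eq_of_nhds, h1]
  refine Eq.trans (b := pullback 𝓘(ℝ, F) 𝓘(ℝ, EP) γ (extD 𝓘(ℝ, EP) (nabla.path φ s i)) x +
    pullback 𝓘(ℝ, F) 𝓘(ℝ, EP) γ (fun p => wedge (ContinuousLinearMap.mul ℝ (Op H)) rfl
      (nabla.path φ s i p) (nabla.path φ s i p)) x) rfl ?_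
  congr 1

/-- The density, along a map, comes from a trace class valued form. -/
theorem PassesThrough.pullback_density (h : PassesThrough nabla₀ nabla₁ Φ r nabla φ)
    (hγ : SmoothNear 𝓘(ℝ, EP) γ x) (hi : γ x ∈ E.V i) (k : ℕ) (s : ℝ) :
    pullback 𝓘(ℝ, F) 𝓘(ℝ, EP) γ (nabla.density φ c i k s) x =
      (opTA H).incl.compContinuousAlternatingMap ((k.factorial : ℝ)⁻¹ •
        wedge (opTA H).rm (Nat.add_comm 1 (2 * k)) (diffAlong nabla₀ nabla₁ Φ i γ (fun _ => r) x)
          ((opTA H).altPow ((opTA H).curv ((opTA H).pathForm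
            (aAlong nabla₀ nabla₁ i γ (fun _ => r)) (diffAlong nabla₀ nabla₁ Φ i γ (fun _ => r)) s) x
            + (opTA H).scalarAlt (pullback 𝓘(ℝ, F) 𝓘(ℝ, EP) γ c.f x)) k)) := by
  rw [compAlternating_smul, (opTA H).incl_comp_wedge_rm, ← h.pullback_curvature hγ hi s,
    ← h.pullback_trDiff hγ.self_of_nhds hi]
  have e1 : (opTA H).incl.compContinuousAlternatingMap (pullback 𝓘(ℝ, F) 𝓘(ℝ, EP) γ
      (trDiff (nabla.A i) (fun p => Φ.T i (p, r))) x) =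
      pullback 𝓘(ℝ, F) 𝓘(ℝ, EP) γ (nabla.diff φ i) x := by
    ext1 v
    exact h.toOp_trDiff hi (mfderiv 𝓘(ℝ, F) 𝓘(ℝ, EP) γ x ∘ v)
  have e2 : pullback 𝓘(ℝ, F) 𝓘(ℝ, EP) γ (curvature (nabla.path φ s i)) x +
      (opTA H).scalarAlt (pullback 𝓘(ℝ, F) 𝓘(ℝ, EP) γ c.f x) =
      pullback 𝓘(ℝ, F) 𝓘(ℝ, EP) γ (curvature (nabla.path φ s i) + scalarForm c.f) x := rfl
  have e3 : (opTA H).altPow (pullback 𝓘(ℝ, F) 𝓘(ℝ, EP) γ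
      (curvature (nabla.path φ s i) + scalarForm c.f) x) k =
      pullback 𝓘(ℝ, F) 𝓘(ℝ, EP) γ (formPow (curvature (nabla.path φ s i) + scalarForm c.f) k) x := by
    rw [pullback, pullback, formPow_comp]
    exact ((opTA H).altPow_compContinuousLinearMap _ _ _).symm
  rw [e1, e2, e3]
  refine Eq.trans (b := (k.factorial : ℝ)⁻¹ • pullback 𝓘(ℝ, F) 𝓘(ℝ, EP) γ
    (fun p => wedge (ContinuousLinearMap.mul ℝ (Op H)) (Nat.add_comm 1 (2 * k)) (nabla.diff φ i p)
      (formPow (curvature (nabla.path φ s i) + scalarForm c.f) k p)) x) rfl ?_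
  congr 1
  exact wedge_compContinuousLinearMap _ _ _ _ _

theorem PassesThrough.pullback_density_apply (h : PassesThrough nabla₀ nabla₁ Φ r nabla φ)
    (hγ : SmoothNear 𝓘(ℝ, EP) γ x) (hi : γ x ∈ E.V i) (k : ℕ) (s : ℝ) (v : Fin (2 * k + 1) → F) :
    IsTraceClass (pullback 𝓘(ℝ, F) 𝓘(ℝ, EP) γ (nabla.density φ c i k s) x v) ∧
    trace (pullback 𝓘(ℝ, F) 𝓘(ℝ, EP) γ (nabla.density φ c i k s) x v) =
      (opTA H).chDensity (aAlong nabla₀ nabla₁ i γ (fun _ => r))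
        (diffAlong nabla₀ nabla₁ Φ i γ (fun _ => r)) (pullback 𝓘(ℝ, F) 𝓘(ℝ, EP) γ c.f) k x s v := by
  rw [h.pullback_density hγ hi, TraceAlgebra.chDensity, ← compAlternating_smul]
  exact ⟨TraceClass.isTraceClass _, rfl⟩

theorem pullback_chart_symm_apply {V : Type*} [NormedAddCommGroup V] [NormedSpace ℝ V] {n : ℕ}
    (θ : Form EP P V n) (p : P) (v : Fin n → EP) :
    pullback 𝓘(ℝ, EP) 𝓘(ℝ, EP) (extChartAt 𝓘(ℝ, EP) p).symm θ (extChartAt 𝓘(ℝ, EP) p p)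
      (fun j => mfderiv 𝓘(ℝ, EP) 𝓘(ℝ, EP) (extChartAt 𝓘(ℝ, EP) p) p (v j)) = θ p v := by
  have h2 := mfderiv_extChartAt_symm_comp (I := 𝓘(ℝ, EP)) p
  have h3 : (extChartAt 𝓘(ℝ, EP) p).symm (extChartAt 𝓘(ℝ, EP) p p) = p := extChartAt_to_inv p
  change θ ((extChartAt 𝓘(ℝ, EP) p).symm (extChartAt 𝓘(ℝ, EP) p p)) (fun j =>
    (mfderiv 𝓘(ℝ, EP) 𝓘(ℝ, EP) (extChartAt 𝓘(ℝ, EP) p).symm (extChartAt 𝓘(ℝ, EP) p p) ∘L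
    mfderiv 𝓘(ℝ, EP) 𝓘(ℝ, EP) (extChartAt 𝓘(ℝ, EP) p) p) (v j)) = _
  rw [h2, h3]
  rfl

end Density

end

section

variable {H : Type*} [NormedAddCommGroup H] [InnerProductSpace ℂ H] [CompleteSpace H]
variable {EM M EP P : Type*} [NormedAddCommGroup EM] [NormedSpace ℝ EM] [TopologicalSpace M]
  [ChartedSpace EM M] [NormedAddCommGroup EP] [NormedSpace ℝ EP] [TopologicalSpace P]
  [ChartedSpace EP P] [IsManifold 𝓘(ℝ, EP) ∞ P]
variable {B : PUBundle H EM M EP P} {nablaL : GerbeConnection B}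

variable {E : UtrModule B} {nabla nabla' : ModuleConnection E nablaL} {φ φ' : TrAut E}
  {nabla₀ nabla₁ : ModuleConnection E nablaL} {Φ : AutPath E} {c : nablaL.Curving} {r : ℝ}

theorem exists_traceClass_diff (nabla : ModuleConnection E nablaL) (φ : TrAut E) (i : E.ι) :
    ∃ a : Form EP P (TraceClass H) 1, IsSmoothOn 𝓘(ℝ, EP) a (E.V i) ∧
      ∀ p ∈ E.V i, ∀ v, (a p v).toOp = nabla.diff φ i p v :=
  ⟨_, (passesThrough_constPath nabla φ).isSmoothOn_trDiff,
    fun _ hp v => (passesThrough_constPath nabla φ).toOp_trDiff hp v⟩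

theorem PassesThrough.density_apply (h : PassesThrough nabla₀ nabla₁ Φ r nabla φ) {i : E.ι} {p : P}
    (hp : p ∈ E.V i) (k : ℕ) (s : ℝ) (v : Fin (2 * k + 1) → EP) :
    IsTraceClass (nabla.density φ c i k s p v) ∧ trace (nabla.density φ c i k s p v) =
      (opTA H).chDensity (aAlong nabla₀ nabla₁ i (extChartAt 𝓘(ℝ, EP) p).symm (fun _ => r))
        (diffAlong nabla₀ nabla₁ Φ i (extChartAt 𝓘(ℝ, EP) p).symm (fun _ => r))
        (pullback 𝓘(ℝ, EP) 𝓘(ℝ, EP) (extChartAt 𝓘(ℝ, EP) p).symm c.f) k (extChartAt 𝓘(ℝ, EP) p p) s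
        (fun j => mfderiv 𝓘(ℝ, EP) 𝓘(ℝ, EP) (extChartAt 𝓘(ℝ, EP) p) p (v j)) := by
  have h1 := h.pullback_density_apply (c := c)
    (smoothNear_extChartAt_symm (I := 𝓘(ℝ, EP)) p (mem_extChartAt_target p))
    (by rwa [extChartAt_to_inv]) k s
    (fun j => mfderiv 𝓘(ℝ, EP) 𝓘(ℝ, EP) (extChartAt 𝓘(ℝ, EP) p) p (v j))
  rwa [pullback_chart_symm_apply] at h1

theorem intervalIntegrable_trace_density (nabla : ModuleConnection E nablaL) (φ : TrAut E)
    (c : nablaL.Curving) (i : E.ι) (k : ℕ) {p : P} (hp : p ∈ E.V i) (v : Fin (2 * k + 1) → EP) :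
    (∀ s, IsTraceClass (nabla.density φ c i k s p v)) ∧
      IntervalIntegrable (fun s => trace (nabla.density φ c i k s p v))
        MeasureTheory.volume 0 1 := by
  have h := passesThrough_constPath nabla φ
  refine ⟨fun s => (h.density_apply hp k s v).1, ?_⟩
  simp only [(h.density_apply hp k _ v).2]
  have hγ := smoothNear_extChartAt_symm (I := 𝓘(ℝ, EP)) p (mem_extChartAt_target p)
  have hi : (extChartAt 𝓘(ℝ, EP) p).symm (extChartAt 𝓘(ℝ, EP) p p) ∈ E.V i := by
    rwa [extChartAt_to_inv]
  have h1 := (opTA H).continuous_chDensity (f := pullback 𝓘(ℝ, EP) 𝓘(ℝ, EP)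
      (extChartAt 𝓘(ℝ, EP) p).symm c.f)
    (contDiffAt_aAlong_const (nabla₀ := nabla) (nabla₁ := nabla) (r := 0) hγ hi)
    (contDiffAt_diffAlong_const (nabla₀ := nabla) (nabla₁ := nabla) (Φ := φ.constPath) (r := 0)
      hγ hi) k
  exact ((ContinuousAlternatingMap.apply ℝ EP ℂ _).continuous.comp h1).intervalIntegrable 0 1

variable [IsManifold 𝓘(ℝ, EM) ∞ M]

theorem PassesThrough.isChForm (h : PassesThrough nabla₀ nabla₁ Φ r nabla φ) :
    nabla.IsChForm φ c (oddMixed (chM nabla₀ nabla₁ Φ c r)) := by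
  refine ⟨mem_parityForms_one.2 (oddMixed_even _), fun k i p hp v => ?_⟩
  have hγ := smoothNear_extChartAt_symm (I := 𝓘(ℝ, EP)) p (mem_extChartAt_target p)
  have hi : (extChartAt 𝓘(ℝ, EP) p).symm (extChartAt 𝓘(ℝ, EP) p p) ∈ E.V i := by
    rwa [extChartAt_to_inv]
  simp only [(h.density_apply (c := c) hp k _ v).2]
  refine Eq.trans ?_ ((opTA H).chForm_apply (contDiffAt_aAlong_const hγ hi)
    (contDiffAt_diffAlong_const hγ hi) k _)
  rw [oddMixed_odd, ← pullback_chart_symm_apply]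
  have h1 := pullback_chM nabla₀ nabla₁ Φ c (r := r) (k := k) hγ
  rw [chPlot_eq hγ hi, pullback_comp_apply (I' := 𝓘(ℝ, EP)) (g := B.proj)
    (κ := (extChartAt 𝓘(ℝ, EP) p).symm) _ B.contMDiff_proj.contMDiffAt.mdifferentiableAt'
    hγ.self_of_nhds.mdifferentiableAt'] at h1
  rw [h1]
  rfl

theorem isChForm_unique {ch ch' : MixedForm EM M} (h : nabla.IsChForm φ c ch)
    (h' : nabla.IsChForm φ c ch') : ch = ch' := by
  funext n
  obtain ⟨k, rfl | rfl⟩ : ∃ k, n = 2 * k ∨ n = 2 * k + 1 := ⟨n / 2, by omega⟩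
  · rw [mem_parityForms_one.1 h.1 k, mem_parityForms_one.1 h'.1 k]
  · refine Subtype.ext (form_ext_of_plots (B := B) fun s x hs => ?_)
    have e (θ : Form EM M ℂ (2 * k + 1)) := pullback_comp_apply (I := 𝓘(ℝ, EM)) (I' := 𝓘(ℝ, EP))
      (I'' := 𝓘(ℝ, EM)) (g := B.proj) (κ := s) (x := x) θ
      B.contMDiff_proj.contMDiffAt.mdifferentiableAt' hs.self_of_nhds.mdifferentiableAt'
    rw [e, e]
    obtain ⟨i, hi⟩ := E.cover (s x)
    ext v
    exact (h.2 k i (s x) hi _).trans (h'.2 k i (s x) hi _).symm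

variable {Θ : SmoothForm M 𝓘(ℝ, EM) ℂ 3}

/-- The odd Chern form `ch_P(∇, φ)`. -/
def chOf (hΘ : c.IsThreeCurvature Θ) (nabla : ModuleConnection E nablaL) (φ : TrAut E) :
    closedOdd Θ :=
  chClosed nabla nabla φ.constPath hΘ 0

theorem isChForm_chOf (hΘ : c.IsThreeCurvature Θ) (nabla : ModuleConnection E nablaL)
    (φ : TrAut E) : nabla.IsChForm φ c (chOf hΘ nabla φ).1 :=
  (passesThrough_constPath nabla φ).isChForm

theorem PassesThrough.chClosed_eq (h : PassesThrough nabla₀ nabla₁ Φ r nabla φ)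
    (hΘ : c.IsThreeCurvature Θ) : chClosed nabla₀ nabla₁ Φ hΘ r = chOf hΘ nabla φ :=
  Subtype.ext (isChForm_unique h.isChForm (isChForm_chOf hΘ nabla φ))

/-- The odd Chern character is invariant under smooth paths of connections and automorphisms. -/
theorem mkQ_chOf_eq_of_path (hΘ : c.IsThreeCurvature Θ) (nabla nabla' : ModuleConnection E nablaL)
    (Φ : AutPath E) (h₀ : ∀ i, ∀ p ∈ E.V i, φ.φ i p = 1 + (Φ.T i (p, 0)).toOp)
    (h₁ : ∀ i, ∀ p ∈ E.V i, φ'.φ i p = 1 + (Φ.T i (p, 1)).toOp) :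
    (exactOdd Θ).mkQ (chOf hΘ nabla φ) = (exactOdd Θ).mkQ (chOf hΘ nabla' φ') := by
  have e₀ : PassesThrough nabla nabla' Φ 0 nabla φ := ⟨fun i => by simp, h₀⟩
  have e₁ : PassesThrough nabla nabla' Φ 1 nabla' φ' := ⟨fun i => by simp, h₁⟩
  rw [← e₀.chClosed_eq hΘ, ← e₁.chClosed_eq hΘ, mkQ_chClosed_eq]

end

section

variable {H : Type*} [NormedAddCommGroup H] [InnerProductSpace ℂ H] [CompleteSpace H]
variable {EM M EP P : Type*} [NormedAddCommGroup EM] [NormedSpace ℝ EM] [TopologicalSpace M]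
  [ChartedSpace EM M] [NormedAddCommGroup EP] [NormedSpace ℝ EP] [TopologicalSpace P]
  [ChartedSpace EP P]
variable {B : PUBundle H EM M EP P}

theorem exists_phase_eq {w : U H} (h : ∃ z : ℂ, (w : Op H) = z • (1 : Op H)) :
    ∃ t : ℝ, w = phase H t := by
  obtain ⟨z, hz⟩ := h
  rcases subsingleton_or_nontrivial H with hH | hH
  · exact ⟨0, Subtype.ext (ContinuousLinearMap.ext fun x => Subsingleton.elim _ _)⟩
  · have h1 : ‖z‖ = 1 := by
      have h2 := CStarRing.norm_of_mem_unitary w.2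
      rwa [hz, norm_smul, norm_one, mul_one] at h2
    refine ⟨Complex.arg z, Subtype.ext ?_⟩
    change (w : Op H) = Complex.exp (Complex.arg z * Complex.I) • (1 : Op H)
    have h2 := Complex.norm_mul_exp_arg_mul_I z
    rw [h1, Complex.ofReal_one, one_mul] at h2
    rw [hz, h2]

theorem PUBundle.exists_phase_mul {p : P} {u u' : U H} (h : B.act p u = B.act p u') :
    ∃ t : ℝ, u' = phase H t * u := by
  have h1 : B.act p (u' * u⁻¹) = p := by
    rw [B.act_mul, ← h, ← B.act_mul, mul_inv_cancel, B.act_one]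
  obtain ⟨t, ht⟩ := exists_phase_eq ((B.act_eq_self_iff _ _).1 h1)
  exact ⟨t, by rw [← ht, inv_mul_cancel_right]⟩

/-- Conjugation of trace class operators. -/
def conjTC (a : Op H) (T : TraceClass H) : TraceClass H :=
  TraceClass.lmul (star a) (TraceClass.rmul T a)

theorem toOp_conjTC (a : Op H) (T : TraceClass H) : (conjTC a T).toOp = star a * (T.toOp * a) := rfl

theorem contMDiffAt_conjTC {E C X : Type*} [NormedAddCommGroup E] [NormedSpace ℝ E]
    [TopologicalSpace C] {I : ModelWithCorners ℝ E C} [TopologicalSpace X] [ChartedSpace C X]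
    {g : X → Op H} {x : X} (hg : ContMDiffAt I 𝓘(ℝ, Op H) ∞ g x) (T : TraceClass H) :
    ContMDiffAt I 𝓘(ℝ, TraceClass H) ∞ (fun y => conjTC (g y) T) x := by
  have h1 : ContDiff ℝ ∞ (fun a : Op H => conjTC a T) := by
    have e1 : ContDiff ℝ ∞ (opTA H).lm := (opTA H).lm.contDiff
    have e2 : ContDiff ℝ ∞ ((opTA H).rm T) := ((opTA H).rm T).contDiff
    have e3 : ContDiff ℝ ∞ (star : Op H → Op H) := (starL' ℝ (A := Op H)).contDiff
    exact (e1.comp e3).clm_apply e2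
  exact h1.contMDiff.contMDiffAt.comp x hg

/-- The local automorphism of a module that is the constant `T` along the section `σ`. -/
def localExt (E : UtrModule B) (σ : M → P) (j : E.ι) (T : TraceClass H) (i : E.ι) (q : P) :
    TraceClass H :=
  conjTC (E.ψ j i (σ (B.proj q), Classical.epsilon fun u => B.act (σ (B.proj q)) u = q)) T

variable {E : UtrModule B} {σ : M → P} {j : E.ι} {T : TraceClass H} {i : E.ι} {q : P}

theorem localExt_eq {u : U H} (hu : B.act (σ (B.proj q)) u = q) (hi : q ∈ E.V i)
    (hj : σ (B.proj q) ∈ E.V j) :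
    localExt E σ j T i q = conjTC (E.ψ j i (σ (B.proj q), u)) T := by
  have h := Classical.epsilon_spec (p := fun u => B.act (σ (B.proj q)) u = q) ⟨u, hu⟩
  obtain ⟨t, ht⟩ := B.exists_phase_mul (hu.trans h.symm)
  have h1 := E.ψ_phase j i (σ (B.proj q)) u t (by rwa [hu]) hj
  rw [localExt, ht, h1]
  apply TraceClass.toOp_injective
  rw [toOp_conjTC, toOp_conjTC, star_smul, mul_smul_comm, smul_mul_smul_comm]
  have h2 : star (Complex.exp (t * Complex.I)) * Complex.exp (t * Complex.I) = 1 := by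
    rw [Complex.star_def, ← Complex.exp_conj, ← Complex.exp_add]; simp
  rw [h2, one_smul]

theorem exists_act_section_eq (hs : B.proj (σ (B.proj q)) = B.proj q) :
    ∃ u, B.act (σ (B.proj q)) u = q :=
  B.exists_act_eq _ _ hs

theorem localExt_transition {i' : E.ι} (hs : B.proj (σ (B.proj q)) = B.proj q)
    (hi : q ∈ E.V i) (hi' : q ∈ E.V i') (hj : σ (B.proj q) ∈ E.V j) :
    (localExt E σ j T i q).toOp * E.g i i' q = E.g i i' q * (localExt E σ j T i' q).toOp := by
  obtain ⟨u, hu⟩ := exists_act_section_eq hs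
  have hg := Unitary.mul_star_self_of_mem (E.g_unitary i i' q ⟨hi, hi'⟩)
  have h1 := E.ψ_g j j i i' (σ (B.proj q), u) (by rw [PUBundle.actMap, hu]; exact ⟨hi, hi'⟩) ⟨hj, hj⟩
  rw [E.g_self j _ hj, one_mul, PUBundle.actMap, hu] at h1
  rw [localExt_eq hu hi hj, localExt_eq hu hi' hj, ← h1, toOp_conjTC, toOp_conjTC, star_mul]
  simp only [← mul_assoc]
  rw [hg, one_mul]

theorem localExt_module {l : E.ι} {x : P × U H} (hs : B.proj (σ (B.proj x.1)) = B.proj x.1)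
    (hi : B.actMap x ∈ E.V i) (hl : x.1 ∈ E.V l) (hj : σ (B.proj x.1) ∈ E.V j) :
    (localExt E σ j T l x.1).toOp * E.ψ l i x =
      E.ψ l i x * (localExt E σ j T i (B.actMap x)).toOp := by
  obtain ⟨p, v⟩ := x
  have hq : B.proj (B.actMap (p, v)) = B.proj p := B.proj_act p v
  obtain ⟨u, hu⟩ := exists_act_section_eq hs
  simp only at hu hs hl hj
  have hg := Unitary.mul_star_self_of_mem (E.ψ_unitary l i (p, v) hi hl)
  have h1 := E.ψ_mul j l i (σ (B.proj p)) u v (by rw [hu]; exact hi) (by rwa [hu]) hj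
  have h2 : B.act (σ (B.proj (B.actMap (p, v)))) (u * v) = B.actMap (p, v) := by
    rw [hq, B.act_mul, hu]; rfl
  rw [localExt_eq hu hl hj, localExt_eq h2 hi (by rwa [hq]), hq, ← h1, hu, toOp_conjTC, toOp_conjTC,
    star_mul]
  simp only [← mul_assoc]
  rw [hg, one_mul]

/-- Automorphisms of a module that differ from the identity by compact operators, not necessarily
continuous. -/
structure UtrModule.IsCptAut (E : UtrModule B) (φ : E.ι → P → Op H) : Prop where
  isUnit : ∀ i, ∀ p ∈ E.V i, IsUnit (φ i p)
  compact : ∀ i, ∀ p ∈ E.V i, IsCompactOperator (φ i p - 1 : Op H)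
  transition : ∀ i j, ∀ p ∈ E.V i ∩ E.V j, φ i p * E.g i j p = E.g i j p * φ j p
  module : ∀ j i x, B.actMap x ∈ E.V i → x.1 ∈ E.V j →
    φ j x.1 * E.ψ j i x = E.ψ j i x * φ i (B.actMap x)

/-- The relative distance of an operator to an invertible operator. -/
def relDist (S S' : Op H) : ℝ := ‖S' - S‖ * ‖Ring.inverse S‖

theorem isUnit_of_relDist_lt_one {S S' : Op H} (hS : IsUnit S) (h : relDist S S' < 1) :
    IsUnit S' := by
  obtain ⟨u, rfl⟩ := hS
  rcases subsingleton_or_nontrivial (Op H) with hH | hH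
  · exact isUnit_of_subsingleton _
  rw [relDist, Ring.inverse_unit] at h
  have h1 : ‖S' - ↑u‖ < ‖(↑u⁻¹ : Op H)‖⁻¹ := by
    rw [← mul_lt_mul_iff_left₀ (norm_pos_iff.2 u⁻¹.ne_zero : 0 < ‖(↑u⁻¹ : Op H)‖)]
    rwa [inv_mul_cancel₀ (norm_ne_zero_iff.2 u⁻¹.ne_zero)]
  exact ⟨Units.ofNearby u S' h1, rfl⟩

theorem relDist_localExt {φ : E.ι → P → Op H} (hφ : E.IsCptAut φ)
    (hs : B.proj (σ (B.proj q)) = B.proj q) (hi : q ∈ E.V i) (hj : σ (B.proj q) ∈ E.V j) :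
    relDist (φ i q) (1 + (localExt E σ j T i q).toOp) =
      relDist (φ j (σ (B.proj q))) (1 + T.toOp) := by
  obtain ⟨u, hu⟩ := exists_act_section_eq hs
  have hψ := E.ψ_unitary j i (σ (B.proj q), u) (by rwa [PUBundle.actMap, hu]) hj
  have h1 := hφ.module j i (σ (B.proj q), u) (by rwa [PUBundle.actMap, hu]) hj
  rw [PUBundle.actMap, hu] at h1
  rw [localExt_eq hu hi hj]
  generalize E.ψ j i (σ (B.proj q), u) = a at hψ h1
  have ha := Unitary.star_mul_self_of_mem hψ
  have ha' := Unitary.mul_star_self_of_mem hψ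
  have h2 : φ i q = star a * (φ j (σ (B.proj q)) * a) := by
    rw [h1, ← mul_assoc, ha, one_mul]
  have e1 : 1 + (conjTC a T).toOp - φ i q = star a * ((1 + T.toOp - φ j (σ (B.proj q))) * a) := by
    rw [h2, toOp_conjTC, sub_mul, add_mul, mul_sub, mul_add, one_mul, ha]
  have e2 : Ring.inverse (φ i q) = star a * (Ring.inverse (φ j (σ (B.proj q))) * a) := by
    have h3 := Ring.inverse_mul_cancel _ (hφ.isUnit j _ hj)
    have h4 := Ring.mul_inverse_cancel _ (hφ.isUnit i _ hi)
    have h5 : star a * (Ring.inverse (φ j (σ (B.proj q))) * a) * φ i q = 1 := by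
      rw [mul_assoc, mul_assoc, ← h1, ← mul_assoc (Ring.inverse _), h3, one_mul, ha]
    calc _ = star a * (Ring.inverse (φ j (σ (B.proj q))) * a) * φ i q * Ring.inverse (φ i q) := by
          rw [h5, one_mul]
      _ = _ := by rw [mul_assoc, h4, mul_one]
  have hn (S : Op H) : ‖star a * (S * a)‖ = ‖S‖ := by
    rw [CStarRing.norm_mem_unitary_mul _ (Unitary.star_mem hψ), CStarRing.norm_mul_mem_unitary _ hψ]
  rw [relDist, relDist, e1, e2, hn, hn]

theorem contMDiffAt_localExt {W : Set M} (hW : IsOpen W)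
    (hσ : ContMDiffOn 𝓘(ℝ, EM) 𝓘(ℝ, EP) ∞ σ W)
    (hσ' : ∀ p, B.proj p ∈ W → ∃ V : Set P, IsOpen V ∧ p ∈ V ∧ ∃ g : P → U H,
      ContMDiffOn 𝓘(ℝ, EP) 𝓘(ℝ, LieU H) ∞ g V ∧ ∀ q ∈ V, B.act (σ (B.proj q)) (g q) = q)
    (hq : B.proj q ∈ W) (hi : q ∈ E.V i) (hj : σ (B.proj q) ∈ E.V j) :
    ContMDiffAt 𝓘(ℝ, EP) 𝓘(ℝ, TraceClass H) ∞ (localExt E σ j T i) q := by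
  obtain ⟨V, hV, hqV, g, hg, hact⟩ := hσ' q hq
  have h1 : ContMDiffAt 𝓘(ℝ, EP) 𝓘(ℝ, EP) ∞ (fun q => σ (B.proj q)) q :=
    (hσ.contMDiffAt (hW.mem_nhds hq)).comp q B.contMDiff_proj.contMDiffAt
  have h2 : ContMDiffAt 𝓘(ℝ, EP) (modelPU EP H) ∞ (fun q => (σ (B.proj q), g q)) q :=
    h1.prodMk (hg.contMDiffAt (hV.mem_nhds hqV))
  have h3 := (E.contMDiffAt_psi (x := (σ (B.proj q), g q)) (i := i) (j := j)
    (by rw [PUBundle.actMap, hact q hqV]; exact hi) hj).comp q h2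
  refine (contMDiffAt_conjTC h3 T).congr_of_eventuallyEq ?_
  filter_upwards [hV.mem_nhds hqV, (E.isOpen i).mem_nhds hi,
    h1.continuousAt ((E.isOpen j).mem_nhds hj)] with y hy1 hy2 hy3
  exact localExt_eq (hact y hy1) hy2 hy3

end

section

section PartitionOfUnity

variable {ι : Type*} {E C N : Type*} [NormedAddCommGroup E] [NormedSpace ℝ E]
  [TopologicalSpace C] {I : ModelWithCorners ℝ E C} [TopologicalSpace N] [ChartedSpace C N]
  {E' C' X : Type*} [NormedAddCommGroup E'] [NormedSpace ℝ E']
  [TopologicalSpace C'] {J : ModelWithCorners ℝ E' C'} [TopologicalSpace X] [ChartedSpace C' X]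
  {V : Type*} [NormedAddCommGroup V] [NormedSpace ℝ V]

theorem SmoothPartitionOfUnity.exists_finset_eventually (f : SmoothPartitionOfUnity ι I N Set.univ)
    (y : N) : ∃ S : Finset ι, ∀ᶠ z in 𝓝 y, ∀ i, f i z ≠ 0 → i ∈ S := by
  obtain ⟨O, hO, hfin⟩ := f.locallyFinite y
  refine ⟨hfin.toFinset, ?_⟩
  filter_upwards [hO] with z hz i hi
  exact hfin.mem_toFinset.2 ⟨z, hi, hz⟩

theorem finsum_smul_eq_sum {f : ι → ℝ} {S : Finset ι} (h : ∀ i, f i ≠ 0 → i ∈ S) (g : ι → V) :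
    ∑ᶠ i, f i • g i = ∑ i ∈ S, f i • g i :=
  finsum_eq_sum_of_support_subset _ fun i hi => h i fun h0 => hi (by simp [h0])

theorem SmoothPartitionOfUnity.contMDiffAt_finsum_comp (f : SmoothPartitionOfUnity ι I N Set.univ)
    {h : X → N} {x : X} (hh : ContMDiffAt J I ∞ h x) {g : ι → X → V}
    (hg : ∀ i, h x ∈ tsupport (f i) → ContMDiffAt J 𝓘(ℝ, V) ∞ (g i) x) :
    ContMDiffAt J 𝓘(ℝ, V) ∞ (fun y => ∑ᶠ i, f i (h y) • g i y) x := by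
  obtain ⟨S, hS⟩ := f.exists_finset_eventually (h x)
  have h1 : ContMDiffAt J 𝓘(ℝ, V) ∞ (fun y => ∑ i ∈ S, f i (h y) • g i y) x := by
    refine contMDiffAt_finsetSum fun i _ => ?_
    by_cases hx : h x ∈ tsupport (f i)
    · exact ((f i).contMDiff.contMDiffAt.comp x hh).smul (hg i hx)
    · have h2 : ∀ᶠ z in 𝓝 (h x), f i z = 0 := by
        filter_upwards [(isClosed_tsupport (f i)).isOpen_compl.mem_nhds hx] with z hz
        exact image_eq_zero_of_notMem_tsupport hz
      refine (contMDiffAt_const (c := (0 : V))).congr_of_eventuallyEq ?_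
      filter_upwards [hh.continuousAt.eventually h2] with y hy
      rw [hy, zero_smul]
  refine h1.congr_of_eventuallyEq ?_
  filter_upwards [hh.continuousAt.eventually hS] with y hy
  exact finsum_smul_eq_sum hy _

theorem SmoothPartitionOfUnity.exists_finset_sum (f : SmoothPartitionOfUnity ι I N Set.univ)
    (y : N) : ∃ S : Finset ι, (∀ i, f i y ≠ 0 ↔ i ∈ S) ∧ ∑ i ∈ S, f i y = 1 := by
  have hfin := f.locallyFinite.point_finite y
  refine ⟨hfin.toFinset, fun i => hfin.mem_toFinset.symm, ?_⟩
  rw [← f.sum_eq_one (Set.mem_univ y)]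
  exact (finsum_eq_sum_of_support_subset _ fun i hi => by simpa using hi).symm

end PartitionOfUnity

variable {H : Type*} [NormedAddCommGroup H] [InnerProductSpace ℂ H] [CompleteSpace H]
variable {EM M EP P : Type*} [NormedAddCommGroup EM] [NormedSpace ℝ EM] [TopologicalSpace M]
  [ChartedSpace EM M] [NormedAddCommGroup EP] [NormedSpace ℝ EP] [TopologicalSpace P]
  [ChartedSpace EP P]
variable {B : PUBundle H EM M EP P}

theorem relDist_sum_lt_one {ι : Type*} {S : Finset ι} {w : ι → ℝ} (hpos : ∀ z ∈ S, 0 < w z)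
    (hsum : ∑ z ∈ S, w z = 1) {A : Op H} {R : ι → Op H} (h : ∀ z ∈ S, relDist A (1 + R z) < 1) :
    relDist A (1 + ∑ z ∈ S, w z • R z) < 1 := by
  have e : 1 + ∑ z ∈ S, w z • R z - A = ∑ z ∈ S, w z • (1 + R z - A) := by
    simp only [smul_sub, smul_add, Finset.sum_sub_distrib, Finset.sum_add_distrib, ← Finset.sum_smul,
      hsum, one_smul]
  have hne : S.Nonempty := by
    by_contra hS
    rw [Finset.not_nonempty_iff_eq_empty.1 hS] at hsum
    simp at hsum
  rw [relDist, e]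
  calc ‖∑ z ∈ S, w z • (1 + R z - A)‖ * ‖Ring.inverse A‖
      ≤ (∑ z ∈ S, w z * ‖1 + R z - A‖) * ‖Ring.inverse A‖ := by
        gcongr
        refine (norm_sum_le _ _).trans (Finset.sum_le_sum fun z hz => ?_)
        rw [norm_smul, Real.norm_of_nonneg (hpos z hz).le]
    _ = ∑ z ∈ S, w z * relDist A (1 + R z) := by
        rw [Finset.sum_mul]
        exact Finset.sum_congr rfl fun z _ => mul_assoc _ _ _
    _ < ∑ z ∈ S, w z := by
        refine Finset.sum_lt_sum_of_nonempty hne fun z hz => ?_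
        exact mul_lt_of_lt_one_right (hpos z hz) (h z hz)
    _ = 1 := hsum

/-- A path of automorphisms of a module that differ from the identity by compact operators,
continuous for the operator norm. -/
structure CptPath (E : UtrModule B) where
  Ψ : ℝ → E.ι → P → Op H
  isCptAut : ∀ r, E.IsCptAut (Ψ r)
  continuousOn : ∀ i, ContinuousOn (fun z : P × ℝ => Ψ z.2 i z.1) (E.V i ×ˢ Set.univ)

variable {E : UtrModule B}

/-- A local approximation of a path of automorphisms by trace class perturbations of the
identity. -/
structure LocalApprox (Ψ : CptPath E) (O : Set (M × ℝ)) (σ : M → P) (j : E.ι) (T : TraceClass H) :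
    Prop where
  isOpen : IsOpen O
  smooth : ∀ {q : P} {r : ℝ} {i : E.ι}, (B.proj q, r) ∈ O → q ∈ E.V i →
    ContMDiffAt 𝓘(ℝ, EP) 𝓘(ℝ, TraceClass H) ∞ (localExt E σ j T i) q
  proj_eq : ∀ z ∈ O, B.proj (σ z.1) = z.1
  mem : ∀ z ∈ O, σ z.1 ∈ E.V j
  relDist_lt : ∀ z ∈ O, relDist (Ψ.Ψ z.2 j (σ z.1)) (1 + T.toOp) < 1

theorem exists_localApprox (Ψ : CptPath E) (z : M × ℝ) :
    ∃ (O : Set (M × ℝ)) (σ : M → P) (j : E.ι) (T : TraceClass H), z ∈ O ∧ LocalApprox Ψ O σ j T := by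
  obtain ⟨W, hW, hzW, σ, hσ, hσp, hσ'⟩ := B.locally_trivial z.1
  obtain ⟨j, hj⟩ := E.cover (σ z.1)
  have hu := (Ψ.isCptAut z.2).isUnit j _ hj
  obtain ⟨T, hT⟩ := ((Ψ.isCptAut z.2).compact j _ hj).exists_isTraceClass_near
    (ε := (‖Ring.inverse (Ψ.Ψ z.2 j (σ z.1))‖ + 1)⁻¹) (by positivity)
  have hT1 : relDist (Ψ.Ψ z.2 j (σ z.1)) (1 + T.toOp) < 1 := by
    rw [relDist, show 1 + T.toOp - Ψ.Ψ z.2 j (σ z.1) = T.toOp - (Ψ.Ψ z.2 j (σ z.1) - 1) by abel]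
    have h0 := norm_nonneg (Ring.inverse (Ψ.Ψ z.2 j (σ z.1)))
    calc _ ≤ (‖Ring.inverse (Ψ.Ψ z.2 j (σ z.1))‖ + 1)⁻¹ * ‖Ring.inverse (Ψ.Ψ z.2 j (σ z.1))‖ := by
          gcongr
      _ < 1 := by
          rw [inv_mul_lt_iff₀ (by positivity)]
          linarith
  have hσc : ContinuousAt (fun y : M × ℝ => σ y.1) z :=
    ((hσ.contMDiffAt (hW.mem_nhds hzW)).continuousAt).comp (f := fun y : M × ℝ => y.1)
      continuous_fst.continuousAt
  have hΨ : ContinuousAt (fun y : M × ℝ => Ψ.Ψ y.2 j (σ y.1)) z :=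
    ((Ψ.continuousOn j).continuousAt (((E.isOpen j).prod isOpen_univ).mem_nhds
      ⟨hj, Set.mem_univ _⟩)).comp (f := fun y : M × ℝ => (σ y.1, y.2))
      (hσc.prodMk continuous_snd.continuousAt)
  have hinv : ContinuousAt (fun y : M × ℝ => Ring.inverse (Ψ.Ψ y.2 j (σ y.1))) z :=
    ContinuousAt.comp (g := Ring.inverse) (contDiffAt_inverse hu).continuousAt hΨ
  have hrel : ContinuousAt (fun y : M × ℝ => relDist (Ψ.Ψ y.2 j (σ y.1)) (1 + T.toOp)) z :=
    (continuousAt_const.sub hΨ).norm.mul hinv.norm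
  have hev : ∀ᶠ y in 𝓝 z, y.1 ∈ W ∧ σ y.1 ∈ E.V j ∧
      relDist (Ψ.Ψ y.2 j (σ y.1)) (1 + T.toOp) < 1 :=
    (continuous_fst.continuousAt.eventually (hW.mem_nhds hzW)).and
      ((hσc.eventually ((E.isOpen j).mem_nhds hj)).and (hrel.eventually (Iio_mem_nhds hT1)))
  obtain ⟨O, hO, hOo, hzO⟩ := eventually_nhds_iff.1 hev
  refine ⟨O, σ, j, T, hzO, hOo, fun {q r i} hq hi => ?_, fun y hy => hσp _ (hO y hy).1,
    fun y hy => (hO y hy).2.1, fun y hy => (hO y hy).2.2⟩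
  exact contMDiffAt_localExt hW hσ hσ' (hO _ hq).1 hi (hO _ hq).2.1

set_option maxHeartbeats 400000 in
/-- Paths of automorphisms that are compact perturbations of the identity are close to smooth paths
of trace class perturbations of the identity. -/
theorem exists_smoothing [IsManifold 𝓘(ℝ, EM) ∞ M] [FiniteDimensional ℝ EM] [T2Space M]
    [SecondCountableTopology M] (Ψ : CptPath E) : ∃ Φ : AutPath E, ∀ r i, ∀ p ∈ E.V i,
      relDist (Ψ.Ψ r i p) (1 + (Φ.T i (p, r)).toOp) < 1 := by
  choose O σ j T hzO hO using exists_localApprox Ψ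
  have : LocallyCompactSpace M := Manifold.locallyCompact_of_finiteDimensional 𝓘(ℝ, EM)
  obtain ⟨f, hf⟩ := SmoothPartitionOfUnity.exists_isSubordinate (𝓘(ℝ, EM).prod 𝓘(ℝ, ℝ))
    isClosed_univ O (fun z => (hO z).isOpen) (fun z _ => Set.mem_iUnion.2 ⟨z, hzO z⟩)
  have hmem {z y : M × ℝ} (h : f z y ≠ 0) : y ∈ O z := hf z (subset_tsupport _ h)
  let R (i : E.ι) (y : P × ℝ) : TraceClass H :=
    ∑ᶠ z, f z (B.proj y.1, y.2) • localExt E (σ z) (j z) (T z) i y.1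
  have hR (i : E.ι) (q : P) (r : ℝ) (S : Finset (M × ℝ))
      (hS : ∀ z, f z (B.proj q, r) ≠ 0 → z ∈ S) : (R i (q, r)).toOp =
      ∑ z ∈ S, f z (B.proj q, r) • (localExt E (σ z) (j z) (T z) i q).toOp := by
    have h1 : R i (q, r) = ∑ z ∈ S, f z (B.proj q, r) • localExt E (σ z) (j z) (T z) i q :=
      finsum_smul_eq_sum hS _
    rw [h1]
    change (opTA H).incl _ = _
    rw [map_sum]
    exact Finset.sum_congr rfl fun z _ => map_smul (opTA H).incl _ _
  have hdist (r : ℝ) (i : E.ι) (p : P) (hp : p ∈ E.V i) :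
      relDist (Ψ.Ψ r i p) (1 + (R i (p, r)).toOp) < 1 := by
    obtain ⟨S, hS, hsum⟩ := f.exists_finset_sum (B.proj p, r)
    rw [hR i p r S fun z hz => (hS z).1 hz]
    refine relDist_sum_lt_one (fun z hz => lt_of_le_of_ne (f.nonneg z _) ((hS z).2 hz).symm) hsum
      fun z hz => ?_
    have hz' := hmem ((hS z).2 hz)
    have h1 := relDist_localExt (T := T z) (Ψ.isCptAut r) ((hO z).proj_eq (B.proj p, r) hz') hp
      ((hO z).mem (B.proj p, r) hz')
    have h2 := (hO z).relDist_lt (B.proj p, r) hz'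
    exact h1.trans_lt h2
  refine ⟨⟨R, fun i y hy => ?_, fun r => ⟨fun i p hp => ?_, fun i p hp => ?_, fun i i' p hp => ?_,
    fun l i x hi hl => ?_⟩⟩, hdist⟩
  · apply ContMDiffAt.contMDiffWithinAt
    have hh : ContMDiffAt (𝓘(ℝ, EP).prod 𝓘(ℝ, ℝ)) (𝓘(ℝ, EM).prod 𝓘(ℝ, ℝ)) ∞
        (fun y : P × ℝ => (B.proj y.1, y.2)) y :=
      (B.contMDiff_proj.contMDiffAt.comp y contMDiffAt_fst).prodMk contMDiffAt_snd
    refine f.contMDiffAt_finsum_comp hh fun z hz => ?_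
    exact ((hO z).smooth (hf z hz) hy.1).comp y contMDiffAt_fst
  · exact isUnit_of_relDist_lt_one ((Ψ.isCptAut r).isUnit i p hp) (hdist r i p hp)
  · rw [add_sub_cancel_left]
    exact (R i (p, r)).isTraceClass
  · obtain ⟨S, hS, -⟩ := f.exists_finset_sum (B.proj p, r)
    rw [hR i p r S fun z hz => (hS z).1 hz, hR i' p r S fun z hz => (hS z).1 hz, add_mul, mul_add,
      one_mul, mul_one, Finset.sum_mul, Finset.mul_sum]
    refine congrArg _ (Finset.sum_congr rfl fun z hz => ?_)
    have hz' := hmem ((hS z).2 hz)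
    rw [smul_mul_assoc, mul_smul_comm, localExt_transition ((hO z).proj_eq _ hz') hp.1 hp.2
      ((hO z).mem _ hz')]
  · obtain ⟨S, hS, -⟩ := f.exists_finset_sum (B.proj x.1, r)
    have hx : B.proj (B.actMap x) = B.proj x.1 := B.proj_act _ _
    rw [hR l x.1 r S fun z hz => (hS z).1 hz, hR i (B.actMap x) r S fun z hz => (hS z).1 (hx ▸ hz),
      add_mul, mul_add, one_mul, mul_one, Finset.sum_mul, Finset.mul_sum, hx]
    refine congrArg _ (Finset.sum_congr rfl fun z hz => ?_)
    have hz' := hmem ((hS z).2 hz)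
    rw [smul_mul_assoc, mul_smul_comm, localExt_module ((hO z).proj_eq _ hz') hi hl
      ((hO z).mem _ hz')]

end

section

variable {H : Type*} [NormedAddCommGroup H] [InnerProductSpace ℂ H] [CompleteSpace H]
variable {EM M EP P : Type*} [NormedAddCommGroup EM] [NormedSpace ℝ EM] [TopologicalSpace M]
  [ChartedSpace EM M] [NormedAddCommGroup EP] [NormedSpace ℝ EP] [TopologicalSpace P]
  [ChartedSpace EP P]
variable {B : PUBundle H EM M EP P} {nablaL : GerbeConnection B} {E : UtrModule B}

/-- The automorphism at a time of a smooth path. -/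
def AutPath.at (Φ : AutPath E) (r : ℝ) : TrAut E where
  φ i p := 1 + (Φ.T i (p, r)).toOp
  isTrAut := Φ.isTrAut r
  smooth i := ⟨fun p => Φ.T i (p, r), (Φ.smooth i).comp
    (contMDiffOn_id.prodMk contMDiffOn_const) fun _ hp => ⟨hp, Set.mem_univ _⟩, fun _ _ => rfl⟩

theorem relDist_self (S : Op H) : relDist S S = 0 := by
  rw [relDist, sub_self, norm_zero, zero_mul]

theorem relDist_segment_lt_one {S A A' : Op H} (h : relDist S A < 1) (h' : relDist S A' < 1) {s : ℝ}
    (hs : 0 ≤ s) (hs' : s ≤ 1) : relDist S (A + s • (A' - A)) < 1 := by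
  have e : A + s • (A' - A) - S = (1 - s) • (A - S) + s • (A' - S) := by module
  calc relDist S (A + s • (A' - A)) ≤ ((1 - s) * ‖A - S‖ + s * ‖A' - S‖) * ‖Ring.inverse S‖ := by
        rw [relDist, e]
        gcongr
        refine (norm_add_le _ _).trans_eq ?_
        rw [norm_smul, norm_smul, Real.norm_of_nonneg hs, Real.norm_of_nonneg (sub_nonneg.2 hs')]
    _ = (1 - s) * relDist S A + s * relDist S A' := by
        rw [relDist, relDist]
        ring
    _ < 1 := by
        rcases hs.eq_or_lt with rfl | hs0
        · simpa using h
        · nlinarith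

/-- The segment between two automorphisms, with a smooth parametrization. -/
def segmentPath {Ψ : E.ι → P → Op H} (hΨ : ∀ i, ∀ p ∈ E.V i, IsUnit (Ψ i p)) {φ φ' : TrAut E}
    (h : ∀ i, ∀ p ∈ E.V i, relDist (Ψ i p) (φ.φ i p) < 1)
    (h' : ∀ i, ∀ p ∈ E.V i, relDist (Ψ i p) (φ'.φ i p) < 1) : AutPath E where
  T i z := φ.constPath.T i (z.1, 0) +
    Real.smoothTransition z.2 • (φ'.constPath.T i (z.1, 0) - φ.constPath.T i (z.1, 0))
  smooth i := by
    have e (φ : TrAut E) : ContMDiffOn (𝓘(ℝ, EP).prod 𝓘(ℝ, ℝ)) 𝓘(ℝ, TraceClass H) ∞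
        (fun z : P × ℝ => φ.constPath.T i (z.1, 0)) (E.V i ×ˢ Set.univ) :=
      (φ.constPath.smooth i).comp (contMDiffOn_fst.prodMk contMDiffOn_const)
        fun _ hz => ⟨hz.1, Set.mem_univ _⟩
    have hχ : ContMDiffOn (𝓘(ℝ, EP).prod 𝓘(ℝ, ℝ)) 𝓘(ℝ, ℝ) ∞
        (fun z : P × ℝ => Real.smoothTransition z.2) (E.V i ×ˢ Set.univ) :=
      (Real.smoothTransition.contDiff (n := ⊤)).contMDiff.comp_contMDiffOn contMDiffOn_snd
    exact (e φ).add (hχ.smul ((e φ').sub (e φ)))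
  isTrAut r := by
    have key (i : E.ι) (p : P) (hp : p ∈ E.V i) : (1 : Op H) + (φ.constPath.T i (p, 0) +
        Real.smoothTransition r • (φ'.constPath.T i (p, 0) - φ.constPath.T i (p, 0))).toOp =
        φ.φ i p + Real.smoothTransition r • (φ'.φ i p - φ.φ i p) := by
      rw [φ.constPath_spec 0 i p hp, φ'.constPath_spec 0 i p hp, add_sub_add_left_eq_sub, add_assoc]
      change 1 + (opTA H).incl _ = 1 + ((opTA H).incl _ + _ • ((opTA H).incl _ - (opTA H).incl _))
      rw [map_add, map_smul, map_sub]
    refine UtrModule.IsTrAut.congr (φ := fun i p => φ.φ i p +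
      Real.smoothTransition r • (φ'.φ i p - φ.φ i p)) ⟨fun i p hp => ?_, fun i p hp => ?_,
      fun i j p hp => ?_, fun j i x hi hj => ?_⟩ fun i p hp => (key i p hp).symm
    · exact isUnit_of_relDist_lt_one (hΨ i p hp) (relDist_segment_lt_one (h i p hp) (h' i p hp)
        (Real.smoothTransition.nonneg r) (Real.smoothTransition.le_one r))
    · rw [← key i p hp, add_sub_cancel_left]
      exact TraceClass.isTraceClass _
    · simp only [add_mul, mul_add, smul_mul_assoc, mul_smul_comm, sub_mul, mul_sub]
      rw [φ.isTrAut.transition i j p hp, φ'.isTrAut.transition i j p hp]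
    · simp only [add_mul, mul_add, smul_mul_assoc, mul_smul_comm, sub_mul, mul_sub]
      rw [φ.isTrAut.module j i x hi hj, φ'.isTrAut.module j i x hi hj]

variable [IsManifold 𝓘(ℝ, EP) ∞ P] [IsManifold 𝓘(ℝ, EM) ∞ M]
variable {c : nablaL.Curving} {Θ : SmoothForm M 𝓘(ℝ, EM) ℂ 3}

theorem mkQ_chOf_eq_of_relDist (hΘ : c.IsThreeCurvature Θ) (nabla : ModuleConnection E nablaL)
    {Ψ : E.ι → P → Op H} (hΨ : ∀ i, ∀ p ∈ E.V i, IsUnit (Ψ i p)) {φ φ' : TrAut E}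
    (h : ∀ i, ∀ p ∈ E.V i, relDist (Ψ i p) (φ.φ i p) < 1)
    (h' : ∀ i, ∀ p ∈ E.V i, relDist (Ψ i p) (φ'.φ i p) < 1) :
    (exactOdd Θ).mkQ (chOf hΘ nabla φ) = (exactOdd Θ).mkQ (chOf hΘ nabla φ') := by
  refine mkQ_chOf_eq_of_path hΘ nabla nabla (segmentPath hΨ h h') (fun i p hp => ?_)
    fun i p hp => ?_
  · simp only [segmentPath, Real.smoothTransition.zero, zero_smul, add_zero]
    exact φ.constPath_spec 0 i p hp
  · simp only [segmentPath, Real.smoothTransition.one, one_smul, add_sub_cancel]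
    exact φ'.constPath_spec 0 i p hp

variable [FiniteDimensional ℝ EM] [T2Space M] [SecondCountableTopology M]

/-- The odd Chern character is invariant under norm continuous paths of compact perturbations of
the identity. -/
theorem mkQ_chOf_eq_of_cptPath (hΘ : c.IsThreeCurvature Θ)
    (nabla nabla' : ModuleConnection E nablaL) {φ φ' : TrAut E} (Ψ : CptPath E)
    (h₀ : ∀ i, ∀ p ∈ E.V i, Ψ.Ψ 0 i p = φ.φ i p) (h₁ : ∀ i, ∀ p ∈ E.V i, Ψ.Ψ 1 i p = φ'.φ i p) :
    (exactOdd Θ).mkQ (chOf hΘ nabla φ) = (exactOdd Θ).mkQ (chOf hΘ nabla' φ') := by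
  obtain ⟨Φ, hΦ⟩ := exists_smoothing Ψ
  have e {S S' : Op H} (h : S = S') : relDist S S' < 1 := by
    rw [h, relDist_self]
    exact zero_lt_one
  rw [mkQ_chOf_eq_of_relDist hΘ nabla (Ψ.isCptAut 0).isUnit (φ' := Φ.at 0)
      (fun i p hp => e (h₀ i p hp)) (hΦ 0),
    mkQ_chOf_eq_of_relDist hΘ nabla' (Ψ.isCptAut 1).isUnit (φ' := Φ.at 1)
      (fun i p hp => e (h₁ i p hp)) (hΦ 1)]
  exact mkQ_chOf_eq_of_path hΘ nabla nabla' Φ (fun _ _ _ => rfl) fun _ _ _ => rfl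

theorem UtrModule.IsTrAut.isCptAut {φ : E.ι → P → Op H} (h : E.IsTrAut φ) : E.IsCptAut φ where
  isUnit := h.isUnit
  compact i p hp := TraceClass.isCompactOperator (TraceClass.mk _ (h.traceClass i p hp))
  transition := h.transition
  module := h.module

theorem mkQ_chOf_eq_of_homotopic (hΘ : c.IsThreeCurvature Θ)
    (nabla nabla' : ModuleConnection E nablaL) {φ φ' : TrAut E} (h : φ.Homotopic φ') :
    (exactOdd Θ).mkQ (chOf hΘ nabla φ) = (exactOdd Θ).mkQ (chOf hΘ nabla' φ') := by
  obtain ⟨Φ, hΦ, hT, he⟩ := h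
  refine mkQ_chOf_eq_of_cptPath hΘ nabla nabla'
    ⟨fun r => Φ (Set.projIcc 0 1 zero_le_one r), fun r => (hΦ _).isCptAut, fun i => ?_⟩
    (fun i p hp => ?_) fun i p hp => ?_
  · obtain ⟨T, hTc, hT⟩ := hT i
    have h1 : ContinuousOn (fun z : P × ℝ =>
        (1 : Op H) + (T (Set.projIcc 0 1 zero_le_one z.2, z.1)).toOp) (E.V i ×ˢ Set.univ) := by
      refine continuousOn_const.add ((opTA H).incl.continuous.comp_continuousOn
        (hTc.comp (Continuous.continuousOn ?_) fun z hz => ⟨Set.mem_univ _, hz.1⟩))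
      exact (continuous_projIcc.comp continuous_snd).prodMk continuous_fst
    exact h1.congr fun z hz => hT _ z.1 hz.1
  · simp only [Set.projIcc_left]
    exact (he i p hp).1
  · simp only [Set.projIcc_right]
    exact (he i p hp).2

end

section

section UnitaryValued

variable {A : Type*} [CStarAlgebra A]
variable {E C X : Type*} [NormedAddCommGroup E] [NormedSpace ℝ E] [TopologicalSpace C]
  {I : ModelWithCorners ℝ E C} [TopologicalSpace X] [ChartedSpace C X]

/-- A map to the unitary group is smooth if it is smooth as a map to the algebra. -/
theorem contMDiffAt_unitary_of_coe {u : X → unitary A} {x : X}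
    (h : ContMDiffAt I 𝓘(ℝ, A) ∞ (fun y => (u y : A)) x) :
    ContMDiffAt I 𝓘(ℝ, Skew A) ∞ u x := by
  rw [contMDiffAt_iff_target]
  refine ⟨Topology.IsInducing.subtypeVal.continuousAt_iff.2 h.continuousAt, ?_⟩
  have h0 : IsUnit (star (u x : A) * (u x : A) + 1) := by
    rw [Unitary.coe_star_mul_self, one_add_one_eq_two]
    exact isUnit_two'
  have hw : ContDiffAt ℝ ∞ (fun a : A => star (u x : A) * a) (u x : A) :=
    contDiffAt_const.mul contDiffAt_id
  have h1 : ContDiffAt ℝ ∞ (fun a : A => skewPart ((star (u x : A) * a - 1) *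
      Ring.inverse (star (u x : A) * a + 1))) (u x : A) :=
    skewPart.contDiff.contDiffAt.comp (u x : A) ((hw.sub contDiffAt_const).mul
      (ContDiffAt.comp (f := fun a : A => star (u x : A) * a + 1) (u x : A)
        (contDiffAt_inverse h0) (hw.add contDiffAt_const)))
  exact ContMDiffAt.comp (f := fun y => (u y : A)) x h1.contMDiffAt h

theorem ContMDiffAt.unitary_coe {u : X → unitary A} {x : X}
    (h : ContMDiffAt I 𝓘(ℝ, Skew A) ∞ u x) : ContMDiffAt I 𝓘(ℝ, A) ∞ (fun y => (u y : A)) x :=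
  contMDiff_unitary_coe.contMDiffAt.comp x h

theorem ContMDiffAt.unitary_mul {u v : X → unitary A} {x : X}
    (hu : ContMDiffAt I 𝓘(ℝ, Skew A) ∞ u x) (hv : ContMDiffAt I 𝓘(ℝ, Skew A) ∞ v x) :
    ContMDiffAt I 𝓘(ℝ, Skew A) ∞ (fun y => u y * v y) x := by
  refine contMDiffAt_unitary_of_coe ?_
  exact (contDiff_mul (𝕜 := ℝ) (𝔸 := A)).contMDiff.contMDiffAt.comp x
    (hu.unitary_coe.prodMk_space hv.unitary_coe)

theorem ContMDiffAt.unitary_inv {u : X → unitary A} {x : X}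
    (hu : ContMDiffAt I 𝓘(ℝ, Skew A) ∞ u x) :
    ContMDiffAt I 𝓘(ℝ, Skew A) ∞ (fun y => (u y)⁻¹) x := by
  refine contMDiffAt_unitary_of_coe ?_
  have h : ContDiff ℝ ∞ (fun a : A => star a) := (starL' ℝ (A := A)).contDiff
  exact h.contMDiff.contMDiffAt.comp x hu.unitary_coe

end UnitaryValued

variable {H : Type*} [NormedAddCommGroup H] [InnerProductSpace ℂ H] [CompleteSpace H]

theorem contMDiff_phase : ContMDiff 𝓘(ℝ, ℝ) 𝓘(ℝ, LieU H) ∞ (phase H) := by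
  intro t
  refine contMDiffAt_unitary_of_coe ?_
  have h : ContDiff ℝ ∞ (fun t : ℝ => Complex.exp (t * Complex.I) • (1 : Op H)) := by
    have h1 : ContDiff ℝ ∞ (fun t : ℝ => (t : ℂ) * Complex.I) :=
      Complex.ofRealCLM.contDiff.mul contDiff_const
    have h2 : ContDiff ℝ ∞ (fun t : ℝ => Complex.exp (t * Complex.I)) :=
      (Complex.contDiff_exp (𝕜 := ℝ)).comp h1
    exact ((ContinuousLinearMap.toSpanSingleton ℂ (1 : Op H)).restrictScalars ℝ).contDiff.comp h2
  exact h.contMDiff.contMDiffAt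

variable {EM M EP P : Type*} [NormedAddCommGroup EM] [NormedSpace ℝ EM] [TopologicalSpace M]
  [ChartedSpace EM M] [NormedAddCommGroup EP] [NormedSpace ℝ EP] [TopologicalSpace P]
  [ChartedSpace EP P]
variable {B : PUBundle H EM M EP P} {nablaL : GerbeConnection B}
variable {E C X : Type*} [NormedAddCommGroup E] [NormedSpace ℝ E] [TopologicalSpace C]
  {I : ModelWithCorners ℝ E C} [TopologicalSpace X] [ChartedSpace C X]
variable {E' C' X' : Type*} [NormedAddCommGroup E'] [NormedSpace ℝ E'] [TopologicalSpace C']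
  {I' : ModelWithCorners ℝ E' C'} [TopologicalSpace X'] [ChartedSpace C' X']

theorem pullback_diag {Y EY CY V : Type*} [NormedAddCommGroup EY] [NormedSpace ℝ EY]
    [TopologicalSpace CY] {J : ModelWithCorners ℝ EY CY} [TopologicalSpace Y] [ChartedSpace CY Y]
    [NormedAddCommGroup V] [NormedSpace ℝ V]
    {G : X × X' → Y} {a : X → X'} {x : X} (hG : MDifferentiableAt (I.prod I') J G (x, a x))
    (ha : MDifferentiableAt I I' a x) (θ : Form EY Y V 1) :
    pullback I J (fun y => G (y, a y)) θ x =
      pullback I J (fun y => G (y, a x)) θ x + pullback I J (fun y => G (x, a y)) θ x := by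
  have hd : MDifferentiableAt I (I.prod I') (fun y => (y, a y)) x := mdifferentiableAt_id.prodMk ha
  have h0 : mfderiv I J (fun y => G (y, a y)) x = mfderiv (I.prod I') J G (x, a x) ∘L
      mfderiv I (I.prod I') (fun y => (y, a y)) x := mfderiv_comp x hG hd
  have h1 : mfderiv I J (fun y => G (y, a x)) x = mfderiv (I.prod I') J G (x, a x) ∘L
      mfderiv I (I.prod I') (fun y => (y, a x)) x :=
    mfderiv_comp (f := fun y => (y, a x)) x hG (mdifferentiableAt_id.prodMk mdifferentiableAt_const)
  have h2 : mfderiv I J (fun y => G (x, a y)) x = mfderiv (I.prod I') J G (x, a x) ∘L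
      mfderiv I (I.prod I') (fun y => (x, a y)) x :=
    mfderiv_comp (f := fun y => (x, a y)) x hG (mdifferentiableAt_const.prodMk ha)
  have e0 : mfderiv I (I.prod I') (fun y => (y, a y)) x =
      (mfderiv I I id x).prod (mfderiv I I' a x) := mfderiv_prodMk mdifferentiableAt_id ha
  have e1 : mfderiv I (I.prod I') (fun y => (y, a x)) x =
      (mfderiv I I id x).prod (mfderiv I I' (fun _ => a x) x) :=
    mfderiv_prodMk mdifferentiableAt_id mdifferentiableAt_const
  have e2 : mfderiv I (I.prod I') (fun y => (x, a y)) x =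
      (mfderiv I I (fun _ => x) x).prod (mfderiv I I' a x) :=
    mfderiv_prodMk mdifferentiableAt_const ha
  ext v
  have hv (L : E →L[ℝ] EY) : L ∘ v = fun _ => L (v 0) := by
    funext i; rw [Subsingleton.elim i 0]; rfl
  have key : (mfderiv I J (fun y => G (y, a y)) x : E →L[ℝ] EY) (v 0) =
      (mfderiv I J (fun y => G (y, a x)) x : E →L[ℝ] EY) (v 0) +
        (mfderiv I J (fun y => G (x, a y)) x : E →L[ℝ] EY) (v 0) := by
    rw [h0, h1, h2, e0, e1, e2, mfderiv_const, mfderiv_const]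
    have := (show E × E' →L[ℝ] EY from mfderiv (I.prod I') J G (x, a x)).map_add
      ((show E →L[ℝ] E from mfderiv I I id x) (v 0), 0) (0, (show E →L[ℝ] E' from mfderiv I I' a x) (v 0))
    rw [Prod.mk_add_mk, add_zero, zero_add] at this
    exact this
  have lin (w w' : EY) : θ (G (x, a x)) (fun _ => w + w') =
      θ (G (x, a x)) (fun _ => w) + θ (G (x, a x)) (fun _ => w') := by
    have := (θ (G (x, a x))).map_update_add (fun _ => 0) 0 w w'
    have hu (w : EY) : Function.update (fun _ : Fin 1 => (0 : EY)) 0 w = fun _ => w := by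
      funext i; rw [Subsingleton.elim i 0]; simp
    rwa [hu, hu, hu] at this
  have fin (D D₁ D₂ : E →L[ℝ] EY) (h : D (v 0) = D₁ (v 0) + D₂ (v 0)) :
      θ (G (x, a x)) (D ∘ v) = θ (G (x, a x)) (D₁ ∘ v) + θ (G (x, a x)) (D₂ ∘ v) := by
    rw [hv, hv, hv, h, lin]
  exact fin _ _ _ key

end

section

variable {H : Type*} [NormedAddCommGroup H] [InnerProductSpace ℂ H] [CompleteSpace H]
variable {EM M EP P : Type*} [NormedAddCommGroup EM] [NormedSpace ℝ EM] [TopologicalSpace M]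
  [ChartedSpace EM M] [NormedAddCommGroup EP] [NormedSpace ℝ EP] [TopologicalSpace P]
  [ChartedSpace EP P]
variable {B : PUBundle H EM M EP P}
variable {E C X : Type*} [NormedAddCommGroup E] [NormedSpace ℝ E] [TopologicalSpace C]
  {I : ModelWithCorners ℝ E C} [TopologicalSpace X] [ChartedSpace C X]
variable {E' C' X' : Type*} [NormedAddCommGroup E'] [NormedSpace ℝ E'] [TopologicalSpace C']
  {I' : ModelWithCorners ℝ E' C'} [TopologicalSpace X'] [ChartedSpace C' X']

variable (H) in
/-- The inclusion of the scalars into the bounded operators. -/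
def scalarOp : ℂ →L[ℝ] Op H :=
  (ContinuousLinearMap.toSpanSingleton ℂ (1 : Op H)).restrictScalars ℝ

theorem dFun_comp {V : Type*} [NormedAddCommGroup V] [NormedSpace ℝ V] {κ : X' → X} {f : X → V}
    {x : X'} (hf : MDifferentiableAt I 𝓘(ℝ, V) f (κ x)) (hκ : MDifferentiableAt I' I κ x) :
    dFun I' (fun y => f (κ y)) x = pullback I' I κ (dFun I f) x := by
  have h : mfderiv I' 𝓘(ℝ, V) (fun y => f (κ y)) x =
      mfderiv I 𝓘(ℝ, V) f (κ x) ∘L mfderiv I' I κ x := mfderiv_comp x hf hκ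
  rw [dFun, h]
  rfl

theorem dFun_congr {V : Type*} [NormedAddCommGroup V] [NormedSpace ℝ V] {f f' : X → V}
    {x : X} (h : f =ᶠ[𝓝 x] f') : dFun I f x = dFun I f' x := by
  rw [dFun, h.mfderiv_eq, dFun]

theorem dFun_mul_apply {f g : X → Op H} {x : X} (hf : MDifferentiableAt I 𝓘(ℝ, Op H) f x)
    (hg : MDifferentiableAt I 𝓘(ℝ, Op H) g x) (v : Fin 1 → E) :
    dFun I (fun y => f y * g y) x v = dFun I f x v * g x + f x * dFun I g x v := by
  have h := (hf.hasMFDerivAt.mul' hg.hasMFDerivAt).mfderiv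
  have h' : dFun I (fun y => f y * g y) x v = f x * dFun I g x v + dFun I f x v * g x :=
    congrArg (fun L => L (v 0)) h
  rw [h', add_comm]

variable (I) in
/-- For `p' = ζ a` the connection form `a⁻¹ da - α(ζ, a)` of the connection on the trivial module
along `p'` that is trivial along `ζ`. -/
def omega (nablaL : GerbeConnection B) (ζ : X → P) (a : X → U H) : Form E X (Op H) 1 := fun x =>
  (ContinuousLinearMap.mul ℝ (Op H) (star (a x : Op H))).compContinuousAlternatingMap
      (dFun I (fun y => (a y : Op H)) x) -
    (scalarOp H).compContinuousAlternatingMap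
      (pullback I (modelPU EP H) (fun y => (ζ y, a y)) nablaL.α x)

variable {nablaL : GerbeConnection B}

theorem omega_apply (ζ : X → P) (a : X → U H) (x : X) (v : Fin 1 → E) :
    omega I nablaL ζ a x v = star (a x : Op H) * dFun I (fun y => (a y : Op H)) x v -
      pullback I (modelPU EP H) (fun y => (ζ y, a y)) nablaL.α x v • (1 : Op H) := rfl

theorem omega_congr {ζ ζ' : X → P} {a a' : X → U H} {x : X} (hζ : ζ =ᶠ[𝓝 x] ζ')
    (ha : a =ᶠ[𝓝 x] a') : omega I nablaL ζ a x = omega I nablaL ζ' a' x := by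
  have h1 : (fun y => (a y : Op H)) =ᶠ[𝓝 x] fun y => (a' y : Op H) := by
    filter_upwards [ha] with y hy
    rw [hy]
  have h2 : (fun y => (ζ y, a y)) =ᶠ[𝓝 x] fun y => (ζ' y, a' y) := hζ.prodMk ha
  rw [omega, omega, dFun_congr h1, (pullback_congr (I := I) (I' := modelPU EP H) h2 _).eq_of_nhds,
    ha.eq_of_nhds]

theorem omega_comp {κ : X' → X} {ζ : X → P} {a : X → U H} {x : X'}
    (hκ : ContMDiffAt I' I ∞ κ x) (hζ : ContMDiffAt I 𝓘(ℝ, EP) ∞ ζ (κ x))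
    (ha : ContMDiffAt I 𝓘(ℝ, LieU H) ∞ a (κ x)) :
    omega I' nablaL (fun y => ζ (κ y)) (fun y => a (κ y)) x =
      pullback I' I κ (omega I nablaL ζ a) x := by
  have h1 := dFun_comp (f := fun y => (a y : Op H)) (κ := κ) (I' := I')
    ha.unitary_coe.mdifferentiableAt' hκ.mdifferentiableAt'
  have h2 := pullback_comp_apply (g := fun y => (ζ y, a y)) (κ := κ) nablaL.α
    (hζ.prodMk ha).mdifferentiableAt' hκ.mdifferentiableAt'
  rw [omega, h1, h2]
  rfl

theorem pullback_alpha_mul {ζ : X → P} {a b : X → U H} {x : X}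
    (hζ : ContMDiffAt I 𝓘(ℝ, EP) ∞ ζ x) (ha : ContMDiffAt I 𝓘(ℝ, LieU H) ∞ a x)
    (hb : ContMDiffAt I 𝓘(ℝ, LieU H) ∞ b x) :
    pullback I (modelPU EP H) (fun y => (ζ y, a y * b y)) nablaL.α x =
      pullback I (modelPU EP H) (fun y => (ζ y, a y)) nablaL.α x +
      pullback I (modelPU EP H) (fun y => (B.act (ζ y) (a y), b y)) nablaL.α x := by
  have hκ : MDifferentiableAt I (𝓘(ℝ, EP).prod (𝓘(ℝ, LieU H).prod 𝓘(ℝ, LieU H)))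
      (fun y => (ζ y, (a y, b y))) x := (hζ.prodMk (ha.prodMk hb)).mdifferentiableAt'
  have f1 : ContMDiff (𝓘(ℝ, EP).prod (𝓘(ℝ, LieU H).prod 𝓘(ℝ, LieU H))) 𝓘(ℝ, LieU H) ∞
      (fun z : P × (U H × U H) => z.2.1) := contMDiff_fst.comp contMDiff_snd
  have f2 : ContMDiff (𝓘(ℝ, EP).prod (𝓘(ℝ, LieU H).prod 𝓘(ℝ, LieU H))) 𝓘(ℝ, LieU H) ∞
      (fun z : P × (U H × U H) => z.2.2) := contMDiff_snd.comp contMDiff_snd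
  have f0 : ContMDiff (𝓘(ℝ, EP).prod (𝓘(ℝ, LieU H).prod 𝓘(ℝ, LieU H))) 𝓘(ℝ, EP) ∞
      (fun z : P × (U H × U H) => z.1) := contMDiff_fst
  have g0 := f0.contMDiffAt (x := (ζ x, (a x, b x)))
  have g1 := f1.contMDiffAt (x := (ζ x, (a x, b x)))
  have g2 := f2.contMDiffAt (x := (ζ x, (a x, b x)))
  have e0 := pullback_comp_apply (κ := fun y => (ζ y, (a y, b y)))
    (g := fun z : P × (U H × U H) => (z.1, z.2.1 * z.2.2)) nablaL.α
    (g0.prodMk (g1.unitary_mul g2)).mdifferentiableAt' hκ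
  have e1 := pullback_comp_apply (κ := fun y => (ζ y, (a y, b y)))
    (g := fun z : P × (U H × U H) => (z.1, z.2.1)) nablaL.α
    (g0.prodMk g1).mdifferentiableAt' hκ
  have e2 := pullback_comp_apply (κ := fun y => (ζ y, (a y, b y)))
    (g := fun z : P × (U H × U H) => (B.act z.1 z.2.1, z.2.2)) nablaL.α
    ((B.contMDiff_actMap.contMDiffAt.comp _ (g0.prodMk g1)).prodMk g2).mdifferentiableAt' hκ
  refine e0.trans ?_
  rw [nablaL.multiplicative]
  refine Eq.trans ?_ (congrArg₂ (· + ·) e1 e2).symm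
  rfl

theorem star_mul_smul_one_mul (b : U H) (z : ℂ) :
    star (b : Op H) * (z • (1 : Op H)) * b = z • (1 : Op H) := by
  rw [mul_smul_comm, mul_one, smul_mul_assoc, Unitary.coe_star_mul_self]

/-- The cocycle identity of `omega`. -/
theorem omega_mul {ζ : X → P} {a b : X → U H} {x : X}
    (hζ : ContMDiffAt I 𝓘(ℝ, EP) ∞ ζ x) (ha : ContMDiffAt I 𝓘(ℝ, LieU H) ∞ a x)
    (hb : ContMDiffAt I 𝓘(ℝ, LieU H) ∞ b x) (v : Fin 1 → E) :
    omega I nablaL ζ (fun y => a y * b y) x v =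
      star (b x : Op H) * omega I nablaL ζ a x v * b x +
        omega I nablaL (fun y => B.act (ζ y) (a y)) b x v := by
  have h := dFun_mul_apply (I := I) (f := fun y => (a y : Op H)) (g := fun y => (b y : Op H))
    ha.unitary_coe.mdifferentiableAt' hb.unitary_coe.mdifferentiableAt' v
  have hc : dFun I (fun y => ((a y * b y : U H) : Op H)) x v =
      dFun I (fun y => (a y : Op H)) x v * b x + a x * dFun I (fun y => (b y : Op H)) x v := h
  rw [omega_apply, omega_apply, omega_apply, hc, pullback_alpha_mul hζ ha hb,
    ContinuousAlternatingMap.add_apply, mul_sub, sub_mul, star_mul_smul_one_mul, Submonoid.coe_mul,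
    star_mul, add_smul, mul_add]
  have h1 : star (b x : Op H) * star (a x : Op H) * ((a x : Op H) * dFun I (fun y => (b y : Op H)) x v) =
      star (b x : Op H) * dFun I (fun y => (b y : Op H)) x v := by
    rw [mul_assoc, ← mul_assoc (star (a x : Op H)), Unitary.coe_star_mul_self, one_mul]
  rw [h1]
  simp only [mul_assoc]
  abel

end

section

variable {H : Type*} [NormedAddCommGroup H] [InnerProductSpace ℂ H] [CompleteSpace H]
variable {EM M EP P : Type*} [NormedAddCommGroup EM] [NormedSpace ℝ EM] [TopologicalSpace M]
  [ChartedSpace EM M] [NormedAddCommGroup EP] [NormedSpace ℝ EP] [TopologicalSpace P]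
  [ChartedSpace EP P]
variable {B : PUBundle H EM M EP P} {nablaL : GerbeConnection B}
variable {E C X : Type*} [NormedAddCommGroup E] [NormedSpace ℝ E] [TopologicalSpace C]
  {I : ModelWithCorners ℝ E C} [TopologicalSpace X] [ChartedSpace C X]

theorem phase_coe (t : ℝ) : (phase H t : Op H) = Complex.exp (t * Complex.I) • (1 : Op H) := rfl

theorem phase_zero : phase H 0 = 1 := Subtype.ext (by simp [phase_coe])

theorem phase_mul_phase (s t : ℝ) : phase H s * phase H t = phase H (s + t) := by
  refine Subtype.ext ?_
  rw [Submonoid.coe_mul, phase_coe, phase_coe, phase_coe, smul_mul_smul_comm, one_mul,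
    ← Complex.exp_add, Complex.ofReal_add, add_mul]

theorem form_one_apply {V : Type*} [NormedAddCommGroup V] [NormedSpace ℝ V]
    (η : ℝ [⋀^Fin 1]→L[ℝ] V) (v : Fin 1 → ℝ) : η v = v 0 • η ![1] := by
  have h := η.map_update_smul (fun _ => 0) 0 (v 0) 1
  have hu (w : ℝ) : Function.update (fun _ : Fin 1 => (0 : ℝ)) 0 w = fun _ => w := by
    funext i; rw [Subsingleton.elim i 0]; simp
  rw [hu, hu, smul_eq_mul, mul_one] at h
  have h1 : v = fun _ => v 0 := by funext i; rw [Subsingleton.elim i 0]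
  have h2 : (![1] : Fin 1 → ℝ) = fun _ => 1 := by funext i; rw [Subsingleton.elim i 0]; rfl
  rw [h1, h2]
  exact h

theorem pullback_real_apply {V : Type*} [NormedAddCommGroup V] [NormedSpace ℝ V] (t : X → ℝ)
    (θ : Form ℝ ℝ V 1) (x : X) (v : Fin 1 → E) :
    pullback I 𝓘(ℝ, ℝ) t θ x v = dFun I t x v • θ (t x) ![1] :=
  form_one_apply (θ (t x)) ((show E →L[ℝ] ℝ from mfderiv I 𝓘(ℝ, ℝ) t x) ∘ v)

theorem pullback_alpha_one {ζ : X → P} {x : X} (hζ : ContMDiffAt I 𝓘(ℝ, EP) ∞ ζ x) :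
    pullback I (modelPU EP H) (fun y => (ζ y, (1 : U H))) nablaL.α x = 0 := by
  have h := pullback_alpha_mul (nablaL := nablaL) hζ (a := fun _ => 1) (b := fun _ => 1)
    contMDiffAt_const contMDiffAt_const
  simp only [mul_one, B.act_one] at h
  exact left_eq_add.1 h

theorem pullback_alpha_phase {ζ : X → P} {t : X → ℝ} {x : X}
    (hζ : ContMDiffAt I 𝓘(ℝ, EP) ∞ ζ x) (ht : ContMDiffAt I 𝓘(ℝ, ℝ) ∞ t x) (v : Fin 1 → E) :
    pullback I (modelPU EP H) (fun y => (ζ y, phase H (t y))) nablaL.α x v =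
      dFun I t x v • Complex.I := by
  have hpt : ContMDiffAt I 𝓘(ℝ, LieU H) ∞ (fun y => phase H (t y)) x :=
    contMDiff_phase.contMDiffAt.comp x ht
  have ht' : ContMDiffAt I 𝓘(ℝ, ℝ) ∞ (fun y => -t x + t y) x := contMDiffAt_const.add ht
  have f0 : ContMDiffAt (modelPU EP H) 𝓘(ℝ, EP) ∞ (fun z : P × U H => z.1) (ζ x, phase H (t x)) :=
    contMDiffAt_fst
  have f1 : ContMDiffAt (modelPU EP H) 𝓘(ℝ, LieU H) ∞ (fun z : P × U H => z.2)
    (ζ x, phase H (t x)) := contMDiffAt_snd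
  have e0 := pullback_comp_apply (κ := fun y => (ζ y, phase H (t y)))
    (g := fun z : P × U H => (z.1, phase H (-t x) * z.2)) nablaL.α
    (f0.prodMk (contMDiffAt_const.unitary_mul f1)).mdifferentiableAt'
    (hζ.prodMk hpt).mdifferentiableAt'
  rw [nablaL.invariant] at e0
  simp only [phase_mul_phase] at e0
  have hG : MDifferentiableAt (I.prod 𝓘(ℝ, ℝ)) (modelPU EP H)
      (fun z : X × ℝ => (ζ z.1, phase H z.2)) (x, -t x + t x) := by
    have h1 : ContMDiffAt (I.prod 𝓘(ℝ, ℝ)) 𝓘(ℝ, EP) ∞ (fun z : X × ℝ => ζ z.1) (x, -t x + t x) :=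
      ContMDiffAt.comp (g := ζ) (x, -t x + t x) hζ contMDiffAt_fst
    have h2 : ContMDiffAt (I.prod 𝓘(ℝ, ℝ)) 𝓘(ℝ, LieU H) ∞ (fun z : X × ℝ => phase H z.2)
        (x, -t x + t x) :=
      ContMDiffAt.comp (x, -t x + t x) contMDiff_phase.contMDiffAt contMDiffAt_snd
    exact (h1.prodMk h2).mdifferentiableAt'
  have e1 := pullback_diag (G := fun z : X × ℝ => (ζ z.1, phase H z.2))
    (a := fun y => -t x + t y) hG ht'.mdifferentiableAt' nablaL.α
  simp only [neg_add_cancel, phase_zero] at e1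
  rw [pullback_alpha_one hζ, zero_add] at e1
  have hv : MDifferentiableAt 𝓘(ℝ, ℝ) (modelPU EP H) (fun s : ℝ => (ζ x, phase H s))
      (-t x + t x) :=
    (contMDiffAt_const.prodMk contMDiff_phase.contMDiffAt).mdifferentiableAt'
  have e2 := pullback_comp_apply (κ := fun y => -t x + t y)
    (g := fun s : ℝ => (ζ x, phase H s)) nablaL.α hv ht'.mdifferentiableAt'
  have hvert := nablaL.vertical (ζ x) 1
  simp only [mul_one] at hvert
  have e3 : dFun I (fun y => -t x + t y) x = dFun I t x := by
    have h := mfderiv_add (I := I) (f := fun _ => -t x) (g := t) mdifferentiableAt_const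
      ht.mdifferentiableAt'
    rw [mfderiv_const] at h
    have h' := h.trans (zero_add (show E →L[ℝ] ℝ from mfderiv I 𝓘(ℝ, ℝ) t x))
    rw [dFun, dFun]
    exact congrArg _ h'
  rw [← e0, e1, e2, pullback_real_apply, neg_add_cancel, hvert, e3]

theorem omega_phase {ζ : X → P} {t : X → ℝ} {x : X}
    (hζ : ContMDiffAt I 𝓘(ℝ, EP) ∞ ζ x) (ht : ContMDiffAt I 𝓘(ℝ, ℝ) ∞ t x) :
    omega I nablaL ζ (fun y => phase H (t y)) x = 0 := by
  ext1 v
  have hd : HasDerivAt (fun s : ℝ => (phase H s : Op H)) (Complex.I • (phase H (t x) : Op H)) (t x) := by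
    have h1 : HasDerivAt (fun s : ℝ => Complex.exp (s * Complex.I))
        (Complex.exp (t x * Complex.I) * Complex.I) (t x) := by
      have h2 : HasDerivAt (fun s : ℝ => (s : ℂ) * Complex.I) (1 * Complex.I) (t x) :=
        Complex.ofRealCLM.hasDerivAt.mul_const Complex.I
      simpa using h2.cexp
    have h3 := h1.smul_const (1 : Op H)
    rw [phase_coe, smul_smul, mul_comm]
    exact h3
  have h1 := dFun_comp (I := 𝓘(ℝ, ℝ)) (f := fun s : ℝ => (phase H s : Op H)) (κ := t) (I' := I)
    hd.hasFDerivAt.hasMFDerivAt.mdifferentiableAt ht.mdifferentiableAt'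
  have h2 : dFun I (fun y => (phase H (t y) : Op H)) x v =
      dFun I t x v • (Complex.I • (phase H (t x) : Op H)) := by
    rw [h1, pullback_real_apply]
    congr 1
    change mfderiv 𝓘(ℝ, ℝ) 𝓘(ℝ, Op H) (fun s : ℝ => (phase H s : Op H)) (t x) (1 : ℝ) = _
    rw [mfderiv_eq_fderiv, hd.hasFDerivAt.fderiv]
    exact one_smul ℝ _
  rw [omega_apply, h2, pullback_alpha_phase hζ ht, mul_smul_comm, mul_smul_comm,
    Unitary.coe_star_mul_self, smul_assoc, sub_self]
  rfl

theorem contMDiffAt_scalar {z : X → ℂ} {x : X} {c : X → Op H} [Nontrivial H]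
    (hc : ContMDiffAt I 𝓘(ℝ, Op H) ∞ c x) (hz : ∀ᶠ y in 𝓝 x, c y = z y • (1 : Op H)) :
    ContMDiffAt I 𝓘(ℝ, ℂ) ∞ z x := by
  obtain ⟨e, he⟩ := exists_norm_eq H zero_le_one
  have h : ContDiff ℝ ∞ (fun a : Op H => ⟪e, a e⟫_ℂ) := by
    have h1 : ContDiff ℂ ∞ (fun a : Op H => innerSL ℂ e (a e)) :=
      (innerSL ℂ e).contDiff.comp (ContinuousLinearMap.apply ℂ H e).contDiff
    exact h1.restrict_scalars ℝ
  refine (h.contMDiff.contMDiffAt.comp x hc).congr_of_eventuallyEq ?_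
  filter_upwards [hz] with y hy
  simp [hy, inner_self_eq_norm_sq_to_K, he]

theorem omega_eq_zero {ζ : X → P} {c : X → U H} {x : X}
    (hζ : ContMDiffAt I 𝓘(ℝ, EP) ∞ ζ x) (hc : ContMDiffAt I 𝓘(ℝ, LieU H) ∞ c x)
    (h : ∀ᶠ y in 𝓝 x, B.act (ζ y) (c y) = ζ y) : omega I nablaL ζ c x = 0 := by
  rcases subsingleton_or_nontrivial H with hH | hH
  · ext v w
    exact Subsingleton.elim _ _
  have h1 : ∀ y, ∃ s : ℝ, B.act (ζ y) (c y) = ζ y → c y = phase H s := fun y => by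
    by_cases hy : B.act (ζ y) (c y) = ζ y
    · obtain ⟨s, hs⟩ := exists_phase_eq ((B.act_eq_self_iff _ _).1 hy)
      exact ⟨s, fun _ => hs⟩
    · exact ⟨0, fun h => absurd h hy⟩
  choose s hs using h1
  set z : X → ℂ := fun y => Complex.exp (s y * Complex.I) with hz
  have hzn (y) : ‖z y‖ = 1 := Complex.norm_exp_ofReal_mul_I (s y)
  have hzs : ContMDiffAt I 𝓘(ℝ, ℂ) ∞ z x := contMDiffAt_scalar hc.unitary_coe (by
    filter_upwards [h] with y hy
    rw [hs y hy, phase_coe])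
  have hzx : (starRingEnd ℂ) (z x) * z x = 1 := by
    rw [Complex.conj_mul', hzn]; simp
  set t : X → ℝ := fun y => Complex.arg (z x) + Complex.arg ((starRingEnd ℂ) (z x) * z y) with ht
  have harg : ContDiffAt ℝ ∞ (fun w : ℂ => Complex.arg (z x) + Complex.arg ((starRingEnd ℂ) (z x) * w))
      (z x) := by
    refine contDiffAt_const.add ?_
    have h2 : ContDiffAt ℝ ∞ Complex.log ((starRingEnd ℂ) (z x) * z x) := by
      rw [hzx]
      exact (Complex.contDiffAt_log (n := ∞) Complex.one_mem_slitPlane).restrict_scalars ℝ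
    have h3 := Complex.imCLM.contDiff.contDiffAt.comp (z x)
      (ContDiffAt.comp (f := fun w => (starRingEnd ℂ) (z x) * w) (z x) h2
        (contDiffAt_const.mul contDiffAt_id))
    refine h3.congr_of_eventuallyEq (Filter.Eventually.of_forall fun w => ?_)
    exact (Complex.log_im _).symm
  have hts : ContMDiffAt I 𝓘(ℝ, ℝ) ∞ t x := harg.contMDiffAt.comp x hzs
  rw [← omega_phase (nablaL := nablaL) hζ hts]
  refine omega_congr Filter.EventuallyEq.rfl ?_
  have hexp (w : ℂ) (hw : ‖w‖ = 1) : Complex.exp (Complex.arg w * Complex.I) = w := by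
    have := Complex.norm_mul_exp_arg_mul_I w
    rwa [hw, Complex.ofReal_one, one_mul] at this
  filter_upwards [h] with y hy
  rw [hs y hy]
  refine Subtype.ext ?_
  rw [phase_coe, phase_coe]
  congr 1
  rw [ht]
  simp only [Complex.ofReal_add, add_mul, Complex.exp_add]
  rw [hexp _ (hzn x), hexp _ (by rw [norm_mul, RCLike.norm_conj, hzn, hzn, one_mul]), ← mul_assoc,
    mul_comm (z x), hzx, one_mul]

/-- `omega` depends on `a` only through the image of `a` in `PU(H)`. -/
theorem omega_eq_of_act_eq {ζ : X → P} {a b : X → U H} {x : X}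
    (hζ : ContMDiffAt I 𝓘(ℝ, EP) ∞ ζ x) (ha : ContMDiffAt I 𝓘(ℝ, LieU H) ∞ a x)
    (hb : ContMDiffAt I 𝓘(ℝ, LieU H) ∞ b x)
    (h : ∀ᶠ y in 𝓝 x, B.act (ζ y) (a y) = B.act (ζ y) (b y)) :
    omega I nablaL ζ a x = omega I nablaL ζ b x := by
  have hc : ContMDiffAt I 𝓘(ℝ, LieU H) ∞ (fun y => a y * (b y)⁻¹) x := ha.unitary_mul hb.unitary_inv
  have hfix : ∀ᶠ y in 𝓝 x, B.act (ζ y) (a y * (b y)⁻¹) = ζ y := by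
    filter_upwards [h] with y hy
    rw [B.act_mul, hy, ← B.act_mul, mul_inv_cancel, B.act_one]
  ext1 v
  have h1 := omega_mul (nablaL := nablaL) hζ hc hb v
  simp only [inv_mul_cancel_right] at h1
  rw [h1, omega_eq_zero hζ hc hfix, omega_congr (ζ' := ζ) hfix Filter.EventuallyEq.rfl]
  change star (b x : Op H) * 0 * b x + _ = _
  rw [mul_zero, zero_mul, zero_add]

end

section

universe u₁ u₂ u₃ u₄ u₅ w

variable {H : Type u₁} [NormedAddCommGroup H] [InnerProductSpace ℂ H] [CompleteSpace H]
variable {EM : Type u₂} {M : Type u₃} {EP : Type u₄} {P : Type u₅} [NormedAddCommGroup EM]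
  [NormedSpace ℝ EM] [TopologicalSpace M]
  [ChartedSpace EM M] [NormedAddCommGroup EP] [NormedSpace ℝ EP] [TopologicalSpace P]
  [ChartedSpace EP P]
variable {B : PUBundle H EM M EP P} {nablaL : GerbeConnection B}

theorem SmoothTrOn.of_eq_one {E C X : Type*} [NormedAddCommGroup E] [NormedSpace ℝ E]
    [TopologicalSpace C] {I : ModelWithCorners ℝ E C} [TopologicalSpace X] [ChartedSpace C X]
    {g : X → Op H} {s : Set X} (h : ∀ x ∈ s, g x = 1) : SmoothTrOn I g s :=
  ⟨fun _ => 0, contMDiffOn_const, fun x hx => by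
    rw [h x hx]
    exact (add_zero (1 : Op H)).symm⟩

variable (B) in
/-- The trivial module `P × H`, on which `(p, û)` acts as `û`. -/
def trivialModule : UtrModule.{u₁, u₂, u₃, u₄, u₅, w} B where
  ι := PUnit
  V _ := Set.univ
  isOpen _ := isOpen_univ
  cover _ := ⟨PUnit.unit, Set.mem_univ _⟩
  g _ _ _ := 1
  g_tr _ _ := SmoothTrOn.of_eq_one fun _ _ => rfl
  g_unitary _ _ _ _ := one_mem _
  g_self _ _ _ := rfl
  g_mul _ _ _ _ _ := one_mul 1
  ψ _ _ x := x.2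
  ψ_tr _ _ := SmoothTrOn.of_eq_one fun x _ => Unitary.mul_star_self_of_mem x.2.2
  ψ_unitary _ _ x _ _ := x.2.2
  ψ_phase _ _ _ u t _ _ := by
    rw [Submonoid.coe_mul, phase_coe, smul_mul_assoc, one_mul]
  ψ_g _ _ _ _ _ _ _ := by rw [mul_one, one_mul]
  ψ_mul _ _ _ _ _ _ _ _ _ := rfl

/-- The identity trivialisation of the trivial module. -/
def trivialTrivialization : ModuleTrivialization (trivialModule.{u₁, u₂, u₃, u₄, u₅, w} B) where
  τ _ _ := 1
  smooth _ := contMDiffOn_const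
  isUnit _ _ _ := isUnit_one
  transition _ _ _ _ := one_mul 1
  module _ _ x _ _ := by
    rw [one_mul, mul_one]
    rfl

variable {F : Type*} [NormedAddCommGroup F] [NormedSpace ℝ F]
variable {E C X : Type*} [NormedAddCommGroup E] [NormedSpace ℝ E] [TopologicalSpace C]
  {I : ModelWithCorners ℝ E C} [TopologicalSpace X] [ChartedSpace C X]

theorem pullback_id {V : Type*} [NormedAddCommGroup V] [NormedSpace ℝ V] {n : ℕ} (θ : Form E X V n)
    (x : X) : pullback I I (fun y => y) θ x = θ x := by
  have h : mfderiv I I (fun y : X => y) x = ContinuousLinearMap.id ℝ (TangentSpace I x) := mfderiv_id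
  rw [pullback, h]
  rfl

theorem pullback_eq_of_eq {E' C' X' V : Type*} [NormedAddCommGroup E'] [NormedSpace ℝ E']
    [TopologicalSpace C'] {I' : ModelWithCorners ℝ E' C'} [TopologicalSpace X'] [ChartedSpace C' X']
    [NormedAddCommGroup V] [NormedSpace ℝ V] {n : ℕ} {κ : X' → X} {x : X'} {θ θ' : Form E X V n}
    (h : θ (κ x) = θ' (κ x)) : pullback I' I κ θ x = pullback I' I κ θ' x := by
  rw [pullback, pullback, h]

theorem contDiffAt_omega [IsManifold 𝓘(ℝ, EP) ∞ P] {ζ : F → P} {a : F → U H} {x : F}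
    (hζ : SmoothNear 𝓘(ℝ, EP) ζ x) (ha : SmoothNear 𝓘(ℝ, LieU H) a x) :
    ContDiffAt ℝ ∞ (omega 𝓘(ℝ, F) nablaL ζ a) x := by
  have hc : ContDiffAt ℝ ∞ (fun y => (a y : Op H)) x :=
    contMDiffAt_iff_contDiffAt.1 ha.self_of_nhds.unitary_coe
  have h1 : ContDiffAt ℝ ∞ (pullback 𝓘(ℝ, F) (modelPU EP H) (fun y => (ζ y, a y)) nablaL.α) x := by
    refine contDiffAt_pullback nablaL.smooth isOpen_univ ?_ (Set.mem_univ _)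
    filter_upwards [hζ, ha] with y h h' using h.prodMk h'
  have h2 : ContDiffAt ℝ ∞ (fun y => (scalarOp H).compContinuousAlternatingMap
      (pullback 𝓘(ℝ, F) (modelPU EP H) (fun y => (ζ y, a y)) nablaL.α y)) x :=
    ContDiffAt.compAlternating contDiffAt_const h1
  have h3 : ContDiffAt ℝ ∞ (dFun 𝓘(ℝ, F) (fun y => (a y : Op H))) x := by
    have h4 : ContDiffAt ℝ ∞ (fderiv ℝ (fun y => (a y : Op H))) x := hc.fderiv_right (by simp)
    have h0 : ContDiff ℝ ∞ (ContinuousAlternatingMap.ofSubsingletonLIE (𝕜 := ℝ) (E := F)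
        (F := Op H) (0 : Fin 1)) := LinearIsometryEquiv.contDiff _
    have h5 := h0.contDiffAt.comp x h4
    refine h5.congr_of_eventuallyEq (Filter.Eventually.of_forall fun y => ?_)
    rw [dFun, mfderiv_eq_fderiv]
    rfl
  have h4 : ContDiffAt ℝ ∞ (fun y => ContinuousLinearMap.mul ℝ (Op H) (star (a y : Op H))) x :=
    (ContinuousLinearMap.mul ℝ (Op H)).contDiff.contDiffAt.comp x
      ((starL' ℝ (A := Op H)).contDiff.contDiffAt.comp x hc)
  exact (ContDiffAt.compAlternating h4 h3).sub h2

variable (B) in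
/-- A smooth local section of `P → M`, with local smooth lifts to `U(H)` of the associated map to
`PU(H)`. -/
structure PUBundle.LocalSection where
  W : Set M
  isOpen : IsOpen W
  σ : M → P
  smooth : ContMDiffOn 𝓘(ℝ, EM) 𝓘(ℝ, EP) ∞ σ W
  g : P → P → U H
  smooth_g : ∀ p, B.proj p ∈ W → ∀ᶠ q in 𝓝 p, ContMDiffAt 𝓘(ℝ, EP) 𝓘(ℝ, LieU H) ∞ (g p) q
  act_g : ∀ p, B.proj p ∈ W → ∀ᶠ q in 𝓝 p, B.act (σ (B.proj q)) (g p q) = q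

theorem PUBundle.exists_localSection (m : M) : ∃ S : B.LocalSection, m ∈ S.W := by
  obtain ⟨W, hW, hm, σ, hσ, -, h⟩ := B.locally_trivial m
  have h' : ∀ p, ∃ g : P → U H, B.proj p ∈ W →
      (∀ᶠ q in 𝓝 p, ContMDiffAt 𝓘(ℝ, EP) 𝓘(ℝ, LieU H) ∞ g q) ∧
      ∀ᶠ q in 𝓝 p, B.act (σ (B.proj q)) (g q) = q := fun p => by
    by_cases hp : B.proj p ∈ W
    · obtain ⟨V, hV, hpV, g, hg, hact⟩ := h p hp
      refine ⟨g, fun _ => ⟨?_, ?_⟩⟩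
      · filter_upwards [hV.mem_nhds hpV] with q hq using hg.contMDiffAt (hV.mem_nhds hq)
      · filter_upwards [hV.mem_nhds hpV] with q hq using hact q hq
    · exact ⟨1, fun h => absurd h hp⟩
  choose g hg using h'
  exact ⟨⟨W, hW, σ, hσ, g, fun p hp => (hg p hp).1, fun p hp => (hg p hp).2⟩, hm⟩

namespace PUBundle.LocalSection

variable (S : B.LocalSection)

variable (nablaL) in
/-- The connection form on the trivial module over `π⁻¹ W` that vanishes along the section. -/
def form : Form EP P (Op H) 1 := fun q =>
  omega 𝓘(ℝ, EP) nablaL (fun q => S.σ (B.proj q)) (S.g q) q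

variable {S}

theorem contMDiffAt_section {p : P} (hp : B.proj p ∈ S.W) :
    ContMDiffAt 𝓘(ℝ, EP) 𝓘(ℝ, EP) ∞ (fun q => S.σ (B.proj q)) p :=
  (S.smooth.contMDiffAt (S.isOpen.mem_nhds hp)).comp p B.contMDiff_proj.contMDiffAt

theorem pullback_form {κ : X → P} {a : X → U H} {x : X}
    (hκ : ContMDiffAt I 𝓘(ℝ, EP) ∞ κ x) (hx : B.proj (κ x) ∈ S.W)
    (ha : ContMDiffAt I 𝓘(ℝ, LieU H) ∞ a x)
    (h : ∀ᶠ y in 𝓝 x, B.act (S.σ (B.proj (κ y))) (a y) = κ y) :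
    pullback I 𝓘(ℝ, EP) κ (S.form nablaL) x =
      omega I nablaL (fun y => S.σ (B.proj (κ y))) a x := by
  have hg := (S.smooth_g _ hx).self_of_nhds
  have h1 := omega_comp (nablaL := nablaL) (κ := κ) hκ (contMDiffAt_section hx) hg
  have h0 : S.form nablaL (κ x) =
      omega 𝓘(ℝ, EP) nablaL (fun q => S.σ (B.proj q)) (S.g (κ x)) (κ x) := rfl
  rw [pullback_eq_of_eq h0]
  rw [← h1]
  refine omega_eq_of_act_eq ((contMDiffAt_section hx).comp x hκ) (hg.comp x hκ) ha ?_
  filter_upwards [h, hκ.continuousAt.eventually (S.act_g _ hx)] with y h1 h2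
  rw [h1, h2]

theorem contDiffAt_pullback_form [IsManifold 𝓘(ℝ, EP) ∞ P] {γ : F → P} {x : F}
    (hγ : SmoothNear 𝓘(ℝ, EP) γ x) (hx : B.proj (γ x) ∈ S.W) :
    ContDiffAt ℝ ∞ (pullback 𝓘(ℝ, F) 𝓘(ℝ, EP) γ (S.form nablaL)) x := by
  have hc := hγ.self_of_nhds.continuousAt
  have hW : ∀ᶠ y in 𝓝 x, B.proj (γ y) ∈ S.W :=
    (B.contMDiff_proj.continuous.continuousAt.comp hc).eventually (S.isOpen.mem_nhds hx)
  have hg : SmoothNear 𝓘(ℝ, LieU H) (fun y => S.g (γ x) (γ y)) x := by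
    filter_upwards [hγ, hc.eventually (S.smooth_g _ hx)] with y h1 h2 using h2.comp y h1
  have hσ : SmoothNear 𝓘(ℝ, EP) (fun y => S.σ (B.proj (γ y))) x := by
    filter_upwards [hγ, hW] with y h1 h2 using (contMDiffAt_section h2).comp y h1
  refine (contDiffAt_omega (nablaL := nablaL) hσ hg).congr_of_eventuallyEq ?_
  filter_upwards [hγ, hW, hg, (hc.eventually (S.act_g _ hx)).eventually_nhds] with y h1 h2 h3 h4
  exact pullback_form h1 h2 h3 h4

theorem mul_add_smul_eq {u : U H} {T D A : Op H} {a : ℂ}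
    (h : T = star (u : Op H) * A * u + (star (u : Op H) * D - a • (1 : Op H))) :
    (u : Op H) * T + a • (u : Op H) = D + A * u := by
  have hu : (u : Op H) * star (u : Op H) = 1 := Unitary.mul_star_self_of_mem u.2
  rw [h, mul_add, mul_sub, ← mul_assoc, ← mul_assoc, ← mul_assoc, hu, one_mul, one_mul,
    mul_smul_comm, mul_one]
  abel

/-- The module law for the connection form of a local section. -/
theorem form_module {x : P × U H} (hx : B.proj x.1 ∈ S.W) (v : Fin 1 → EP × LieU H) :
    (x.2 : Op H) * pullback (modelPU EP H) 𝓘(ℝ, EP) B.actMap (S.form nablaL) x v +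
        nablaL.α x v • (x.2 : Op H) =
      dFun (modelPU EP H) (fun x : P × U H => (x.2 : Op H)) x v +
        pullback (modelPU EP H) 𝓘(ℝ, EP) Prod.fst (S.form nablaL) x v * x.2 := by
  have hx' : B.proj (B.actMap x) ∈ S.W := by rwa [actMap, B.proj_act]
  have hfst : ContMDiffAt (modelPU EP H) 𝓘(ℝ, EP) ∞ (Prod.fst : P × U H → P) x := contMDiffAt_fst
  have hsnd : ContMDiffAt (modelPU EP H) 𝓘(ℝ, LieU H) ∞ (fun y : P × U H => y.2) x :=
    contMDiffAt_snd
  have hg : ContMDiffAt (modelPU EP H) 𝓘(ℝ, LieU H) ∞ (fun y : P × U H => S.g x.1 y.1) x :=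
    (S.smooth_g _ hx).self_of_nhds.comp x hfst
  have hact : ∀ᶠ y : P × U H in 𝓝 x, B.act (S.σ (B.proj y.1)) (S.g x.1 y.1) = y.1 :=
    hfst.continuousAt.eventually (S.act_g _ hx)
  have e1 : pullback (modelPU EP H) 𝓘(ℝ, EP) Prod.fst (S.form nablaL) x =
      omega (modelPU EP H) nablaL (fun y : P × U H => S.σ (B.proj y.1)) (fun y => S.g x.1 y.1) x :=
    pullback_form (κ := Prod.fst) hfst hx hg hact
  have e2 : pullback (modelPU EP H) 𝓘(ℝ, EP) B.actMap (S.form nablaL) x =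
      omega (modelPU EP H) nablaL (fun y : P × U H => S.σ (B.proj y.1))
        (fun y => S.g x.1 y.1 * y.2) x := by
    rw [pullback_form (κ := B.actMap) B.contMDiff_actMap.contMDiffAt hx' (hg.unitary_mul hsnd)]
    · refine omega_congr (Filter.Eventually.of_forall fun y => ?_) Filter.EventuallyEq.rfl
      change S.σ (B.proj (B.actMap y)) = _
      rw [actMap, B.proj_act]
    · filter_upwards [hact] with y hy
      rw [actMap, B.proj_act, B.act_mul, hy]
  have hσ : ContMDiffAt (modelPU EP H) 𝓘(ℝ, EP) ∞ (fun y : P × U H => S.σ (B.proj y.1)) x :=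
    (contMDiffAt_section hx).comp x hfst
  have e3 := omega_mul (nablaL := nablaL) hσ hg hsnd v
  have e4 : omega (modelPU EP H) nablaL (fun y : P × U H => B.act (S.σ (B.proj y.1)) (S.g x.1 y.1))
      (fun y => y.2) x = omega (modelPU EP H) nablaL Prod.fst (fun y => y.2) x :=
    omega_congr hact Filter.EventuallyEq.rfl
  have e5 : pullback (modelPU EP H) (modelPU EP H) (fun y : P × U H => (y.1, y.2)) nablaL.α x =
      nablaL.α x := pullback_id nablaL.α x
  have e6 := e3.trans (congrArg _ (congrArg (fun η => η v) e4))
  rw [omega_apply (ζ := Prod.fst), e5] at e6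
  rw [e1, e2]
  exact mul_add_smul_eq e6

end PUBundle.LocalSection

end

section

universe u₁ u₂ u₃ u₄ u₅ w w'

variable {H : Type u₁} [NormedAddCommGroup H] [InnerProductSpace ℂ H] [CompleteSpace H]
variable {EM : Type u₂} {M : Type u₃} {EP : Type u₄} {P : Type u₅} [NormedAddCommGroup EM]
  [NormedSpace ℝ EM] [TopologicalSpace M]
  [ChartedSpace EM M] [NormedAddCommGroup EP] [NormedSpace ℝ EP] [TopologicalSpace P]
  [ChartedSpace EP P]
variable {B : PUBundle H EM M EP P} {nablaL : GerbeConnection B}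
variable {F : Type*} [NormedAddCommGroup F] [NormedSpace ℝ F]
variable {E C X : Type*} [NormedAddCommGroup E] [NormedSpace ℝ E] [TopologicalSpace C]
  {I : ModelWithCorners ℝ E C} [TopologicalSpace X] [ChartedSpace C X]
variable {E' C' X' : Type*} [NormedAddCommGroup E'] [NormedSpace ℝ E'] [TopologicalSpace C']
  {I' : ModelWithCorners ℝ E' C'} [TopologicalSpace X'] [ChartedSpace C' X']

theorem pullback_finsum_smul {ι V : Type*} [NormedAddCommGroup V] [NormedSpace ℝ V] {n : ℕ}
    {κ : X' → X} {x : X'} {f : ι → X → ℝ} {A : ι → Form E X V n} {S : Finset ι}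
    (hS : ∀ m, f m (κ x) ≠ 0 → m ∈ S) :
    pullback I' I κ (fun q => ∑ᶠ m, f m q • A m q) x =
      ∑ m ∈ S, f m (κ x) • pullback I' I κ (A m) x := by
  have gen (L : E' →L[ℝ] E) : (∑ᶠ m, f m (κ x) • A m (κ x)).compContinuousLinearMap L =
      ∑ m ∈ S, f m (κ x) • (A m (κ x)).compContinuousLinearMap L := by
    rw [finsum_smul_eq_sum hS fun m => A m (κ x)]
    exact (map_sum (ContinuousAlternatingMap.compContinuousLinearMapCLM L) _ _).trans
      (Finset.sum_congr rfl fun m _ => rfl)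
  exact gen _

/-- The trivial module has a module connection. -/
theorem exists_moduleConnection [IsManifold 𝓘(ℝ, EM) ∞ M] [FiniteDimensional ℝ EM] [T2Space M]
    [SecondCountableTopology M] [IsManifold 𝓘(ℝ, EP) ∞ P] (nablaL : GerbeConnection B) :
    Nonempty (ModuleConnection (trivialModule.{u₁, u₂, u₃, u₄, u₅, w} B) nablaL) := by
  choose S hS using B.exists_localSection
  have : LocallyCompactSpace M := Manifold.locallyCompact_of_finiteDimensional 𝓘(ℝ, EM)
  obtain ⟨f, hf⟩ := SmoothPartitionOfUnity.exists_isSubordinate 𝓘(ℝ, EM)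
    isClosed_univ (fun m => (S m).W) (fun m => (S m).isOpen) (fun m _ => Set.mem_iUnion.2 ⟨m, hS m⟩)
  have hmem {m y : M} (h : f m y ≠ 0) : y ∈ (S m).W := hf m (subset_tsupport _ h)
  let A : Form EP P (Op H) 1 := fun q => ∑ᶠ m, f m (B.proj q) • (S m).form nablaL q
  refine ⟨⟨fun _ => A, fun _ => ?_, fun i j p _ v => ?_, fun j i x _ _ v => ?_⟩⟩
  · refine isSmoothOn_of_pullback fun γ x hγ _ => ?_
    have hh : ContMDiffAt 𝓘(ℝ, EP) 𝓘(ℝ, EM) ∞ (fun y => B.proj (γ y)) x :=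
      B.contMDiff_proj.contMDiffAt.comp x hγ.self_of_nhds
    have h1 := f.contMDiffAt_finsum_comp hh
      (g := fun m => pullback 𝓘(ℝ, EP) 𝓘(ℝ, EP) γ ((S m).form nablaL)) fun m hm =>
        (PUBundle.LocalSection.contDiffAt_pullback_form hγ (hf m hm)).contMDiffAt
    refine (contMDiffAt_iff_contDiffAt.1 h1).congr_of_eventuallyEq
      (Filter.Eventually.of_forall fun y => ?_)
    obtain ⟨T, hT, -⟩ := f.exists_finset_sum (B.proj (γ y))
    have h2 := pullback_finsum_smul (I := 𝓘(ℝ, EP)) (I' := 𝓘(ℝ, EP)) (κ := γ) (x := y)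
      (f := fun m q => f m (B.proj q)) (A := fun m => (S m).form nablaL) fun m hm => (hT m).1 hm
    exact h2.trans (finsum_smul_eq_sum (fun m hm => (hT m).1 hm) _).symm
  · change (1 : Op H) * A p v = dFun 𝓘(ℝ, EP) (fun _ => (1 : Op H)) p v + A p v * 1
    have h : dFun 𝓘(ℝ, EP) (fun _ : P => (1 : Op H)) p v = 0 := by
      rw [dFun, mfderiv_const]
      rfl
    rw [h, one_mul, mul_one, zero_add]
  · change (x.2 : Op H) * pullback (modelPU EP H) 𝓘(ℝ, EP) B.actMap A x v +
        nablaL.α x v • (x.2 : Op H) = dFun (modelPU EP H) (fun x : P × U H => (x.2 : Op H)) x v +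
        pullback (modelPU EP H) 𝓘(ℝ, EP) Prod.fst A x v * x.2
    obtain ⟨T, hT, hsum⟩ := f.exists_finset_sum (B.proj x.1)
    have hx : B.proj (B.actMap x) = B.proj x.1 := B.proj_act _ _
    have h1 := pullback_finsum_smul (I := 𝓘(ℝ, EP)) (I' := modelPU EP H) (κ := B.actMap) (x := x)
      (f := fun m q => f m (B.proj q)) (A := fun m => (S m).form nablaL)
      fun m hm => (hT m).1 (hx ▸ hm)
    have h2 := pullback_finsum_smul (I := 𝓘(ℝ, EP)) (I' := modelPU EP H)
      (κ := (Prod.fst : P × U H → P)) (x := x)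
      (f := fun m q => f m (B.proj q)) (A := fun m => (S m).form nablaL) fun m hm => (hT m).1 hm
    rw [h1, h2, hx, ContinuousAlternatingMap.sum_apply, ContinuousAlternatingMap.sum_apply,
      Finset.mul_sum, Finset.sum_mul]
    have key (D : Op H) : D = ∑ m ∈ T, f m (B.proj x.1) • D := by
      rw [← Finset.sum_smul, hsum, one_smul]
    rw [key (nablaL.α x v • (x.2 : Op H)),
      key (dFun (modelPU EP H) (fun x : P × U H => (x.2 : Op H)) x v), ← Finset.sum_add_distrib,
      ← Finset.sum_add_distrib]
    refine Finset.sum_congr rfl fun m hm => ?_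
    have h3 := PUBundle.LocalSection.form_module (nablaL := nablaL) (hmem ((hT m).2 hm)) v
    rw [ContinuousAlternatingMap.smul_apply, ContinuousAlternatingMap.smul_apply, mul_smul_comm,
      smul_mul_assoc, ← smul_add, ← smul_add, h3]

variable (I) in
/-- The connection form `g⁻¹ dg + g⁻¹ A g`. -/
def gaugeForm (g : X → Op H) (A : Form E X (Op H) 1) : Form E X (Op H) 1 := fun x =>
  (ContinuousLinearMap.mul ℝ (Op H) (Ring.inverse (g x))).compContinuousAlternatingMap
    (dFun I g x + ((ContinuousLinearMap.mul ℝ (Op H)).flip (g x)).compContinuousAlternatingMap (A x))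

theorem mul_gaugeForm {g : X → Op H} {x : X} (hg : IsUnit (g x)) (A : Form E X (Op H) 1)
    (v : Fin 1 → E) : g x * gaugeForm I g A x v = dFun I g x v + A x v * g x := by
  change g x * (Ring.inverse (g x) * (dFun I g x v + A x v * g x)) = _
  rw [← mul_assoc, Ring.mul_inverse_cancel _ hg, one_mul]

theorem pullback_gaugeForm {g : X → Op H} {A : Form E X (Op H) 1} {κ : X' → X} {x : X'}
    (hg : MDifferentiableAt I 𝓘(ℝ, Op H) g (κ x)) (hκ : MDifferentiableAt I' I κ x) :
    pullback I' I κ (gaugeForm I g A) x =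
      gaugeForm I' (fun y => g (κ y)) (pullback I' I κ A) x := by
  rw [gaugeForm, dFun_comp hg hκ]
  rfl

theorem contDiffAt_gaugeForm {g : F → Op H} {A : Form F F (Op H) 1} {x : F}
    (hg : ContDiffAt ℝ ∞ g x) (hu : IsUnit (g x)) (hA : ContDiffAt ℝ ∞ A x) :
    ContDiffAt ℝ ∞ (gaugeForm 𝓘(ℝ, F) g A) x := by
  have h1 : ContDiffAt ℝ ∞ (dFun 𝓘(ℝ, F) g) x := by
    have h4 : ContDiffAt ℝ ∞ (fderiv ℝ g) x := hg.fderiv_right (by simp)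
    have h0 : ContDiff ℝ ∞ (ContinuousAlternatingMap.ofSubsingletonLIE (𝕜 := ℝ) (E := F)
        (F := Op H) (0 : Fin 1)) := LinearIsometryEquiv.contDiff _
    refine (h0.contDiffAt.comp x h4).congr_of_eventuallyEq (Filter.Eventually.of_forall fun y => ?_)
    rw [dFun, mfderiv_eq_fderiv]
    rfl
  have h2 : ContDiffAt ℝ ∞ (fun y => ContinuousLinearMap.mul ℝ (Op H) (Ring.inverse (g y))) x :=
    (ContinuousLinearMap.mul ℝ (Op H)).contDiff.contDiffAt.comp x
      (ContDiffAt.comp x (contDiffAt_inverse hu) hg)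
  have h3 : ContDiffAt ℝ ∞ (fun y => (ContinuousLinearMap.mul ℝ (Op H)).flip (g y)) x :=
    (ContinuousLinearMap.mul ℝ (Op H)).flip.contDiff.contDiffAt.comp x hg
  exact ContDiffAt.compAlternating h2 (h1.add (ContDiffAt.compAlternating h3 hA))

end

section

universe u₁ u₂ u₃ u₄ u₅ w w'

variable {H : Type u₁} [NormedAddCommGroup H] [InnerProductSpace ℂ H] [CompleteSpace H]
variable {EM : Type u₂} {M : Type u₃} {EP : Type u₄} {P : Type u₅} [NormedAddCommGroup EM]
  [NormedSpace ℝ EM] [TopologicalSpace M]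
  [ChartedSpace EM M] [NormedAddCommGroup EP] [NormedSpace ℝ EP] [TopologicalSpace P]
  [ChartedSpace EP P]
variable {B : PUBundle H EM M EP P} {nablaL : GerbeConnection B}
variable {E : UtrModule.{u₁, u₂, u₃, u₄, u₅, w} B}

theorem gauge_transition_identity {R : Type*} [Ring R] {T T' g a a' dT dT' dg b : R}
    (h : T * g = T') (hd : dT * g + T * dg = dT') (ha : T * a = dT + b * T)
    (ha' : T' * a' = dT' + b * T') : T * (g * a') = T * (dg + a * g) := by
  rw [← mul_assoc, h, ha', ← h, ← hd, mul_add, ← mul_assoc T a g, ha]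
  noncomm_ring

theorem gauge_module_identity {T S p u a b dT dS dp du a₀ b₀ : Op H} (h : T * p = u * S)
    (hd : dT * p + T * dp = du * S + u * dS) (ha : S * a = dS + a₀ * S) (hb : T * b = dT + b₀ * T)
    {c : ℂ} (h₀ : u * a₀ + c • u = du + b₀ * u) : T * (p * a + c • p) = T * (dp + b * p) := by
  have h1 : T * (p * a) = u * dS + u * a₀ * S := by
    rw [← mul_assoc, h, mul_assoc, ha, mul_add, mul_assoc]
  have h2 : T * (b * p) = dT * p + b₀ * u * S := by
    rw [← mul_assoc, hb, add_mul, mul_assoc b₀, h, mul_assoc]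
  have h3 : u * a₀ * S + c • (u * S) = du * S + b₀ * u * S := by
    rw [← smul_mul_assoc, ← add_mul, h₀, add_mul]
  rw [mul_add, mul_add, h1, h2, mul_smul_comm, h, add_assoc, h3, eq_sub_of_add_eq' hd]
  abel

theorem ModuleTrivialization.contMDiffAt (τ : ModuleTrivialization E) {i : E.ι} {p : P}
    (hp : p ∈ E.V i) : ContMDiffAt 𝓘(ℝ, EP) 𝓘(ℝ, Op H) ∞ (τ.τ i) p :=
  (τ.smooth i).contMDiffAt ((E.isOpen i).mem_nhds hp)

theorem UtrModule.contMDiffAt_g (E : UtrModule.{u₁, u₂, u₃, u₄, u₅, w} B) {i j : E.ι} {p : P}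
    (hp : p ∈ E.V i ∩ E.V j) : ContMDiffAt 𝓘(ℝ, EP) 𝓘(ℝ, Op H) ∞ (E.g i j) p :=
  (E.g_tr i j).contMDiffOn.contMDiffAt (((E.isOpen i).inter (E.isOpen j)).mem_nhds hp)

/-- The module connection that corresponds to a connection on the trivial module. -/
def ModuleTrivialization.pullConnection [IsManifold 𝓘(ℝ, EP) ∞ P] (τ : ModuleTrivialization E)
    (nabla : ModuleConnection (trivialModule.{u₁, u₂, u₃, u₄, u₅, w'} B) nablaL) :
    ModuleConnection E nablaL where
  A i := gaugeForm 𝓘(ℝ, EP) (τ.τ i) (nabla.A PUnit.unit)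
  smooth i := by
    refine isSmoothOn_of_pullback fun γ x hγ hi => ?_
    have h1 : ContDiffAt ℝ ∞ (fun y => τ.τ i (γ y)) x :=
      contMDiffAt_iff_contDiffAt.1 ((τ.contMDiffAt hi).comp x hγ.self_of_nhds)
    have h2 : ContDiffAt ℝ ∞ (pullback 𝓘(ℝ, EP) 𝓘(ℝ, EP) γ (nabla.A PUnit.unit)) x :=
      contDiffAt_pullback (nabla.smooth PUnit.unit) isOpen_univ hγ (Set.mem_univ _)
    refine (contDiffAt_gaugeForm h1 (τ.isUnit i _ hi) h2).congr_of_eventuallyEq ?_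
    filter_upwards [hγ, eventually_mem_V hγ.self_of_nhds.continuousAt hi] with y h3 h4
    exact pullback_gaugeForm (τ.contMDiffAt h4).mdifferentiableAt' h3.mdifferentiableAt'
  transition i j p hp v := by
    refine (τ.isUnit i p hp.1).mul_left_cancel ?_
    have hd : dFun 𝓘(ℝ, EP) (fun q => τ.τ i q * E.g i j q) p = dFun 𝓘(ℝ, EP) (τ.τ j) p := by
      refine dFun_congr ?_
      filter_upwards [((E.isOpen i).inter (E.isOpen j)).mem_nhds hp] with q hq
      exact τ.transition i j q hq
    exact gauge_transition_identity (τ.transition i j p hp)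
      ((dFun_mul_apply (τ.contMDiffAt hp.1).mdifferentiableAt'
        (E.contMDiffAt_g hp).mdifferentiableAt' v).symm.trans (congrArg (fun η => η v) hd))
      (mul_gaugeForm (τ.isUnit i p hp.1) _ v) (mul_gaugeForm (τ.isUnit j p hp.2) _ v)
  module j i x hi hj v := by
    refine (τ.isUnit j x.1 hj).mul_left_cancel ?_
    have hact : ContMDiffAt (modelPU EP H) 𝓘(ℝ, EP) ∞ B.actMap x := B.contMDiff_actMap.contMDiffAt
    have hfst : ContMDiffAt (modelPU EP H) 𝓘(ℝ, EP) ∞ (Prod.fst : P × U H → P) x := contMDiffAt_fst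
    have hi' : ContMDiffAt (modelPU EP H) 𝓘(ℝ, Op H) ∞ (fun y => τ.τ i (B.actMap y)) x :=
      (τ.contMDiffAt hi).comp x hact
    have hj' : ContMDiffAt (modelPU EP H) 𝓘(ℝ, Op H) ∞ (fun y : P × U H => τ.τ j y.1) x :=
      (τ.contMDiffAt hj).comp x hfst
    have hd : dFun (modelPU EP H) (fun y : P × U H => τ.τ j y.1 * E.ψ j i y) x =
        dFun (modelPU EP H) (fun y : P × U H => (y.2 : Op H) * τ.τ i (B.actMap y)) x := by
      refine dFun_congr ?_
      filter_upwards [(E.isOpen_psi_domain j i).mem_nhds ⟨hi, hj⟩] with y hy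
      exact τ.module j i y hy.1 hy.2
    have hd' := congrArg (fun η => η v) hd
    rw [dFun_mul_apply hj'.mdifferentiableAt' (E.contMDiffAt_psi hi hj).mdifferentiableAt',
      dFun_mul_apply contMDiff_snd_coe.contMDiffAt.mdifferentiableAt' hi'.mdifferentiableAt'] at hd'
    have ha : τ.τ i (B.actMap x) * pullback (modelPU EP H) 𝓘(ℝ, EP) B.actMap
        (gaugeForm 𝓘(ℝ, EP) (τ.τ i) (nabla.A PUnit.unit)) x v =
        dFun (modelPU EP H) (fun y => τ.τ i (B.actMap y)) x v +
          pullback (modelPU EP H) 𝓘(ℝ, EP) B.actMap (nabla.A PUnit.unit) x v *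
            τ.τ i (B.actMap x) := by
      rw [pullback_gaugeForm (τ.contMDiffAt hi).mdifferentiableAt' hact.mdifferentiableAt']
      exact mul_gaugeForm (g := fun y => τ.τ i (B.actMap y)) (τ.isUnit i _ hi) _ v
    have hb : τ.τ j x.1 * pullback (modelPU EP H) 𝓘(ℝ, EP) Prod.fst
        (gaugeForm 𝓘(ℝ, EP) (τ.τ j) (nabla.A PUnit.unit)) x v =
        dFun (modelPU EP H) (fun y : P × U H => τ.τ j y.1) x v +
          pullback (modelPU EP H) 𝓘(ℝ, EP) Prod.fst (nabla.A PUnit.unit) x v * τ.τ j x.1 := by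
      rw [pullback_gaugeForm (τ.contMDiffAt hj).mdifferentiableAt' hfst.mdifferentiableAt']
      exact mul_gaugeForm (g := fun y : P × U H => τ.τ j y.1) (τ.isUnit j _ hj) _ v
    exact gauge_module_identity (τ.module j i x hi hj) hd' ha hb
      (nabla.module PUnit.unit PUnit.unit x (Set.mem_univ _) (Set.mem_univ _) v)

end

section

universe u₁ u₂ u₃ u₄ u₅ w w'

variable {H : Type u₁} [NormedAddCommGroup H] [InnerProductSpace ℂ H] [CompleteSpace H]
variable {EM : Type u₂} {M : Type u₃} {EP : Type u₄} {P : Type u₅} [NormedAddCommGroup EM]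
  [NormedSpace ℝ EM] [TopologicalSpace M]
  [ChartedSpace EM M] [NormedAddCommGroup EP] [NormedSpace ℝ EP] [TopologicalSpace P]
  [ChartedSpace EP P] [IsManifold 𝓘(ℝ, EP) ∞ P]
variable {B : PUBundle H EM M EP P} {nablaL : GerbeConnection B}
variable {E : UtrModule.{u₁, u₂, u₃, u₄, u₅, w} B} {E₀ : UtrModule.{u₁, u₂, u₃, u₄, u₅, w'} B}
variable {F : Type*} [NormedAddCommGroup F] [NormedSpace ℝ F]

/-- `g` is an isomorphism from `(E, ∇, φ)` to `(E₀, ∇₀, φ₀)`, in the trivialisations `i`, `i₀`. -/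
structure IsIntertwiner (nabla : ModuleConnection E nablaL) (nabla₀ : ModuleConnection E₀ nablaL)
    (φ : TrAut E) (φ₀ : TrAut E₀) (i : E.ι) (i₀ : E₀.ι) (g : P → Op H) : Prop where
  smooth : ∀ p ∈ E.V i ∩ E₀.V i₀, ContMDiffAt 𝓘(ℝ, EP) 𝓘(ℝ, Op H) ∞ g p
  isUnit : ∀ p ∈ E.V i ∩ E₀.V i₀, IsUnit (g p)
  connection : ∀ p ∈ E.V i ∩ E₀.V i₀, ∀ v,
    g p * nabla.A i p v = dFun 𝓘(ℝ, EP) g p v + nabla₀.A i₀ p v * g p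
  aut : ∀ p ∈ E.V i ∩ E₀.V i₀, g p * φ.φ i p = φ₀.φ i₀ p * g p

theorem aAlong_self (nabla : ModuleConnection E nablaL) (i : E.ι) (γ : F → P) (τ : F → ℝ) (x : F) :
    aAlong nabla nabla i γ τ x = pullback 𝓘(ℝ, F) 𝓘(ℝ, EP) γ (nabla.A i) x := by
  rw [aAlong, ← add_smul, sub_add_cancel, one_smul]

/-- Isomorphic data have the same Chern form. -/
theorem IsIntertwiner.chAlong_eq {nabla : ModuleConnection E nablaL}
    {nabla₀ : ModuleConnection E₀ nablaL} {φ : TrAut E} {φ₀ : TrAut E₀} {i : E.ι} {i₀ : E₀.ι}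
    {g : P → Op H} (h : IsIntertwiner nabla nabla₀ φ φ₀ i i₀ g) {c : nablaL.Curving} {γ : F → P}
    {x : F} (hγ : SmoothNear 𝓘(ℝ, EP) γ x) (hi : γ x ∈ E.V i) (hi₀ : γ x ∈ E₀.V i₀) (k : ℕ) :
    chAlong nabla nabla φ.constPath c i γ (fun _ => 0) k x =
      chAlong nabla₀ nabla₀ φ₀.constPath c i₀ γ (fun _ => 0) k x := by
  have hev := eventually_mem_V hγ.self_of_nhds.continuousAt hi
  have hev₀ := eventually_mem_V hγ.self_of_nhds.continuousAt hi₀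
  have hg : ∀ᶠ y in 𝓝 x, ContDiffAt ℝ ∞ (fun y => g (γ y)) y := by
    filter_upwards [hγ, hev, hev₀] with y h1 h2 h3
    exact contMDiffAt_iff_contDiffAt.1 ((h.smooth _ ⟨h2, h3⟩).comp y h1)
  have hgauge : ∀ᶠ y in 𝓝 x, (opTA H).IsGauge (aAlong nabla₀ nabla₀ i₀ γ (fun _ => 0))
      (aAlong nabla nabla i γ (fun _ => 0)) (fun y => g (γ y)) 0 y := by
    filter_upwards [hγ, hev, hev₀] with y h1 h2 h3 v
    have e1 := dFun_comp (I' := 𝓘(ℝ, F)) (f := g) (κ := γ)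
      (h.smooth _ ⟨h2, h3⟩).mdifferentiableAt' h1.mdifferentiableAt'
    have e2 : fderiv ℝ (fun y => g (γ y)) y (v 0) =
        pullback 𝓘(ℝ, F) 𝓘(ℝ, EP) γ (dFun 𝓘(ℝ, EP) g) y v := by
      rw [← e1, dFun, mfderiv_eq_fderiv]
      rfl
    have e3 : (opTA H).smulA ((0 : F → F [⋀^Fin 1]→L[ℝ] ℂ) y v) (g (γ y)) = 0 :=
      zero_smul ℂ (g (γ y))
    rw [aAlong_self, aAlong_self, e2, e3, sub_zero]
    exact h.connection _ ⟨h2, h3⟩ _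
  have htg : ∀ᶠ y in 𝓝 x, (opTA H).mul (g (γ y))
      ((opTA H).incl (tAlong φ.constPath i γ (fun _ => 0) y)) =
      (opTA H).mul ((opTA H).incl (tAlong φ₀.constPath i₀ γ (fun _ => 0) y)) (g (γ y)) := by
    filter_upwards [hev, hev₀] with y h1 h2
    have h3 := h.aut _ ⟨h1, h2⟩
    rw [φ.constPath_spec 0 i _ h1, φ₀.constPath_spec 0 i₀ _ h2, add_mul, mul_add, one_mul,
      mul_one] at h3
    exact add_left_cancel h3
  have hτ {y : F} : ContDiffAt ℝ ∞ (fun _ : F => (0 : ℝ)) y := contDiffAt_const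
  have hδ : ∀ᶠ y in 𝓝 x, ∀ v, (opTA H).mul (g (γ y))
      ((opTA H).incl (diffAlong nabla nabla φ.constPath i γ (fun _ => 0) y v)) =
      (opTA H).mul ((opTA H).incl (diffAlong nabla₀ nabla₀ φ₀.constPath i₀ γ (fun _ => 0) y v))
        (g (γ y)) := by
    filter_upwards [hgauge, hg, hγ, hev, hev₀, htg.eventually_nhds] with y h1 h2 h3 h4 h5 h6 v
    exact (opTA H).mul_incl_diffT_of_isGauge h1 h2 (contDiffAt_tAlong h3 hτ h5)
      (contDiffAt_tAlong h3 hτ h4) h6 (mul_invAlong h5) (invAlong_mul h5) (mul_invAlong h4) v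
  have hu := h.isUnit _ ⟨hi, hi₀⟩
  refine (opTA H).chForm_eq_of_isGauge (h₀ := Ring.inverse (g (γ x)))
    (contDiffAt_aAlong hγ hτ hi₀) (contDiffAt_aAlong hγ hτ hi)
    (contDiffAt_diffAlong hγ hτ hi₀) (contDiffAt_diffAlong hγ hτ hi) hg.self_of_nhds
    (β := 0) contDiffAt_const hgauge hδ (Ring.inverse_mul_cancel _ hu) (Ring.mul_inverse_cancel _ hu) ?_ k
  have h0 : extDeriv (0 : F → F [⋀^Fin 1]→L[ℝ] ℂ) x = 0 := by
    have h1 : fderiv ℝ (0 : F → F [⋀^Fin 1]→L[ℝ] ℂ) x = 0 := fderiv_const_apply 0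
    rw [extDeriv, h1]
    exact map_zero (ContinuousAlternatingMap.alternatizeUncurryFinCLM ℝ F ℂ)
  change _ = _ + extDeriv (0 : F → F [⋀^Fin 1]→L[ℝ] ℂ) x
  rw [h0, add_zero]

theorem chOf_eq_of_isIntertwiner [IsManifold 𝓘(ℝ, EM) ∞ M] {c : nablaL.Curving}
    {Θ : SmoothForm M 𝓘(ℝ, EM) ℂ 3} (hΘ : c.IsThreeCurvature Θ) {nabla : ModuleConnection E nablaL}
    {nabla₀ : ModuleConnection E₀ nablaL} {φ : TrAut E} {φ₀ : TrAut E₀} {g : E.ι → E₀.ι → P → Op H}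
    (h : ∀ i i₀, IsIntertwiner nabla nabla₀ φ φ₀ i i₀ (g i i₀)) :
    chOf hΘ nabla φ = chOf hΘ nabla₀ φ₀ := by
  refine Subtype.ext (congrArg oddMixed (funext fun k => Subtype.ext ?_))
  refine form_ext_of_plots (B := B) fun γ x hγ => ?_
  obtain ⟨i, hi⟩ := E.cover (γ x)
  obtain ⟨i₀, hi₀⟩ := E₀.cover (γ x)
  rw [pullback_chM _ _ _ _ hγ, pullback_chM _ _ _ _ hγ, chPlot_eq hγ hi, chPlot_eq hγ hi₀,
    (h i i₀).chAlong_eq hγ hi hi₀]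

/-- The automorphism of the trivial module that corresponds to an automorphism of a trivialised
module. -/
theorem ModuleTrivialization.exists_trAut (τ : ModuleTrivialization E) {φ : TrAut E}
    {Φ : C(P, Op H)} (hΦ : IsGLKMap B Φ) (h : τ.Represents φ Φ) :
    ∃ φ₀ : TrAut (trivialModule.{u₁, u₂, u₃, u₄, u₅, w'} B), ∀ i p, φ₀.φ i p = Φ p := by
  let t (i : E.ι) (q : P) : TraceClass H := (opTA H).lm (τ.τ i q)
    ((opTA H).rm (φ.constPath.T i (q, 0)) (Ring.inverse (τ.τ i q)))
  have ht (i : E.ι) (q : P) (hq : q ∈ E.V i) : (t i q).toOp = Φ q - 1 := by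
    have e := Ring.mul_inverse_cancel _ (τ.isUnit i q hq)
    have e1 : (t i q).toOp = τ.τ i q * ((φ.constPath.T i (q, 0)).toOp * Ring.inverse (τ.τ i q)) := rfl
    have e2 : (φ.constPath.T i (q, 0)).toOp = φ.φ i q - 1 := by
      rw [φ.constPath_spec 0 i q hq, add_sub_cancel_left]
    rw [e1, e2, ← mul_assoc, mul_sub, ← h i q hq, mul_one, sub_mul, mul_assoc, e, mul_one]
  have hs (i : E.ι) (q : P) (hq : q ∈ E.V i) :
      ContMDiffAt 𝓘(ℝ, EP) 𝓘(ℝ, TraceClass H) ∞ (t i) q := by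
    have h1 := τ.contMDiffAt hq
    have h2 : ContMDiffAt 𝓘(ℝ, EP) 𝓘(ℝ, Op H) ∞ (fun q => Ring.inverse (τ.τ i q)) q :=
      (contDiffAt_inverse (τ.isUnit i q hq)).contMDiffAt.comp q h1
    have h3 : ContMDiffAt 𝓘(ℝ, EP) 𝓘(ℝ, TraceClass H) ∞ (fun q => φ.constPath.T i (q, 0)) q :=
      (φ.smooth i).choose_spec.1.contMDiffAt ((E.isOpen i).mem_nhds hq)
    have h4 : ContDiff ℝ ∞ (opTA H).lm := (opTA H).lm.contDiff
    have h5 : ContDiff ℝ ∞ (opTA H).rm := (opTA H).rm.contDiff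
    have h6 : ContDiff ℝ ∞ (fun z : Op H × TraceClass H × Op H =>
        (opTA H).lm z.1 ((opTA H).rm z.2.1 z.2.2)) :=
      (h4.comp contDiff_fst).clm_apply
        ((h5.comp (contDiff_fst.comp contDiff_snd)).clm_apply (contDiff_snd.comp contDiff_snd))
    exact h6.contMDiff.contMDiffAt.comp q (h1.prodMk_space (h3.prodMk_space h2))
  have htc (q : P) : IsTraceClass (Φ q - 1) := by
    obtain ⟨i, hi⟩ := E.cover q
    exact ht i q hi ▸ (t i q).isTraceClass
  refine ⟨⟨fun _ => Φ, ⟨fun _ p _ => hΦ.isUnit p, fun _ p _ => htc p,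
    fun _ _ p _ => (mul_one (Φ p)).trans (one_mul (Φ p)).symm, fun _ _ x _ _ => ?_⟩, fun _ =>
    ⟨fun q => TraceClass.mk _ (htc q), fun q _ => ?_, fun q _ => ?_⟩⟩, fun _ _ => rfl⟩
  · change Φ x.1 * (x.2 : Op H) = (x.2 : Op H) * Φ (B.act x.1 x.2)
    rw [hΦ.equivariant, ← mul_assoc, ← mul_assoc, Unitary.mul_star_self_of_mem x.2.2, one_mul]
  · obtain ⟨i, hi⟩ := E.cover q
    refine ((hs i q hi).congr_of_eventuallyEq ?_).contMDiffWithinAt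
    filter_upwards [(E.isOpen i).mem_nhds hi] with y hy
    exact TraceClass.toOp_injective (ht i y hy).symm
  · exact (add_sub_cancel (1 : Op H) (Φ q)).symm

/-- On a trivialised module the class of the Chern form can be computed on the trivial module. -/
theorem ModuleTrivialization.mkQ_chOf_eq [IsManifold 𝓘(ℝ, EM) ∞ M] {c : nablaL.Curving}
    {Θ : SmoothForm M 𝓘(ℝ, EM) ℂ 3} (hΘ : c.IsThreeCurvature Θ) (τ : ModuleTrivialization E)
    (nabla : ModuleConnection E nablaL)
    (nabla₀ : ModuleConnection (trivialModule.{u₁, u₂, u₃, u₄, u₅, w'} B) nablaL) {φ : TrAut E}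
    {Φ : C(P, Op H)} (h : τ.Represents φ Φ)
    {φ₀ : TrAut (trivialModule.{u₁, u₂, u₃, u₄, u₅, w'} B)} (hφ₀ : ∀ i p, φ₀.φ i p = Φ p) :
    (exactOdd Θ).mkQ (chOf hΘ nabla φ) = (exactOdd Θ).mkQ (chOf hΘ nabla₀ φ₀) := by
  rw [mkQ_chOf_eq_of_path hΘ nabla (τ.pullConnection nabla₀) φ.constPath (φ.constPath_spec 0)
    (φ.constPath_spec 1)]
  refine congrArg _ (chOf_eq_of_isIntertwiner hΘ (g := fun i _ => τ.τ i) fun i i₀ =>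
    ⟨fun p hp => τ.contMDiffAt hp.1, fun p hp => τ.isUnit i p hp.1, fun p hp v => ?_,
      fun p hp => ?_⟩)
  · exact mul_gaugeForm (τ.isUnit i p hp.1) _ v
  · rw [hφ₀, h i p hp.1]

end

section

universe u₁ u₂ u₃ u₄ u₅ w

variable {H : Type u₁} [NormedAddCommGroup H] [InnerProductSpace ℂ H] [CompleteSpace H]
variable {EM : Type u₂} {M : Type u₃} {EP : Type u₄} {P : Type u₅} [NormedAddCommGroup EM]
  [NormedSpace ℝ EM] [TopologicalSpace M]
  [ChartedSpace EM M] [NormedAddCommGroup EP] [NormedSpace ℝ EP] [TopologicalSpace P]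
  [ChartedSpace EP P]
variable {B : PUBundle H EM M EP P} {nablaL : GerbeConnection B}

theorem IsGLKMap.isCptAut {Φ : C(P, Op H)} (h : IsGLKMap B Φ) :
    (trivialModule.{u₁, u₂, u₃, u₄, u₅, w} B).IsCptAut fun _ => Φ where
  isUnit _ p _ := h.isUnit p
  compact _ p _ := h.compact p
  transition _ _ p _ := (mul_one (Φ p)).trans (one_mul (Φ p)).symm
  module _ _ x _ _ := by
    change Φ x.1 * (x.2 : Op H) = (x.2 : Op H) * Φ (B.act x.1 x.2)
    rw [h.equivariant, ← mul_assoc, ← mul_assoc, Unitary.mul_star_self_of_mem x.2.2, one_mul]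

/-- A homotopy of equivariant maps to `GL_K` as a path of automorphisms of the trivial module. -/
def cptPathOfHomotopy {Φ Φ' : C(P, Op H)} (h : ContinuousMap.HomotopyWith Φ Φ' (IsGLKMap B)) :
    CptPath (trivialModule.{u₁, u₂, u₃, u₄, u₅, w} B) where
  Ψ r _ p := h (Set.projIcc 0 1 zero_le_one r, p)
  isCptAut r := (h.prop' (Set.projIcc 0 1 zero_le_one r)).isCptAut
  continuousOn _ := (h.continuous.comp ((continuous_projIcc.comp continuous_snd).prodMk
    continuous_fst)).continuousOn

/-- The automorphism of the trivial module is given by the map `Φ`. -/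
theorem TrAut.equivariant (φ : TrAut (trivialModule.{u₁, u₂, u₃, u₄, u₅, w} B)) (p : P) (u : U H) :
    φ.φ PUnit.unit (B.act p u) = star (u : Op H) * φ.φ PUnit.unit p * u := by
  have h : φ.φ PUnit.unit p * (u : Op H) = (u : Op H) * φ.φ PUnit.unit (B.act p u) :=
    φ.isTrAut.module PUnit.unit PUnit.unit (p, u) (Set.mem_univ _) (Set.mem_univ _)
  rw [mul_assoc, h, ← mul_assoc, Unitary.coe_star_mul_self, one_mul]

/-- The equivariant map given by an automorphism of the trivial module. -/
def TrAut.toMap (φ : TrAut (trivialModule.{u₁, u₂, u₃, u₄, u₅, w} B)) : C(P, Op H) :=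
  ⟨φ.φ PUnit.unit, continuousOn_univ.1 (φ.smooth PUnit.unit).contMDiffOn.continuousOn⟩

theorem TrAut.isGLKMap_toMap (φ : TrAut (trivialModule.{u₁, u₂, u₃, u₄, u₅, w} B)) :
    IsGLKMap B φ.toMap where
  isUnit p := φ.isTrAut.isUnit PUnit.unit p (Set.mem_univ _)
  compact p := TraceClass.isCompactOperator
    (TraceClass.mk _ (φ.isTrAut.traceClass PUnit.unit p (Set.mem_univ _)))
  equivariant := φ.equivariant

theorem homotopicWith_of_relDist {Φ Φ' : C(P, Op H)} (hΦ : IsGLKMap B Φ) (hΦ' : IsGLKMap B Φ')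
    (h : ∀ p, relDist (Φ p) (Φ' p) < 1) : ContinuousMap.HomotopicWith Φ Φ' (IsGLKMap B) := by
  refine ⟨⟨⟨⟨fun z => Φ z.2 + (z.1 : ℝ) • (Φ' z.2 - Φ z.2), ?_⟩, fun p => ?_, fun p => ?_⟩,
    fun t => ⟨fun p => ?_, fun p => ?_, fun p u => ?_⟩⟩⟩
  · fun_prop
  · simp
  · simp
  · refine isUnit_of_relDist_lt_one (hΦ.isUnit p)
      (relDist_segment_lt_one ?_ (h p) t.2.1 t.2.2)
    rw [relDist_self]
    exact zero_lt_one
  · have e : Φ p + (t : ℝ) • (Φ' p - Φ p) - 1 =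
        (Φ p - 1) + ((t : ℝ) : ℂ) • ((Φ' p - 1) - (Φ p - 1)) := by
      rw [Complex.coe_smul]
      module
    change IsCompactOperator (Φ p + (t : ℝ) • (Φ' p - Φ p) - 1 : Op H)
    rw [e]
    exact (hΦ.compact p).add (((hΦ'.compact p).sub (hΦ.compact p)).smul _)
  · change Φ (B.act p u) + (t : ℝ) • (Φ' (B.act p u) - Φ (B.act p u)) =
      star (u : Op H) * (Φ p + (t : ℝ) • (Φ' p - Φ p)) * u
    rw [hΦ.equivariant, hΦ'.equivariant]
    simp only [mul_add, add_mul, mul_sub, sub_mul, mul_smul_comm, smul_mul_assoc]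

variable [IsManifold 𝓘(ℝ, EP) ∞ P] [IsManifold 𝓘(ℝ, EM) ∞ M]
  [FiniteDimensional ℝ EM] [T2Space M] [SecondCountableTopology M]

/-- Equivariant maps to `GL_K` are close to smooth automorphisms of the trivial module that differ
from the identity by trace class operators. -/
theorem IsGLKMap.exists_trAut {Φ : C(P, Op H)} (h : IsGLKMap B Φ) :
    ∃ φ : TrAut (trivialModule.{u₁, u₂, u₃, u₄, u₅, w} B), ∀ i p, relDist (Φ p) (φ.φ i p) < 1 := by
  obtain ⟨T, hT⟩ := exists_smoothing (E := trivialModule.{u₁, u₂, u₃, u₄, u₅, w} B)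
    ⟨fun _ _ => Φ, fun _ => h.isCptAut, fun _ => (Φ.continuous.comp continuous_fst).continuousOn⟩
  exact ⟨T.at 0, fun i p => hT 0 i p (Set.mem_univ _)⟩

variable {c : nablaL.Curving} {Θ : SmoothForm M 𝓘(ℝ, EM) ℂ 3}

/-- The Chern character of an equivariant map to `GL_K`, computed on a smooth approximation. -/
def chMap (hΘ : c.IsThreeCurvature Θ)
    (nabla : ModuleConnection (trivialModule.{u₁, u₂, u₃, u₄, u₅, w} B) nablaL)
    (Φ : {Φ : C(P, Op H) // IsGLKMap B Φ}) : TwistedOdd Θ :=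
  (exactOdd Θ).mkQ (chOf hΘ nabla Φ.2.exists_trAut.choose)

theorem chMap_eq (hΘ : c.IsThreeCurvature Θ)
    (nabla : ModuleConnection (trivialModule.{u₁, u₂, u₃, u₄, u₅, w} B) nablaL)
    (Φ : {Φ : C(P, Op H) // IsGLKMap B Φ}) {φ : TrAut (trivialModule.{u₁, u₂, u₃, u₄, u₅, w} B)}
    (h : ∀ i p, relDist (Φ.1 p) (φ.φ i p) < 1) :
    chMap hΘ nabla Φ = (exactOdd Θ).mkQ (chOf hΘ nabla φ) :=
  mkQ_chOf_eq_of_relDist hΘ nabla (Ψ := fun _ => Φ.1) (fun _ p _ => Φ.2.isUnit p)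
    (fun i p _ => Φ.2.exists_trAut.choose_spec i p) fun i p _ => h i p

theorem chMap_eq_of_homotopicWith (hΘ : c.IsThreeCurvature Θ)
    (nabla : ModuleConnection (trivialModule.{u₁, u₂, u₃, u₄, u₅, w} B) nablaL)
    {Φ Φ' : {Φ : C(P, Op H) // IsGLKMap B Φ}}
    (h : ContinuousMap.HomotopicWith Φ.1 Φ'.1 (IsGLKMap B)) :
    chMap hΘ nabla Φ = chMap hΘ nabla Φ' := by
  obtain ⟨h⟩ := h
  obtain ⟨T, hT⟩ := exists_smoothing (cptPathOfHomotopy.{u₁, u₂, u₃, u₄, u₅, w} h)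
  have h₀ (i p) : relDist (Φ.1 p) ((T.at 0).φ i p) < 1 := by
    have := hT 0 i p (Set.mem_univ _)
    simp only [cptPathOfHomotopy, Set.projIcc_left] at this
    rwa [show h ((⟨0, _⟩ : unitInterval), p) = Φ.1 p from h.apply_zero p] at this
  have h₁ (i p) : relDist (Φ'.1 p) ((T.at 1).φ i p) < 1 := by
    have := hT 1 i p (Set.mem_univ _)
    simp only [cptPathOfHomotopy, Set.projIcc_right] at this
    rwa [show h ((⟨1, _⟩ : unitInterval), p) = Φ'.1 p from h.apply_one p] at this
  rw [chMap_eq hΘ nabla Φ h₀, chMap_eq hΘ nabla Φ' h₁]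
  exact mkQ_chOf_eq_of_path hΘ nabla nabla T (fun _ _ _ => rfl) fun _ _ _ => rfl

/-- The odd Chern character on `K^1(M, P)` exists and is unique. -/
theorem existsUnique_chP (hΘ : c.IsThreeCurvature Θ) : ∃! chP : K1 B → TwistedOdd Θ,
    ∀ (E : UtrModule.{u₁, u₂, u₃, u₄, u₅, w} B) (τ : ModuleTrivialization E)
      (nabla : ModuleConnection E nablaL) (φ : TrAut E) (Φ : C(P, Op H)) (hΦ : IsGLKMap B Φ),
      τ.Represents φ Φ → chP (Quot.mk _ ⟨Φ, hΦ⟩) = (exactOdd Θ).mkQ (chOf hΘ nabla φ) := by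
  obtain ⟨nabla₀⟩ := exists_moduleConnection.{u₁, u₂, u₃, u₄, u₅, w} nablaL
  refine ⟨Quot.lift (chMap hΘ nabla₀) fun Φ Φ' h => chMap_eq_of_homotopicWith hΘ nabla₀ h,
    fun E τ nabla φ Φ hΦ h => ?_, fun chP' h' => ?_⟩
  · obtain ⟨φ₀, hφ₀⟩ := τ.exists_trAut hΦ h
    rw [τ.mkQ_chOf_eq hΘ nabla nabla₀ h hφ₀]
    refine chMap_eq hΘ nabla₀ ⟨Φ, hΦ⟩ fun i p => ?_
    rw [hφ₀, relDist_self]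
    exact zero_lt_one
  · funext κ
    obtain ⟨Φ, rfl⟩ := Quot.exists_rep κ
    obtain ⟨φ, hφ⟩ := IsGLKMap.exists_trAut.{u₁, u₂, u₃, u₄, u₅, w} Φ.2
    have e : (Quot.mk _ Φ : K1 B) = Quot.mk _ ⟨φ.toMap, φ.isGLKMap_toMap⟩ :=
      Quot.sound (homotopicWith_of_relDist Φ.2 φ.isGLKMap_toMap fun p => hφ PUnit.unit p)
    have h1 := h' _ trivialTrivialization nabla₀ φ φ.toMap φ.isGLKMap_toMap fun i p _ =>
      (mul_one _).trans (one_mul _).symm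
    exact (congrArg chP' e).trans (h1.trans (chMap_eq hΘ nabla₀ Φ hφ).symm)

end

end OddChern

end

theorem proposition5p1
    {H : Type*} [NormedAddCommGroup H] [InnerProductSpace ℂ H] [CompleteSpace H]
    [TopologicalSpace.SeparableSpace H] (hH : ¬ FiniteDimensional ℂ H)
    {EM M : Type*} [NormedAddCommGroup EM] [NormedSpace ℝ EM] [FiniteDimensional ℝ EM]
    [TopologicalSpace M] [ChartedSpace EM M] [IsManifold 𝓘(ℝ, EM) ∞ M]
    [T2Space M] [SecondCountableTopology M]
    {EP P : Type*} [NormedAddCommGroup EP] [NormedSpace ℝ EP] [CompleteSpace EP]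
    [TopologicalSpace P] [ChartedSpace EP P] [IsManifold 𝓘(ℝ, EP) ∞ P]
    (B : PUBundle H EM M EP P) (nablaL : GerbeConnection B) (c : nablaL.Curving)
    (Θ : SmoothForm M 𝓘(ℝ, EM) ℂ 3) (hΘ : c.IsThreeCurvature Θ) :
    -- `A(φ)` is a smooth form with values in the trace class operators
    (∀ (E : UtrModule B) (nabla : ModuleConnection E nablaL) (φ : TrAut E) (i : E.ι),
      ∃ a : Form EP P (TraceClass H) 1, IsSmoothOn 𝓘(ℝ, EP) a (E.V i) ∧
        ∀ p ∈ E.V i, ∀ v, (a p v).toOp = nabla.diff φ i p v) ∧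
    -- the traces and the integral that define the form on `P` exist
    (∀ (E : UtrModule B) (nabla : ModuleConnection E nablaL) (φ : TrAut E) (i : E.ι) (k : ℕ),
      ∀ p ∈ E.V i, ∀ v : Fin (2 * k + 1) → EP,
        (∀ s, IsTraceClass (nabla.density φ c i k s p v)) ∧
        IntervalIntegrable (fun s => trace (nabla.density φ c i k s p v))
          MeasureTheory.volume 0 1) ∧
    -- the form descends to a unique form `ch` on `M`, which is closed for `d - Θ`
    ∃ ch : ∀ E : UtrModule B, ModuleConnection E nablaL → TrAut E → closedOdd Θ,
      (∀ (E : UtrModule B) (nabla : ModuleConnection E nablaL) (φ : TrAut E),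
        nabla.IsChForm φ c (ch E nabla φ).1 ∧
        ∀ ch' : MixedForm EM M, nabla.IsChForm φ c ch' → ch' = (ch E nabla φ).1) ∧
      -- its class is independent of the module connection and of `φ` up to homotopy
      (∀ (E : UtrModule B) (nabla nabla' : ModuleConnection E nablaL) (φ φ' : TrAut E),
        φ.Homotopic φ' →
        (exactOdd Θ).mkQ (ch E nabla φ) = (exactOdd Θ).mkQ (ch E nabla' φ')) ∧
      -- and it defines a map `ch_P` on `K^1(M, P)`
      ∃! chP : K1 B → TwistedOdd Θ,
        ∀ (E : UtrModule B) (τ : ModuleTrivialization E) (nabla : ModuleConnection E nablaL)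
          (φ : TrAut E) (Φ : C(P, Op H)) (hΦ : IsGLKMap B Φ), τ.Represents φ Φ →
          chP (Quot.mk _ ⟨Φ, hΦ⟩) = (exactOdd Θ).mkQ (ch E nabla φ) := by
  refine ⟨fun E nabla φ i => exists_traceClass_diff nabla φ i,
    fun E nabla φ i k p hp v => intervalIntegrable_trace_density nabla φ c i k hp v,
    fun E nabla φ => chOf hΘ nabla φ, fun E nabla φ => ⟨isChForm_chOf hΘ nabla φ, fun ch' h =>
      isChForm_unique h (isChForm_chOf hΘ nabla φ)⟩,
    fun E nabla nabla' φ φ' h => mkQ_chOf_eq_of_homotopic hΘ nabla nabla' h, existsUnique_chP hΘ⟩
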